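/- \textbf{Model.} Let $\chi_a$ ($1\le a\le M$) be matrices on a finite-dimensional space which anticommute with a Hermitian involution (fermion parity), let $S=(S^{ab})$ satisfy $S^{ab}=\pm (S^{ba})^*$, and let $Q_\alpha$ ($1\le\alpha\le r$) be Hermitian, parity-even charges acting linearly on the flavour index, $[Q_\alpha,\chi_a]=\sum_b (T_\alpha)_{ba}\chi_b$, such that $S$ is invariant, $S\,T_\alpha^{T}=\overline{T_\alpha}\,S$. On the $N$-fold tensor power let $\chi_{ia}$ ($1\le i\le N$) be the corresponding fermions, those of different colours $i\neq j$ (and their adjoints) anticommuting. For $I=\{i_1<\dots<i_p\}\subset\{1,\dots,N\}$ and $A=(a_1,\dots,a_p)$ put $X_{IA}=\chi_{i_1a_1}\cdots\chi_{i_pa_p}$, $S^{AB}=\prod_l S^{a_lb_l}$; repeated flavour indices are summed. Let $$H=\sum_{I,J}J_{IJ}\,X^\dagger_{IA}X_{JB}S^{AB},\qquad M_{\tilde A}=\sum_{\tilde I}\tilde J_{\tilde I}X_{\tilde I\tilde A},$$ with $|I|=|J|=p$ even and $|\tilde I|=\tilde p$, where the couplings are centred and jointly Gaussian, $J$ is Hermitian,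 $\tilde J$ is real and independent of $J$, and $\langle\langle J_{IJ}J_{KL}\rangle\rangle=\delta_{IL}\delta_{JK}\big/\big(\binom Np^2M^p\big)$, $\langle\langle\tilde J_{\tilde I}\tilde J_{\tilde K}\rangle\rangle=\delta_{\tilde I\tilde K}\big/\big(\binom N{\tilde p}M^{\tilde p/2}\big)$. For real chemical potentials $\mu_\alpha$ let $\Lambda=e^{-\sum_\alpha\mu_\alpha Q_\alpha}$ (total charges), $\mathrm{Tr}_\Lambda(O)=\mathrm{Tr}(O\Lambda)/\mathrm{Tr}(\Lambda)$, let $tr_\Lambda$ be the analogous one-colour trace, and let $\mathcal N$ be the normalized one-colour trace of $e^{-\sum_\alpha\mu_\alpha Q_\alpha}$. The moments of the symmetry-invariant two-point function are $$\tilde m_{k,k_1}=\mathcal N^N\,\langle\langle \mathrm{Tr}_\Lambda(M^\dagger_{\tilde A}H^{k_1}M_{\tilde B}H^{k-k_1})\rangle\rangle\,S^{\tilde A\tilde B},\qquad 0\le k_1\le k.$$ \textbf{Parameters.} Let $x^2M=S^{ab}S^{cd}\,tr_\Lambda(\chi^\dagger_a\chi_d)\,tr_\Lambda(\chi_b\chi_c^\dagger)$,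 $\ \tilde x\sqrt M=S^{ab}\,tr_\Lambda(\chi^\dagger_a\chi_b)$, and assume $x^2\ne0$, $\tilde x\neq0$. Let $W^{ad}=S^{ab}tr_\Lambda(\chi_b\chi_c^\dagger)S^{cd}$, $\tilde W^{ad}=S^{ba}tr_\Lambda(\chi^\dagger_b\chi_c)S^{dc}$ and $$\lambda_H=\tfrac{\lambda}{x^4M^2}\,tr_\Lambda(\chi_a^\dagger\chi_b\chi_c^\dagger\chi_d)W^{ad}\tilde W^{bc},$$ $$\lambda_{NN}=\tfrac{\lambda}{x^4M^2}\big(tr_\Lambda(\chi_a^\dagger\chi_b\chi_c^\dagger\chi_d)W^{ab}W^{cd}+tr_\Lambda(\chi_a\chi_b^\dagger\chi_c\chi_d^\dagger)\tilde W^{ab}\tilde W^{cd}+tr_\Lambda(\{\chi_a\chi_b^\dagger,\chi_c^\dagger\chi_d\})\tilde W^{ab}W^{cd}\big),$$ $$\lambda_N=\tfrac{\lambda}{x^4M^2}\big(tr_\Lambda(\chi_a^\dagger\chi_c^\dagger\chi_d\chi_b)W^{ab}W^{cd}+tr_\Lambda(\chi_a\chi_c\chi_d^\dagger\chi_b^\dagger)\tilde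 W^{ab}\tilde W^{cd}+[tr_\Lambda(\chi_c^\dagger\chi_a\chi_b^\dagger\chi_d)+tr_\Lambda(\chi_a\chi_c^\dagger\chi_d\chi_b^\dagger)]\tilde W^{ab}W^{cd}\big)-\lambda_{NN},$$ $$\lambda_C=-\tfrac{\lambda}{x^4M^2}\big(tr_\Lambda(\chi_a^\dagger\chi_c^\dagger\chi_b\chi_d)W^{ab}W^{cd}+tr_\Lambda(\chi_a\chi_c\chi_b^\dagger\chi_d^\dagger)\tilde W^{ab}\tilde W^{cd}+[tr_\Lambda(\chi_c^\dagger\chi_a\chi_d\chi_b^\dagger)+tr_\Lambda(\chi_a\chi_c^\dagger\chi_b^\dagger\chi_d)]\tilde W^{ab}W^{cd}\big)-\lambda_{NN}.$$ With $g=\tilde\lambda/(x^2\tilde xM^{3/2})$ let $$\begin{aligned} \gamma_1&=g\,S^{ef}\big(tr_\Lambda(\chi_e^\dagger\chi_f\chi_a^\dagger\chi_b)W^{ab}+tr_\Lambda(\chi_e^\dagger\chi_f\chi_a\chi_b^\dagger)\tilde W^{ab}\big),\\ \gamma_2&=g\,S^{ef}\big(tr_\Lambda(\chi_a^\dagger\chi_b\chi_e^\dagger\chi_f)W^{ab}+tr_\Lambda(\chi_a\chi_b^\dagger\chi_e^\dagger\chi_f)\tilde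 W^{ab}\big),\\ \gamma_3&=g\,S^{ef}\big(tr_\Lambda(\chi_e^\dagger\chi_a^\dagger\chi_b\chi_f)W^{ab}+tr_\Lambda(\chi_e^\dagger\chi_a\chi_b^\dagger\chi_f)\tilde W^{ab}\big),\\ \gamma_4&=g\,S^{ef}\big(tr_\Lambda(\chi_a^\dagger\chi_e^\dagger\chi_f\chi_b)W^{ab}+tr_\Lambda(\chi_a\chi_e^\dagger\chi_f\chi_b^\dagger)\tilde W^{ab}\big),\\ \gamma_5&=-g\,S^{ef}\big(tr_\Lambda(\chi_e^\dagger\chi_a^\dagger\chi_f\chi_b)W^{ab}+tr_\Lambda(\chi_e^\dagger\chi_a\chi_f\chi_b^\dagger)\tilde W^{ab}\big),\\ \gamma_6&=-g\,S^{ef}\big(tr_\Lambda(\chi_a^\dagger\chi_e^\dagger\chi_b\chi_f)W^{ab}+tr_\Lambda(\chi_a\chi_e^\dagger\chi_b^\dagger\chi_f)\tilde W^{ab}\big). \end{aligned}$$ \textbf{Chord diagrams.} A diagram consists of $k$ H nodes on a line (the circle cut open at $\Lambda$), a perfect matching $\pi$ of them into H chords, and one M chord which starts after the first $k_0$ H nodes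 and encloses the next $k_1$ of them; $k_0$ with $k_0+k_1\le k$ is fixed (the ordering in the definition of $\tilde m_{k,k_1}$ is $k_0=0$; moving $k_0$ factors $H$ cyclically past $\Lambda$ gives the others). Its contribution is $$\tilde m^{(\pi)}_{k,k_1}=\frac{\mathcal N^N}{\binom Np^{k}\binom N{\tilde p}M^{pk/2+\tilde p/2}}\sum_{I_1,\dots,I_k,\tilde I}S^{\tilde A\tilde B}\,\mathrm{Tr}_\Lambda\big(h_1\cdots h_{k_0}X^\dagger_{\tilde I\tilde A}h_{k_0+1}\cdots h_{k_0+k_1}X_{\tilde I\tilde B}h_{k_0+k_1+1}\cdots h_k\big),$$ where $h_s=S^{AB}X^\dagger_{I_sA}X_{I_{\pi(s)}B}$. \textbf{Theorem.} For all $k_0+k_1\le k$ and all $N\ge p,\tilde p$ ($p$ even) one has $\tilde m_{k,k_1}=\sum_\pi\tilde m^{(\pi)}_{k,k_1}$, the sum being over all perfect matchings of the $k$ H nodes (so it is $0$ for odd $k$). In the double scaling limit $N,p,\tilde p\to\infty$, $p^2/N\to\lambda$, $p\tilde p/N\to\tilde\lambda$, each contribution satisfies $$\frac{\tilde m^{(\pi)}_{k,k_1}}{\mathcal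 N^N x^{pk}\tilde x^{\tilde p}}\longrightarrow w(\pi)= e^{-\lambda\binom k2-\tilde\lambda k}\,e^{k\lambda_H/2}\,e^{\lambda_{NN}\binom{k/2}2}\,e^{\lambda_N\,n(\pi)}\,e^{\lambda_C\,c(\pi)}\prod_{\text{H chords}}e^{\gamma},$$ where $n(\pi)$ and $c(\pi)$ are the numbers of nested and of intersecting pairs of H chords, and for each H chord $\gamma$ is determined by its position relative to the M chord on the line: $\gamma_1$ if it lies after the M chord, $\gamma_2$ if before, $\gamma_3$ if it is nested inside the M chord, $\gamma_4$ if the M chord is nested inside it, $\gamma_5$ if they intersect and the M chord starts first, $\gamma_6$ if they intersect and the H chord starts first. Consequently $\tilde m_{k,k_1}/(\mathcal N^N x^{pk}\tilde x^{\tilde p})\to\sum_\pi w(\pi)$. -/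

import Mathlib

open Filter Topology MeasureTheory ProbabilityTheory
open scoped Matrix

noncomputable section

namespace DSSYK

/-! ### The model -/

/-- One colour of the model: `M` fermions `χ a` acting on the finite dimensional space `ℂ^ι`, odd
with respect to a fermion parity operator, the invariant tensor `S` and the (one-colour parts of
the) conserved charges `Q α`.  No relation among fermions of the same colour is imposed. -/
structure FlavourModel (ι : Type*) [Fintype ι] [DecidableEq ι] (M r : ℕ) where
  χ : Fin M → Matrix ι ι ℂ
  parity : Matrix ι ι ℂ
  parity_isHermitian : parity.IsHermitian
  parity_sq : parity * parity = 1
  parity_anticomm : ∀ a, parity * χ a = -(χ a * parity)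
  S : Matrix (Fin M) (Fin M) ℂ
  /-- `S^{ab} = ± (S^{ba})^*`. -/
  S_hermitian : Sᴴ = S ∨ Sᴴ = -S
  Q : Fin r → Matrix ι ι ℂ
  Q_isHermitian : ∀ α, (Q α).IsHermitian
  Q_even : ∀ α, Commute parity (Q α)
  /-- The charges act linearly on the flavour index, `[Q α, χ a] = ∑ b, T b a • χ b`, and leave
  the tensor `S` contracting `χ† a` with `χ b` invariant. -/
  invariant : ∀ α, ∃ T : Matrix (Fin M) (Fin M) ℂ,
    (∀ a, Q α * χ a - χ a * Q α = ∑ b, T b a • χ b) ∧ S * Tᵀ = T.map star * S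

variable {ι : Type*} [Fintype ι] [DecidableEq ι] {M r : ℕ}

/-- Operators on the Hilbert space of `N` colours, `(ℂ^ι)^{⊗ N}`. -/
abbrev Op (ι : Type*) (N : ℕ) := Matrix (Fin N → ι) (Fin N → ι) ℂ

/-- The tensor product of one-colour operators. -/
def tensorOp {N : ℕ} (A : Fin N → Matrix ι ι ℂ) : Op ι N :=
  Matrix.of fun x y => ∏ i, A i (x i) (y i)

/-- An ordered set `i_1 < ⋯ < i_p` of `p` colours out of `N`. -/
abbrev ColourSet (N p : ℕ) := {I : Finset (Fin N) // I.card = p}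

/-- The normalized trace, `Tr 1 = 1`. -/
def ntr {n : Type*} [Fintype n] (A : Matrix n n ℂ) : ℂ := A.trace / (Fintype.card n : ℂ)

namespace FlavourModel

variable (m : FlavourModel ι M r) (μ : Fin r → ℝ)

/-- The fermion `χ_{i a}`: fermions of different colours anticommute thanks to the parity string. -/
def fermion {N : ℕ} (i : Fin N) (a : Fin M) : Op ι N :=
  tensorOp fun j => if j < i then m.parity else if j = i then m.χ a else 1

/-- `X_{I A} = χ_{i_1 a_1} ⋯ χ_{i_p a_p}`. -/
def X {N p : ℕ} (I : ColourSet N p) (A : Fin p → Fin M) : Op ι N :=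
  (List.ofFn fun l : Fin p => m.fermion (I.1.orderEmbOfFin I.2 l) (A l)).prod

/-- `S^{A B} = ∏_l S^{a_l b_l}`. -/
def tensorS {p : ℕ} (A B : Fin p → Fin M) : ℂ := ∏ l, m.S (A l) (B l)

/-- `∑_{A, B} S^{A B} X†_{I A} X_{K B}`. -/
def vertex {N p : ℕ} (I K : ColourSet N p) : Op ι N :=
  ∑ A : Fin p → Fin M, ∑ B : Fin p → Fin M, m.tensorS A B • ((m.X I A)ᴴ * m.X K B)

/-- The Hamiltonian `H = ∑ J_{I K} S^{A B} X†_{I A} X_{K B}`. -/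
def hamiltonian {N p : ℕ} (J : ColourSet N p → ColourSet N p → ℂ) : Op ι N :=
  ∑ I, ∑ K, J I K • m.vertex I K

/-- The operator `M_A = ∑ J̃_I X_{I A}`. -/
def probe {N p : ℕ} (Jt : ColourSet N p → ℝ) (A : Fin p → Fin M) : Op ι N :=
  ∑ I, (Jt I : ℂ) • m.X I A

/-- The total charge `Q_α`, the sum over colours of the one-colour charges. -/
def totalCharge (N : ℕ) (α : Fin r) : Op ι N :=
  ∑ i : Fin N, tensorOp fun j => if j = i then m.Q α else 1

/-- `Λ = exp (-∑ μ_α Q_α)` on the full Hilbert space. -/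
def Lam (N : ℕ) : Op ι N := NormedSpace.exp (-∑ α, (μ α : ℂ) • m.totalCharge N α)

/-- `Tr_Λ`, normalized so that `Tr_Λ 1 = 1`. -/
def TrLam {N : ℕ} (A : Op ι N) : ℂ := ntr (A * m.Lam μ N) / ntr (m.Lam μ N)

/-- The one-colour density `exp (-∑ μ_α Q_{i α})`. -/
def lam : Matrix ι ι ℂ := NormedSpace.exp (-∑ α, (μ α : ℂ) • m.Q α)

/-- `𝒩`, the one-colour normalized trace of `exp (-∑ μ_α Q_{i α})`. -/
def calN : ℂ := ntr (m.lam μ)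

/-- The one-colour trace `tr_Λ`, normalized so that `tr_Λ 1 = 1`. -/
def tr (A : Matrix ι ι ℂ) : ℂ := ntr (A * m.lam μ) / ntr (m.lam μ)

end FlavourModel

/-- The couplings: `J` is Hermitian, `J̃` is real, they are jointly Gaussian and centred, independent
of each other, and have the covariances
`⟨J_{I K} J_{L O}⟩ = δ_{I O} δ_{K L} / (C(N, p)² M^p)` and
`⟨J̃_I J̃_K⟩ = δ_{I K} / (C(N, p̃) M^{p̃/2})`. -/
structure IsCouplingEnsemble {Ω : Type*} [MeasurableSpace Ω] (P : Measure Ω) (M N p pt : ℕ)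
    (J : Ω → ColourSet N p → ColourSet N p → ℂ) (Jt : Ω → ColourSet N pt → ℝ) : Prop where
  gaussian : HasGaussianLaw (fun ω => (J ω, Jt ω)) P
  hermitian : ∀ᵐ ω ∂P, ∀ I K, star (J ω I K) = J ω K I
  indep : IndepFun J Jt P
  mean_J : ∀ I K, ∫ ω, J ω I K ∂P = 0
  mean_Jt : ∀ I, ∫ ω, Jt ω I ∂P = 0
  cov_J : ∀ I K L O, ∫ ω, J ω I K * J ω L O ∂P =
    if I = O ∧ K = L then 1 / ((N.choose p : ℂ) ^ 2 * (M : ℂ) ^ p) else 0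
  cov_Jt : ∀ I K, ∫ ω, Jt ω I * Jt ω K ∂P =
    if I = K then 1 / ((N.choose pt : ℝ) * Real.sqrt M ^ pt) else 0

/-- The moment `m̃_{k, k₁} = 𝒩^N ⟨⟨Tr_Λ (M†_A H^{k₁} M_B H^{k - k₁})⟩⟩ S^{A B}`. -/
def twoPointMoment (m : FlavourModel ι M r) (μ : Fin r → ℝ) {N p pt : ℕ}
    {Ω : Type*} [MeasurableSpace Ω] (P : Measure Ω)
    (J : Ω → ColourSet N p → ColourSet N p → ℂ) (Jt : Ω → ColourSet N pt → ℝ) (k k₁ : ℕ) : ℂ :=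
  m.calN μ ^ N * ∫ ω, ∑ A : Fin pt → Fin M, ∑ B : Fin pt → Fin M,
    m.tensorS A B * m.TrLam μ ((m.probe (Jt ω) A)ᴴ * m.hamiltonian (J ω) ^ k₁ *
      m.probe (Jt ω) B * m.hamiltonian (J ω) ^ (k - k₁)) ∂P

/-! ### Chord diagrams -/

/-- The H chords of a chord diagram with `k` H nodes: a fixed point free involution of the nodes.
The nodes are numbered along the circle, starting right after the insertion of `Λ`. -/
abbrev ChordDiagram (k : ℕ) := {π : Equiv.Perm (Fin k) // ∀ s, π (π s) = s ∧ π s ≠ s}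

/-- The product along the circle of the operators `h s` at the H nodes, with `A` inserted after
`k₀` of the nodes and `B` after `k₁` further ones. -/
def word {N k : ℕ} (k₀ k₁ : ℕ) (h : Fin k → Op ι N) (A B : Op ι N) : Op ι N :=
  ((List.ofFn h).take k₀).prod * A * (((List.ofFn h).drop k₀).take k₁).prod * B *
    ((List.ofFn h).drop (k₀ + k₁)).prod

/-- The contribution `m̃_{k, k₁}^{(CD)}` of the chord diagram with H chords `π` whose M chord starts
after `k₀` H nodes and encloses `k₁` of them: the node `s` carries `X†_{I_s} X_{I_{π s}}`, so the
H chord `{s, π s}` consists of the two oriented chords `I_s` and `I_{π s}`. -/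
def diagramMoment (m : FlavourModel ι M r) (μ : Fin r → ℝ) (N p pt : ℕ) {k : ℕ} (k₀ k₁ : ℕ)
    (π : ChordDiagram k) : ℂ :=
  m.calN μ ^ N /
      ((N.choose p : ℂ) ^ k * (N.choose pt : ℂ) * (M : ℂ) ^ (p * k / 2) *
        (Real.sqrt M : ℂ) ^ pt) *
    ∑ I : Fin k → ColourSet N p, ∑ It : ColourSet N pt,
      ∑ A : Fin pt → Fin M, ∑ B : Fin pt → Fin M,
        m.tensorS A B *
          m.TrLam μ (word k₀ k₁ (fun s => m.vertex (I s) (I (π.1 s))) (m.X It A)ᴴ (m.X It B))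

/-- The number of nested pairs of H chords. -/
def nestedPairs {k : ℕ} (π : ChordDiagram k) : ℕ :=
  (Finset.univ.filter fun q : Fin k × Fin k =>
    q.1 < q.2 ∧ q.2 < π.1 q.2 ∧ π.1 q.2 < π.1 q.1).card

/-- The number of intersecting pairs of H chords. -/
def crossingPairs {k : ℕ} (π : ChordDiagram k) : ℕ :=
  (Finset.univ.filter fun q : Fin k × Fin k =>
    q.1 < q.2 ∧ q.2 < π.1 q.1 ∧ π.1 q.1 < π.1 q.2).card

/-! ### The parameters of the chord rules -/

namespace FlavourModel

variable (m : FlavourModel ι M r) (μ : Fin r → ℝ) (lamb lambt : ℝ)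

/-- `x²`, where `x² M = S^{ab} S^{cd} tr_Λ(χ†_a χ_d) tr_Λ(χ_b χ†_c)`. -/
def xSq : ℂ :=
  (∑ a, ∑ b, ∑ c, ∑ d, m.S a b * m.S c d * m.tr μ ((m.χ a)ᴴ * m.χ d) *
    m.tr μ (m.χ b * (m.χ c)ᴴ)) / M

/-- `x̃`, where `x̃ √M = S^{ab} tr_Λ(χ†_a χ_b)`. -/
def xt : ℂ := (∑ a, ∑ b, m.S a b * m.tr μ ((m.χ a)ᴴ * m.χ b)) / (Real.sqrt M : ℂ)

/-- `W^{ad} = S^{ab} tr_Λ(χ_b χ†_c) S^{cd}`. -/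
def W (a d : Fin M) : ℂ := ∑ b, ∑ c, m.S a b * m.tr μ (m.χ b * (m.χ c)ᴴ) * m.S c d

/-- `W̃^{ad} = S^{ba} tr_Λ(χ†_b χ_c) S^{dc}`. -/
def Wt (a d : Fin M) : ℂ := ∑ b, ∑ c, m.S b a * m.tr μ ((m.χ b)ᴴ * m.χ c) * m.S d c

/-- `λ_H`, from the two oriented chords of one H chord. -/
def lamH : ℂ :=
  lamb / (m.xSq μ * M) ^ 2 * ∑ a, ∑ b, ∑ c, ∑ d,
    m.tr μ ((m.χ a)ᴴ * m.χ b * (m.χ c)ᴴ * m.χ d) * m.W μ a d * m.Wt μ b c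

/-- `λ_NN`, from two non-intersecting and non-nested H chords. -/
def lamNN : ℂ :=
  lamb / (m.xSq μ * M) ^ 2 * ∑ a, ∑ b, ∑ c, ∑ d,
    (m.tr μ ((m.χ a)ᴴ * m.χ b * (m.χ c)ᴴ * m.χ d) * m.W μ a b * m.W μ c d +
      m.tr μ (m.χ a * (m.χ b)ᴴ * m.χ c * (m.χ d)ᴴ) * m.Wt μ a b * m.Wt μ c d +
      m.tr μ (m.χ a * (m.χ b)ᴴ * ((m.χ c)ᴴ * m.χ d) + (m.χ c)ᴴ * m.χ d * (m.χ a * (m.χ b)ᴴ)) *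
        m.Wt μ a b * m.W μ c d)

/-- `λ_N`: a nested pair of H chords contributes `exp (λ_N + λ_NN)`. -/
def lamN : ℂ :=
  lamb / (m.xSq μ * M) ^ 2 * (∑ a, ∑ b, ∑ c, ∑ d,
    (m.tr μ ((m.χ a)ᴴ * (m.χ c)ᴴ * m.χ d * m.χ b) * m.W μ a b * m.W μ c d +
      m.tr μ (m.χ a * m.χ c * (m.χ d)ᴴ * (m.χ b)ᴴ) * m.Wt μ a b * m.Wt μ c d +
      (m.tr μ ((m.χ c)ᴴ * m.χ a * (m.χ b)ᴴ * m.χ d) +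
        m.tr μ (m.χ a * (m.χ c)ᴴ * m.χ d * (m.χ b)ᴴ)) * m.Wt μ a b * m.W μ c d)) -
    m.lamNN μ lamb

/-- `λ_C`: an intersecting pair of H chords contributes `exp (λ_C + λ_NN)`. -/
def lamC : ℂ :=
  -(lamb / (m.xSq μ * M) ^ 2 * (∑ a, ∑ b, ∑ c, ∑ d,
    (m.tr μ ((m.χ a)ᴴ * (m.χ c)ᴴ * m.χ b * m.χ d) * m.W μ a b * m.W μ c d +
      m.tr μ (m.χ a * m.χ c * (m.χ b)ᴴ * (m.χ d)ᴴ) * m.Wt μ a b * m.Wt μ c d +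
      (m.tr μ ((m.χ c)ᴴ * m.χ a * m.χ d * (m.χ b)ᴴ) +
        m.tr μ (m.χ a * (m.χ c)ᴴ * (m.χ b)ᴴ * m.χ d)) * m.Wt μ a b * m.W μ c d))) -
    m.lamNN μ lamb

/-- The common shape of the six parameters `γ_i`:
`λ̃ / (x² x̃ M^{3/2}) · ∑ S^{ef} (w₁ e f a b · W^{ab} + w₂ e f a b · W̃^{ab})`. -/
def gammaSum (w₁ w₂ : Fin M → Fin M → Fin M → Fin M → Matrix ι ι ℂ) : ℂ :=
  lambt / (m.xSq μ * M * (m.xt μ * (Real.sqrt M : ℂ))) * ∑ e, ∑ f, ∑ a, ∑ b,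
    m.S e f * (m.tr μ (w₁ e f a b) * m.W μ a b + m.tr μ (w₂ e f a b) * m.Wt μ a b)

/-- M chord first, then the H chord. -/
def gamma1 : ℂ := m.gammaSum μ lambt
  (fun e f a b => (m.χ e)ᴴ * m.χ f * (m.χ a)ᴴ * m.χ b)
  (fun e f a b => (m.χ e)ᴴ * m.χ f * m.χ a * (m.χ b)ᴴ)

/-- H chord first, then the M chord. -/
def gamma2 : ℂ := m.gammaSum μ lambt
  (fun e f a b => (m.χ a)ᴴ * m.χ b * (m.χ e)ᴴ * m.χ f)
  (fun e f a b => m.χ a * (m.χ b)ᴴ * (m.χ e)ᴴ * m.χ f)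

/-- H chord nested inside the M chord. -/
def gamma3 : ℂ := m.gammaSum μ lambt
  (fun e f a b => (m.χ e)ᴴ * (m.χ a)ᴴ * m.χ b * m.χ f)
  (fun e f a b => (m.χ e)ᴴ * m.χ a * (m.χ b)ᴴ * m.χ f)

/-- M chord nested inside the H chord. -/
def gamma4 : ℂ := m.gammaSum μ lambt
  (fun e f a b => (m.χ a)ᴴ * (m.χ e)ᴴ * m.χ f * m.χ b)
  (fun e f a b => m.χ a * (m.χ e)ᴴ * m.χ f * (m.χ b)ᴴ)

/-- Intersecting chords, the M chord starting first. -/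
def gamma5 : ℂ := -m.gammaSum μ lambt
  (fun e f a b => (m.χ e)ᴴ * (m.χ a)ᴴ * m.χ f * m.χ b)
  (fun e f a b => (m.χ e)ᴴ * m.χ a * m.χ f * (m.χ b)ᴴ)

/-- Intersecting chords, the H chord starting first. -/
def gamma6 : ℂ := -m.gammaSum μ lambt
  (fun e f a b => (m.χ a)ᴴ * (m.χ e)ᴴ * m.χ b * m.χ f)
  (fun e f a b => m.χ a * (m.χ e)ᴴ * (m.χ b)ᴴ * m.χ f)

/-- The parameter `γ_i` of the configuration formed by the H chord with end points `s < t` and the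
M chord which starts after `k₀` H nodes and encloses the next `k₁`. -/
def gammaHM (k₀ k₁ s t : ℕ) : ℂ :=
  if s < k₀ then
    if t < k₀ then m.gamma2 μ lambt
    else if t < k₀ + k₁ then m.gamma6 μ lambt
    else m.gamma4 μ lambt
  else if s < k₀ + k₁ then
    if t < k₀ + k₁ then m.gamma3 μ lambt else m.gamma5 μ lambt
  else m.gamma1 μ lambt

/-- The diagram independent factor `𝒩^N x^{pk} x̃^p̃` (with `p` even). -/
def prefactor (N p pt k : ℕ) : ℂ := m.calN μ ^ N * m.xSq μ ^ (p * k / 2) * m.xt μ ^ pt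

/-- The remaining weight of a chord diagram: `exp (-λ C(k,2) - λ̃ k + k λ_H / 2)`, times the factors
`exp (λ_NN C(k/2, 2))`, `exp λ_N` per nested and `exp λ_C` per intersecting pair of H chords, times
`exp γ_i` for every H chord together with the M chord. -/
def diagramWeight {k : ℕ} (k₀ k₁ : ℕ) (π : ChordDiagram k) : ℂ :=
  Complex.exp (-lamb * (k.choose 2 : ℂ) - lambt * (k : ℂ) + (k : ℂ) * m.lamH μ lamb / 2) *
    Complex.exp (m.lamNN μ lamb * ((k / 2).choose 2 : ℂ)) *
    Complex.exp (m.lamN μ lamb) ^ nestedPairs π *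
    Complex.exp (m.lamC μ lamb) ^ crossingPairs π *
    ∏ s ∈ Finset.univ.filter (fun s : Fin k => s < π.1 s),
      Complex.exp (m.gammaHM μ lambt k₀ k₁ s (π.1 s))

end FlavourModel

end DSSYK

end

/-! Averaging over the Gaussian couplings by Wick's theorem turns the moment into a sum over
matchings `π` of the H nodes. A contraction leaves one free colour set `I_s` for every H node and
one for the M chord: `k + 1` oriented chords, each with one end point `X†` and one end point `X`.
After division by the binomial coefficients a diagram is an expectation over independent uniform
random colour sets. The invariance of `S` is used only to make `H` commute with `Λ`, so that factors
of `H` may be moved cyclically. Wick's theorem itself follows by differentiating the rotation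
invariance of `ν.prod ν` for a centred Gaussian `ν` (`integral_mul_prod_clm`).

For fixed sets the trace factorizes over colours. Sorting the fermions by colour costs a sign `-1`
for every colour shared by two oriented chords which intersect on the circle, and the parity strings
cancel because every slot occurs twice (`sign_word`, `FlavourModel.TrLam_word`). What remains is a
network of one-colour traces, in which `S` joins the `l`-th slot of `I_s` to the `l`-th slot of
`I_{π s}` (`sum_TrLam_word_eq`). Without shared colours the network is a product over pairs of
opposite slots and gives the prefactor. If no colour lies in three sets and no two opposite slots
are both shared (`Good`), the network is still local: every colour common to `u` and `v` multiplies
the value by a fixed ratio `q_{uv}` (`FlavourModel.net_of_good`).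

In the double scaling limit the sizes of the pairwise intersections behave like independent Poisson
variables with means `λ` (two H labels) or `λ̃` (M and H). Hence the average of the product of
`q_{uv} ^ #(I_u ∩ I_v)` tends to the exponential of the sum of `λ_{uv} (q_{uv} - 1)`
(`tendsto_expect_pairWeight`). Grouping the pairs of oriented chords by H chords, and computing
`q_{uv}` from the order of the four end points, gives the stated weight
(`FlavourModel.exp_sum_collWeight`).

The bad configurations must be shown to be negligible. Most of them force a third coincidence and
cost a further factor of order `p / N` or `p̃ / N`. The delicate case is that of slot `l` of `I_s`
lying in `I_{π s}` while slot `l` of `I_{π s}` lies in `I_s`: elements of equal rank tend to be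
close to each other, so one needs that the `l`-th smallest element of a random set has small atoms,
also jointly with the event that the set contains a given colour (`card_el_eq_mem_le`, resting on a
Vandermonde estimate). Finally the network is bounded by a constant to the power of the number of
collisions (`FlavourModel.norm_net_le`), whose exponential moments are bounded
(`expect_pow_coll_le`), so rare configurations do not contribute (`tendsto_expect_net`). -/

set_option linter.unusedSectionVars false

noncomputable section

namespace DSSYK

open scoped BigOperators

/-! ### Averages over finite product spaces and independence. -/

section Averages

variable {U : Type*} [Fintype U] [DecidableEq U] {β : U → Type*} [∀ u, Fintype (β u)]

/-- Resampling one coordinate does not change the average over a product. -/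
lemma expect_update [∀ u, Nonempty (β u)] {E : Type*} [AddCommMonoid E] [Module ℚ≥0 E]
    (u : U) (f : (∀ u, β u) → E) :
    𝔼 I, f I = 𝔼 I, 𝔼 J : β u, f (Function.update I u J) := by
  have h1 : 𝔼 I : ∀ u, β u, 𝔼 J : β u, f (Function.update I u J) =
      𝔼 z : (∀ u, β u) × β u, f (Function.update z.1 u z.2) := by
    rw [← Finset.univ_product_univ, Finset.expect_product]
  have h2 : 𝔼 I, f I = 𝔼 z : (∀ u, β u) × β u, f z.1 := by
    rw [← Finset.univ_product_univ, Finset.expect_product]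
    exact Finset.expect_congr rfl fun I _ => (Fintype.expect_const _).symm
  rw [h1, h2]
  -- Exchanging `I u` with the extra sample `J` is a bijection of the pairs.
  have hinv : Function.Involutive
      (fun z : (∀ u, β u) × β u => (Function.update z.1 u z.2, z.1 u)) := by
    rintro ⟨I, J⟩
    simp
  refine Fintype.expect_equiv hinv.toPerm _ _ ?_
  rintro ⟨I, J⟩
  simp [Function.Involutive.toPerm]

variable {𝕜 : Type*} [Field 𝕜] [CharZero 𝕜]

/-- Take two independent copies and exchange their coordinates off `D`. The factor `f` does not
notice the exchange, while `g` now reads the second copy. -/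
lemma expect_mul_of_dependsOn [∀ u, Nonempty (β u)] {f g : (∀ u, β u) → 𝕜} {D : Set U}
    (hf : DependsOn f D) (hg : DependsOn g Dᶜ) :
    𝔼 I, f I * g I = (𝔼 I, f I) * 𝔼 I, g I := by
  classical
  rw [Fintype.expect_mul_expect]
  have h0 : 𝔼 I, f I * g I = 𝔼 I, 𝔼 _I' : ∀ u, β u, f I * g I :=
    Finset.expect_congr rfl fun I _ => (Fintype.expect_const _).symm
  rw [h0, ← Finset.expect_product' Finset.univ Finset.univ (fun I _ => f I * g I),
    ← Finset.expect_product' Finset.univ Finset.univ (fun I I' => f I * g I')]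
  have hinv : Function.Involutive (fun z : (∀ u, β u) × (∀ u, β u) =>
      ((fun u => if u ∈ D then z.1 u else z.2 u), (fun u => if u ∈ D then z.2 u else z.1 u))) := by
    rintro ⟨I, J⟩
    ext u <;> by_cases hu : u ∈ D <;> simp [hu]
  refine Fintype.expect_equiv hinv.toPerm _ _ ?_
  rintro ⟨I, J⟩
  simp only [Function.Involutive.coe_toPerm]
  congr 1
  · exact hf fun u hu => by simp [hu]
  · exact hg fun u hu => by simp [show u ∉ D from hu]

lemma dependsOn_finset_prod {C : Type*} {s : Finset C} {G : C → (∀ u, β u) → 𝕜} {D : C → Set U}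
    (h : ∀ c ∈ s, DependsOn (G c) (D c)) :
    DependsOn (fun I => ∏ c ∈ s, G c I) (⋃ c ∈ s, D c) := fun _ _ hxy =>
  Finset.prod_congr rfl fun c hc => h c hc fun u hu => hxy u (Set.mem_biUnion hc hu)

/-- Functions of disjoint sets of coordinates are independent. -/
lemma expect_prod_of_dependsOn [∀ u, Nonempty (β u)] {C : Type*} (s : Finset C)
    {G : C → (∀ u, β u) → 𝕜} {D : C → Set U} (h : ∀ c ∈ s, DependsOn (G c) (D c))
    (hD : (s : Set C).PairwiseDisjoint D) :
    𝔼 I, ∏ c ∈ s, G c I = ∏ c ∈ s, 𝔼 I, G c I := by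
  classical
  induction s using Finset.induction_on with
  | empty => simp
  | insert c s hc ih =>
    simp only [Finset.prod_insert hc]
    rw [expect_mul_of_dependsOn (D := D c) (h c (by simp)), ih]
    · exact fun d hd => h d (by simp [hd])
    · exact hD.subset (by simp)
    · refine DependsOn.mono ?_ (dependsOn_finset_prod fun d hd => h d (by simp [hd]))
      intro u hu
      simp only [Set.mem_iUnion] at hu
      obtain ⟨d, hd, hu⟩ := hu
      intro hu'
      exact Set.disjoint_left.1 (hD (by simp) (by simp [hd]) (by rintro rfl; exact hc hd)) hu' hu

lemma norm_expect_le {ι : Type*} [Fintype ι] {E : Type*} [NormedField E] [NormedAlgebra ℝ E]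
    [CharZero E] (f : ι → E) : ‖𝔼 i, f i‖ ≤ 𝔼 i, ‖f i‖ := by
  rw [Fintype.expect_eq_sum_div_card, Fintype.expect_eq_sum_div_card, norm_div]
  have : ‖(Fintype.card ι : E)‖ = Fintype.card ι := by
    have := norm_algebraMap' E (Fintype.card ι : ℝ)
    simpa using this
  rw [this]
  gcongr
  exact norm_sum_le _ _

lemma expect_le_expect' {ι : Type*} [Fintype ι] {f g : ι → ℝ} (h : ∀ i, f i ≤ g i) :
    𝔼 i, f i ≤ 𝔼 i, g i := by
  rw [Fintype.expect_eq_sum_div_card, Fintype.expect_eq_sum_div_card]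
  gcongr
  exact h _

lemma expect_le_of_forall_le {ι : Type*} [Fintype ι] [Nonempty ι] {f : ι → ℝ} {c : ℝ} (h : ∀ i, f i ≤ c) :
    𝔼 i, f i ≤ c :=
  (expect_le_expect' h).trans_eq (Fintype.expect_const c)

lemma expect_nonneg' {ι : Type*} [Fintype ι] {f : ι → ℝ} (h : ∀ i, 0 ≤ f i) :
    0 ≤ 𝔼 i, f i := by
  rw [Fintype.expect_eq_sum_div_card]
  exact div_nonneg (Finset.sum_nonneg fun i _ => h i) (by positivity)

end Averages

/-! ### Uniform random subsets compared with independent Bernoulli choices. -/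

section Subsets

lemma ColourSet.nonempty {N p : ℕ} (h : p ≤ N) : Nonempty (ColourSet N p) := by
  obtain ⟨s, -, hs⟩ := Finset.exists_subset_card_eq (s := (Finset.univ : Finset (Fin N)))
    (n := p) (by simpa using h)
  exact ⟨⟨s, hs⟩⟩

lemma card_colourSet (N p : ℕ) : Fintype.card (ColourSet N p) = N.choose p := by
  rw [Fintype.card_finset_len, Fintype.card_fin]

lemma card_colourSet_superset {N p : ℕ} (T : Finset (Fin N)) (hT : T.card ≤ p) :
    (Finset.univ.filter fun J : ColourSet N p => T ⊆ J.1).card =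
      (N - T.card).choose (p - T.card) := by
  have : (N - T.card).choose (p - T.card) = ((Finset.powersetCard (p - T.card) Tᶜ)).card := by
    rw [Finset.card_powersetCard, Finset.card_compl, Fintype.card_fin]
  rw [this]
  refine Finset.card_bij' (fun J _ => J.1 \ T)
    (fun S hS => ⟨S ∪ T, ?_⟩) ?_ ?_ ?_ ?_
  · rw [Finset.mem_powersetCard] at hS
    rw [Finset.card_union_of_disjoint, hS.2]
    · omega
    · exact Finset.disjoint_left.2 fun x hx hx' => by simpa [hx'] using hS.1 hx
  · intro J hJ
    simp only [Finset.mem_filter, Finset.mem_univ, true_and] at hJ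
    rw [Finset.mem_powersetCard, Finset.card_sdiff_of_subset hJ, J.2]
    exact ⟨fun x hx => by simpa using (Finset.mem_sdiff.1 hx).2, rfl⟩
  · intro S hS
    simp
  · intro J hJ
    simp only [Finset.mem_filter, Finset.mem_univ, true_and] at hJ
    ext1
    simpa using hJ
  · intro S hS
    rw [Finset.mem_powersetCard] at hS
    simp only
    rw [Finset.union_sdiff_right, Finset.sdiff_eq_self_iff_disjoint]
    exact Finset.disjoint_left.2 fun x hx hx' => by simpa [hx'] using hS.1 hx

/-- The probability that a uniform `p`-subset of `N` colours contains `n` given ones. -/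
def superProb (N p n : ℕ) : ℝ := (p.descFactorial n : ℝ) / (N.descFactorial n : ℝ)

lemma expect_superset {N p : ℕ} (h : p ≤ N) (T : Finset (Fin N)) :
    𝔼 J : ColourSet N p, (if T ⊆ J.1 then (1 : ℝ) else 0) = superProb N p T.card := by
  rw [Fintype.expect_eq_sum_div_card, card_colourSet, Finset.sum_boole]
  by_cases hT : T.card ≤ p
  · rw [card_colourSet_superset T hT, superProb]
    have h1 := Nat.choose_mul (n := N) (k := p) (s := T.card) hT
    have hN : 0 < N.choose p := Nat.choose_pos h
    have hd : 0 < N.descFactorial T.card := Nat.descFactorial_pos.2 (hT.trans h)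
    rw [div_eq_div_iff (by positivity) (by positivity)]
    have h2 : N.choose p * p.descFactorial T.card =
        N.descFactorial T.card * (N - T.card).choose (p - T.card) := by
      rw [Nat.descFactorial_eq_factorial_mul_choose, Nat.descFactorial_eq_factorial_mul_choose]
      calc _ = T.card.factorial * (N.choose p * p.choose T.card) := by ring
        _ = _ := by rw [h1]; ring
    have h3 : (N.choose p : ℝ) * p.descFactorial T.card =
        N.descFactorial T.card * (N - T.card).choose (p - T.card) := by exact_mod_cast h2
    linarith
  · have : (Finset.univ.filter fun J : ColourSet N p => T ⊆ J.1) = ∅ := by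
      rw [Finset.filter_eq_empty_iff]
      intro J _ hJ
      exact hT ((Finset.card_le_card hJ).trans_eq J.2)
    rw [this, superProb, Nat.descFactorial_of_lt (by omega)]
    simp

lemma superProb_succ {N p n : ℕ} :
    superProb N p (n + 1) = superProb N p n * (((p - n : ℕ) : ℝ) / ((N - n : ℕ) : ℝ)) := by
  simp only [superProb, Nat.descFactorial_succ, Nat.cast_mul]
  ring

lemma superProb_nonneg (N p n : ℕ) : 0 ≤ superProb N p n := by
  unfold superProb; positivity

lemma superProb_le {N p : ℕ} (h : p ≤ N) (n : ℕ) : superProb N p n ≤ ((p : ℝ) / N) ^ n := by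
  induction n with
  | zero => simp [superProb]
  | succ n ih =>
    by_cases hn : n < p
    · rw [superProb_succ, pow_succ]
      have : ((p - n : ℕ) : ℝ) / ((N - n : ℕ) : ℝ) ≤ (p : ℝ) / N := by
        rw [Nat.cast_sub hn.le, Nat.cast_sub (hn.le.trans h)]
        have h1 : (n : ℝ) < p := by exact_mod_cast hn
        have h2 : (p : ℝ) ≤ N := by exact_mod_cast h
        rw [div_le_div_iff₀ (by linarith) (by linarith [(Nat.cast_nonneg n : (0:ℝ) ≤ n)])]
        nlinarith [(Nat.cast_nonneg n : (0:ℝ) ≤ n)]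
      exact mul_le_mul ih this (by positivity) (by positivity)
    · rw [superProb, Nat.descFactorial_of_lt (by omega)]
      simp only [Nat.cast_zero, zero_div]
      positivity

/-- Each new factor `(p - n) / (N - n)` is at least `(p / N) (1 - n / p)`, and the quadratic loss
absorbs the accumulated linear ones because `(1 - n²/p) (1 - n/p) ≥ 1 - (n+1)²/p`. For `n ≥ p` the
left side of the next step is nonpositive. -/
lemma le_superProb {N p : ℕ} (h : p ≤ N) (hp : 0 < p) (n : ℕ) :
    ((p : ℝ) / N) ^ n * (1 - (n : ℝ) ^ 2 / p) ≤ superProb N p n := by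
  have hp' : (0 : ℝ) < p := by exact_mod_cast hp
  have hN : (0 : ℝ) < N := by exact_mod_cast hp.trans_le h
  induction n with
  | zero => simp [superProb]
  | succ n ih =>
    by_cases hn : n < p
    · rw [superProb_succ, pow_succ]
      have h1 : (n : ℝ) < p := by exact_mod_cast hn
      have h2 : (p : ℝ) ≤ N := by exact_mod_cast h
      have h0 : (0 : ℝ) ≤ n := Nat.cast_nonneg n
      have key : (p : ℝ) / N * (1 - n / p) ≤ ((p - n : ℕ) : ℝ) / ((N - n : ℕ) : ℝ) := by
        rw [Nat.cast_sub hn.le, Nat.cast_sub (hn.le.trans h)]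
        have : (p : ℝ) / N * (1 - n / p) = (p - n) / N := by field_simp
        rw [this]
        gcongr
        · linarith
        · linarith
      have hnp : (n : ℝ) / p ≤ 1 := by rw [div_le_one hp']; exact h1.le
      calc ((p : ℝ) / N) ^ n * (p / N) * (1 - ((n + 1 : ℕ) : ℝ) ^ 2 / p)
          ≤ ((p : ℝ) / N) ^ n * (p / N) * ((1 - (n : ℝ) ^ 2 / p) * (1 - n / p)) := by
            gcongr
            have h3 : (0 : ℝ) ≤ (n : ℝ) ^ 2 / p * (n / p) := by positivity
            have h4 : ((n + 1 : ℕ) : ℝ) ^ 2 / p = (n : ℝ) ^ 2 / p + n / p + n / p + 1 / p := by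
              push_cast; ring
            have h5 : (0 : ℝ) ≤ 1 / p := by positivity
            have h6 : (0 : ℝ) ≤ n / p := by positivity
            rw [h4]
            nlinarith
        _ = (((p : ℝ) / N) ^ n * (1 - (n : ℝ) ^ 2 / p)) * ((p / N) * (1 - n / p)) := by ring
        _ ≤ superProb N p n * ((p / N) * (1 - n / p)) := by
            gcongr
        _ ≤ _ := by
            gcongr
            exact superProb_nonneg _ _ _
    · have h1 : (p : ℝ) ≤ n := by exact_mod_cast not_lt.1 hn
      have : 1 - ((n + 1 : ℕ) : ℝ) ^ 2 / p ≤ 0 := by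
        rw [sub_nonpos, le_div_iff₀ hp']
        push_cast
        nlinarith
      exact (mul_nonpos_of_nonneg_of_nonpos (by positivity) this).trans (superProb_nonneg _ _ _)

/-- The bound `n² ≤ 4^n` makes the error geometric in `n`, so that summing it over all subsets gives
a product again. -/
lemma abs_superProb_sub_le {N p : ℕ} (h : p ≤ N) (hp : 0 < p) (n : ℕ) :
    |superProb N p n - ((p : ℝ) / N) ^ n| ≤ (1 / p) * (4 * ((p : ℝ) / N)) ^ n := by
  have h1 := superProb_le h n
  have h2 := le_superProb h hp n
  have h3 : ((n : ℝ)) ^ 2 ≤ 4 ^ n := by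
    have : (n : ℝ) ≤ 2 ^ n := by exact_mod_cast Nat.lt_two_pow_self.le
    calc (n : ℝ) ^ 2 ≤ (2 ^ n) ^ 2 := by gcongr
      _ = 4 ^ n := by rw [← pow_mul, mul_comm, pow_mul]; norm_num
  have h4 : (0 : ℝ) ≤ ((p : ℝ) / N) ^ n := by positivity
  rw [abs_of_nonpos (by linarith), mul_pow]
  calc -(superProb N p n - ((p : ℝ) / N) ^ n) ≤ (1 / p) * ((n : ℝ) ^ 2 * ((p : ℝ) / N) ^ n) := by
        have : ((p : ℝ) / N) ^ n * (1 - (n : ℝ) ^ 2 / p) =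
          ((p : ℝ) / N) ^ n - (1 / p) * ((n : ℝ) ^ 2 * ((p : ℝ) / N) ^ n) := by ring
        linarith
    _ ≤ _ := by gcongr

lemma expect_prod_one_add {N p : ℕ} (h : p ≤ N) (y : Fin N → ℂ) :
    𝔼 J : ColourSet N p, ∏ i ∈ J.1, (1 + y i) =
      ∑ T : Finset (Fin N), (superProb N p T.card : ℂ) * ∏ i ∈ T, y i := by
  have h1 : ∀ J : ColourSet N p, ∏ i ∈ J.1, (1 + y i) =
      ∑ T : Finset (Fin N), (((if T ⊆ J.1 then (1 : ℝ) else 0 : ℝ)) : ℂ) * ∏ i ∈ T, y i := by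
    intro J
    rw [Finset.prod_one_add]
    simp only [apply_ite Complex.ofReal, Complex.ofReal_one, Complex.ofReal_zero, ite_mul, one_mul,
      zero_mul]
    rw [← Finset.sum_filter]
    exact Finset.sum_congr (by ext; simp) fun _ _ => rfl
  simp_rw [h1]
  rw [Finset.expect_sum_comm]
  refine Finset.sum_congr rfl fun T _ => ?_
  rw [← Finset.expect_mul, ← expect_superset h]
  congr 1
  rw [Fintype.expect_eq_sum_div_card, Fintype.expect_eq_sum_div_card]
  push_cast
  rfl

/-- Expand both sides over subsets `T`: the random set contributes `superProb N p T.card`,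
independent choices of density `p / N` contribute `(p / N) ^ T.card`. The termwise errors add up to
a product over colours, which is bounded by an exponential. -/
lemma norm_expect_prod_sub_le {N p : ℕ} (h : p ≤ N) (hp : 0 < p) (w : Fin N → ℂ) :
    ‖𝔼 J : ColourSet N p, ∏ i ∈ J.1, w i - ∏ i, (1 + ((p : ℝ) / N : ℝ) * (w i - 1))‖ ≤
      (1 / p) * Real.exp (4 * ((p : ℝ) / N) * ∑ i, ‖w i - 1‖) := by
  have h1 : ∀ J : ColourSet N p, ∏ i ∈ J.1, w i = ∏ i ∈ J.1, (1 + (w i - 1)) := fun J => by simp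
  simp_rw [h1]
  rw [expect_prod_one_add h, Finset.prod_one_add, ← Finset.powerset_univ, ← Finset.sum_sub_distrib]
  refine (norm_sum_le _ _).trans ?_
  have h2 : ∀ T ∈ (Finset.univ : Finset (Fin N)).powerset,
      ‖(superProb N p T.card : ℂ) * ∏ i ∈ T, (w i - 1) -
        ∏ i ∈ T, (((p : ℝ) / N : ℝ) : ℂ) * (w i - 1)‖ ≤
      (1 / p) * ∏ i ∈ T, (4 * ((p : ℝ) / N) * ‖w i - 1‖) := by
    intro T _
    rw [Finset.prod_mul_distrib, Finset.prod_const, ← sub_mul, norm_mul, Finset.prod_mul_distrib,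
      Finset.prod_const, ← mul_assoc, norm_prod]
    refine mul_le_mul_of_nonneg_right ?_ (by positivity)
    rw [← Complex.ofReal_pow, ← Complex.ofReal_sub, Complex.norm_real]
    exact abs_superProb_sub_le h hp _
  refine (Finset.sum_le_sum h2).trans ?_
  rw [← Finset.mul_sum, ← Finset.prod_one_add, Finset.mul_sum, Real.exp_sum]
  gcongr with i
  rw [add_comm]
  exact Real.add_one_le_exp _

/-- With `w ≥ 1` every term of the expansion over subsets is nonnegative, so the upper bound for
`superProb` suffices and there is no error term. -/
lemma expect_prod_le_exp {N p : ℕ} (h : p ≤ N) (w : Fin N → ℝ) (hw : ∀ i, 1 ≤ w i) :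
    𝔼 J : ColourSet N p, ∏ i ∈ J.1, w i ≤ Real.exp (((p : ℝ) / N) * ∑ i, (w i - 1)) := by
  have h0 := expect_prod_one_add h (fun i => ((w i - 1 : ℝ) : ℂ))
  have h1 : 𝔼 J : ColourSet N p, ∏ i ∈ J.1, w i =
      ∑ T : Finset (Fin N), superProb N p T.card * ∏ i ∈ T, (w i - 1) := by
    have : ((𝔼 J : ColourSet N p, ∏ i ∈ J.1, w i : ℝ) : ℂ) =
      ((∑ T : Finset (Fin N), superProb N p T.card * ∏ i ∈ T, (w i - 1) : ℝ) : ℂ) := by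
      push_cast at h0 ⊢
      rw [← h0]
      simp [Fintype.expect_eq_sum_div_card]
    exact_mod_cast this
  rw [h1, Finset.mul_sum, Real.exp_sum]
  calc _ ≤ ∑ T : Finset (Fin N), ∏ i ∈ T, (((p : ℝ) / N) * (w i - 1)) := by
        gcongr with T
        rw [Finset.prod_mul_distrib, Finset.prod_const]
        have : 0 ≤ ∏ i ∈ T, (w i - 1) := Finset.prod_nonneg fun i _ => by linarith [hw i]
        gcongr
        exact superProb_le h _
    _ = ∏ i, (1 + ((p : ℝ) / N) * (w i - 1)) := by
        rw [Finset.prod_one_add, Finset.powerset_univ]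
    _ ≤ _ := by
        gcongr with i
        · intro i _
          have := hw i
          have : 0 ≤ ((p : ℝ) / N) * (w i - 1) := mul_nonneg (by positivity) (by linarith)
          linarith
        · rw [add_comm]
          exact Real.add_one_le_exp _

end Subsets

/-! ### Counting coincidences between the colour sets, and their exponential moments. -/

section Collisions

variable {U : Type*} [Fintype U] [LinearOrder U]

/-- A family of colour sets, one for every label `u`. -/
abbrev Config (N : ℕ) (sz : U → ℕ) := ∀ u, ColourSet N (sz u)

/-- The total size of the pairwise intersections of the sets with labels in `T`. -/
def coll {N : ℕ} {sz : U → ℕ} (T : Finset U) (I : Config N sz) : ℕ :=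
  ∑ u ∈ T, ∑ v ∈ T with v < u, ((I v).1 ∩ (I u).1).card

/-- The product over pairs of labels in `T` of `q v u ^ #(I v ∩ I u)`. -/
def pairWeight {N : ℕ} {sz : U → ℕ} (q : U → U → ℂ) (T : Finset U) (I : Config N sz) : ℂ :=
  ∏ u ∈ T, ∏ v ∈ T with v < u, q v u ^ ((I v).1 ∩ (I u).1).card

variable {N : ℕ} {sz : U → ℕ}

lemma filter_lt_insert_max {u : U} {T : Finset U} (hu : ∀ v ∈ T, v < u) :
    (insert u T).filter (· < u) = T := by
  ext v
  simp only [Finset.mem_filter, Finset.mem_insert]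
  constructor
  · rintro ⟨rfl | h, h'⟩
    · exact absurd h' (lt_irrefl _)
    · exact h
  · exact fun h => ⟨Or.inr h, hu v h⟩

lemma filter_lt_insert_of_mem {u w : U} {T : Finset U} (hu : ∀ v ∈ T, v < u) (hw : w ∈ T) :
    (insert u T).filter (· < w) = T.filter (· < w) := by
  rw [Finset.filter_insert, if_neg (hu w hw).not_gt]

lemma coll_insert {u : U} {T : Finset U} (hu : ∀ v ∈ T, v < u) (I : Config N sz) :
    coll (insert u T) I = coll T I + ∑ v ∈ T, ((I v).1 ∩ (I u).1).card := by
  have hn : u ∉ T := fun h => lt_irrefl _ (hu u h)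
  rw [coll, Finset.sum_insert hn, filter_lt_insert_max hu, add_comm, coll]
  congr 1
  exact Finset.sum_congr rfl fun w hw => by rw [filter_lt_insert_of_mem hu hw]

lemma pairWeight_insert (q : U → U → ℂ) {u : U} {T : Finset U} (hu : ∀ v ∈ T, v < u)
    (I : Config N sz) : pairWeight q (insert u T) I =
      pairWeight q T I * ∏ v ∈ T, q v u ^ ((I v).1 ∩ (I u).1).card := by
  have hn : u ∉ T := fun h => lt_irrefl _ (hu u h)
  rw [pairWeight, Finset.prod_insert hn, filter_lt_insert_max hu, mul_comm, pairWeight]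
  congr 1
  exact Finset.prod_congr rfl fun w hw => by rw [filter_lt_insert_of_mem hu hw]

lemma coll_update {u : U} {T : Finset U} (hu : u ∉ T) (I : Config N sz) (J : ColourSet N (sz u)) :
    coll T (Function.update I u J) = coll T I := by
  refine Finset.sum_congr rfl fun w hw => Finset.sum_congr rfl fun v hv => ?_
  rw [Function.update_of_ne (fun e : w = u => hu (e ▸ hw)),
    Function.update_of_ne (fun e : v = u => hu (e ▸ (Finset.mem_filter.1 hv).1))]

lemma pairWeight_update (q : U → U → ℂ) {u : U} {T : Finset U} (hu : u ∉ T) (I : Config N sz)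
    (J : ColourSet N (sz u)) : pairWeight q T (Function.update I u J) = pairWeight q T I := by
  refine Finset.prod_congr rfl fun w hw => Finset.prod_congr rfl fun v hv => ?_
  rw [Function.update_of_ne (fun e : w = u => hu (e ▸ hw)),
    Function.update_of_ne (fun e : v = u => hu (e ▸ (Finset.mem_filter.1 hv).1))]

/-- Turns a product over the other sets into a product over the elements of `J`, the form in which
the average over a random `J` is computed. -/
lemma prod_pow_card_inter {R : Type*} [CommMonoid R] (T : Finset U) (c : U → R) (I : Config N sz)
    (J : Finset (Fin N)) : ∏ v ∈ T, c v ^ ((I v).1 ∩ J).card =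
      ∏ i ∈ J, ∏ v ∈ T, if i ∈ (I v).1 then c v else 1 := by
  rw [Finset.prod_comm]
  refine Finset.prod_congr rfl fun v _ => ?_
  rw [Finset.prod_ite, Finset.prod_const, Finset.prod_const_one, mul_one, Finset.filter_mem_eq_inter,
    Finset.inter_comm]

/-- The number of sets with labels in `T` which contain the colour `i`. -/
def occ (T : Finset U) (I : Config N sz) (i : Fin N) : ℕ := (T.filter fun v => i ∈ (I v).1).card

lemma sum_occ (T : Finset U) (I : Config N sz) : ∑ i, occ T I i = ∑ v ∈ T, sz v := by
  simp only [occ, Finset.card_filter]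
  rw [Finset.sum_comm]
  refine Finset.sum_congr rfl fun v _ => ?_
  rw [← Finset.card_filter]
  simp [(I v).2]

lemma occ_le (T : Finset U) (I : Config N sz) (i : Fin N) : occ T I i ≤ Fintype.card U :=
  (Finset.card_filter_le _ _).trans (Finset.card_le_univ T)

lemma prod_ite_occ (T : Finset U) (I : Config N sz) (i : Fin N) (C : ℝ) :
    (∏ v ∈ T, if i ∈ (I v).1 then C else 1) = C ^ occ T I i := by
  rw [Finset.prod_ite, Finset.prod_const, Finset.prod_const_one, mul_one, occ]

lemma pow_sub_one_le {C : ℝ} (hC : 1 ≤ C) {n m : ℕ} (h : n ≤ m) : C ^ n - 1 ≤ C ^ m * n := by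
  rcases Nat.eq_zero_or_pos n with rfl | hn
  · simp
  · have h1 : C ^ n ≤ C ^ m := pow_le_pow_right₀ hC h
    have h2 : (1 : ℝ) ≤ n := by exact_mod_cast hn
    nlinarith [pow_pos (zero_lt_one.trans_le hC) m]

/-- Exponential moments of the total number of coincidences. -/
lemma expect_pow_coll_le (hsz : ∀ u, sz u ≤ N) {C : ℝ} (hC : 1 ≤ C) (T : Finset U) :
    𝔼 I : Config N sz, C ^ coll T I ≤ Real.exp (C ^ Fintype.card U *
      ∑ u ∈ T, ∑ v ∈ T with v < u, ((sz u : ℝ) * sz v / N)) := by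
  have : ∀ u, Nonempty (ColourSet N (sz u)) := fun u => ColourSet.nonempty (hsz u)
  induction T using Finset.induction_on_max with
  | empty => simp [coll]
  | insert u T hu ih =>
    have hn : u ∉ T := fun h => lt_irrefl _ (hu u h)
    -- Resample the set with the largest label: given the other sets, its contribution to `coll` is
    -- a product over its elements.
    rw [expect_update u]
    have h1 : ∀ (I : Config N sz) (J : ColourSet N (sz u)),
        C ^ coll (insert u T) (Function.update I u J) =
        C ^ coll T I * ∏ i ∈ J.1, C ^ occ T I i := by
      intro I J
      rw [coll_insert hu, pow_add, coll_update hn, ← Finset.prod_pow_eq_pow_sum]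
      congr 1
      have := prod_pow_card_inter T (fun _ => C) I J.1
      simp only [prod_ite_occ] at this
      rw [← this]
      refine Finset.prod_congr rfl fun v hv => ?_
      rw [Function.update_self, Function.update_of_ne (by rintro rfl; exact hn hv)]
    simp_rw [h1, ← Finset.mul_expect]
    -- The sum of `occ T I i` over `i` is the total size of the sets, so the conditional bound does
    -- not depend on `I`.
    have h2 : ∀ I : Config N sz, 𝔼 J : ColourSet N (sz u), ∏ i ∈ J.1, C ^ occ T I i ≤
        Real.exp (C ^ Fintype.card U * ∑ v ∈ T, ((sz u : ℝ) * sz v / N)) := by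
      intro I
      refine (expect_prod_le_exp (hsz u) _ fun i => one_le_pow₀ hC).trans ?_
      rw [Real.exp_le_exp]
      calc ((sz u : ℝ) / N) * ∑ i, (C ^ occ T I i - 1)
          ≤ ((sz u : ℝ) / N) * ∑ i, (C ^ Fintype.card U * occ T I i) := by
            gcongr with i
            exact pow_sub_one_le hC (occ_le T I i)
        _ = _ := by
            rw [← Finset.mul_sum, ← Nat.cast_sum, sum_occ]
            push_cast
            rw [Finset.mul_sum, Finset.mul_sum, Finset.mul_sum]
            exact Finset.sum_congr rfl fun v _ => by ring
    calc _ ≤ 𝔼 I : Config N sz, C ^ coll T I *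
          Real.exp (C ^ Fintype.card U * ∑ v ∈ T, ((sz u : ℝ) * sz v / N)) := by
          refine expect_le_expect' fun I => ?_
          have : (0 : ℝ) ≤ C ^ coll T I := by positivity
          exact mul_le_mul_of_nonneg_left (h2 I) this
      _ ≤ _ := by
          rw [← Finset.expect_mul, Finset.sum_insert hn, filter_lt_insert_max hu, mul_add,
            Real.exp_add, mul_comm]
          gcongr
          refine ih.trans_eq ?_
          congr 2
          exact Finset.sum_congr rfl fun w hw => by rw [filter_lt_insert_of_mem hu hw]

lemma norm_pairWeight_le {q : U → U → ℂ} {Q : ℝ} (hQ : ∀ u v, ‖q u v‖ ≤ Q)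
    (T : Finset U) (I : Config N sz) : ‖pairWeight q T I‖ ≤ Q ^ coll T I := by
  rw [pairWeight, coll, norm_prod, ← Finset.prod_pow_eq_pow_sum]
  refine Finset.prod_le_prod (fun _ _ => norm_nonneg _) fun u _ => ?_
  rw [norm_prod, ← Finset.prod_pow_eq_pow_sum]
  refine Finset.prod_le_prod (fun _ _ => norm_nonneg _) fun v _ => ?_
  rw [norm_pow]
  gcongr
  exact hQ _ _

lemma card_pairs_le_coll (T : Finset U) (I : Config N sz) :
    (∑ i, if 2 ≤ occ T I i then 1 else 0) ≤ coll T I := by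
  have : coll T I = ∑ i : Fin N, ∑ u ∈ T, ∑ v ∈ T with v < u,
      if i ∈ (I v).1 ∩ (I u).1 then 1 else 0 := by
    rw [Finset.sum_comm, coll]
    refine Finset.sum_congr rfl fun u _ => ?_
    rw [Finset.sum_comm]
    refine Finset.sum_congr rfl fun v _ => ?_
    rw [← Finset.card_filter, Finset.filter_mem_eq_inter, Finset.univ_inter]
  rw [this]
  refine Finset.sum_le_sum fun i _ => ?_
  split_ifs with h
  · obtain ⟨a, ha, b, hb, hab⟩ := Finset.one_lt_card.1 (show 1 < (T.filter fun v => i ∈ (I v).1).card from h)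
    rw [Finset.mem_filter] at ha hb
    wlog hlt : b < a generalizing a b
    · exact this b hb a ha hab.symm (lt_of_le_of_ne (not_lt.1 hlt) hab)
    calc 1 = if i ∈ (I b).1 ∩ (I a).1 then 1 else 0 := by simp [ha.2, hb.2]
      _ ≤ ∑ v ∈ T with v < a, if i ∈ (I v).1 ∩ (I a).1 then 1 else 0 :=
          Finset.single_le_sum (f := fun v => if i ∈ (I v).1 ∩ (I a).1 then 1 else 0)
            (fun _ _ => Nat.zero_le _) (Finset.mem_filter.2 ⟨hb.1, hlt⟩)
      _ ≤ _ := Finset.single_le_sum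
            (f := fun u => ∑ v ∈ T with v < u, if i ∈ (I v).1 ∩ (I u).1 then 1 else 0)
            (fun _ _ => Nat.zero_le _) ha.1
  · exact Nat.zero_le _

end Collisions

/-! ### Poisson limit of the intersection sizes. -/

section Limit

/-- Telescoping: exchange one factor at a time and bound the remaining ones by their exponentials.
-/
lemma norm_prod_sub_prod_le {ι : Type*} (s : Finset ι) (a b : ι → ℂ) (α : ι → ℝ)
    (ha : ∀ i ∈ s, ‖a i‖ ≤ Real.exp (α i)) (hb : ∀ i ∈ s, ‖b i‖ ≤ Real.exp (α i))
    (hα : ∀ i ∈ s, 0 ≤ α i) :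
    ‖∏ i ∈ s, a i - ∏ i ∈ s, b i‖ ≤ (∑ i ∈ s, ‖a i - b i‖) * Real.exp (∑ i ∈ s, α i) := by
  classical
  induction s using Finset.induction_on with
  | empty => simp
  | insert c s hc ih =>
    rw [Finset.prod_insert hc, Finset.prod_insert hc, Finset.sum_insert hc, Finset.sum_insert hc,
      Real.exp_add]
    have e : a c * ∏ i ∈ s, a i - b c * ∏ i ∈ s, b i =
      (a c - b c) * ∏ i ∈ s, a i + b c * (∏ i ∈ s, a i - ∏ i ∈ s, b i) := by ring
    have ih' := ih (fun i hi => ha i (by simp [hi])) (fun i hi => hb i (by simp [hi]))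
      fun i hi => hα i (by simp [hi])
    have h1 : ‖∏ i ∈ s, a i‖ ≤ Real.exp (∑ i ∈ s, α i) := by
      rw [norm_prod, Real.exp_sum]
      exact Finset.prod_le_prod (fun _ _ => norm_nonneg _) fun i hi => ha i (by simp [hi])
    have h2 : 1 ≤ Real.exp (α c) := Real.one_le_exp (hα c (by simp))
    have h3 := hb c (by simp)
    rw [e]
    refine (norm_add_le _ _).trans ?_
    rw [norm_mul, norm_mul, add_mul]
    have h4 : 0 ≤ ∑ i ∈ s, ‖a i - b i‖ := Finset.sum_nonneg fun _ _ => norm_nonneg _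
    have h5 := Real.exp_pos (∑ i ∈ s, α i)
    refine add_le_add ?_ ?_
    · have := norm_nonneg (a c - b c)
      nlinarith [mul_le_mul_of_nonneg_left h1 this,
        mul_nonneg (mul_nonneg this h5.le) (sub_nonneg.2 h2)]
    · calc ‖b c‖ * ‖∏ i ∈ s, a i - ∏ i ∈ s, b i‖
          ≤ Real.exp (α c) * ((∑ i ∈ s, ‖a i - b i‖) * Real.exp (∑ i ∈ s, α i)) := by gcongr
        _ = _ := by ring

lemma norm_exp_sub_one_sub_le' {z : ℂ} : ‖Complex.exp z - 1 - z‖ ≤ ‖z‖ ^ 2 * Real.exp ‖z‖ := by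
  simpa using Complex.norm_exp_sub_sum_le_norm_mul_exp z 2 |>.trans_eq' (by
    simp [Finset.sum_range_succ, sub_sub])

lemma norm_exp_sub_one_le' {z : ℂ} : ‖Complex.exp z - 1‖ ≤ ‖z‖ * Real.exp ‖z‖ := by
  simpa using Complex.norm_exp_sub_sum_le_norm_mul_exp z 1 |>.trans_eq' (by
    simp)


variable {U : Type*} [Fintype U] [LinearOrder U] {N : ℕ} {sz : U → ℕ}

/-- Averaging over one of the sets: quantitative Poisson approximation. -/
lemma norm_expect_pow_inter_sub_le {u : U} (hu : sz u ≤ N) (hpos : 0 < sz u) {c : U → ℂ} {Q : ℝ}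
    (hQ : 1 ≤ Q) (hc : ∀ v, ‖c v‖ ≤ Q) (T : Finset U) (I : Config N sz) {n : ℕ} {K ρ S : ℝ}
    (hn : n = Fintype.card U) (hK : K = Q ^ (n + 1) + 1) (hρ : ρ = (sz u : ℝ) / N)
    (hS : S = ∑ v ∈ T, (sz v : ℝ)) :
    ‖𝔼 J : ColourSet N (sz u), ∏ v ∈ T, c v ^ ((I v).1 ∩ J.1).card -
        Complex.exp (∑ v ∈ T, ((sz u : ℝ) * sz v / N : ℝ) * (c v - 1))‖ ≤
      ((1 / sz u) * Real.exp (4 * K * (ρ * S)) + ρ * ((ρ * S) * K ^ 2 * n + 2 * K * n) *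
        Real.exp (ρ * K * n) * Real.exp (K * (ρ * S))) * 2 ^ coll T I := by
  have hρ0 : 0 ≤ ρ := by rw [hρ]; positivity
  have hQn : (1 : ℝ) ≤ Q ^ (n + 1) := one_le_pow₀ hQ
  have hQ0 : 0 < Q := zero_lt_one.trans_le hQ
  have hK0 : 0 < K := by rw [hK]; positivity
  -- `w i` is the factor which the colour `i` contributes when `J` contains it and `z i` is its
  -- linearization. The numbers `w i - 1` and `z i` differ only at colours lying in at least two of
  -- the sets.
  set w : Fin N → ℂ := fun i => ∏ v ∈ T, if i ∈ (I v).1 then c v else 1 with hw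
  set z : Fin N → ℂ := fun i => ∑ v ∈ T, if i ∈ (I v).1 then c v - 1 else 0 with hz
  have hwf : ∀ i, w i = ∏ v ∈ T with i ∈ (I v).1, c v := fun i => by
    simp only [hw]; rw [Finset.prod_filter]
  have hzf : ∀ i, z i = ∑ v ∈ T with i ∈ (I v).1, (c v - 1) := fun i => by
    simp only [hz]; rw [Finset.sum_filter]
  have hoccn : ∀ i, (occ T I i : ℝ) ≤ n := fun i => by
    rw [hn]; exact_mod_cast occ_le T I i
  have hw1 : ∀ i, ‖w i - 1‖ ≤ K * occ T I i := by
    intro i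
    rcases Nat.eq_zero_or_pos (occ T I i) with h0 | h0
    · have : T.filter (fun v => i ∈ (I v).1) = ∅ := Finset.card_eq_zero.1 h0
      rw [hwf, this, h0]
      simp
    · have h1 : ‖w i‖ ≤ Q ^ occ T I i := by
        rw [hwf, norm_prod, occ, ← Finset.prod_const]
        exact Finset.prod_le_prod (fun _ _ => norm_nonneg _) fun v _ => hc v
      have h2 : Q ^ occ T I i ≤ Q ^ (n + 1) :=
        pow_le_pow_right₀ hQ ((occ_le T I i).trans (by omega))
      have h3 : (1 : ℝ) ≤ occ T I i := by exact_mod_cast h0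
      calc ‖w i - 1‖ ≤ ‖w i‖ + ‖(1 : ℂ)‖ := norm_sub_le _ _
        _ ≤ K := by rw [norm_one, hK]; linarith
        _ ≤ _ := le_mul_of_one_le_right hK0.le h3
  have hz1 : ∀ i, ‖z i‖ ≤ K * occ T I i := by
    intro i
    rw [hzf]
    refine (norm_sum_le _ _).trans ?_
    rw [occ, mul_comm, ← nsmul_eq_mul]
    refine Finset.sum_le_card_nsmul _ _ _ fun v _ => ?_
    have : Q ≤ Q ^ (n + 1) := le_self_pow₀ hQ (by omega)
    calc ‖c v - 1‖ ≤ ‖c v‖ + ‖(1 : ℂ)‖ := norm_sub_le _ _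
      _ ≤ K := by rw [norm_one, hK]; linarith [hc v]
  have hwz : ∀ i, occ T I i ≤ 1 → w i - 1 = z i := by
    intro i hi
    rw [hwf, hzf]
    rcases Nat.le_one_iff_eq_zero_or_eq_one.1 hi with h | h
    · rw [Finset.card_eq_zero.1 h]; simp
    · obtain ⟨v, hv⟩ := Finset.card_eq_one.1 h
      rw [hv]; simp
  have hocc : ∑ i, (occ T I i : ℝ) = S := by
    rw [hS]; exact_mod_cast sum_occ T I
  have h1 : ∀ J : ColourSet N (sz u), ∏ v ∈ T, c v ^ ((I v).1 ∩ J.1).card = ∏ i ∈ J.1, w i :=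
    fun J => prod_pow_card_inter T c I J.1
  simp_rw [h1]
  have h2 := norm_expect_prod_sub_le hu hpos w
  rw [← hρ] at h2
  have h3 : Complex.exp (∑ v ∈ T, ((sz u : ℝ) * sz v / N : ℝ) * (c v - 1)) =
      ∏ i, Complex.exp (ρ * z i) := by
    rw [← Complex.exp_sum, ← Finset.mul_sum]
    congr 1
    simp only [hz]
    rw [Finset.sum_comm, Finset.mul_sum]
    refine Finset.sum_congr rfl fun v _ => ?_
    rw [Finset.sum_ite, Finset.sum_const, Finset.sum_const_zero, add_zero, Finset.filter_mem_eq_inter,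
      Finset.univ_inter, (I v).2, hρ, nsmul_eq_mul]
    push_cast
    ring
  rw [h3]
  have h4 := norm_prod_sub_prod_le Finset.univ (fun i => 1 + (ρ : ℂ) * (w i - 1))
    (fun i => Complex.exp (ρ * z i)) (fun i => ρ * (K * occ T I i)) ?_ ?_ ?_
  rotate_left
  · intro i _
    calc ‖1 + (ρ : ℂ) * (w i - 1)‖ ≤ ‖(1 : ℂ)‖ + ‖(ρ : ℂ) * (w i - 1)‖ := norm_add_le _ _
      _ = ρ * ‖w i - 1‖ + 1 := by
        rw [norm_one, norm_mul, Complex.norm_real, Real.norm_of_nonneg hρ0, add_comm]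
      _ ≤ ρ * (K * occ T I i) + 1 := by gcongr; exact hw1 i
      _ ≤ _ := Real.add_one_le_exp _
  · intro i _
    refine (Complex.norm_exp_le_exp_norm _).trans ?_
    rw [norm_mul, Complex.norm_real, Real.norm_of_nonneg hρ0]
    gcongr
    exact hz1 i
  · intro i _; positivity
  set E := Real.exp (ρ * K * n) with hE
  have hE1 : 1 ≤ E := Real.one_le_exp (by positivity)
  -- At a colour of occupancy at most one the two factors agree to first order in `ρ`. At the others
  -- only a first order bound is available, but there are at most `coll T I` of them.
  have h5 : ∀ i, ‖(1 + (ρ : ℂ) * (w i - 1)) - Complex.exp (ρ * z i)‖ ≤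
      ρ ^ 2 * K ^ 2 * n * E * occ T I i + 2 * ρ * K * n * E * (if 2 ≤ occ T I i then 1 else 0) := by
    intro i
    have hzn : ‖(ρ : ℂ) * z i‖ ≤ ρ * (K * occ T I i) := by
      rw [norm_mul, Complex.norm_real, Real.norm_of_nonneg hρ0]
      gcongr
      exact hz1 i
    have hzn' : ‖(ρ : ℂ) * z i‖ ≤ ρ * K * n := by
      refine hzn.trans ?_
      rw [mul_assoc]
      exact mul_le_mul_of_nonneg_left (mul_le_mul_of_nonneg_left (hoccn i) hK0.le) hρ0
    have hEz : Real.exp ‖(ρ : ℂ) * z i‖ ≤ E := Real.exp_le_exp.2 hzn'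
    by_cases h : 2 ≤ occ T I i
    · rw [if_pos h]
      have e : (1 + (ρ : ℂ) * (w i - 1)) - Complex.exp (ρ * z i) =
        (ρ : ℂ) * (w i - 1) - (Complex.exp (ρ * z i) - 1) := by ring
      rw [e]
      have h6 : ‖(ρ : ℂ) * (w i - 1)‖ ≤ ρ * K * n := by
        rw [norm_mul, Complex.norm_real, Real.norm_of_nonneg hρ0, mul_assoc]
        gcongr
        exact (hw1 i).trans (mul_le_mul_of_nonneg_left (hoccn i) hK0.le)
      have h7 : ‖Complex.exp (ρ * z i) - 1‖ ≤ ρ * K * n * E :=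
        norm_exp_sub_one_le'.trans (by gcongr)
      have h8 : ρ * K * n ≤ ρ * K * n * E := le_mul_of_one_le_right (by positivity) hE1
      have h9 : 0 ≤ ρ ^ 2 * K ^ 2 * n * E * occ T I i := by positivity
      linarith [norm_sub_le ((ρ : ℂ) * (w i - 1)) (Complex.exp (ρ * z i) - 1)]
    · rw [if_neg h, hwz i (by omega), mul_zero, add_zero, norm_sub_rev, ← sub_sub]
      refine norm_exp_sub_one_sub_le'.trans ?_
      calc ‖(ρ : ℂ) * z i‖ ^ 2 * Real.exp ‖(ρ : ℂ) * z i‖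
          ≤ (ρ * (K * occ T I i) * (ρ * K * n)) * E := by
            rw [sq]
            gcongr
        _ = _ := by ring
  have h6 : ∑ i, ‖(1 + (ρ : ℂ) * (w i - 1)) - Complex.exp (ρ * z i)‖ ≤
      ρ ^ 2 * K ^ 2 * n * E * S + 2 * ρ * K * n * E * coll T I := by
    refine (Finset.sum_le_sum fun i _ => h5 i).trans ?_
    rw [Finset.sum_add_distrib, ← Finset.mul_sum, ← Finset.mul_sum, hocc]
    gcongr
    have := card_pairs_le_coll T I
    exact_mod_cast this
  have h7 : ∑ i, ρ * (K * occ T I i) = K * (ρ * S) := by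
    rw [← Finset.mul_sum, ← Finset.mul_sum, hocc]; ring
  rw [h7] at h4
  have h8 : ∑ i, ‖w i - 1‖ ≤ K * S := by
    rw [← hocc, Finset.mul_sum]
    exact Finset.sum_le_sum fun i _ => hw1 i
  have hS0 : 0 ≤ S := by rw [hS]; positivity
  have hcoll : (coll T I : ℝ) ≤ 2 ^ coll T I := by exact_mod_cast Nat.lt_two_pow_self.le
  have hcoll1 : (1 : ℝ) ≤ 2 ^ coll T I := one_le_pow₀ (by norm_num)
  calc _ ≤ ‖𝔼 J : ColourSet N (sz u), ∏ i ∈ J.1, w i - ∏ i, (1 + (ρ : ℂ) * (w i - 1))‖ +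
        ‖∏ i, (1 + (ρ : ℂ) * (w i - 1)) - ∏ i, Complex.exp (ρ * z i)‖ :=
        norm_sub_le_norm_sub_add_norm_sub _ _ _
    _ ≤ (1 / sz u) * Real.exp (4 * K * (ρ * S)) * 2 ^ coll T I +
        (ρ ^ 2 * K ^ 2 * n * E * S * 2 ^ coll T I + 2 * ρ * K * n * E * 2 ^ coll T I) *
          Real.exp (K * (ρ * S)) := by
        refine add_le_add ?_ ?_
        · refine h2.trans ?_
          have : Real.exp (4 * ρ * ∑ i, ‖w i - 1‖) ≤ Real.exp (4 * K * (ρ * S)) := by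
            rw [Real.exp_le_exp]
            calc 4 * ρ * ∑ i, ‖w i - 1‖ ≤ 4 * ρ * (K * S) := by gcongr
              _ = _ := by ring
          calc _ ≤ 1 / (sz u : ℝ) * Real.exp (4 * K * (ρ * S)) := by gcongr
            _ ≤ _ := le_mul_of_one_le_right (by positivity) hcoll1
        · refine h4.trans ?_
          gcongr
          refine h6.trans (add_le_add (le_mul_of_one_le_right (by positivity) hcoll1) ?_)
          gcongr
    _ = _ := by ring

/-- In the double scaling limit, the numbers of coincidences between uniform random sets behave
like independent Poisson variables. -/
theorem tendsto_expect_pairWeight {N : ℕ → ℕ} {sz : ℕ → U → ℕ} {lam : U → U → ℝ}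
    (hle : ∀ᶠ n in atTop, ∀ u, sz n u ≤ N n)
    (hsz : ∀ u, Tendsto (fun n => sz n u) atTop atTop)
    (hρ : ∀ u, Tendsto (fun n => (sz n u : ℝ) / N n) atTop (𝓝 0))
    (hlam : ∀ u v, v < u → Tendsto (fun n => (sz n u : ℝ) * sz n v / N n) atTop (𝓝 (lam v u)))
    (q : U → U → ℂ) (T : Finset U) :
    Tendsto (fun n => 𝔼 I : Config (N n) (sz n), pairWeight q T I) atTop
      (𝓝 (Complex.exp (∑ u ∈ T, ∑ v ∈ T with v < u, lam v u * (q v u - 1)))) := by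
  obtain ⟨Q, hQ1, hQ⟩ : ∃ Q : ℝ, 1 ≤ Q ∧ ∀ u v, ‖q u v‖ ≤ Q := by
    refine ⟨1 + ∑ u, ∑ v, ‖q u v‖, ?_, fun u v => ?_⟩
    · have : 0 ≤ ∑ u, ∑ v, ‖q u v‖ := by positivity
      linarith
    · have h1 : ‖q u v‖ ≤ ∑ v, ‖q u v‖ :=
        Finset.single_le_sum (f := fun v => ‖q u v‖) (fun _ _ => norm_nonneg _) (Finset.mem_univ v)
      have h2 : ∑ v, ‖q u v‖ ≤ ∑ u, ∑ v, ‖q u v‖ :=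
        Finset.single_le_sum (f := fun u => ∑ v, ‖q u v‖) (fun _ _ => by positivity)
          (Finset.mem_univ u)
      linarith
  induction T using Finset.induction_on_max with
  | empty =>
    simp only [pairWeight, Finset.prod_empty, Finset.sum_empty, Complex.exp_zero]
    refine Tendsto.congr' ?_ tendsto_const_nhds
    filter_upwards [hle] with n hn
    have : ∀ u, Nonempty (ColourSet (N n) (sz n u)) := fun u => ColourSet.nonempty (hn u)
    rw [Fintype.expect_const]
  | insert u T hu ih =>
    have hn : u ∉ T := fun h => lt_irrefl _ (hu u h)
    rw [Finset.sum_insert hn, filter_lt_insert_max hu, Complex.exp_add]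
    have e1 : ∑ w ∈ T, ∑ v ∈ insert u T with v < w, (lam v w : ℂ) * (q v w - 1) =
        ∑ w ∈ T, ∑ v ∈ T with v < w, (lam v w : ℂ) * (q v w - 1) :=
      Finset.sum_congr rfl fun w hw => by rw [filter_lt_insert_of_mem hu hw]
    rw [e1]
    set A : ℕ → ℂ := fun n =>
      Complex.exp (∑ v ∈ T, ((sz n u : ℝ) * sz n v / N n : ℝ) * (q v u - 1)) with hA
    have hAt : Tendsto A atTop (𝓝 (Complex.exp (∑ v ∈ T, (lam v u : ℂ) * (q v u - 1)))) := by
      refine (Complex.continuous_exp.tendsto _).comp (tendsto_finsetSum _ fun v hv => ?_)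
      exact ((Complex.continuous_ofReal.tendsto _).comp (hlam u v (hu v hv))).mul_const _
    have hmain := hAt.mul ih
    set m := Fintype.card U with hm
    set K := Q ^ (m + 1) + 1 with hK
    set ρ : ℕ → ℝ := fun n => (sz n u : ℝ) / N n with hρd
    set S : ℕ → ℝ := fun n => ∑ v ∈ T, (sz n v : ℝ) with hS
    set δ : ℕ → ℝ := fun n => (1 / sz n u) * Real.exp (4 * K * (ρ n * S n)) +
      ρ n * ((ρ n * S n) * K ^ 2 * m + 2 * K * m) * Real.exp (ρ n * K * m) *
        Real.exp (K * (ρ n * S n)) with hδ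
    set L := ∑ v ∈ T, lam v u with hL
    have hρS : Tendsto (fun n => ρ n * S n) atTop (𝓝 L) := by
      have : ∀ n, ρ n * S n = ∑ v ∈ T, (sz n u : ℝ) * sz n v / N n := fun n => by
        simp only [hρd, hS, Finset.mul_sum]
        exact Finset.sum_congr rfl fun _ _ => by ring
      simp_rw [this]
      exact tendsto_finsetSum _ fun v hv => hlam u v (hu v hv)
    have hδ0 : Tendsto δ atTop (𝓝 0) := by
      have hinv : Tendsto (fun n => 1 / (sz n u : ℝ)) atTop (𝓝 0) := by
        simp_rw [one_div]
        exact tendsto_inv_atTop_zero.comp (tendsto_natCast_atTop_atTop.comp (hsz u))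
      have hρu := hρ u
      have t1 := hinv.mul ((Real.continuous_exp.tendsto _).comp (hρS.const_mul (4 * K)))
      have t2 := ((hρu.mul (((hρS.mul_const (K ^ 2)).mul_const (m : ℝ)).add_const (2 * K * m))).mul
        ((Real.continuous_exp.tendsto _).comp ((hρu.mul_const K).mul_const (m : ℝ)))).mul
          ((Real.continuous_exp.tendsto _).comp (hρS.const_mul K))
      have t3 := t1.add t2
      simp only [zero_mul, zero_add] at t3
      exact t3
    -- Bounds the average of `(2 * Q) ^ coll`: a factor `Q ^ coll` comes from the weights of the
    -- remaining pairs and a factor `2 ^ coll` from the error of the Poisson approximation.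
    set B : ℕ → ℝ := fun n => Real.exp ((2 * Q) ^ m *
      ∑ u ∈ T, ∑ v ∈ T with v < u, ((sz n u : ℝ) * sz n v / N n)) with hB
    have hBt : ∃ b, Tendsto B atTop (𝓝 b) := by
      refine ⟨_, (Real.continuous_exp.tendsto _).comp (Tendsto.const_mul _
        (tendsto_finsetSum _ fun u _ => tendsto_finsetSum _ fun v hv =>
          hlam u v (Finset.mem_filter.1 hv).2))⟩
    obtain ⟨b, hb⟩ := hBt
    have herr := hδ0.mul hb
    rw [zero_mul] at herr
    -- Averaging over the set of the largest label replaces its factors by the deterministic number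
    -- `A n`, with an error that vanishes after averaging over the other sets.
    have hdiff : Tendsto (fun n => 𝔼 I : Config (N n) (sz n), pairWeight q (insert u T) I -
        A n * 𝔼 I : Config (N n) (sz n), pairWeight q T I) atTop (𝓝 0) := by
      refine squeeze_zero_norm' ?_ herr
      filter_upwards [hle, (hsz u).eventually_gt_atTop 0] with n hn' hpos
      have : ∀ u, Nonempty (ColourSet (N n) (sz n u)) := fun u => ColourSet.nonempty (hn' u)
      have h1 : ∀ I : Config (N n) (sz n), 𝔼 J : ColourSet (N n) (sz n u),
          pairWeight q (insert u T) (Function.update I u J) = pairWeight q T I *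
            𝔼 J : ColourSet (N n) (sz n u), ∏ v ∈ T, q v u ^ ((I v).1 ∩ J.1).card := by
        intro I
        rw [Finset.mul_expect]
        refine Finset.expect_congr rfl fun J _ => ?_
        rw [pairWeight_insert q hu, pairWeight_update q hn]
        congr 1
        refine Finset.prod_congr rfl fun v hv => ?_
        rw [Function.update_self, Function.update_of_ne (fun e : v = u => hn (e ▸ hv))]
      rw [expect_update u, Finset.expect_congr rfl fun I _ => h1 I, Finset.mul_expect,
        ← Finset.expect_sub_distrib]
      refine (norm_expect_le _).trans ?_
      calc _ ≤ 𝔼 I : Config (N n) (sz n), δ n * (2 * Q) ^ coll T I := by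
            refine expect_le_expect' fun I => ?_
            rw [mul_comm (A n), ← mul_sub, norm_mul]
            have e := norm_expect_pow_inter_sub_le (hn' u) hpos hQ1 (c := fun v => q v u)
              (fun v => hQ v u) T I hm hK (ρ := ρ n) (S := S n) rfl rfl
            have e' := norm_pairWeight_le hQ T I
            calc _ ≤ Q ^ coll T I * (δ n * 2 ^ coll T I) := by gcongr
              _ = _ := by rw [mul_pow]; ring
        _ = δ n * 𝔼 I : Config (N n) (sz n), (2 * Q) ^ coll T I := by rw [← Finset.mul_expect]
        _ ≤ δ n * B n := by
            have hδn : 0 ≤ δ n := by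
              simp only [hδ, hρd, hS, hK]
              positivity
            gcongr
            exact expect_pow_coll_le hn' (by linarith) T
    have := hdiff.add hmain
    simpa using this

end Limit

/-! ### Small atoms of order statistics, and rarity of aligned coincidences. -/

section Anticoncentration

/-- Passing from `t` to `t + 1` multiplies the right side by `(r - t) / (r + t + 1)` and by the same
expression with `a - r` in place of `r`. Since `2t + 1 ≤ 2m`, and `r` and `a - r` are at least
`8m²`, each ratio is at least `1 - 1/(4m)`; the losses accumulate linearly. -/
lemma choose_sq_le_choose_mul_choose {a r m : ℕ} (hm : 0 < m) (hr : 8 * m ^ 2 ≤ r)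
    (ha : r + 8 * m ^ 2 ≤ a) {t : ℕ} (ht : t ≤ m) :
    (1 - (t : ℝ) / (2 * m)) * (a.choose r : ℝ) ^ 2 ≤
      (a.choose (r + t) : ℝ) * (a.choose (r - t) : ℝ) := by
  have hm2 : m ≤ m ^ 2 := Nat.le_self_pow (by norm_num) m
  have hm' : (0 : ℝ) < m := by exact_mod_cast hm
  induction t with
  | zero => simp [sq]
  | succ t ih =>
    have ih' := ih (by omega)
    have h1 : (a.choose (r + (t + 1)) : ℝ) * (r + t + 1) = a.choose (r + t) * (a - r - t) := by
      have := Nat.choose_succ_right_eq a (r + t)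
      have h2 : ((a - (r + t) : ℕ) : ℝ) = a - r - t := by
        rw [Nat.cast_sub (by omega)]; push_cast; ring
      rw [← h2]
      have h3 : (r : ℝ) + t + 1 = ((r + t + 1 : ℕ) : ℝ) := by push_cast; ring
      rw [h3]
      exact_mod_cast this
    have h2 : (a.choose (r - (t + 1)) : ℝ) * (a - r + t + 1) = a.choose (r - t) * (r - t) := by
      have := Nat.choose_succ_right_eq a (r - (t + 1))
      rw [show r - (t + 1) + 1 = r - t by omega] at this
      have h3 : ((a - (r - (t + 1)) : ℕ) : ℝ) = a - r + t + 1 := by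
        rw [Nat.cast_sub (by omega), Nat.cast_sub (by omega)]; push_cast; ring
      have h4 : ((r - t : ℕ) : ℝ) = r - t := by rw [Nat.cast_sub (by omega)]
      rw [← h3, ← h4]
      exact_mod_cast this.symm
    have hrR : (8 : ℝ) * m ^ 2 ≤ r := by exact_mod_cast hr
    have haR : (r : ℝ) + 8 * m ^ 2 ≤ a := by exact_mod_cast ha
    have htR : (t : ℝ) + 1 ≤ m := by exact_mod_cast ht
    have ht0 : (0 : ℝ) ≤ t := Nat.cast_nonneg t
    have hm1 : (1 : ℝ) ≤ m := by exact_mod_cast hm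
    have frac : ∀ x : ℝ, 8 * (m : ℝ) ^ 2 ≤ x → 1 - 1 / (4 * m) ≤ (x - t) / (x + t + 1) := by
      intro x hx
      have hx0 : 0 < x + t + 1 := by nlinarith
      rw [le_div_iff₀ hx0]
      have : (x + t + 1) / (4 * m) ≥ 2 * t + 1 := by
        rw [ge_iff_le, le_div_iff₀ (by positivity)]
        nlinarith
      have e : (1 - 1 / (4 * (m : ℝ))) * (x + t + 1) = (x + t + 1) - (x + t + 1) / (4 * m) := by ring
      rw [e]; linarith
    have f1 := frac r hrR
    have f2 := frac (a - r) (by linarith)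
    have hq : (1 : ℝ) / (4 * m) ≤ 1 / 4 := by
      rw [div_le_div_iff₀ (by positivity) (by norm_num)]; linarith
    have hf : 1 - 1 / (2 * (m : ℝ)) ≤ (r - t) / (r + t + 1) * ((a - r - t) / (a - r + t + 1)) := by
      have e : (1 : ℝ) / (2 * m) = 1 / (4 * m) + 1 / (4 * m) := by field_simp; norm_num
      have hq0 : (0 : ℝ) ≤ 1 / (4 * m) := by positivity
      calc 1 - 1 / (2 * (m : ℝ)) ≤ (1 - 1 / (4 * m)) * (1 - 1 / (4 * m)) := by rw [e]; nlinarith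
        _ ≤ _ := mul_le_mul f1 f2 (by linarith) (le_trans (by linarith) f1)
    have hr1 : (0 : ℝ) < r + t + 1 := by nlinarith
    have ha1 : (0 : ℝ) < a - r + t + 1 := by nlinarith
    have h1' : (a.choose (r + (t + 1)) : ℝ) = a.choose (r + t) * (a - r - t) / (r + t + 1) := by
      rw [eq_div_iff hr1.ne']; exact h1
    have h2' : (a.choose (r - (t + 1)) : ℝ) = a.choose (r - t) * (r - t) / (a - r + t + 1) := by
      rw [eq_div_iff ha1.ne']; exact h2
    have hhalf : (1 : ℝ) / (2 * m) ≤ 1 / 2 := by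
      rw [div_le_div_iff₀ (by positivity) (by norm_num)]; linarith
    have htm : (t : ℝ) / (2 * m) ≤ 1 := by
      rw [div_le_one (by positivity)]; linarith
    calc (1 - ((t + 1 : ℕ) : ℝ) / (2 * m)) * (a.choose r : ℝ) ^ 2
        ≤ ((1 - 1 / (2 * m)) * (1 - (t : ℝ) / (2 * m))) * (a.choose r : ℝ) ^ 2 := by
          gcongr
          have e : ((t + 1 : ℕ) : ℝ) / (2 * m) = t / (2 * m) + 1 / (2 * m) := by push_cast; ring
          have : 0 ≤ (t : ℝ) / (2 * m) * (1 / (2 * m)) := by positivity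
          rw [e]; nlinarith
      _ = (1 - 1 / (2 * m)) * ((1 - (t : ℝ) / (2 * m)) * (a.choose r : ℝ) ^ 2) := by ring
      _ ≤ ((r - t) / (r + t + 1) * ((a - r - t) / (a - r + t + 1))) *
          ((a.choose (r + t) : ℝ) * (a.choose (r - t) : ℝ)) := by
          refine mul_le_mul hf ih' ?_ (le_trans (by linarith) hf)
          exact mul_nonneg (by linarith) (by positivity)
      _ = _ := by rw [h1', h2']; ring

/-- A hypergeometric distribution has small atoms. -/
lemma choose_mul_choose_mul_le {a b r s m : ℕ} (hm : 0 < m) (hr : 8 * m ^ 2 ≤ r)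
    (ha : r + 8 * m ^ 2 ≤ a) (hs : 8 * m ^ 2 ≤ s) (hb : s + 8 * m ^ 2 ≤ b) :
    m * (a.choose r * b.choose s) ≤ (a + b).choose (r + s) := by
  have hm2 : m ≤ m ^ 2 := Nat.le_self_pow (by norm_num) m
  rw [Nat.add_choose_eq]
  set f : ℕ × ℕ → ℕ := fun x => a.choose x.1 * b.choose x.2
  -- By the preceding estimate the two terms shifted by `t` in opposite directions have product at
  -- least a quarter of the square of the central term, so by the inequality of arithmetic and
  -- geometric means their sum is at least the central term. The `m` shifts give disjoint pairs of
  -- terms of the Vandermonde sum.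
  have step : ∀ t ∈ Finset.Icc 1 m, a.choose r * b.choose s ≤ f (r + t, s - t) + f (r - t, s + t) := by
    intro t ht
    rw [Finset.mem_Icc] at ht
    have h1 := choose_sq_le_choose_mul_choose hm hr ha ht.2
    have h2 := choose_sq_le_choose_mul_choose hm hs hb ht.2
    have hm' : (0 : ℝ) < m := by exact_mod_cast hm
    have htm : (1 : ℝ) / 2 ≤ 1 - (t : ℝ) / (2 * m) := by
      have : (t : ℝ) / (2 * m) ≤ 1 / 2 := by
        rw [div_le_div_iff₀ (by positivity) (by norm_num)]
        have : (t : ℝ) ≤ m := by exact_mod_cast ht.2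
        linarith
      linarith
    have h1' : (1 : ℝ) / 2 * (a.choose r : ℝ) ^ 2 ≤ a.choose (r + t) * a.choose (r - t) :=
      le_trans (by gcongr) h1
    have h2' : (1 : ℝ) / 2 * (b.choose s : ℝ) ^ 2 ≤ b.choose (s + t) * b.choose (s - t) :=
      le_trans (by gcongr) h2
    have h3 := mul_le_mul h1' h2' (by positivity) (by positivity)
    have h4 : (a.choose r * b.choose s : ℝ) ≤
        a.choose (r + t) * b.choose (s - t) + a.choose (r - t) * b.choose (s + t) := by
      refine abs_le_of_sq_le_sq' ?_ (by positivity) |>.2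
      nlinarith [sq_nonneg ((a.choose (r + t) : ℝ) * b.choose (s - t) -
        a.choose (r - t) * b.choose (s + t))]
    exact_mod_cast h4
  have h1 : m * (a.choose r * b.choose s) ≤
      ∑ t ∈ Finset.Icc 1 m, (f (r + t, s - t) + f (r - t, s + t)) := by
    have := Finset.sum_le_sum step
    simpa using this
  refine h1.trans ?_
  rw [Finset.sum_add_distrib]
  have i1 : Set.InjOn (fun t => (r + t, s - t)) (Finset.Icc 1 m : Set ℕ) := by
    intro x _ y _ h
    simp only [Prod.mk.injEq] at h
    omega
  have i2 : Set.InjOn (fun t => (r - t, s + t)) (Finset.Icc 1 m : Set ℕ) := by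
    intro x _ y _ h
    simp only [Prod.mk.injEq] at h
    omega
  rw [← Finset.sum_image (f := f) i1, ← Finset.sum_image (f := f) i2, ← Finset.sum_union]
  · refine Finset.sum_le_sum_of_subset ?_
    intro x hx
    simp only [Finset.mem_union, Finset.mem_image, Finset.mem_Icc] at hx
    rw [Finset.HasAntidiagonal.mem_antidiagonal]
    rcases hx with ⟨t, ht, rfl⟩ | ⟨t, ht, rfl⟩
    · show r + t + (s - t) = r + s
      omega
    · show r - t + (s + t) = r + s
      omega
  · rw [Finset.disjoint_left]
    intro x hx hy
    simp only [Finset.mem_image, Finset.mem_Icc] at hx hy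
    obtain ⟨t, ht, rfl⟩ := hx
    obtain ⟨t', ht', h⟩ := hy
    simp only [Prod.mk.injEq] at h
    omega

/-- The `l`-th element of a set of colours. -/
def ColourSet.el {N p : ℕ} (J : ColourSet N p) (l : Fin p) : Fin N := J.1.orderEmbOfFin J.2 l

variable {N p : ℕ}

lemma ColourSet.el_mem (J : ColourSet N p) (l : Fin p) : J.el l ∈ J.1 :=
  Finset.orderEmbOfFin_mem _ _ _

lemma ColourSet.el_injective (J : ColourSet N p) : Function.Injective J.el :=
  (J.1.orderEmbOfFin J.2).injective

lemma ColourSet.el_strictMono (J : ColourSet N p) : StrictMono J.el :=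
  (J.1.orderEmbOfFin J.2).strictMono

lemma ColourSet.exists_el (J : ColourSet N p) {i : Fin N} (hi : i ∈ J.1) : ∃ l, J.el l = i := by
  have : i ∈ Set.range (J.1.orderEmbOfFin J.2) := by rw [Finset.range_orderEmbOfFin]; exact hi
  exact this

lemma ColourSet.image_el (J : ColourSet N p) : Finset.univ.image J.el = J.1 := by
  ext i
  simp only [Finset.mem_image, Finset.mem_univ, true_and]
  exact ⟨fun ⟨l, hl⟩ => hl ▸ J.el_mem l, fun h => J.exists_el h⟩

lemma ColourSet.sum_el {R : Type*} [AddCommMonoid R] (J : ColourSet N p) (f : Fin N → R) :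
    ∑ l, f (J.el l) = ∑ i ∈ J.1, f i := by
  conv_rhs => rw [← J.image_el]
  rw [Finset.sum_image fun x _ y _ h => J.el_injective h]

lemma ColourSet.card_filter_lt (J : ColourSet N p) (l : Fin p) :
    (J.1.filter (· < J.el l)).card = l := by
  have : J.1.filter (· < J.el l) = (Finset.Iio l).image J.el := by
    ext i
    simp only [Finset.mem_filter, Finset.mem_image, Finset.mem_Iio]
    constructor
    · rintro ⟨hi, hl⟩
      obtain ⟨l', rfl⟩ := J.exists_el hi
      exact ⟨l', J.el_strictMono.lt_iff_lt.1 hl, rfl⟩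
    · rintro ⟨l', hl, rfl⟩
      exact ⟨J.el_mem _, J.el_strictMono hl⟩
  rw [this, Finset.card_image_of_injective _ J.el_injective]
  simp

lemma expect_mem (h : p ≤ N) (i : Fin N) :
    𝔼 J : ColourSet N p, (if i ∈ J.1 then (1 : ℝ) else 0) ≤ (p : ℝ) / N := by
  have := expect_superset h {i}
  simp only [Finset.singleton_subset_iff, Finset.card_singleton] at this
  rw [this]
  simpa using superProb_le h 1

lemma expect_mem_mem (h : p ≤ N) (i j : Fin N) :
    𝔼 J : ColourSet N p, (if i ∈ J.1 ∧ j ∈ J.1 then (1 : ℝ) else 0) ≤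
      ((p : ℝ) / N) ^ ({i, j} : Finset (Fin N)).card := by
  have := expect_superset h {i, j}
  simp only [Finset.insert_subset_iff, Finset.singleton_subset_iff] at this
  rw [this]
  exact superProb_le h _

/-- Prescribing that `i` has rank `l` and that `j` belongs to `J` fixes how many of the other
elements lie below and above `i`. These sets are thus counted by one term of the Vandermonde sum for
all sets containing `i` and `j`. The hypotheses keep `l` and `i` away from the edges, with a margin
of one because `j` may be one of the elements counted. -/
lemma card_el_eq_mem_le {m : ℕ} (hm : 0 < m) (l : Fin p) (i j : Fin N)
    (hl : 8 * m ^ 2 + 1 ≤ l) (hl' : l + (8 * m ^ 2 + 1) < p) (hi : p + (8 * m ^ 2 + 1) ≤ i)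
    (hi' : i + p + (8 * m ^ 2 + 1) < N) :
    m * (Finset.univ.filter fun J : ColourSet N p => J.el l = i ∧ j ∈ J.1).card ≤
      (Finset.univ.filter fun J : ColourSet N p => ({i, j} : Finset (Fin N)) ⊆ J.1).card := by
  set c := ({i, j} : Finset (Fin N)).card with hc
  have hc2 : c ≤ 2 := Finset.card_le_two
  have hc1 : 1 ≤ c := Finset.card_pos.2 ⟨i, by simp⟩
  rw [card_colourSet_superset _ (by omega)]
  set Lo := (Finset.Iio i).erase j with hLo
  set Hi := (Finset.Ioi i).erase j with hHi
  have hdisj : Disjoint Lo Hi := by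
    rw [Finset.disjoint_left]
    intro x hx hx'
    rw [hLo, Finset.mem_erase, Finset.mem_Iio] at hx
    rw [hHi, Finset.mem_erase, Finset.mem_Ioi] at hx'
    exact lt_asymm hx.2 hx'.2
  have hunion : Lo ∪ Hi = ({i, j} : Finset (Fin N))ᶜ := by
    ext x
    simp only [hLo, hHi, Finset.mem_union, Finset.mem_erase, Finset.mem_Iio, Finset.mem_Ioi,
      Finset.mem_compl, Finset.mem_insert, Finset.mem_singleton]
    have := lt_trichotomy x i
    have h2 : x < i → x ≠ i := ne_of_lt
    have h3 : i < x → x ≠ i := ne_of_gt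
    tauto
  have hcardU : Lo.card + Hi.card = N - c := by
    rw [← Finset.card_union_of_disjoint hdisj, hunion, Finset.card_compl, Fintype.card_fin]
  have hLoc : (i : ℕ) - 1 ≤ Lo.card := by
    rw [hLo]
    have := Finset.pred_card_le_card_erase (s := Finset.Iio i) (a := j)
    simpa using this
  have hHic : N - 1 - i - 1 ≤ Hi.card := by
    rw [hHi]
    have := Finset.pred_card_le_card_erase (s := Finset.Ioi i) (a := j)
    simpa using this
  -- Of the `l` elements below `i` one is `j` itself if `j < i`, and it has been removed from `Lo`.
  set d := if j < i then 1 else 0 with hd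
  have hd1 : d ≤ 1 := by rw [hd]; split_ifs <;> omega
  set r := (l : ℕ) - d with hr
  set s := p - c - r with hs
  have hcard : ∀ J : ColourSet N p, J.el l = i → j ∈ J.1 →
      (J.1 ∩ Lo).card = r ∧ (J.1 ∩ Hi).card = s := by
    intro J hJ hj
    have h1 : (J.1 ∩ Lo).card = r := by
      have e : J.1 ∩ Lo = (J.1.filter (· < i)).erase j := by
        ext x
        simp only [hLo, Finset.mem_inter, Finset.mem_erase, Finset.mem_Iio, Finset.mem_filter]
        tauto
      rw [e, Finset.card_erase_eq_ite, ← hJ, J.card_filter_lt, hJ, hr, hd]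
      by_cases hji : j < i <;> simp [hji, hj]
    refine ⟨h1, ?_⟩
    have e : J.1 ∩ Lo ∪ J.1 ∩ Hi = J.1 \ {i, j} := by
      rw [← Finset.inter_union_distrib_left, hunion, Finset.sdiff_eq_inter_compl]
    have hij : ({i, j} : Finset (Fin N)) ⊆ J.1 := by
      rw [Finset.insert_subset_iff, Finset.singleton_subset_iff]
      exact ⟨hJ ▸ J.el_mem l, hj⟩
    have h2 := Finset.card_sdiff_of_subset hij
    rw [← e, Finset.card_union_of_disjoint, J.2, ← hc, h1] at h2
    · omega
    · exact Disjoint.mono Finset.inter_subset_right Finset.inter_subset_right hdisj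
  have hinj : (Finset.univ.filter fun J : ColourSet N p => J.el l = i ∧ j ∈ J.1).card ≤
      ((Finset.powersetCard r Lo) ×ˢ (Finset.powersetCard s Hi)).card := by
    refine Finset.card_le_card_of_injOn (fun J => (J.1 ∩ Lo, J.1 ∩ Hi)) ?_ ?_
    · intro J hJ
      simp only [Finset.coe_filter, Finset.mem_univ, true_and, Set.mem_ofPred_eq] at hJ
      simp only [Finset.coe_product, Set.mem_prod, Finset.mem_coe, Finset.mem_powersetCard]
      exact ⟨⟨Finset.inter_subset_right, (hcard J hJ.1 hJ.2).1⟩,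
        ⟨Finset.inter_subset_right, (hcard J hJ.1 hJ.2).2⟩⟩
    · intro J hJ K hK e
      simp only [Finset.coe_filter, Finset.mem_univ, true_and, Set.mem_ofPred_eq] at hJ hK
      simp only [Prod.mk.injEq] at e
      ext x
      by_cases hx : x ∈ ({i, j} : Finset (Fin N))
      · rw [Finset.mem_insert, Finset.mem_singleton] at hx
        rcases hx with rfl | rfl
        · exact iff_of_true (hJ.1 ▸ J.el_mem l) (hK.1 ▸ K.el_mem l)
        · exact iff_of_true hJ.2 hK.2
      · rw [← Finset.mem_compl, ← hunion, Finset.mem_union] at hx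
        rcases hx with hx | hx
        · have := Finset.ext_iff.1 e.1 x
          simpa [hx] using this
        · have := Finset.ext_iff.1 e.2 x
          simpa [hx] using this
  rw [Finset.card_product, Finset.card_powersetCard, Finset.card_powersetCard] at hinj
  have hl2 := l.2
  calc _ ≤ m * (Lo.card.choose r * Hi.card.choose s) := Nat.mul_le_mul_left _ hinj
    _ ≤ (Lo.card + Hi.card).choose (r + s) := by
        refine choose_mul_choose_mul_le hm ?_ ?_ ?_ ?_ <;> omega
    _ = _ := by rw [hcardU, ← hc]; congr 1; omega

lemma expect_el_eq_mem_le {m : ℕ} (hm : 0 < m) (h : p ≤ N) (l : Fin p) (i j : Fin N)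
    (hl : 8 * m ^ 2 + 1 ≤ l) (hl' : l + (8 * m ^ 2 + 1) < p) (hi : p + (8 * m ^ 2 + 1) ≤ i)
    (hi' : i + p + (8 * m ^ 2 + 1) < N) :
    𝔼 J : ColourSet N p, (if J.el l = i ∧ j ∈ J.1 then (1 : ℝ) else 0) ≤
      (1 / m) * ((p : ℝ) / N) ^ ({i, j} : Finset (Fin N)).card := by
  have h1 := expect_superset h {i, j}
  have h2 := card_el_eq_mem_le hm l i j hl hl' hi hi'
  have hm' : (0 : ℝ) < m := by exact_mod_cast hm
  calc _ ≤ (1 / m) * superProb N p ({i, j} : Finset (Fin N)).card := by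
        rw [← h1, Fintype.expect_eq_sum_div_card, Fintype.expect_eq_sum_div_card, Finset.sum_boole,
          Finset.sum_boole, ← mul_div_assoc]
        gcongr
        rw [one_div, le_inv_mul_iff₀ hm']
        exact_mod_cast h2
    _ ≤ _ := by
        gcongr
        exact superProb_le h _

lemma card_edge_le (n a : ℕ) :
    (Finset.univ.filter fun l : Fin n => (l : ℕ) < a ∨ n ≤ l + a).card ≤ 2 * a := by
  rw [Finset.filter_or]
  refine (Finset.card_union_le _ _).trans ?_
  have h1 : (Finset.univ.filter fun l : Fin n => (l : ℕ) < a).card ≤ a := by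
    have := Finset.card_le_card_of_injOn (s := Finset.univ.filter fun l : Fin n => (l : ℕ) < a)
      (t := Finset.range a) (fun l => (l : ℕ)) (by intro l hl; simpa using hl)
      (fun x _ y _ e => Fin.ext e)
    simpa using this
  have h2 : (Finset.univ.filter fun l : Fin n => n ≤ l + a).card ≤ a := by
    have := Finset.card_le_card_of_injOn (s := Finset.univ.filter fun l : Fin n => n ≤ l + a)
      (t := Finset.range a) (fun l => n - 1 - (l : ℕ))
      (by
        intro l hl
        have := l.2
        simp at hl ⊢
        omega)
      (fun x _ y _ e => by
        have := x.2; have := y.2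
        simp only at e
        exact Fin.ext (by omega))
    simpa using this
  omega

/-- Positions in `EL` and colours in `EN` (the edges) are estimated crudely. In the bulk one also
sums over the two values `i` and `j` of the `l`-th elements: every term is then a function of `I`
times a function of `K`, so that its average factorizes. -/
lemma sum_aligned_le (EL : Finset (Fin p)) (EN : Finset (Fin N)) (I K : ColourSet N p) :
    ∑ l, (if I.el l ∈ K.1 ∧ K.el l ∈ I.1 then (1 : ℝ) else 0) ≤
    ∑ l ∈ EL, (if I.el l ∈ K.1 then (1 : ℝ) else 0) +
    ∑ i ∈ EN, (if i ∈ I.1 then (1 : ℝ) else 0) * (if i ∈ K.1 then (1 : ℝ) else 0) +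
    ∑ i ∈ ENᶜ, ∑ j, ∑ l ∈ ELᶜ, (if I.el l = i ∧ j ∈ I.1 then (1 : ℝ) else 0) *
      (if K.el l = j ∧ i ∈ K.1 then (1 : ℝ) else 0) := by
  rw [← Finset.sum_add_sum_compl EL, add_assoc]
  refine add_le_add (Finset.sum_le_sum fun l _ => ?_) ?_
  · by_cases h1 : I.el l ∈ K.1 <;> by_cases h2 : K.el l ∈ I.1 <;> simp [h1, h2]
  · have e1 : ∀ l : Fin p, (if I.el l ∈ K.1 ∧ K.el l ∈ I.1 then (1 : ℝ) else 0) ≤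
        ∑ i ∈ EN, (if I.el l = i then 1 else 0) * (if i ∈ K.1 then (1 : ℝ) else 0) +
        ∑ i ∈ ENᶜ, ∑ j, (if I.el l = i ∧ j ∈ I.1 then (1 : ℝ) else 0) *
          (if K.el l = j ∧ i ∈ K.1 then (1 : ℝ) else 0) := by
      intro l
      have p1 : 0 ≤ ∑ i ∈ EN, (if I.el l = i then 1 else 0) * (if i ∈ K.1 then (1 : ℝ) else 0) :=
        Finset.sum_nonneg fun i _ => by positivity
      have p2 : ∀ i, 0 ≤ ∑ j, (if I.el l = i ∧ j ∈ I.1 then (1 : ℝ) else 0) *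
          (if K.el l = j ∧ i ∈ K.1 then (1 : ℝ) else 0) := fun i =>
        Finset.sum_nonneg fun i _ => by positivity
      have p3 := Finset.sum_nonneg fun i (_ : i ∈ ENᶜ) => p2 i
      split_ifs with hc
      · by_cases hE : I.el l ∈ EN
        · have := Finset.single_le_sum (f := fun i => (if I.el l = i then 1 else 0) *
            (if i ∈ K.1 then (1 : ℝ) else 0)) (fun i _ => by positivity) hE
          simp only [hc.1, if_true, mul_one] at this
          linarith
        · have h1 := Finset.single_le_sum (f := fun i => ∑ j, (if I.el l = i ∧ j ∈ I.1 then (1 : ℝ)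
            else 0) * (if K.el l = j ∧ i ∈ K.1 then (1 : ℝ) else 0)) (fun i _ => p2 i)
            (Finset.mem_compl.2 hE)
          have h2 := Finset.single_le_sum (f := fun j => (if I.el l = I.el l ∧ j ∈ I.1 then (1 : ℝ)
            else 0) * (if K.el l = j ∧ I.el l ∈ K.1 then (1 : ℝ) else 0))
            (fun i _ => by positivity) (Finset.mem_univ (K.el l))
          simp only [hc.1, hc.2, and_self, if_true, mul_one] at h1 h2
          linarith
      · linarith
    refine (Finset.sum_le_sum fun l _ => e1 l).trans ?_
    rw [Finset.sum_add_distrib]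
    refine add_le_add ?_ ?_
    · rw [Finset.sum_comm]
      refine Finset.sum_le_sum fun i _ => ?_
      rw [← Finset.sum_mul]
      refine mul_le_mul_of_nonneg_right ?_ (by positivity)
      calc ∑ l ∈ ELᶜ, (if I.el l = i then (1 : ℝ) else 0) ≤ ∑ l, (if I.el l = i then (1 : ℝ) else 0) :=
            Finset.sum_le_sum_of_subset_of_nonneg (Finset.subset_univ _) fun _ _ _ => by positivity
        _ = ∑ i' ∈ I.1, (if i' = i then (1 : ℝ) else 0) :=
            I.sum_el (fun i' => if i' = i then (1 : ℝ) else 0)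
        _ ≤ _ := by simp
    · rw [Finset.sum_comm]
      refine Finset.sum_le_sum fun i _ => ?_
      rw [Finset.sum_comm]

/-- The atom bound gains `1 / m` on the first factor uniformly in `l`. The second factor can be
summed over `l` for free, since `j` has at most one rank in `K`. -/
lemma sum_bulk_le {m : ℕ} (hm : 0 < m) (h : p ≤ N) {L : ℕ} (hL : L = 8 * m ^ 2 + 1) (i j : Fin N)
    (hi : p + L ≤ i) (hi' : i + p + L < N) :
    ∑ l ∈ (Finset.univ.filter fun l : Fin p => (l : ℕ) < L ∨ p ≤ l + L)ᶜ,
      (𝔼 I : ColourSet N p, (if I.el l = i ∧ j ∈ I.1 then (1 : ℝ) else 0)) *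
      (𝔼 K : ColourSet N p, if K.el l = j ∧ i ∈ K.1 then (1 : ℝ) else 0) ≤
    (1 / m) * (((p : ℝ) / N) ^ ({i, j} : Finset (Fin N)).card *
      ((p : ℝ) / N) ^ ({i, j} : Finset (Fin N)).card) := by
  set ρ : ℝ := (p : ℝ) / N with hρ
  have hρ0 : 0 ≤ ρ := by positivity
  have hm' : (0 : ℝ) < m := by exact_mod_cast hm
  set EL : Finset (Fin p) := Finset.univ.filter fun l => (l : ℕ) < L ∨ p ≤ l + L with hEL
  calc _ ≤ ∑ l ∈ ELᶜ, ((1 / m) * ρ ^ ({i, j} : Finset (Fin N)).card) *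
        (𝔼 K : ColourSet N p, if K.el l = j ∧ i ∈ K.1 then (1 : ℝ) else 0) := by
        refine Finset.sum_le_sum fun l hl => ?_
        rw [Finset.mem_compl, hEL, Finset.mem_filter] at hl
        simp only [Finset.mem_univ, true_and, not_or, not_lt, not_le] at hl
        refine mul_le_mul_of_nonneg_right ?_ (expect_nonneg' fun _ => by positivity)
        exact expect_el_eq_mem_le hm h l i j (by omega) (by omega) (by omega) (by omega)
    _ ≤ ((1 / m) * ρ ^ ({i, j} : Finset (Fin N)).card) *
          ρ ^ ({i, j} : Finset (Fin N)).card := by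
        rw [← Finset.mul_sum, ← Finset.expect_sum_comm]
        refine mul_le_mul_of_nonneg_left ?_ (by positivity)
        refine le_trans (expect_le_expect' fun K => ?_) (expect_mem_mem h i j)
        calc ∑ l ∈ ELᶜ, (if K.el l = j ∧ i ∈ K.1 then (1 : ℝ) else 0)
            ≤ ∑ l, (if K.el l = j ∧ i ∈ K.1 then (1 : ℝ) else 0) :=
              Finset.sum_le_sum_of_subset_of_nonneg (Finset.subset_univ _)
                fun _ _ _ => by positivity
          _ = ∑ j' ∈ K.1, (if j' = j ∧ i ∈ K.1 then (1 : ℝ) else 0) :=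
              K.sum_el (fun j' => if j' = j ∧ i ∈ K.1 then (1 : ℝ) else 0)
          _ ≤ _ := by
            by_cases hiK : i ∈ K.1 <;> simp [hiK]
    _ = _ := by ring

/-- Aligned coincidences of two independent sets are rare. -/
lemma expect_aligned_le {m : ℕ} (hm : 0 < m) (h : p ≤ N) {L : ℕ} (hL : L = 8 * m ^ 2 + 1) :
    𝔼 I : ColourSet N p, 𝔼 K : ColourSet N p,
      ∑ l, (if I.el l ∈ K.1 ∧ K.el l ∈ I.1 then (1 : ℝ) else 0) ≤
    2 * L * ((p : ℝ) / N) + 2 * (p + L) * ((p : ℝ) / N) ^ 2 +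
      (1 / m) * (N * ((p : ℝ) / N) ^ 2 + N ^ 2 * ((p : ℝ) / N) ^ 4) := by
  have : Nonempty (ColourSet N p) := ColourSet.nonempty h
  set ρ : ℝ := (p : ℝ) / N with hρ
  have hρ0 : 0 ≤ ρ := by positivity
  have hm' : (0 : ℝ) < m := by exact_mod_cast hm
  set EL : Finset (Fin p) := Finset.univ.filter fun l => (l : ℕ) < L ∨ p ≤ l + L with hEL
  set EN : Finset (Fin N) := Finset.univ.filter fun i => (i : ℕ) < p + L ∨ N ≤ i + p + L with hEN
  calc _ ≤ 𝔼 I : ColourSet N p, 𝔼 K : ColourSet N p,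
        (∑ l ∈ EL, (if I.el l ∈ K.1 then (1 : ℝ) else 0) +
      ∑ i ∈ EN, (if i ∈ I.1 then (1 : ℝ) else 0) * (if i ∈ K.1 then (1 : ℝ) else 0) +
      ∑ i ∈ ENᶜ, ∑ j, ∑ l ∈ ELᶜ, (if I.el l = i ∧ j ∈ I.1 then (1 : ℝ) else 0) *
        (if K.el l = j ∧ i ∈ K.1 then (1 : ℝ) else 0)) :=
        expect_le_expect' fun I => expect_le_expect' fun K => sum_aligned_le EL EN I K
    _ = 𝔼 I : ColourSet N p, ∑ l ∈ EL, 𝔼 K : ColourSet N p, (if I.el l ∈ K.1 then (1 : ℝ) else 0) +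
        ∑ i ∈ EN, (𝔼 I : ColourSet N p, (if i ∈ I.1 then (1 : ℝ) else 0)) *
          (𝔼 K : ColourSet N p, if i ∈ K.1 then (1 : ℝ) else 0) +
        ∑ i ∈ ENᶜ, ∑ j, ∑ l ∈ ELᶜ,
          (𝔼 I : ColourSet N p, (if I.el l = i ∧ j ∈ I.1 then (1 : ℝ) else 0)) *
          (𝔼 K : ColourSet N p, if K.el l = j ∧ i ∈ K.1 then (1 : ℝ) else 0) := by
        simp only [Finset.expect_add_distrib, Finset.expect_sum_comm, Fintype.expect_mul_expect]
    _ ≤ 2 * L * ρ + 2 * (p + L) * ρ ^ 2 + ∑ i ∈ ENᶜ, ∑ j, (1 / m) *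
          (ρ ^ ({i, j} : Finset (Fin N)).card * ρ ^ ({i, j} : Finset (Fin N)).card) := by
        refine add_le_add (add_le_add ?_ ?_) ?_
        · refine expect_le_of_forall_le fun I => ?_
          calc _ ≤ ∑ l ∈ EL, ρ := Finset.sum_le_sum fun l _ => expect_mem h _
            _ = EL.card * ρ := by simp
            _ ≤ _ := by
              gcongr
              exact_mod_cast card_edge_le p L
        · calc _ ≤ ∑ i ∈ EN, ρ * ρ := by
                refine Finset.sum_le_sum fun i _ => ?_
                refine mul_le_mul (expect_mem h _) (expect_mem h _) ?_ hρ0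
                exact expect_nonneg' fun _ => by positivity
            _ = EN.card * (ρ * ρ) := by simp
            _ ≤ (2 * (p + L) : ℕ) * (ρ * ρ) := by
              gcongr
              have := card_edge_le N (p + L)
              simpa only [hEN, add_assoc] using this
            _ = _ := by push_cast; ring
        · refine Finset.sum_le_sum fun i hi => Finset.sum_le_sum fun j _ => ?_
          rw [Finset.mem_compl, hEN, Finset.mem_filter] at hi
          simp only [Finset.mem_univ, true_and, not_or, not_lt, not_le] at hi
          exact sum_bulk_le hm h hL i j hi.1 hi.2
    _ ≤ _ := by
        gcongr
        calc _ ≤ ∑ i : Fin N, ∑ j, (1 / m) *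
          (ρ ^ ({i, j} : Finset (Fin N)).card * ρ ^ ({i, j} : Finset (Fin N)).card) :=
              Finset.sum_le_sum_of_subset_of_nonneg (Finset.subset_univ _) fun _ _ _ => by positivity
          -- For `i = j` the pair is a single colour, which gives `N ρ²` in total; the other pairs
          -- give at most `N² ρ⁴`. Both stay bounded when `p² / N` does.
          _ ≤ ∑ i : Fin N, ∑ j, (1 / m) * ((if i = j then ρ ^ 2 else 0) + ρ ^ 4) := by
              gcongr with i _ j _
              by_cases hij : i = j
              · subst hij
                simp only [Finset.pair_eq_singleton, Finset.card_singleton, if_true]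
                have : 0 ≤ ρ ^ 4 := by positivity
                nlinarith
              · rw [Finset.card_pair hij, if_neg hij]
                exact le_of_eq (by ring)
          _ = _ := by
              simp only [← Finset.mul_sum, Finset.sum_add_distrib, Finset.sum_ite_eq,
                Finset.mem_univ, if_true, Finset.sum_const, Finset.card_univ, Fintype.card_fin,
                nsmul_eq_mul]
              ring

end Anticoncentration

/-! ### Expected numbers of the bad coincidences. -/

section Rare

variable {U : Type*} [Fintype U] [LinearOrder U]

/-- No colour lies in three of the sets, and no two colours which are paired by an H chord both
lie in a second set. -/
def Good {N : ℕ} {sz : U → ℕ} (τ : U → U) (hτ : ∀ u, sz u = sz (τ u)) (I : Config N sz) : Prop :=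
  (∀ i, occ Finset.univ I i ≤ 2) ∧ ∀ u, τ u ≠ u → ∀ l : Fin (sz u),
    occ Finset.univ I ((I u).el l) ≤ 1 ∨
      occ Finset.univ I ((I (τ u)).el (Fin.cast (hτ u) l)) ≤ 1

variable {N : ℕ} {sz : U → ℕ}

lemma expect_le_of_update (hsz : ∀ u, sz u ≤ N) (u : U) {f g : Config N sz → ℝ} {c : ℝ}
    (h : ∀ I, 𝔼 J : ColourSet N (sz u), f (Function.update I u J) ≤ c * g I) :
    𝔼 I, f I ≤ c * 𝔼 I, g I := by
  have : ∀ u, Nonempty (ColourSet N (sz u)) := fun u => ColourSet.nonempty (hsz u)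
  rw [expect_update u, Finset.mul_expect]
  exact expect_le_expect' h

/-- Indicator function of a proposition. -/
abbrev ind (P : Prop) [Decidable P] : ℝ := if P then 1 else 0

lemma ind_nonneg (P : Prop) [Decidable P] : 0 ≤ ind P := by
  unfold ind; positivity

lemma ind_and (P Q : Prop) [Decidable P] [Decidable Q] : ind (P ∧ Q) = ind P * ind Q := by
  by_cases hP : P <;> by_cases hQ : Q <;> simp [ind, hP, hQ]

/-- Resampling `I w` and then `I v` costs one density each; the remaining sum over colours is the
size of `I u`. -/
lemma expect_triple_le (hsz : ∀ u, sz u ≤ N) {u v w : U} (huv : u ≠ v) (huw : u ≠ w) (hvw : v ≠ w) :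
    𝔼 I : Config N sz, ∑ i, ind (i ∈ (I u).1) * ind (i ∈ (I v).1) * ind (i ∈ (I w).1) ≤
      (sz w : ℝ) / N * ((sz v : ℝ) / N * sz u) := by
  have : ∀ u, Nonempty (ColourSet N (sz u)) := fun u => ColourSet.nonempty (hsz u)
  refine (expect_le_of_update hsz w (g := fun I => ∑ i, ind (i ∈ (I u).1) * ind (i ∈ (I v).1))
    fun I => ?_).trans (mul_le_mul_of_nonneg_left ((expect_le_of_update hsz v
      (g := fun I => ∑ i, ind (i ∈ (I u).1)) fun I => ?_).trans
        (mul_le_mul_of_nonneg_left ?_ (by positivity))) (by positivity))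
  · rw [Finset.expect_sum_comm, Finset.mul_sum]
    refine Finset.sum_le_sum fun i _ => ?_
    simp only [Function.update_self, Function.update_of_ne huw, Function.update_of_ne hvw]
    rw [← Finset.mul_expect, mul_comm]
    exact mul_le_mul_of_nonneg_right (expect_mem (hsz w) i)
      (mul_nonneg (ind_nonneg _) (ind_nonneg _))
  · rw [Finset.expect_sum_comm, Finset.mul_sum]
    refine Finset.sum_le_sum fun i _ => ?_
    simp only [Function.update_self, Function.update_of_ne huv]
    rw [← Finset.mul_expect, mul_comm]
    exact mul_le_mul_of_nonneg_right (expect_mem (hsz v) i) (ind_nonneg _)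
  · refine expect_le_of_forall_le fun I => ?_
    simp [ind, (I u).2]

/-- The number of `l` such that the `l`-th elements of `I s` and `I t` lie in `I u` and `I v`. -/
def doubleHits (s t u v : U) (h : sz s = sz t) (I : Config N sz) : ℝ :=
  ∑ l, ind (((I s).el l ∈ (I u).1 ∧ (I t).el (Fin.cast h l) ∈ (I v).1) ∧
    (u = v → (I s).el l ≠ (I t).el (Fin.cast h l)))

lemma doubleHits_nonneg (s t u v : U) (h : sz s = sz t) (I : Config N sz) :
    0 ≤ doubleHits s t u v h I := Finset.sum_nonneg fun _ _ => ind_nonneg _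

lemma ind_mono {P Q : Prop} [Decidable P] [Decidable Q] (h : P → Q) : ind P ≤ ind Q := by
  unfold ind
  split_ifs with h1 h2 <;> first | exact absurd (h h1) h2 | simp

lemma expect_sum_el_mem_le (hsz : ∀ u, sz u ≤ N) {s u : U} (hsu : s ≠ u) :
    𝔼 I : Config N sz, ∑ l, ind ((I s).el l ∈ (I u).1) ≤ (sz u : ℝ) / N * sz s := by
  have : ∀ u, Nonempty (ColourSet N (sz u)) := fun u => ColourSet.nonempty (hsz u)
  refine (expect_le_of_update hsz u (g := fun _ => (sz s : ℝ)) (c := (sz u : ℝ) / N)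
    fun I => ?_).trans_eq (by simp)
  rw [Finset.expect_sum_comm]
  simp only [Function.update_self, Function.update_of_ne hsu]
  refine (Finset.sum_le_sum fun l _ => expect_mem (hsz u) _).trans_eq ?_
  simp [mul_comm]

/-- Outside the excluded case some set can be resampled independently of the slots it has to hit. If
`u = v`, this set must contain two distinct colours, which costs a squared density. If `u = t`,
resample `v`, which is then neither `s` nor `t`. Otherwise resample `u`. In the last two cases one
membership between two sets is left. -/
lemma expect_doubleHits_le (hsz : ∀ u, sz u ≤ N) {s t u v : U} (h : sz s = sz t) (hst : s ≠ t)
    (hu : u ≠ s) (hv : v ≠ t) (huv : ¬(u = t ∧ v = s)) :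
    𝔼 I : Config N sz, doubleHits s t u v h I ≤ (sz u : ℝ) / N * ((sz v : ℝ) / N * sz s) := by
  have : ∀ u, Nonempty (ColourSet N (sz u)) := fun u => ColourSet.nonempty (hsz u)
  have hcast : ∀ (I : Config N sz) (w : U), ∑ l, ind ((I t).el (Fin.cast h l) ∈ (I w).1) =
      ∑ l, ind ((I t).el l ∈ (I w).1) := fun I w =>
    Fintype.sum_equiv (finCongr h) _ _ fun l => rfl
  by_cases huv' : u = v
  · subst huv'
    have hut : u ≠ t := hv
    refine (expect_le_of_update hsz u (g := fun _ => (sz s : ℝ)) (c := ((sz u : ℝ) / N) ^ 2)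
      fun I => ?_).trans_eq (by simp; ring)
    unfold doubleHits
    simp only [Function.update_self, Function.update_of_ne hu.symm, Function.update_of_ne hut.symm]
    rw [Finset.expect_sum_comm]
    calc _ ≤ ∑ l : Fin (sz s), ((sz u : ℝ) / N) ^ 2 := by
          refine Finset.sum_le_sum fun l _ => ?_
          by_cases hne : (I s).el l = (I t).el (Fin.cast h l)
          · simp only [hne, ne_eq, not_true_eq_false, imp_false, and_false, ind,
              if_false, Finset.expect_const_zero]
            positivity
          · refine (expect_le_expect' fun J => ind_mono fun h => h.1).trans ?_
            refine (expect_mem_mem (hsz u) _ _).trans_eq ?_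
            rw [Finset.card_pair hne]
      _ = _ := by simp [mul_comm]
  by_cases hut : u = t
  · have hvs : v ≠ s := fun e => huv ⟨hut, e⟩
    subst hut
    rw [mul_left_comm]
    refine (expect_le_of_update hsz v (g := fun I => ∑ l, ind ((I s).el l ∈ (I u).1))
      fun I => ?_).trans (mul_le_mul_of_nonneg_left (expect_sum_el_mem_le hsz hst) (by positivity))
    unfold doubleHits
    simp only [Function.update_self, Function.update_of_ne hvs.symm, Function.update_of_ne hv.symm]
    rw [Finset.expect_sum_comm, Finset.mul_sum]
    refine Finset.sum_le_sum fun l _ => ?_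
    refine (expect_le_expect' fun J => ind_mono fun h => h.1).trans ?_
    simp_rw [ind_and]
    rw [← Finset.mul_expect, mul_comm]
    exact mul_le_mul_of_nonneg_right (expect_mem (hsz v) _) (ind_nonneg _)
  · refine (expect_le_of_update hsz u (g := fun I => ∑ l, ind ((I t).el l ∈ (I v).1))
      fun I => ?_).trans (mul_le_mul_of_nonneg_left
        ((expect_sum_el_mem_le hsz hv.symm).trans_eq (by rw [h])) (by positivity))
    rw [← hcast]
    unfold doubleHits
    simp only [Function.update_self, Function.update_of_ne hu.symm,
      Function.update_of_ne (Ne.symm hut), Function.update_of_ne (Ne.symm huv')]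
    rw [Finset.expect_sum_comm, Finset.mul_sum]
    refine Finset.sum_le_sum fun l _ => ?_
    refine (expect_le_expect' fun J => ind_mono fun h => h.1).trans ?_
    simp_rw [ind_and]
    rw [← Finset.expect_mul]
    exact mul_le_mul_of_nonneg_right (expect_mem (hsz u) _) (ind_nonneg _)

lemma expect_aligned_cast_le {p p' : ℕ} (hpp : p = p') {m : ℕ} (hm : 0 < m) (h : p ≤ N) {L : ℕ}
    (hL : L = 8 * m ^ 2 + 1) :
    𝔼 I : ColourSet N p, 𝔼 K : ColourSet N p',
      ∑ l, ind (I.el l ∈ K.1 ∧ K.el (Fin.cast hpp l) ∈ I.1) ≤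
    2 * L * ((p : ℝ) / N) + 2 * (p + L) * ((p : ℝ) / N) ^ 2 +
      (1 / m) * (N * ((p : ℝ) / N) ^ 2 + N ^ 2 * ((p : ℝ) / N) ^ 4) := by
  subst hpp
  exact expect_aligned_le hm h hL

/-- Here both hits tie the same two sets to each other, and resampling one set does not separate
them. The estimate for aligned coincidences applies instead. -/
lemma expect_doubleHits_swap_le (hsz : ∀ u, sz u ≤ N) {s t : U} (h : sz s = sz t) (hst : s ≠ t)
    {m : ℕ} (hm : 0 < m) {L : ℕ} (hL : L = 8 * m ^ 2 + 1) :
    𝔼 I : Config N sz, doubleHits s t t s h I ≤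
      2 * L * ((sz s : ℝ) / N) + 2 * (sz s + L) * ((sz s : ℝ) / N) ^ 2 +
      (1 / m) * (N * ((sz s : ℝ) / N) ^ 2 + N ^ 2 * ((sz s : ℝ) / N) ^ 4) := by
  have : ∀ u, Nonempty (ColourSet N (sz u)) := fun u => ColourSet.nonempty (hsz u)
  rw [expect_update t, expect_update s]
  refine expect_le_of_forall_le fun I => ?_
  refine le_trans (expect_le_expect' fun J => expect_le_expect' fun K => ?_)
    (expect_aligned_cast_le h hm (hsz s) hL)
  unfold doubleHits
  simp only [Function.update_self, Function.update_of_ne hst]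
  exact Finset.sum_le_sum fun l _ => ind_mono fun h => h.1

-- A union bound: a configuration which is not good has a colour in three sets or a position at
-- which two opposite slots are both hit.
open scoped Classical in
lemma ind_not_good_le (τ : U → U) (hτ : ∀ u, sz u = sz (τ u)) (I : Config N sz) :
    ind (¬ Good τ hτ I) ≤
      ∑ u, ∑ v, ∑ w, (if u ≠ v ∧ u ≠ w ∧ v ≠ w then
        ∑ i, ind (i ∈ (I u).1) * ind (i ∈ (I v).1) * ind (i ∈ (I w).1) else 0) +
      ∑ s, ∑ u, ∑ v, (if τ s ≠ s ∧ u ≠ s ∧ v ≠ τ s then doubleHits s (τ s) u v (hτ s) I else 0) := by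
  have q1 : ∀ u v w, 0 ≤ (if u ≠ v ∧ u ≠ w ∧ v ≠ w then
        ∑ i, ind (i ∈ (I u).1) * ind (i ∈ (I v).1) * ind (i ∈ (I w).1) else 0) := fun u v w => by
    split_ifs
    · exact Finset.sum_nonneg fun i _ => mul_nonneg (mul_nonneg (ind_nonneg _) (ind_nonneg _))
        (ind_nonneg _)
    · exact le_rfl
  have q2 : ∀ s u v, 0 ≤ (if τ s ≠ s ∧ u ≠ s ∧ v ≠ τ s then
      doubleHits s (τ s) u v (hτ s) I else 0) := fun s u v => by
    split_ifs
    · exact doubleHits_nonneg _ _ _ _ _ _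
    · exact le_rfl
  have q1' := Finset.sum_nonneg fun u (_ : u ∈ Finset.univ) => Finset.sum_nonneg fun v
    (_ : v ∈ Finset.univ) => Finset.sum_nonneg fun w (_ : w ∈ Finset.univ) => q1 u v w
  have q2' := Finset.sum_nonneg fun u (_ : u ∈ Finset.univ) => Finset.sum_nonneg fun v
    (_ : v ∈ Finset.univ) => Finset.sum_nonneg fun w (_ : w ∈ Finset.univ) => q2 u v w
  have single : ∀ (f : U → U → U → ℝ), (∀ u v w, 0 ≤ f u v w) → ∀ u v w,
      f u v w ≤ ∑ u, ∑ v, ∑ w, f u v w := by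
    intro f hf u v w
    calc f u v w ≤ ∑ w, f u v w :=
          Finset.single_le_sum (f := fun w => f u v w) (fun _ _ => hf _ _ _) (Finset.mem_univ w)
      _ ≤ ∑ v, ∑ w, f u v w := Finset.single_le_sum (f := fun v => ∑ w, f u v w)
          (fun _ _ => Finset.sum_nonneg fun _ _ => hf _ _ _) (Finset.mem_univ v)
      _ ≤ _ := Finset.single_le_sum (f := fun u => ∑ v, ∑ w, f u v w)
          (fun _ _ => Finset.sum_nonneg fun _ _ => Finset.sum_nonneg fun _ _ => hf _ _ _)
          (Finset.mem_univ u)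
  by_cases hG : Good τ hτ I
  · rw [ind, if_neg (not_not.2 hG)]
    exact add_nonneg q1' q2'
  rw [ind, if_pos hG]
  have triple : (∃ i u v w, u ≠ v ∧ u ≠ w ∧ v ≠ w ∧ i ∈ (I u).1 ∧ i ∈ (I v).1 ∧ i ∈ (I w).1) →
      1 ≤ ∑ u, ∑ v, ∑ w, (if u ≠ v ∧ u ≠ w ∧ v ≠ w then
        ∑ i, ind (i ∈ (I u).1) * ind (i ∈ (I v).1) * ind (i ∈ (I w).1) else 0) := by
    rintro ⟨i, u, v, w, h1, h2, h3, m1, m2, m3⟩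
    refine le_trans ?_ (single _ q1 u v w)
    rw [if_pos ⟨h1, h2, h3⟩]
    refine le_trans ?_ (Finset.single_le_sum (f := fun i =>
      ind (i ∈ (I u).1) * ind (i ∈ (I v).1) * ind (i ∈ (I w).1)) (fun i _ =>
        mul_nonneg (mul_nonneg (ind_nonneg _) (ind_nonneg _)) (ind_nonneg _)) (Finset.mem_univ i))
    simp [ind, m1, m2, m3]
  by_cases h2 : ∀ i, occ Finset.univ I i ≤ 2
  · simp only [Good, not_and, not_forall, not_or, not_le] at hG
    obtain ⟨s, hs, l, ha, hb⟩ := hG h2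
    set a := (I s).el l with haDef
    set b := (I (τ s)).el (Fin.cast (hτ s) l) with hbDef
    have other : ∀ (x : Fin N) (r : U), 1 < occ Finset.univ I x → ∃ u, u ≠ r ∧ x ∈ (I u).1 := by
      intro x r hx
      obtain ⟨u, hu, hur⟩ := Finset.exists_mem_ne hx r
      exact ⟨u, hur, (Finset.mem_filter.1 hu).2⟩
    obtain ⟨u, hu, hua⟩ := other a s ha
    obtain ⟨v, hv, hvb⟩ := other b (τ s) hb
    -- If both slots carry the same colour and are hit by the same further set, that colour lies in
    -- three sets and is counted in the first sum. This is why `doubleHits` may leave the case out.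
    by_cases hab : u = v ∧ a = b
    · have := triple ⟨a, s, τ s, u, hs.symm, hu.symm, fun e => hv (hab.1 ▸ e.symm),
        (I s).el_mem l, hab.2 ▸ (I (τ s)).el_mem _, hua⟩
      linarith
    · have h3 := single _ q2 s u v
      rw [if_pos ⟨hs, hu, hv⟩] at h3
      have h4 : 1 ≤ doubleHits s (τ s) u v (hτ s) I := by
        unfold doubleHits
        refine le_trans ?_ (Finset.single_le_sum (fun l _ => ind_nonneg _) (Finset.mem_univ l))
        rw [ind, if_pos ⟨⟨hua, hvb⟩, fun e e' => hab ⟨e, e'⟩⟩]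
      linarith
  · simp only [not_forall, not_le] at h2
    obtain ⟨i, hi⟩ := h2
    obtain ⟨u, v, w, hu, hv, hw, h1, h2, h3⟩ := Finset.two_lt_card_iff.1 hi
    have := triple ⟨i, u, v, w, h1, h2, h3, (Finset.mem_filter.1 hu).2, (Finset.mem_filter.1 hv).2,
      (Finset.mem_filter.1 hw).2⟩
    linarith

end Rare

/-! ### Bad configurations have vanishing probability. -/

section RareLimit

variable {U : Type*} [Fintype U] [LinearOrder U]

lemma tendsto_sum_sum_sum_zero {f : U → U → U → ℕ → ℝ}
    (h : ∀ u v w, Tendsto (f u v w) atTop (𝓝 0)) :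
    Tendsto (fun n => ∑ u, ∑ v, ∑ w, f u v w n) atTop (𝓝 0) := by
  have := tendsto_finsetSum (Finset.univ : Finset U) fun u _ =>
    tendsto_finsetSum (Finset.univ : Finset U) fun v _ =>
      tendsto_finsetSum (Finset.univ : Finset U) fun w _ => h u v w
  simpa using this

/-- For fixed `m` the bound converges to `(l + l²) / m`, where `l` is the limit of `p² / N`; `m` is
then chosen large in terms of `ε`. -/
lemma tendsto_expect_doubleHits_swap {N : ℕ → ℕ} {sz : ℕ → U → ℕ} {lam : U → U → ℝ}
    (hN : Tendsto N atTop atTop)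
    (hle : ∀ᶠ n in atTop, ∀ u, sz n u ≤ N n)
    (hρ : ∀ u, Tendsto (fun n => (sz n u : ℝ) / N n) atTop (𝓝 0))
    (hlam : ∀ u v, u ≠ v → Tendsto (fun n => (sz n u : ℝ) * sz n v / N n) atTop (𝓝 (lam u v)))
    {s t : U} (h : ∀ n, sz n s = sz n t) (hst : s ≠ t) :
    Tendsto (fun n => 𝔼 I : Config (N n) (sz n), doubleHits s t t s (h n) I) atTop (𝓝 0) := by
  have hl : Tendsto (fun n => (sz n s : ℝ) * sz n s / N n) atTop (𝓝 (lam s t)) :=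
    (hlam s t hst).congr fun n => by rw [h n]
  have hr := hρ s
  set l := lam s t with hldef
  have hl0 : 0 ≤ l := ge_of_tendsto' hl fun n => by positivity
  refine Metric.tendsto_atTop.2 fun ε hε => ?_
  obtain ⟨m, hm⟩ := exists_nat_gt ((l + l ^ 2) / (ε / 2))
  have hm0 : 0 < m := by
    have : (0 : ℝ) < m := lt_of_le_of_lt (by positivity) hm
    exact_mod_cast this
  have hm' : (0 : ℝ) < m := by exact_mod_cast hm0
  set L : ℕ := 8 * m ^ 2 + 1 with hL
  have hbound : Tendsto (fun n => 2 * (L : ℝ) * ((sz n s : ℝ) / N n) +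
      (2 * ((sz n s : ℝ) * sz n s / N n) * ((sz n s : ℝ) / N n) + 2 * L * ((sz n s : ℝ) / N n) ^ 2) +
      (1 / m) * ((sz n s : ℝ) * sz n s / N n + ((sz n s : ℝ) * sz n s / N n) ^ 2)) atTop
      (𝓝 ((2 * (L : ℝ)) * 0 + (2 * l * 0 + 2 * L * 0 ^ 2) + (1 / m) * (l + l ^ 2))) :=
    ((hr.const_mul _).add (((hl.const_mul 2).mul hr).add ((hr.pow 2).const_mul _))).add
      ((hl.add (hl.pow 2)).const_mul _)
  have hlt : (2 * (L : ℝ)) * 0 + (2 * l * 0 + 2 * L * 0 ^ 2) + (1 / m) * (l + l ^ 2) < ε := by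
    rw [div_lt_iff₀ (by positivity)] at hm
    have : (1 / (m : ℝ)) * (l + l ^ 2) < ε / 2 := by
      rw [one_div, inv_mul_lt_iff₀ hm']
      linarith
    simp only [mul_zero, zero_add, ne_eq, OfNat.ofNat_ne_zero, not_false_eq_true, zero_pow, add_zero]
    linarith
  obtain ⟨n₀, hn₀⟩ := eventually_atTop.1 ((hbound.eventually (gt_mem_nhds hlt)).and
    (hle.and (hN.eventually_gt_atTop 0)))
  refine ⟨n₀, fun n hn => ?_⟩
  obtain ⟨h1, h2, h3⟩ := hn₀ n hn
  have h3' : (N n : ℝ) ≠ 0 := by exact_mod_cast h3.ne'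
  rw [Real.dist_eq, sub_zero, abs_of_nonneg (expect_nonneg' fun I => doubleHits_nonneg _ _ _ _ _ _)]
  refine (expect_doubleHits_swap_le h2 (h n) hst hm0 hL).trans_lt (lt_of_eq_of_lt ?_ h1)
  field_simp

open scoped Classical in
/-- Configurations in which more than two chords meet are rare. -/
theorem tendsto_expect_not_good {N : ℕ → ℕ} {sz : ℕ → U → ℕ} {lam : U → U → ℝ}
    (hN : Tendsto N atTop atTop)
    (hle : ∀ᶠ n in atTop, ∀ u, sz n u ≤ N n)
    (hρ : ∀ u, Tendsto (fun n => (sz n u : ℝ) / N n) atTop (𝓝 0))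
    (hlam : ∀ u v, u ≠ v → Tendsto (fun n => (sz n u : ℝ) * sz n v / N n) atTop (𝓝 (lam u v)))
    (τ : U → U) (hτ : ∀ n u, sz n u = sz n (τ u)) :
    Tendsto (fun n => 𝔼 I : Config (N n) (sz n), ind (¬ Good τ (hτ n) I)) atTop (𝓝 0) := by
  have key : Tendsto (fun n => ∑ u, ∑ v, ∑ w, (if u ≠ v ∧ u ≠ w ∧ v ≠ w then
        𝔼 I : Config (N n) (sz n),
          ∑ i, ind (i ∈ (I u).1) * ind (i ∈ (I v).1) * ind (i ∈ (I w).1) else 0) +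
      ∑ s, ∑ u, ∑ v, (if τ s ≠ s ∧ u ≠ s ∧ v ≠ τ s then
        𝔼 I : Config (N n) (sz n), doubleHits s (τ s) u v (hτ n s) I else 0)) atTop (𝓝 0) := by
    rw [show 𝓝 (0 : ℝ) = 𝓝 (0 + 0) by rw [add_zero]]
    refine Tendsto.add (tendsto_sum_sum_sum_zero ?_) (tendsto_sum_sum_sum_zero ?_)
    · intro u v w
      split_ifs with hd
      · have hb : Tendsto (fun n => (sz n w : ℝ) / N n * ((sz n u : ℝ) * sz n v / N n)) atTop
            (𝓝 (0 * lam u v)) := (hρ w).mul (hlam u v hd.1)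
        rw [zero_mul] at hb
        refine squeeze_zero' (Eventually.of_forall fun n => expect_nonneg' fun I =>
          Finset.sum_nonneg fun i _ => mul_nonneg (mul_nonneg (ind_nonneg _) (ind_nonneg _))
            (ind_nonneg _)) ?_ hb
        filter_upwards [hle] with n hn
        refine (expect_triple_le hn hd.1 hd.2.1 hd.2.2).trans_eq ?_
        ring
      · exact tendsto_const_nhds
    · intro s u v
      split_ifs with hd
      · by_cases hsw : u = τ s ∧ v = s
        · obtain ⟨rfl, rfl⟩ := hsw
          exact tendsto_expect_doubleHits_swap hN hle hρ hlam (fun n => hτ n _) hd.1.symm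
        · have hb : Tendsto (fun n => (sz n v : ℝ) / N n * ((sz n s : ℝ) * sz n u / N n)) atTop
              (𝓝 (0 * lam s u)) := (hρ v).mul (hlam s u hd.2.1.symm)
          rw [zero_mul] at hb
          refine squeeze_zero' (Eventually.of_forall fun n => expect_nonneg' fun I =>
            doubleHits_nonneg _ _ _ _ _ _) ?_ hb
          filter_upwards [hle] with n hn
          refine (expect_doubleHits_le hn (hτ n s) hd.1.symm hd.2.1 hd.2.2 hsw).trans_eq ?_
          ring
      · exact tendsto_const_nhds
  refine squeeze_zero (fun n => expect_nonneg' fun I => ind_nonneg _) (fun n => ?_) key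
  refine (expect_le_expect' fun I => ind_not_good_le τ (hτ n) I).trans_eq ?_
  rw [Finset.expect_add_distrib]
  simp only [Finset.expect_sum_comm]
  congr 1
  · refine Finset.sum_congr rfl fun u _ => Finset.sum_congr rfl fun v _ =>
      Finset.sum_congr rfl fun w _ => ?_
    split_ifs <;> simp only [Finset.expect_sum_comm, Finset.expect_const_zero]
  · refine Finset.sum_congr rfl fun u _ => Finset.sum_congr rfl fun v _ =>
      Finset.sum_congr rfl fun w _ => ?_
    split_ifs <;> simp

end RareLimit

/-! ### Tensor products of one-colour operators. -/

section Tensor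

variable {ι : Type*} [Fintype ι] [DecidableEq ι] {N : ℕ}

lemma tensorOp_mul (A B : Fin N → Matrix ι ι ℂ) :
    tensorOp A * tensorOp B = tensorOp fun j => A j * B j := by
  ext x y
  simp only [tensorOp, Matrix.mul_apply, Matrix.of_apply]
  rw [Finset.prod_univ_sum, Fintype.piFinset_univ]
  exact Finset.sum_congr rfl fun z _ => Finset.prod_mul_distrib.symm

lemma tensorOp_one : tensorOp (fun _ : Fin N => (1 : Matrix ι ι ℂ)) = 1 := by
  ext x y
  simp only [tensorOp, Matrix.of_apply, Matrix.one_apply]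
  rw [Fintype.prod_ite_zero]
  simp [funext_iff]

lemma tensorOp_smul (z : Fin N → ℂ) (A : Fin N → Matrix ι ι ℂ) :
    tensorOp (fun j => z j • A j) = (∏ j, z j) • tensorOp A := by
  ext x y
  simp [tensorOp, Finset.prod_mul_distrib]

lemma trace_tensorOp (A : Fin N → Matrix ι ι ℂ) : (tensorOp A).trace = ∏ j, (A j).trace := by
  simp only [Matrix.trace, Matrix.diag_apply, tensorOp, Matrix.of_apply]
  rw [Finset.prod_univ_sum, Fintype.piFinset_univ]

lemma conjTranspose_tensorOp (A : Fin N → Matrix ι ι ℂ) :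
    (tensorOp A)ᴴ = tensorOp fun j => (A j)ᴴ := by
  ext x y
  simp [tensorOp, Matrix.conjTranspose_apply]

/-- The one-colour operator `B` acting on the colour `i`. -/
def siteHom (i : Fin N) : Matrix ι ι ℂ →ₐ[ℂ] Op ι N :=
  AlgHom.ofLinearMap
    { toFun := fun B => tensorOp fun j => if j = i then B else 1
      map_add' := fun B C => by
        ext x y
        simp only [tensorOp, Matrix.of_apply, Matrix.add_apply]
        rw [← Finset.mul_prod_erase _ _ (Finset.mem_univ i),
          ← Finset.mul_prod_erase _ _ (Finset.mem_univ i),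
          ← Finset.mul_prod_erase _ _ (Finset.mem_univ i)]
        simp only [if_true, Matrix.add_apply, add_mul]
        congr 1 <;> congr 1 <;>
        exact Finset.prod_congr rfl fun j hj => by simp [Finset.ne_of_mem_erase hj]
      map_smul' := fun z B => by
        ext x y
        simp only [tensorOp, Matrix.of_apply, Matrix.smul_apply, RingHom.id_apply, smul_eq_mul]
        rw [← Finset.mul_prod_erase _ _ (Finset.mem_univ i),
          ← Finset.mul_prod_erase _ _ (Finset.mem_univ i)]
        simp only [if_true, Matrix.smul_apply, smul_eq_mul, mul_assoc]
        congr 2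
        exact Finset.prod_congr rfl fun j hj => by simp [Finset.ne_of_mem_erase hj] }
    (by simp [tensorOp_one])
    (fun B C => by
      simp only [LinearMap.coe_mk, AddHom.coe_mk, tensorOp_mul]
      congr 1
      ext1 j
      split_ifs <;> simp)

lemma siteHom_apply (i : Fin N) (B : Matrix ι ι ℂ) :
    siteHom i B = tensorOp fun j => if j = i then B else 1 := rfl

open scoped Matrix.Norms.Operator in
lemma siteHom_exp (i : Fin N) (B : Matrix ι ι ℂ) :
    siteHom i (NormedSpace.exp B) = NormedSpace.exp (siteHom i B) := by
  refine NormedSpace.map_exp (siteHom i) ?_ B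
  exact LinearMap.continuous_of_finiteDimensional (siteHom i).toLinearMap

lemma siteHom_commute {i j : Fin N} (h : i ≠ j) (B C : Matrix ι ι ℂ) :
    Commute (siteHom i B) (siteHom j C) := by
  simp only [Commute, SemiconjBy, siteHom_apply, tensorOp_mul]
  congr 1
  ext1 l
  by_cases h1 : l = i
  · subst h1; simp [h]
  · simp [h1]

lemma exp_sum_siteHom (D : Matrix ι ι ℂ) (s : Finset (Fin N)) :
    NormedSpace.exp (∑ i ∈ s, siteHom i D) =
      tensorOp fun j => if j ∈ s then NormedSpace.exp D else 1 := by
  induction s using Finset.induction_on with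
  | empty => simp [tensorOp_one]
  | insert i s hi ih =>
    rw [Finset.sum_insert hi, Matrix.exp_add_of_commute, ih, ← siteHom_exp, siteHom_apply, tensorOp_mul]
    · congr 1
      ext1 j
      by_cases h : j = i
      · subst h; simp [hi]
      · simp [h]
    · exact Commute.sum_right _ _ _ fun j hj => siteHom_commute (by rintro rfl; exact hi hj) _ _

end Tensor

/-! ### Factorization of the trace over colours. -/

section Trace

variable {ι : Type*} [Fintype ι] [DecidableEq ι] {M r : ℕ} (m : FlavourModel ι M r)
  (μ : Fin r → ℝ) {N : ℕ}

/-- The total charges are sums of one-colour charges acting on different colours, which commute, so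
the exponential is a tensor power. -/
lemma FlavourModel.Lam_eq (N : ℕ) : m.Lam μ N = tensorOp fun _ => m.lam μ := by
  have h : -∑ α, (μ α : ℂ) • m.totalCharge N α =
      ∑ i, siteHom i (-∑ α, (μ α : ℂ) • m.Q α) := by
    simp only [map_neg, map_sum, map_smul, FlavourModel.totalCharge, Finset.smul_sum,
      Finset.sum_neg_distrib, siteHom_apply]
    rw [Finset.sum_comm]
  rw [FlavourModel.Lam, h, exp_sum_siteHom]
  simp [FlavourModel.lam]

lemma FlavourModel.TrLam_tensorOp (A : Fin N → Matrix ι ι ℂ) :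
    m.TrLam μ (tensorOp A) = ∏ j, m.tr μ (A j) := by
  simp only [FlavourModel.TrLam, FlavourModel.tr, ntr, m.Lam_eq, tensorOp_mul, trace_tensorOp,
    Finset.prod_div_distrib, Finset.prod_const, Finset.card_univ, Fintype.card_fin,
    Fintype.card_fun, Nat.cast_pow]

end Trace

/-! ### Sums over ordered pairs of list entries. -/

section PairSum

variable {α β : Type*}

/-- The sum of `f x y` over all pairs of entries of a list, `x` preceding `y`. -/
def pairSum (f : α → α → ℕ) : List α → ℕ
  | [] => 0
  | a :: l => (l.map (f a)).sum + pairSum f l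

lemma pairSum_append (f : α → α → ℕ) (l l' : List α) :
    pairSum f (l ++ l') = pairSum f l + pairSum f l' + (l.map fun x => (l'.map (f x)).sum).sum := by
  induction l with
  | nil => simp [pairSum]
  | cons a l ih =>
    simp only [List.cons_append, pairSum, List.map_append, List.sum_append, ih, List.map_cons,
      List.sum_cons]
    ring

lemma sum_map_flatMap (W : List β) (B : β → List α) (f : α → ℕ) :
    ((W.flatMap B).map f).sum = (W.map fun y => ((B y).map f).sum).sum := by
  induction W with
  | nil => simp
  | cons a l ih => simp [ih]

lemma list_sum_comm (l : List α) (l' : List β) (f : α → β → ℕ) :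
    (l.map fun x => (l'.map fun y => f x y).sum).sum =
      (l'.map fun y => (l.map fun x => f x y).sum).sum := by
  induction l with
  | nil => simp
  | cons a l ih => simp [ih, List.sum_map_add]

lemma pairSum_flatMap (f : α → α → ℕ) (W : List β) (B : β → List α) :
    pairSum f (W.flatMap B) = (W.map fun y => pairSum f (B y)).sum +
      pairSum (fun y y' => ((B y).map fun x => ((B y').map (f x)).sum).sum) W := by
  induction W with
  | nil => simp [pairSum]
  | cons a l ih =>
    rw [List.flatMap_cons, pairSum_append, ih, List.map_cons, List.sum_cons, pairSum]
    have : ((B a).map fun x => ((l.flatMap B).map (f x)).sum).sum =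
        (l.map fun y' => ((B a).map fun x => ((B y').map (f x)).sum).sum).sum := by
      simp only [sum_map_flatMap]
      exact list_sum_comm _ _ _
    rw [this]
    ring

/-- In a list sorted by `key` the relation of preceding is read off from the keys. The sum then runs
over all pairs of entries and no longer refers to positions. -/
lemma pairSum_of_pairwise {γ : Type*} [LinearOrder γ] (key : α → γ) (f : α → α → ℕ) {W : List α}
    (h : W.Pairwise fun x y => key x < key y) :
    pairSum f W = (W.map fun x => (W.map fun y => if key x < key y then f x y else 0).sum).sum := by
  induction W with
  | nil => simp [pairSum]
  | cons a l ih =>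
    rw [List.pairwise_cons] at h
    rw [pairSum, ih h.2]
    simp only [List.map_cons, List.sum_cons, lt_irrefl, if_false, zero_add]
    congr 1
    · congr 1
      exact List.map_congr_left fun y hy => by rw [if_pos (h.1 y hy)]
    · congr 1
      refine List.map_congr_left fun y hy => ?_
      rw [if_neg (h.1 y hy).not_gt, zero_add]

end PairSum

/-! ### Fermions with parity strings. -/

section Strings

variable {ι : Type*} [Fintype ι] [DecidableEq ι] {N : ℕ}

/-- A fermionic operator `c` on the colour `i`, with its parity string. -/
def stringOp (P : Matrix ι ι ℂ) (i : Fin N) (c : Matrix ι ι ℂ) : Op ι N :=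
  tensorOp fun j => if j < i then P else if j = i then c else 1

lemma pow_anticomm {P c : Matrix ι ι ℂ} (h : P * c = -(c * P)) (n : ℕ) :
    c * P ^ n = (-1 : ℂ) ^ n • (P ^ n * c) := by
  induction n with
  | zero => simp
  | succ n ih =>
    have h' : c * P = -(P * c) := by rw [h, neg_neg]
    rw [pow_succ, ← mul_assoc, ih, smul_mul_assoc, mul_assoc (P ^ n), h', mul_assoc, pow_succ]
    simp

/-- A product of fermionic operators, sorted by colours. -/
lemma prod_stringOp {α : Type*} (P : Matrix ι ι ℂ) (col : α → Fin N) (op : α → Matrix ι ι ℂ)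
    (hop : ∀ x, P * op x = -(op x * P)) (L : List α) :
    (L.map fun x => stringOp P (col x) (op x)).prod =
      (-1 : ℂ) ^ pairSum (fun x y => if col x < col y then 1 else 0) L •
        tensorOp fun j => P ^ (L.map fun y => if j < col y then 1 else 0).sum *
          ((L.filter fun x => col x = j).map op).prod := by
  induction L with
  | nil => simp [pairSum, tensorOp_one]
  | cons x L ih =>
    set n := (L.map fun y => if col x < col y then 1 else 0).sum with hn
    rw [List.map_cons, List.prod_cons, ih, mul_smul_comm, stringOp, tensorOp_mul, pairSum, pow_add,
      mul_comm, mul_smul, ← hn]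
    congr 1
    -- The sign belongs to the single colour `col x`, where `op x` is carried through the parities
    -- of the `n` later operators of larger colour.
    have h1 : ((-1 : ℂ)) ^ n = ∏ j : Fin N, (if j = col x then (-1 : ℂ) ^ n else 1) := by simp
    rw [h1, ← tensorOp_smul]
    congr 1
    ext1 j
    rcases lt_trichotomy j (col x) with hj | hj | hj
    · rw [if_pos hj, if_neg hj.ne, one_smul, ← mul_assoc, List.map_cons, List.sum_cons, if_pos hj,
        pow_add, pow_one, List.filter_cons_of_neg (by simpa using hj.ne')]
    · subst hj
      rw [if_neg (lt_irrefl _), if_pos rfl, if_pos rfl, ← mul_assoc, pow_anticomm (hop x),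
        List.map_cons, List.sum_cons, if_neg (lt_irrefl _), zero_add,
        List.filter_cons_of_pos (by simp), List.map_cons, List.prod_cons, smul_mul_assoc, mul_assoc]
    · rw [if_neg hj.not_gt, if_neg hj.ne', if_neg hj.ne', one_smul, one_mul, List.map_cons,
        List.sum_cons, if_neg hj.not_gt, zero_add, List.filter_cons_of_neg (by simpa using hj.ne)]

end Strings

/-! ### The sign and the one-colour factors of a word in `X†` and `X`. -/

section Words

variable {ι : Type*} [Fintype ι] [DecidableEq ι] {M r : ℕ} (m : FlavourModel ι M r)
  (μ : Fin r → ℝ) {N : ℕ} {U : Type*} [Fintype U] [LinearOrder U] {sz : U → ℕ}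

lemma FlavourModel.conjTranspose_stringOp (i : Fin N) (c : Matrix ι ι ℂ) :
    (stringOp m.parity i c)ᴴ = stringOp m.parity i cᴴ := by
  rw [stringOp, conjTranspose_tensorOp, stringOp]
  congr 1
  ext1 j
  split_ifs
  · exact m.parity_isHermitian
  · rfl
  · exact Matrix.conjTranspose_one

/-- The one-colour operator at a slot: `χ†` with the first or `χ` with the second flavour. -/
def FlavourModel.leg (e : Fin M × Fin M) (b : Bool) : Matrix ι ι ℂ :=
  if b then (m.χ e.1)ᴴ else m.χ e.2

lemma FlavourModel.parity_leg (e : Fin M × Fin M) (b : Bool) :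
    m.parity * m.leg e b = -(m.leg e b * m.parity) := by
  unfold FlavourModel.leg
  split_ifs
  · have := congrArg Matrix.conjTranspose (m.parity_anticomm e.1)
    rw [Matrix.conjTranspose_mul, Matrix.conjTranspose_neg, Matrix.conjTranspose_mul,
      m.parity_isHermitian] at this
    rw [this, neg_neg]
  · exact m.parity_anticomm _

/-- The slots: positions in the colour sets. -/
abbrev Slot (sz : U → ℕ) := Σ u, Fin (sz u)

/-- The colour of a slot. -/
def Config.col (I : Config N sz) (x : Slot sz) : Fin N := (I x.1).el x.2

/-- The slots of the symbol `(u, b)`, in the order of their operators. -/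
def block (sz : U → ℕ) (y : U × Bool) : List (Slot sz × Bool) :=
  if y.2 then (List.ofFn fun l : Fin (sz y.1) => ((⟨y.1, l⟩ : Slot sz), y.2)).reverse
  else List.ofFn fun l : Fin (sz y.1) => ((⟨y.1, l⟩ : Slot sz), y.2)

/-- The operator of a symbol: `X†` for `(u, true)` and `X` for `(u, false)`. -/
def FlavourModel.symbolOp (I : Config N sz) (e : Slot sz → Fin M × Fin M) (y : U × Bool) : Op ι N :=
  if y.2 then (m.X (I y.1) fun l => (e ⟨y.1, l⟩).1)ᴴ else m.X (I y.1) fun l => (e ⟨y.1, l⟩).2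

lemma FlavourModel.symbolOp_eq (I : Config N sz) (e : Slot sz → Fin M × Fin M) (y : U × Bool) :
    m.symbolOp I e y =
      ((block sz y).map fun z => stringOp m.parity (Config.col I z.1) (m.leg (e z.1) z.2)).prod := by
  obtain ⟨u, b⟩ := y
  cases b
  · simp only [FlavourModel.symbolOp, block, FlavourModel.X, List.map_ofFn, FlavourModel.leg,
      Bool.false_eq_true, if_false]
    rfl
  · simp only [FlavourModel.symbolOp, block, FlavourModel.X, if_true, Matrix.conjTranspose_list_prod,
      List.map_reverse, List.map_ofFn, FlavourModel.leg]
    congr 3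
    ext1 l
    simp only [Function.comp_apply, if_true]
    rw [← m.conjTranspose_stringOp]
    rfl

/-- The number of pairs `i < j` with `i ∈ I u`, `j ∈ I v`. -/
def ltPairs (I : Config N sz) (u v : U) : ℕ :=
  ∑ l : Fin (sz u), ∑ l' : Fin (sz v), if (I u).el l < (I v).el l' then 1 else 0

lemma sum_map_block (y : U × Bool) (f : Slot sz × Bool → ℕ) :
    ((block sz y).map f).sum = ∑ l, f (⟨y.1, l⟩, y.2) := by
  unfold block
  split_ifs
  · rw [List.map_reverse, List.sum_reverse, List.map_ofFn, List.sum_ofFn]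
    rfl
  · rw [List.map_ofFn, List.sum_ofFn]
    rfl

lemma pairSum_block_false (I : Config N sz) (u : U) :
    pairSum (fun x y => if Config.col I x.1 < Config.col I y.1 then 1 else 0) (block sz (u, false)) =
      ltPairs I u u := by
  rw [pairSum_of_pairwise (fun z => Config.col I z.1), sum_map_block]
  · simp only [sum_map_block, ltPairs]
    refine Finset.sum_congr rfl fun l _ => Finset.sum_congr rfl fun l' _ => ?_
    by_cases h : (I u).el l < (I u).el l' <;> simp [Config.col, h]
  · simp only [block, Bool.false_eq_true, if_false]
    rw [List.pairwise_ofFn]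
    intro i j hij
    exact (I u).el_strictMono hij

/-- The adjoint reverses the factors, so the colours of `X†` decrease and no pair is counted, in
contrast to those of `X`. -/
lemma pairSum_block_true (I : Config N sz) (u : U) :
    pairSum (fun x y => if Config.col I x.1 < Config.col I y.1 then 1 else 0) (block sz (u, true)) = 0 := by
  rw [pairSum_of_pairwise (fun z => OrderDual.toDual (Config.col I z.1)), sum_map_block]
  · simp only [sum_map_block]
    refine Finset.sum_eq_zero fun l _ => Finset.sum_eq_zero fun l' _ => ?_
    split_ifs with h1 h2
    · exact absurd h2 (OrderDual.toDual_lt_toDual.1 h1).not_gt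
    · rfl
    · rfl
  · simp only [block, if_true]
    rw [List.pairwise_reverse, List.pairwise_ofFn]
    intro i j hij
    exact OrderDual.toDual_lt_toDual.2 ((I u).el_strictMono hij)

/-- Trichotomy for pairs of elements. When the product of the sizes is even, it identifies the
parity of the number of unequal pairs with that of the intersection. -/
lemma ltPairs_add (I : Config N sz) (u v : U) :
    ltPairs I u v + ltPairs I v u + ((I v).1 ∩ (I u).1).card = sz u * sz v := by
  have h1 : ltPairs I v u = ∑ l : Fin (sz u), ∑ l' : Fin (sz v),
      if (I v).el l' < (I u).el l then 1 else 0 := by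
    rw [ltPairs, Finset.sum_comm]
  have h2 : ((I v).1 ∩ (I u).1).card = ∑ l : Fin (sz u), ∑ l' : Fin (sz v),
      if (I v).el l' = (I u).el l then 1 else 0 := by
    have : ∀ l : Fin (sz u), (∑ l' : Fin (sz v), if (I v).el l' = (I u).el l then 1 else 0) =
        if (I u).el l ∈ (I v).1 then 1 else 0 := fun l => by
      rw [(I v).sum_el (fun i => if i = (I u).el l then 1 else 0)]
      simp
    simp_rw [this]
    rw [(I u).sum_el (fun i => if i ∈ (I v).1 then 1 else 0)]
    rw [← Finset.card_filter, Finset.filter_mem_eq_inter, Finset.inter_comm]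
  rw [h1, h2, ltPairs, ← Finset.sum_add_distrib, ← Finset.sum_add_distrib]
  have : ∀ l : Fin (sz u), ((∑ l' : Fin (sz v), if (I u).el l < (I v).el l' then 1 else 0) +
      (∑ l' : Fin (sz v), if (I v).el l' < (I u).el l then 1 else 0)) +
      (∑ l' : Fin (sz v), if (I v).el l' = (I u).el l then 1 else 0) = sz v := fun l => by
    rw [← Finset.sum_add_distrib, ← Finset.sum_add_distrib]
    rw [Finset.sum_congr rfl fun l' _ => show _ = 1 from ?_]
    · simp
    · rcases lt_trichotomy ((I u).el l) ((I v).el l') with h | h | h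
      · simp [h, h.not_gt, h.ne']
      · simp [h]
      · simp [h, h.not_gt, h.ne]
  rw [Finset.sum_congr rfl fun l _ => this l]
  simp

variable {W : List (U × Bool)} {key : U × Bool → ℕ}

/-- The number of pairs of end points of `u` and `v` in this order. -/
def orderCount (key : U × Bool → ℕ) (u v : U) : ℕ :=
  ∑ b, ∑ b', if key (u, b) < key (v, b') then 1 else 0

/-- `-1` if the oriented chords `u` and `v` intersect and `1` otherwise. -/
def crossSign (key : U × Bool → ℕ) (u v : U) : ℂ := (-1) ^ orderCount key u v

lemma orderCount_add (hkey : Function.Injective key) {u v : U} (h : u ≠ v) :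
    orderCount key u v + orderCount key v u = 4 := by
  have h1 : orderCount key v u = ∑ b, ∑ b', if key (v, b') < key (u, b) then 1 else 0 := by
    rw [orderCount, Finset.sum_comm]
  rw [h1, orderCount, ← Finset.sum_add_distrib]
  simp_rw [← Finset.sum_add_distrib]
  rw [Finset.sum_congr rfl fun b _ => Finset.sum_congr rfl fun b' _ => show _ = 1 from ?_]
  · simp
  · have : key (u, b) ≠ key (v, b') := fun e => h (Prod.ext_iff.1 (hkey e)).1
    rcases lt_or_gt_of_ne this with h | h
    · simp [h, h.not_gt]
    · simp [h, h.not_gt]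

lemma orderCount_self (hkey : Function.Injective key) (u : U) : orderCount key u u = 1 := by
  have : key (u, true) ≠ key (u, false) := fun e => by simpa using hkey e
  simp only [orderCount, Fintype.sum_bool, lt_irrefl, if_false]
  rcases lt_or_gt_of_ne this with h | h <;> simp [h, h.not_gt]

lemma crossSign_comm (hkey : Function.Injective key) (u v : U) :
    crossSign key u v = crossSign key v u := by
  by_cases h : u = v
  · rw [h]
  have := orderCount_add hkey h
  unfold crossSign
  rw [show orderCount key v u = 4 - orderCount key u v by omega]
  have h5 : orderCount key u v ≤ 4 := by omega
  interval_cases orderCount key u v <;> norm_num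

lemma sum_map_of_complete {α : Type*} [Fintype α] {l : List α} (hnd : l.Nodup)
    (hm : ∀ x, x ∈ l) (f : α → ℕ) : (l.map f).sum = ∑ x, f x := by
  classical
  rw [← List.sum_toFinset f hnd]
  congr 1
  ext x
  simp [hm x]

/-- The sign from sorting a word by colours. -/
lemma sign_word (hkey : Function.Injective key) (hW : W.Pairwise fun x y => key x < key y)
    (hWm : ∀ y, y ∈ W) (I : Config N sz) (heven : ∀ u v, u ≠ v → Even (sz u * sz v)) :
    (-1 : ℂ) ^ pairSum (fun x y => if Config.col I x.1 < Config.col I y.1 then 1 else 0)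
        (W.flatMap (block sz)) =
      ∏ u, ∏ v with v < u, crossSign key v u ^ ((I v).1 ∩ (I u).1).card := by
  have hnd : W.Nodup := hW.imp fun h e => by simp [e] at h
  have h1 : pairSum (fun x y => if Config.col I x.1 < Config.col I y.1 then 1 else 0)
        (W.flatMap (block sz)) = ∑ u, ltPairs I u u + ∑ u, ∑ v, orderCount key u v * ltPairs I u v := by
    rw [pairSum_flatMap, pairSum_of_pairwise key _ hW]
    simp only [sum_map_of_complete hnd hWm, sum_map_block]
    congr 1
    · rw [Fintype.sum_prod_type]
      refine Finset.sum_congr rfl fun u _ => ?_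
      rw [Fintype.sum_bool, pairSum_block_false, pairSum_block_true, zero_add]
    · rw [Fintype.sum_prod_type]
      refine Finset.sum_congr rfl fun u _ => ?_
      simp_rw [Fintype.sum_prod_type]
      rw [Finset.sum_comm]
      refine Finset.sum_congr rfl fun v _ => ?_
      rw [orderCount, Finset.sum_mul]
      refine Finset.sum_congr rfl fun b _ => ?_
      rw [Finset.sum_mul]
      refine Finset.sum_congr rfl fun b' _ => ?_
      rw [ite_mul, zero_mul, one_mul]
      rfl
  -- Since `orderCount key u u = 1`, the internal pairs of `u` are counted here once more, in
  -- addition to those within `X`; together they drop out of the sign.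
  have h2 : ∑ u, ∑ v, orderCount key u v * ltPairs I u v = ∑ u, ltPairs I u u +
      ∑ u, ∑ v with v < u, (orderCount key u v * ltPairs I u v + orderCount key v u * ltPairs I v u) := by
    have split : ∀ f : U → U → ℕ, ∑ u, ∑ v, f u v =
        ∑ u, f u u + ∑ u, ∑ v with v < u, (f u v + f v u) := by
      intro f
      have e1 : ∀ u, ∑ v, f u v = f u u + (∑ v with v < u, f u v + ∑ v with u < v, f u v) := by
        intro u
        rw [← Finset.sum_filter_add_sum_filter_not Finset.univ (fun v => v < u),
          ← Finset.sum_filter_add_sum_filter_not (Finset.univ.filter fun v => ¬ v < u)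
            (fun v => u < v), Finset.filter_filter, Finset.filter_filter]
        have s1 : (Finset.univ.filter fun v => ¬ v < u ∧ u < v) = Finset.univ.filter fun v => u < v := by
          ext v; simp only [Finset.mem_filter, Finset.mem_univ, true_and]
          exact ⟨fun h => h.2, fun h => ⟨h.not_gt, h⟩⟩
        have s2 : (Finset.univ.filter fun v => ¬ v < u ∧ ¬ u < v) = {u} := by
          ext v; simp only [Finset.mem_filter, Finset.mem_univ, true_and, Finset.mem_singleton]
          exact ⟨fun h => le_antisymm (not_lt.1 h.2) (not_lt.1 h.1), fun h => by simp [h]⟩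
        rw [s1, s2, Finset.sum_singleton]
        ring
      simp_rw [e1]
      rw [Finset.sum_add_distrib, Finset.sum_add_distrib]
      congr 1
      simp_rw [Finset.sum_add_distrib]
      congr 1
      simp_rw [Finset.sum_filter]
      rw [Finset.sum_comm]
    rw [split]
    congr 1
    refine Finset.sum_congr rfl fun u _ => ?_
    rw [orderCount_self hkey, one_mul]
  rw [h1, h2, ← add_assoc, pow_add, ← two_mul, pow_mul, neg_one_sq, one_pow, one_mul,
    ← Finset.prod_pow_eq_pow_sum]
  refine Finset.prod_congr rfl fun u _ => ?_
  rw [← Finset.prod_pow_eq_pow_sum]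
  refine Finset.prod_congr rfl fun v hv => ?_
  have hvu : v ≠ u := (Finset.mem_filter.1 hv).2.ne
  have hc := crossSign_comm hkey u v
  rw [pow_add, pow_mul, pow_mul]
  change crossSign key u v ^ _ * crossSign key v u ^ _ = _
  rw [hc, ← pow_add]
  -- As `sz u * sz v` is even, the exponent `ltPairs I u v + ltPairs I v u` has the parity of the
  -- size of the intersection.
  have h4 := ltPairs_add I u v
  have hev := heven u v hvu.symm
  have hs : crossSign key v u ^ 2 = 1 := by
    rw [crossSign, ← pow_mul, mul_comm, pow_mul, neg_one_sq, one_pow]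
  rw [← h4] at hev
  obtain ⟨t, ht⟩ := hev
  have e1 : crossSign key v u ^ (ltPairs I u v + ltPairs I v u) *
      crossSign key v u ^ ((I v).1 ∩ (I u).1).card = 1 := by
    rw [← pow_add, ht, ← two_mul, pow_mul, hs, one_pow]
  have e2 : crossSign key v u ^ ((I v).1 ∩ (I u).1).card *
      crossSign key v u ^ ((I v).1 ∩ (I u).1).card = 1 := by
    rw [← pow_add, ← two_mul, pow_mul, hs, one_pow]
  calc _ = crossSign key v u ^ (ltPairs I u v + ltPairs I v u) *
      (crossSign key v u ^ ((I v).1 ∩ (I u).1).card *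
      crossSign key v u ^ ((I v).1 ∩ (I u).1).card) := by rw [e2, mul_one]
    _ = _ := by rw [← mul_assoc, e1, one_mul]

/-- The operators of a word which act on the colour `j`, in order. -/
def siteList (W : List (U × Bool)) (I : Config N sz) (j : Fin N) : List (Slot sz × Bool) :=
  (W.flatMap (block sz)).filter fun z => Config.col I z.1 = j

lemma mem_block (y : U × Bool) (z : Slot sz × Bool) : z ∈ block sz y ↔ (z.1.1, z.2) = y := by
  obtain ⟨⟨u, l⟩, b⟩ := z
  obtain ⟨v, b'⟩ := y
  simp only [block, Prod.mk.injEq]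
  split_ifs <;> simp only [List.mem_reverse, List.mem_ofFn, Prod.mk.injEq, Sigma.mk.injEq] <;>
  · constructor
    · rintro ⟨l', ⟨rfl, h⟩, rfl⟩; exact ⟨rfl, rfl⟩
    · rintro ⟨rfl, rfl⟩; exact ⟨l, ⟨rfl, HEq.rfl⟩, rfl⟩

lemma mem_siteList (hWm : ∀ y, y ∈ W) (I : Config N sz) (j : Fin N) (z : Slot sz × Bool) :
    z ∈ siteList W I j ↔ Config.col I z.1 = j := by
  simp only [siteList, List.mem_filter, List.mem_flatMap, decide_eq_true_eq, and_iff_right_iff_imp]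
  exact fun _ => ⟨(z.1.1, z.2), hWm _, (mem_block _ _).2 rfl⟩

/-- The colours within one block are distinct, so at a given colour every end point contributes at
most one operator, and the order of the operators is that of the end points. -/
lemma pairwise_siteList (hW : W.Pairwise fun x y => key x < key y) (I : Config N sz) (j : Fin N) :
    (siteList W I j).Pairwise fun z z' => key (z.1.1, z.2) < key (z'.1.1, z'.2) := by
  have h : (W.flatMap (block sz)).Pairwise fun z z' =>
      Config.col I z.1 ≠ Config.col I z'.1 ∨ key (z.1.1, z.2) < key (z'.1.1, z'.2) := by
    rw [List.pairwise_flatMap]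
    constructor
    · intro y _
      refine List.Pairwise.imp (fun h => Or.inl h) ?_
      unfold block
      split_ifs
      · rw [List.pairwise_reverse, List.pairwise_ofFn]
        exact fun i j hij e => hij.ne' ((I y.1).el_injective e)
      · rw [List.pairwise_ofFn]
        exact fun i j hij e => hij.ne ((I y.1).el_injective e)
    · refine hW.imp fun {y y'} hy z hz z' hz' => Or.inr ?_
      rw [mem_block] at hz hz'
      rw [hz, hz']
      exact hy
  have h2 := h.filter (fun z => Config.col I z.1 = j)
  refine List.Pairwise.imp_of_mem ?_ h2
  intro z z' hz hz' hzz
  replace hz := List.mem_filter.1 hz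
  replace hz' := List.mem_filter.1 hz'
  simp only [decide_eq_true_eq] at hz hz'
  rcases hzz with h | h
  · exact absurd (hz.2.trans hz'.2.symm) h
  · exact h

lemma sum_map_flatMap_block (hW : W.Pairwise fun x y => key x < key y) (hWm : ∀ y, y ∈ W)
    (f : Slot sz → ℕ) : ((W.flatMap (block sz)).map fun z => f z.1).sum = 2 * ∑ x, f x := by
  have hnd : W.Nodup := hW.imp fun h e => by simp [e] at h
  rw [sum_map_flatMap, sum_map_of_complete hnd hWm]
  simp only [sum_map_block]
  rw [Fintype.sum_prod_type, Fintype.sum_sigma, Finset.mul_sum]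
  refine Finset.sum_congr rfl fun u _ => ?_
  rw [Fintype.sum_bool, two_mul]

/-- The trace of a word factorizes over the colours. -/
theorem FlavourModel.TrLam_word (hkey : Function.Injective key)
    (hW : W.Pairwise fun x y => key x < key y)
    (hWm : ∀ y, y ∈ W) (I : Config N sz) (heven : ∀ u v, u ≠ v → Even (sz u * sz v))
    (e : Slot sz → Fin M × Fin M) :
    m.TrLam μ (W.map (m.symbolOp I e)).prod =
      (∏ u, ∏ v with v < u, crossSign key v u ^ ((I v).1 ∩ (I u).1).card) *
        ∏ j, m.tr μ ((siteList W I j).map fun z => m.leg (e z.1) z.2).prod := by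
  have h1 : (W.map (m.symbolOp I e)).prod = ((W.flatMap (block sz)).map fun z =>
      stringOp m.parity (Config.col I z.1) (m.leg (e z.1) z.2)).prod := by
    clear hW hWm
    induction W with
    | nil => simp
    | cons y W ih => simp [ih, m.symbolOp_eq]
  rw [h1, prod_stringOp m.parity (fun z : Slot sz × Bool => Config.col I z.1)
    (fun z => m.leg (e z.1) z.2) (fun z => m.parity_leg _ _), sign_word hkey hW hWm I heven]
  -- Every slot occurs in exactly two blocks, so each parity appears to an even power.
  have h2 : ∀ j : Fin N, m.parity ^ ((W.flatMap (block sz)).map fun z =>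
      if j < Config.col I z.1 then 1 else 0).sum = 1 := by
    intro j
    rw [sum_map_flatMap_block hW hWm (fun x => if j < Config.col I x then 1 else 0), pow_mul, sq,
      m.parity_sq, one_pow]
  simp_rw [h2, one_mul]
  have h3 : ∀ (z : ℂ) (A : Op ι N), m.TrLam μ (z • A) = z * m.TrLam μ A := by
    intro z A
    simp only [FlavourModel.TrLam, ntr, smul_mul_assoc, Matrix.trace_smul, smul_eq_mul, mul_div_assoc]
  rw [h3, m.TrLam_tensorOp]
  rfl

end Words

/-! ### Products over the orbits of an involution. -/

section Involutions

/-- A product over a set which is stable under an involution, orbit by orbit. -/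
lemma prod_orbits {X R : Type*} [DecidableEq X] [CommMonoid R] {θ : X → X} (hθ : ∀ x, θ (θ x) = x)
    {A T : Finset X} (hA : ∀ x, x ∈ A ↔ x ∈ T ∨ θ x ∈ T)
    (hT : ∀ x ∈ T, θ x ∈ T → θ x = x) (o : X → R) :
    ∏ x ∈ A, o x = ∏ x ∈ T, ∏ z ∈ {x, θ x}, o z := by
  have h1 : A = T.biUnion fun x => {x, θ x} := by
    ext z
    simp only [hA, Finset.mem_biUnion, Finset.mem_insert, Finset.mem_singleton]
    constructor
    · rintro (h | h)
      · exact ⟨z, h, Or.inl rfl⟩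
      · exact ⟨θ z, h, Or.inr (hθ z).symm⟩
    · rintro ⟨x, hx, rfl | rfl⟩
      · exact Or.inl hx
      · exact Or.inr (by rwa [hθ])
  rw [h1, Finset.prod_biUnion]
  intro x hx y hy hxy
  have e1 : θ x = y → x = y := fun h => by
    have := hT x hx (h ▸ hy)
    rw [← h, this]
  have e2 : θ y = x → x = y := fun h => by
    have := hT y hy (h ▸ hx)
    rw [← h, this]
  have e3 : θ x = θ y → x = y := fun h => by rw [← hθ x, h, hθ]
  simp only [Function.onFun]
  rw [Finset.disjoint_left]
  intro z hz hz'
  simp only [Finset.mem_insert, Finset.mem_singleton] at hz hz'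
  rcases hz with rfl | rfl <;> rcases hz' with h | h
  · exact hxy h
  · exact hxy (e2 h.symm)
  · exact hxy (e1 h)
  · exact hxy (e3 h)

/-- Two choices of one point from every orbit give the same product of an invariant function; fixed
points belong to both choices. This permits choosing the colliding slot of each pair instead of the
one with the smaller label. -/
lemma prod_transversal {X R : Type*} [DecidableEq X] [CommMonoid R] {θ : X → X}
    (hθ : ∀ x, θ (θ x) = x) {A T T' : Finset X} (hA : ∀ x, x ∈ A ↔ x ∈ T ∨ θ x ∈ T)
    (hT : ∀ x ∈ T, θ x ∈ T → θ x = x) (hA' : ∀ x, x ∈ A ↔ x ∈ T' ∨ θ x ∈ T')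
    (hT' : ∀ x ∈ T', θ x ∈ T' → θ x = x) {g : X → R} (hg : ∀ x, g (θ x) = g x) :
    ∏ x ∈ T, g x = ∏ x ∈ T', g x := by
  have h1 : ∏ x ∈ T, g x = ∏ x ∈ A, if x ∈ T then g x else 1 := by
    rw [Finset.prod_ite_mem, Finset.inter_eq_right.2 fun x hx => (hA x).2 (Or.inl hx)]
  rw [h1, prod_orbits hθ hA' hT']
  refine Finset.prod_congr rfl fun x hx => ?_
  have hx' := (hA x).1 ((hA' x).2 (Or.inl hx))
  by_cases h : θ x = x
  · rw [h] at hx' ⊢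
    rw [Finset.pair_eq_singleton, Finset.prod_singleton, if_pos (or_self_iff.1 hx')]
  · rw [Finset.prod_pair (Ne.symm h)]
    by_cases hxT : x ∈ T
    · rw [if_pos hxT, if_neg fun h' => h (hT x hxT h'), mul_one]
    · rw [if_neg hxT, if_pos (hx'.resolve_left hxT), one_mul, hg]

end Involutions

/-! ### Averages of functions of one or two coordinates, and the layout of oriented chords. -/

section Evaluations

variable {X E : Type*} [Fintype X] [DecidableEq X] [Fintype E] [Nonempty E]

lemma expect_eval (x : X) (g : E → ℂ) : 𝔼 e : X → E, g (e x) = 𝔼 a, g a := by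
  rw [expect_update x]
  simp

lemma expect_eval_pair {x y : X} (h : x ≠ y) (g : E → E → ℂ) :
    𝔼 e : X → E, g (e x) (e y) = 𝔼 a, 𝔼 b, g a b := by
  rw [expect_update y]
  simp only [Function.update_self, Function.update_of_ne h]
  exact expect_eval x fun a => 𝔼 b, g a b

lemma card_mul_expect (g : E → ℂ) : (Fintype.card E : ℂ) * 𝔼 a, g a = ∑ a, g a := by
  rw [Fintype.expect_eq_sum_div_card, mul_div_cancel₀]
  exact_mod_cast Fintype.card_ne_zero

end Evaluations

/-- The layout of the oriented chords: `τ` exchanges the two oriented chords of an H chord, and `W`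
lists the end points (`true` for `X†`, `false` for `X`) in the order of their `key`. -/
structure Layout (U : Type*) where
  τ : U → U
  τ_τ : ∀ u, τ (τ u) = u
  key : U × Bool → ℕ
  key_injective : Function.Injective key
  W : List (U × Bool)
  sorted : W.Pairwise fun x y => key x < key y
  complete : ∀ y, y ∈ W

namespace FlavourModel

variable {ι : Type*} [Fintype ι] [DecidableEq ι] {M r : ℕ} (m : FlavourModel ι M r)
  (μ : Fin r → ℝ) {N : ℕ} {U : Type*} [Fintype U] [LinearOrder U] (L : Layout U)

/-- The one-colour trace over the end points of the chords in `A`, the chord `u` carrying the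
flavours `e u`. -/
def wordTr (A : Finset U) (e : U → Fin M × Fin M) : ℂ :=
  m.tr μ ((L.W.filter fun y => y.1 ∈ A).map fun y => m.leg (e y.1) y.2).prod

/-- The weight of the flavours at a slot of `u` after summing over the opposite slot. -/
def env (u : U) (a : Fin M × Fin M) : ℂ :=
  if L.τ u = u then m.S a.1 a.2
  else ∑ c : Fin M × Fin M, m.S a.1 c.2 * m.S c.1 a.2 * m.wordTr μ L {L.τ u} fun _ => c

/-- The value of a pair of opposite slots without collisions. -/
def slotNorm (u : U) : ℂ := ∑ a, m.wordTr μ L {u} (fun _ => a) * m.env μ L u a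

/-- The value of a collision of `u` and `v`. -/
def collValue (u v : U) : ℂ :=
  ∑ a, ∑ b, m.wordTr μ L {u, v} (fun w => if w = u then a else b) * m.env μ L u a * m.env μ L v b

/-- The relative weight of a collision. -/
def collWeight (u v : U) : ℂ :=
  crossSign L.key u v * m.collValue μ L u v / (m.slotNorm μ L u * m.slotNorm μ L v)

end FlavourModel

/-! ### The flavour network: slots, opposite slots and one-colour traces. -/

section Network

variable {ι : Type*} [Fintype ι] [DecidableEq ι] {M r : ℕ} (m : FlavourModel ι M r)
  (μ : Fin r → ℝ) {N : ℕ} {U : Type*} [Fintype U] [LinearOrder U] (L : Layout U) {sz : U → ℕ}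

/-- The slot at the same position of the opposite oriented chord. -/
def Layout.flip (hτ : ∀ u, sz u = sz (L.τ u)) (x : Slot sz) : Slot sz :=
  ⟨L.τ x.1, Fin.cast (hτ x.1) x.2⟩

variable (hτ : ∀ u, sz u = sz (L.τ u))

lemma slot_ext {x y : Slot sz} (h : x.1 = y.1) (h' : (x.2 : ℕ) = y.2) : x = y := by
  obtain ⟨u, l⟩ := x
  obtain ⟨v, l'⟩ := y
  obtain rfl : u = v := h
  obtain rfl : l = l' := Fin.ext h'
  rfl

lemma Layout.flip_flip (x : Slot sz) : L.flip hτ (L.flip hτ x) = x :=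
  slot_ext (L.τ_τ _) rfl

lemma Layout.flip_eq_iff (x : Slot sz) : L.flip hτ x = x ↔ L.τ x.1 = x.1 :=
  ⟨fun h => congrArg Sigma.fst h, fun h => slot_ext h rfl⟩

lemma Config.slot_eq {I : Config N sz} {x y : Slot sz} (h : x.1 = y.1)
    (h' : Config.col I x = Config.col I y) : x = y := by
  obtain ⟨u, l⟩ := x
  obtain ⟨v, l'⟩ := y
  obtain rfl : u = v := h
  obtain rfl : l = l' := (I u).el_injective h'
  rfl

lemma exists_slot (I : Config N sz) {u : U} {j : Fin N} (h : j ∈ (I u).1) :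
    ∃ x : Slot sz, x.1 = u ∧ Config.col I x = j := by
  obtain ⟨l, hl⟩ := (I u).exists_el h
  exact ⟨⟨u, l⟩, rfl, hl⟩

lemma Config.col_mem (I : Config N sz) (x : Slot sz) : Config.col I x ∈ (I x.1).1 :=
  (I x.1).el_mem _

/-- The labels of the sets which contain `j`. -/
def labelsAt (I : Config N sz) (j : Fin N) : Finset U := Finset.univ.filter fun v => j ∈ (I v).1

lemma occ_eq_card_labelsAt (I : Config N sz) (j : Fin N) :
    occ Finset.univ I j = (labelsAt I j).card := rfl

/-- Two lists strictly sorted by the key with the same members coincide. Hence the trace at a colour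
depends only on the labels present there and on their flavours. -/
lemma map_siteList (I : Config N sz) (j : Fin N) :
    (siteList L.W I j).map (fun z => (z.1.1, z.2)) = L.W.filter fun y => y.1 ∈ labelsAt I j := by
  have h1 : ((siteList L.W I j).map fun z => (z.1.1, z.2)).Pairwise fun x y => L.key x < L.key y :=
    List.pairwise_map.2 (pairwise_siteList L.sorted I j)
  have h2 : (L.W.filter fun y => y.1 ∈ labelsAt I j).Pairwise fun x y => L.key x < L.key y :=
    L.sorted.filter _
  have n1 : ((siteList L.W I j).map fun z => (z.1.1, z.2)).Nodup := h1.imp fun h e => by simp [e] at h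
  have n2 : (L.W.filter fun y => y.1 ∈ labelsAt I j).Nodup := h2.imp fun h e => by simp [e] at h
  refine List.Perm.eq_of_pairwise (fun a b _ _ h h' => absurd h h'.not_gt) h1 h2
    ((List.perm_ext_iff_of_nodup n1 n2).2 fun y => ?_)
  simp only [List.mem_map, mem_siteList L.complete, List.mem_filter, L.complete, true_and,
    decide_eq_true_eq, labelsAt, Finset.mem_filter, Finset.mem_univ]
  constructor
  · rintro ⟨z, hz, rfl⟩
    rw [← hz]
    exact Config.col_mem I z.1
  · intro h
    obtain ⟨x, hx, hx'⟩ := exists_slot I h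
    exact ⟨(x, y.2), hx', by rw [hx]⟩

/-- The one-colour trace at the colour `j`. -/
def FlavourModel.siteTr (I : Config N sz) (j : Fin N) (e : Slot sz → Fin M × Fin M) : ℂ :=
  m.tr μ ((siteList L.W I j).map fun z => m.leg (e z.1) z.2).prod

lemma FlavourModel.siteTr_eq (I : Config N sz) (j : Fin N) (e : Slot sz → Fin M × Fin M)
    {η : U → Fin M × Fin M} (hη : ∀ x, Config.col I x = j → η x.1 = e x) :
    m.siteTr μ L I j e = m.wordTr μ L (labelsAt I j) η := by
  rw [FlavourModel.siteTr, FlavourModel.wordTr, ← map_siteList, List.map_map]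
  congr 2
  refine List.map_congr_left fun z hz => ?_
  rw [mem_siteList L.complete] at hz
  simp [hη _ hz]

lemma FlavourModel.siteTr_dependsOn (I : Config N sz) (j : Fin N) :
    DependsOn (m.siteTr μ L I j) {x | Config.col I x = j} := by
  intro e e' h
  rw [FlavourModel.siteTr, FlavourModel.siteTr]
  congr 2
  refine List.map_congr_left fun z hz => ?_
  rw [mem_siteList L.complete] at hz
  rw [h _ hz]

/-- The trace at a slot which is alone at its colour. -/
def FlavourModel.slotTr (x : Slot sz) (e : Slot sz → Fin M × Fin M) : ℂ :=
  m.wordTr μ L {x.1} fun _ => e x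

lemma labelsAt_of_occ_le_one {I : Config N sz} {x : Slot sz}
    (h : ¬ 2 ≤ occ Finset.univ I (Config.col I x)) : labelsAt I (Config.col I x) = {x.1} := by
  have hx : x.1 ∈ labelsAt I (Config.col I x) :=
    Finset.mem_filter.2 ⟨Finset.mem_univ _, Config.col_mem I x⟩
  rw [occ_eq_card_labelsAt] at h
  symm
  apply Finset.eq_of_subset_of_card_le (Finset.singleton_subset_iff.2 hx)
  rw [Finset.card_singleton]
  omega

lemma FlavourModel.siteTr_of_occ_le_one {I : Config N sz} {x : Slot sz}
    (h : ¬ 2 ≤ occ Finset.univ I (Config.col I x)) (e : Slot sz → Fin M × Fin M) :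
    m.siteTr μ L I (Config.col I x) e = m.slotTr μ L x e := by
  rw [FlavourModel.slotTr, m.siteTr_eq μ L I _ e (η := fun _ => e x), labelsAt_of_occ_le_one h]
  intro y hy
  have : y.1 ∈ labelsAt I (Config.col I x) :=
    Finset.mem_filter.2 ⟨Finset.mem_univ _, hy ▸ Config.col_mem I y⟩
  rw [labelsAt_of_occ_le_one h, Finset.mem_singleton] at this
  rw [Config.slot_eq this hy]

/-- The factor of a slot: the invariant tensor, times the number of flavour pairs, and the trace if
the slot is alone at its colour. -/
def FlavourModel.slotFactor (I : Config N sz) (x : Slot sz) (e : Slot sz → Fin M × Fin M) : ℂ :=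
  ((Fintype.card (Fin M × Fin M) : ℂ) * m.S (e x).1 (e (L.flip hτ x)).2) *
    if 2 ≤ occ Finset.univ I (Config.col I x) then 1 else m.slotTr μ L x e

/-- The colours with collisions. -/
def collSites (I : Config N sz) : Finset (Fin N) :=
  Finset.univ.filter fun j => 2 ≤ occ Finset.univ I j

/-- The slots with collisions at them. -/
def collSlots (I : Config N sz) : Finset (Slot sz) :=
  Finset.univ.filter fun x => 2 ≤ occ Finset.univ I (Config.col I x)

lemma FlavourModel.tr_one (h : m.calN μ ≠ 0) : m.tr μ 1 = 1 := by
  rw [FlavourModel.tr, one_mul, div_self]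
  exact h

/-- A colour in no set contributes the trace of the identity, which is one; a colour in exactly one
set is the colour of a unique slot. -/
lemma FlavourModel.prod_siteTr (h : m.calN μ ≠ 0) (I : Config N sz)
    (e : Slot sz → Fin M × Fin M) :
    ∏ j, m.siteTr μ L I j e = (∏ j ∈ collSites I, m.siteTr μ L I j e) *
      ∏ x, if 2 ≤ occ Finset.univ I (Config.col I x) then 1 else m.slotTr μ L x e := by
  rw [← Finset.prod_filter_mul_prod_filter_not Finset.univ (fun j => 2 ≤ occ Finset.univ I j)]
  congr 1
  have h1 : ∏ x, (if 2 ≤ occ Finset.univ I (Config.col I x) then 1 else m.slotTr μ L x e) =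
      ∏ x with ¬ 2 ≤ occ Finset.univ I (Config.col I x), m.slotTr μ L x e := by
    rw [Finset.prod_filter]
    exact Finset.prod_congr rfl fun x _ => by split_ifs <;> simp_all
  rw [h1]
  symm
  refine Finset.prod_of_injOn (Config.col I) ?_ ?_ ?_ ?_
  · intro x hx y hy hxy
    simp only [Finset.coe_filter, Finset.mem_univ, true_and, Set.mem_ofPred_eq] at hx hy
    refine Config.slot_eq ?_ hxy
    have := labelsAt_of_occ_le_one hx
    rw [hxy, labelsAt_of_occ_le_one hy] at this
    exact (Finset.singleton_injective this).symm
  · intro x hx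
    simpa using hx
  · intro j hj hj'
    simp only [Finset.mem_filter, Finset.mem_univ, true_and] at hj
    have : siteList L.W I j = [] := by
      rw [List.eq_nil_iff_forall_not_mem]
      intro z hz
      rw [mem_siteList L.complete] at hz
      exact hj' ⟨z.1, by simpa [hz] using hj, hz⟩
    rw [FlavourModel.siteTr, this]
    simp [m.tr_one μ h]
  · intro x hx
    simp only [Finset.mem_filter, Finset.mem_univ, true_and] at hx
    exact (m.siteTr_of_occ_le_one μ L hx e).symm

/-- The flavour network of a configuration, as an average. -/
def FlavourModel.net (I : Config N sz) : ℂ :=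
  ∑ e : Slot sz → Fin M × Fin M, (∏ x, m.S (e x).1 (e (L.flip hτ x)).2) * ∏ j, m.siteTr μ L I j e

/-- The number of flavour assignments is a power with one factor per slot, and these factors are
absorbed in the `slotFactor`s. As an average, the network is open to the independence lemmas. -/
lemma FlavourModel.net_eq [NeZero M] (h : m.calN μ ≠ 0) (I : Config N sz) :
    m.net μ L hτ I = 𝔼 e : Slot sz → Fin M × Fin M,
      (∏ j ∈ collSites I, m.siteTr μ L I j e) * ∏ x, m.slotFactor μ L hτ I x e := by
  rw [FlavourModel.net, ← card_mul_expect, Finset.mul_expect]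
  refine Finset.expect_congr rfl fun e _ => ?_
  simp only [FlavourModel.slotFactor, Finset.prod_mul_distrib]
  rw [m.prod_siteTr μ L h, Fintype.card_fun]
  simp only [Finset.prod_const, Finset.card_univ]
  push_cast
  ring

/-- Summing over the slot opposite to `x`. -/
lemma FlavourModel.expect_mul_orbit [NeZero M] (I : Config N sz) (x : Slot sz)
    (hx : L.flip hτ x ≠ x → ¬ 2 ≤ occ Finset.univ I (Config.col I (L.flip hτ x)))
    {K : (Slot sz → Fin M × Fin M) → ℂ} (hK : L.flip hτ x ≠ x → DependsOn K {L.flip hτ x}ᶜ) :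
    𝔼 e, K e * ∏ z ∈ {x, L.flip hτ x}, m.slotFactor μ L hτ I z e =
      𝔼 e : Slot sz → Fin M × Fin M, K e *
        ((Fintype.card (Fin M × Fin M) : ℂ) * m.env μ L x.1 (e x) *
        if 2 ≤ occ Finset.univ I (Config.col I x) then 1 else m.slotTr μ L x e) := by
  by_cases hxx : L.flip hτ x = x
  · refine Finset.expect_congr rfl fun e _ => ?_
    rw [hxx, Finset.pair_eq_singleton, Finset.prod_singleton, FlavourModel.slotFactor, hxx,
      FlavourModel.env, if_pos ((L.flip_eq_iff hτ x).1 hxx)]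
  · have hτx : L.τ x.1 ≠ x.1 := fun h => hxx ((L.flip_eq_iff hτ x).2 h)
    rw [expect_update (L.flip hτ x)]
    refine Finset.expect_congr rfl fun e _ => ?_
    have h1 : ∀ a, K (Function.update e (L.flip hτ x) a) = K e := fun a =>
      hK hxx fun z hz => by
        rw [Function.update_of_ne]
        simpa using hz
    have h2 : ∀ a, (∏ z ∈ {x, L.flip hτ x}, m.slotFactor μ L hτ I z
        (Function.update e (L.flip hτ x) a)) = (Fintype.card (Fin M × Fin M) : ℂ) *
          ((if 2 ≤ occ Finset.univ I (Config.col I x) then 1 else m.slotTr μ L x e) *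
          ((Fintype.card (Fin M × Fin M) : ℂ) * (m.S (e x).1 a.2 * m.S a.1 (e x).2 *
            m.wordTr μ L {L.τ x.1} fun _ => a))) := by
      intro a
      rw [Finset.prod_pair (Ne.symm hxx), FlavourModel.slotFactor, FlavourModel.slotFactor,
        if_neg (hx hxx), L.flip_flip, FlavourModel.slotTr, FlavourModel.slotTr, FlavourModel.slotTr,
        Function.update_self, Function.update_of_ne (Ne.symm hxx)]
      simp only [Layout.flip]
      ring
    simp only [h1, h2]
    rw [← Finset.mul_expect, ← Finset.mul_expect, ← Finset.mul_expect, ← Finset.mul_expect,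
      card_mul_expect, FlavourModel.env, if_neg hτx]
    ring

end Network

/-! ### Locality of the network for good configurations. -/

section NetworkValue

variable {ι : Type*} [Fintype ι] [DecidableEq ι] {M r : ℕ} (m : FlavourModel ι M r)
  (μ : Fin r → ℝ) {N : ℕ} {U : Type*} [Fintype U] [LinearOrder U] (L : Layout U) {sz : U → ℕ}
  (hτ : ∀ u, sz u = sz (L.τ u))

/-- The slots for which neither they nor the opposite slots have collisions. -/
def freeSlots (I : Config N sz) : Finset (Slot sz) :=
  Finset.univ.filter fun x => x ∉ collSlots I ∧ L.flip hτ x ∉ collSlots I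

/-- One slot of each pair of opposite slots. -/
def Layout.reps (L : Layout U) (sz : U → ℕ) : Finset (Slot sz) :=
  Finset.univ.filter fun x => x.1 ≤ L.τ x.1

lemma mem_collSlots {I : Config N sz} {x : Slot sz} :
    x ∈ collSlots I ↔ 2 ≤ occ Finset.univ I (Config.col I x) := by
  simp [collSlots]

lemma mem_freeSlots {I : Config N sz} {x : Slot sz} :
    x ∈ freeSlots L hτ I ↔ x ∉ collSlots I ∧ L.flip hτ x ∉ collSlots I := by
  simp [freeSlots]

lemma Layout.mem_reps {x : Slot sz} : x ∈ L.reps sz ↔ x.1 ≤ L.τ x.1 := by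
  simp [Layout.reps]

lemma Layout.mem_or_flip_mem_reps (x : Slot sz) : x ∈ L.reps sz ∨ L.flip hτ x ∈ L.reps sz := by
  rw [L.mem_reps, L.mem_reps]
  simp only [Layout.flip, L.τ_τ]
  exact le_total _ _

lemma Layout.flip_eq_of_mem_reps {x : Slot sz} (h : x ∈ L.reps sz) (h' : L.flip hτ x ∈ L.reps sz) :
    L.flip hτ x = x := by
  rw [L.mem_reps] at h h'
  simp only [Layout.flip, L.τ_τ] at h'
  exact (L.flip_eq_iff hτ x).2 (le_antisymm h' h)

lemma flip_mem_freeSlots {I : Config N sz} {x : Slot sz} (h : x ∈ freeSlots L hτ I) :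
    L.flip hτ x ∈ freeSlots L hτ I := by
  rw [mem_freeSlots] at h ⊢
  rw [L.flip_flip]
  exact ⟨h.2, h.1⟩

lemma slotFactor_dependsOn (I : Config N sz) (x : Slot sz) :
    DependsOn (m.slotFactor μ L hτ I x) {x, L.flip hτ x} := by
  intro e e' h
  rw [FlavourModel.slotFactor, FlavourModel.slotFactor, FlavourModel.slotTr, FlavourModel.slotTr,
    h x (by simp), h (L.flip hτ x) (by simp)]

lemma orbit_dependsOn (I : Config N sz) (x : Slot sz) :
    DependsOn (fun e => ∏ z ∈ {x, L.flip hτ x}, m.slotFactor μ L hτ I z e) {x, L.flip hτ x} := by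
  intro e e' h
  refine Finset.prod_congr rfl fun z hz => slotFactor_dependsOn m μ L hτ I z fun y hy => h y ?_
  simp only [Finset.mem_insert, Finset.mem_singleton] at hz
  simp only [Set.mem_insert_iff, Set.mem_singleton_iff] at hy ⊢
  rcases hz with rfl | rfl
  · exact hy
  · rw [L.flip_flip] at hy
    exact hy.symm

lemma expect_orbit [NeZero M] {I : Config N sz} {x : Slot sz} (hx : x ∈ freeSlots L hτ I) :
    𝔼 e, ∏ z ∈ {x, L.flip hτ x}, m.slotFactor μ L hτ I z e = m.slotNorm μ L x.1 := by
  rw [mem_freeSlots, mem_collSlots, mem_collSlots] at hx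
  have := m.expect_mul_orbit μ L hτ I x (fun _ => hx.2) (K := fun _ => 1) (fun _ _ _ _ => rfl)
  simp only [one_mul, if_neg hx.1] at this
  rw [this]
  refine (expect_eval x fun a => (Fintype.card (Fin M × Fin M) : ℂ) * m.env μ L x.1 a *
    m.wordTr μ L {x.1} fun _ => a).trans ?_
  simp only [mul_assoc]
  rw [← Finset.mul_expect, card_mul_expect]
  exact Finset.sum_congr rfl fun a _ => mul_comm _ _

/-- The free slots factor out of the network. -/
lemma FlavourModel.net_eq_free_mul [NeZero M] (h : m.calN μ ≠ 0) (I : Config N sz) :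
    m.net μ L hτ I =
      (𝔼 e : Slot sz → Fin M × Fin M, (∏ j ∈ collSites I, m.siteTr μ L I j e) *
        ∏ x with x ∉ freeSlots L hτ I, m.slotFactor μ L hτ I x e) *
      ∏ x ∈ freeSlots L hτ I with x ∈ L.reps sz, m.slotNorm μ L x.1 := by
  rw [m.net_eq μ L hτ h]
  have h1 : ∀ e : Slot sz → Fin M × Fin M, (∏ j ∈ collSites I, m.siteTr μ L I j e) *
      ∏ x, m.slotFactor μ L hτ I x e =
      ((∏ j ∈ collSites I, m.siteTr μ L I j e) *
        ∏ x with x ∉ freeSlots L hτ I, m.slotFactor μ L hτ I x e) *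
      ∏ x ∈ freeSlots L hτ I with x ∈ L.reps sz, ∏ z ∈ {x, L.flip hτ x},
        m.slotFactor μ L hτ I z e := by
    intro e
    rw [← prod_orbits (A := freeSlots L hτ I) (L.flip_flip hτ), mul_assoc,
      ← Finset.prod_filter_mul_prod_filter_not Finset.univ (fun x => x ∉ freeSlots L hτ I)]
    · simp
    · intro x
      simp only [Finset.mem_filter]
      constructor
      · intro hx
        rcases L.mem_or_flip_mem_reps hτ x with h | h
        · exact Or.inl ⟨hx, h⟩
        · exact Or.inr ⟨flip_mem_freeSlots L hτ hx, h⟩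
      · rintro (hx | hx)
        · exact hx.1
        · rw [← L.flip_flip hτ x]
          exact flip_mem_freeSlots L hτ hx.1
    · intro x hx hx'
      exact L.flip_eq_of_mem_reps hτ (Finset.mem_filter.1 hx).2 (Finset.mem_filter.1 hx').2
  simp only [h1]
  -- The traces at collisions and the touched factors involve only slots that are not free, the
  -- orbit factors only free ones.
  rw [expect_mul_of_dependsOn (D := {x | x ∉ freeSlots L hτ I})]
  · congr 1
    refine (expect_prod_of_dependsOn
      (G := fun x e => ∏ z ∈ {x, L.flip hτ x}, m.slotFactor μ L hτ I z e)
      (D := fun x => {x, L.flip hτ x}) _ ?_ ?_).trans ?_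
    · exact fun x _ => orbit_dependsOn m μ L hτ I x
    · intro x hx y hy hxy
      have hx := (Finset.mem_filter.1 (Finset.mem_coe.1 hx)).2
      have hy := (Finset.mem_filter.1 (Finset.mem_coe.1 hy)).2
      have e1 : ∀ {x y}, x ∈ L.reps sz → y ∈ L.reps sz → x = L.flip hτ y → x = y := by
        rintro x y hx hy rfl
        exact L.flip_eq_of_mem_reps hτ hy hx
      simp only [Function.onFun]
      rw [Set.disjoint_left]
      intro z hz hz'
      simp only [Set.mem_insert_iff, Set.mem_singleton_iff] at hz hz'
      rcases hz with rfl | rfl <;> rcases hz' with h | h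
      · exact hxy h
      · exact hxy (e1 hx hy h)
      · exact hxy (e1 hy hx h.symm).symm
      · exact hxy (by rw [← L.flip_flip hτ x, h, L.flip_flip])
    · exact Finset.prod_congr rfl fun x hx => expect_orbit m μ L hτ (Finset.mem_filter.1 hx).1
  · intro e e' hee
    refine congrArg₂ (· * ·) ?_ ?_
    · refine Finset.prod_congr rfl fun j hj => m.siteTr_dependsOn μ L I j fun x hx => hee x ?_
      simp only [Set.mem_ofPred_eq, mem_freeSlots, mem_collSlots] at hx ⊢
      rw [hx]
      exact fun h => h.1 (Finset.mem_filter.1 hj).2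
    · refine Finset.prod_congr rfl fun x hx => slotFactor_dependsOn m μ L hτ I x fun y hy => hee y ?_
      simp only [Finset.mem_filter, Finset.mem_univ, true_and] at hx
      rcases hy with rfl | rfl
      · exact hx
      · exact fun h => hx (by rw [← L.flip_flip hτ x]; exact flip_mem_freeSlots L hτ h)
  · intro e e' hee
    refine Finset.prod_congr rfl fun x hx => orbit_dependsOn m μ L hτ I x fun y hy => hee y ?_
    simp only [Set.mem_compl_iff, Set.mem_ofPred_eq, not_not]
    rcases hy with rfl | rfl
    · exact (Finset.mem_filter.1 hx).1
    · exact flip_mem_freeSlots L hτ (Finset.mem_filter.1 hx).1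

/-- The value of the network if there are no collisions. -/
def FlavourModel.netNorm (sz : U → ℕ) : ℂ := ∏ x ∈ L.reps sz, m.slotNorm μ L x.1

lemma FlavourModel.netNorm_eq (I : Config N sz) : m.netNorm μ L sz =
    (∏ x ∈ freeSlots L hτ I with x ∈ L.reps sz, m.slotNorm μ L x.1) *
      ∏ x with x ∉ freeSlots L hτ I ∧ x ∈ L.reps sz, m.slotNorm μ L x.1 := by
  rw [FlavourModel.netNorm, ← Finset.prod_filter_mul_prod_filter_not (L.reps sz)
    (fun x => x ∈ freeSlots L hτ I)]
  congr 1 <;> refine Finset.prod_congr ?_ fun _ _ => rfl <;> ext x <;>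
    simp [and_comm]

/-- The second clause of `Good`: two opposite slots both have collisions only if they coincide,
which happens for chords fixed by `τ`. -/
lemma flip_mem_collSlots {I : Config N sz} (hI : Good L.τ hτ I) {x : Slot sz}
    (h : x ∈ collSlots I) (h' : L.flip hτ x ∈ collSlots I) : L.flip hτ x = x := by
  by_contra hne
  rw [mem_collSlots] at h h'
  have := hI.2 x.1 (fun e => hne ((L.flip_eq_iff hτ x).2 e)) x.2
  simp only [Config.col, Layout.flip] at h h'
  omega

/-- The value of the network around a collision. -/
lemma expect_collision [NeZero M] {I : Config N sz} (hI : Good L.τ hτ I) {j : Fin N}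
    {x y : Slot sz} (hxy : x.1 ≠ y.1) (hx : Config.col I x = j) (hy : Config.col I y = j)
    (hj : labelsAt I j = {x.1, y.1}) :
    𝔼 e, m.siteTr μ L I j e * ((∏ z ∈ {x, L.flip hτ x}, m.slotFactor μ L hτ I z e) *
      ∏ z ∈ {y, L.flip hτ y}, m.slotFactor μ L hτ I z e) = m.collValue μ L x.1 y.1 := by
  have hne : x ≠ y := fun h => hxy (by rw [h])
  have hocc : 2 ≤ occ Finset.univ I j := by
    rw [occ_eq_card_labelsAt, hj, Finset.card_pair hxy]
  have hcx : x ∈ collSlots I := mem_collSlots.2 (hx ▸ hocc)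
  have hcy : y ∈ collSlots I := mem_collSlots.2 (hy ▸ hocc)
  have hsite : ∀ z, Config.col I z = j → z = x ∨ z = y := by
    intro z hz
    have : z.1 ∈ labelsAt I j := Finset.mem_filter.2 ⟨Finset.mem_univ _, hz ▸ Config.col_mem I z⟩
    rw [hj, Finset.mem_insert, Finset.mem_singleton] at this
    exact this.imp (fun h => Config.slot_eq h (hz.trans hx.symm))
      fun h => Config.slot_eq h (hz.trans hy.symm)
  have hcoll : ∀ z, L.flip hτ z ≠ z → z ∈ collSlots I → L.flip hτ z ∉ collSlots I :=
    fun z hz h h' => hz (flip_mem_collSlots L hτ hI h h')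
  have hdep : ∀ z, z ∈ collSlots I → L.flip hτ z ≠ z →
      DependsOn (m.siteTr μ L I j) {L.flip hτ z}ᶜ := by
    intro z hz hzz e e' hee
    refine m.siteTr_dependsOn μ L I j fun w hw => hee w ?_
    rintro rfl
    refine hcoll z hzz hz (mem_collSlots.2 ?_)
    rw [show Config.col I (L.flip hτ z) = j from hw]
    exact hocc
  -- The colliding slots are not opposite to each other, so the slots opposite to `x` and `y` can be
  -- summed separately.
  have hfx : L.flip hτ y ≠ x := fun h => hne (by
    have := flip_mem_collSlots L hτ hI hcy (h ▸ hcx)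
    rw [← h, this])
  have hfy : L.flip hτ x ≠ y := fun h => hfx (by rw [← h, L.flip_flip])
  have hff : L.flip hτ x ≠ L.flip hτ y := fun h => hne (by rw [← L.flip_flip hτ x, h, L.flip_flip])
  simp only [← mul_assoc]
  -- A slot opposite to a colliding one is collision free, hence absent from the trace at `j`;
  -- summing it out leaves `env`. This is done for `y` and then for `x`.
  rw [m.expect_mul_orbit μ L hτ I y (fun h => fun h' => hcoll y h hcy (mem_collSlots.2 h'))]
  swap
  · intro h e e' hee
    dsimp only
    congr 1
    · exact hdep y hcy h hee
    · refine orbit_dependsOn m μ L hτ I x fun w hw => hee w ?_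
      rcases hw with rfl | rfl
      · exact fun h => hfx (Set.mem_singleton_iff.1 h).symm
      · exact fun h => hff (Set.mem_singleton_iff.1 h)
  simp only [if_pos (mem_collSlots.1 hcy), mul_one]
  have := m.expect_mul_orbit μ L hτ I x (fun h => fun h' => hcoll x h hcx (mem_collSlots.2 h'))
    (K := fun e => m.siteTr μ L I j e *
      ((Fintype.card (Fin M × Fin M) : ℂ) * m.env μ L y.1 (e y))) ?_
  swap
  · intro h e e' hee
    dsimp only
    congr 1
    · exact hdep x hcx h hee
    · rw [hee y]
      exact fun h => hfy (Set.mem_singleton_iff.1 h).symm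
  simp only [if_pos (mem_collSlots.1 hcx), mul_one] at this
  have h2 : ∀ e : Slot sz → Fin M × Fin M, m.siteTr μ L I j e *
      (∏ z ∈ {x, L.flip hτ x}, m.slotFactor μ L hτ I z e) *
      ((Fintype.card (Fin M × Fin M) : ℂ) * m.env μ L y.1 (e y)) = m.siteTr μ L I j e *
      ((Fintype.card (Fin M × Fin M) : ℂ) * m.env μ L y.1 (e y)) *
      ∏ z ∈ {x, L.flip hτ x}, m.slotFactor μ L hτ I z e := fun e => by ring
  simp only [h2, this]
  clear this h2 hcoll hdep hfx hfy hff
  obtain ⟨g, hg⟩ : ∃ g : Fin M × Fin M → Fin M × Fin M → ℂ, ∀ a b, g a b =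
      m.wordTr μ L {x.1, y.1} (fun w => if w = x.1 then a else b) * m.env μ L x.1 a *
        m.env μ L y.1 b := ⟨_, fun _ _ => rfl⟩
  have h3 : ∀ e : Slot sz → Fin M × Fin M, m.siteTr μ L I j e *
      ((Fintype.card (Fin M × Fin M) : ℂ) * m.env μ L y.1 (e y)) *
      ((Fintype.card (Fin M × Fin M) : ℂ) * m.env μ L x.1 (e x)) =
      (Fintype.card (Fin M × Fin M) : ℂ) * ((Fintype.card (Fin M × Fin M) : ℂ) * g (e x) (e y)) := by
    intro e
    rw [hg, m.siteTr_eq μ L I j e (η := fun w => if w = x.1 then e x else e y), hj]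
    · ring
    · intro z hz
      rcases hsite z hz with rfl | rfl
      · exact if_pos rfl
      · exact if_neg hxy.symm
  rw [Finset.expect_congr rfl fun e _ => h3 e, ← Finset.mul_expect, ← Finset.mul_expect,
    expect_eval_pair hne, card_mul_expect, Finset.mul_sum, FlavourModel.collValue]
  refine Finset.sum_congr rfl fun a _ => ?_
  rw [card_mul_expect]
  exact Finset.sum_congr rfl fun b _ => hg a b

/-- The network of a good configuration, up to the free slots. -/
lemma expect_touched [NeZero M] {I : Config N sz} (hI : Good L.τ hτ I) :
    (𝔼 e : Slot sz → Fin M × Fin M, (∏ j ∈ collSites I, m.siteTr μ L I j e) *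
        ∏ x with x ∉ freeSlots L hτ I, m.slotFactor μ L hτ I x e) =
      ∏ j ∈ collSites I, 𝔼 e, m.siteTr μ L I j e *
        ∏ x with Config.col I x = j, ∏ z ∈ {x, L.flip hτ x}, m.slotFactor μ L hτ I z e := by
  refine Eq.trans ?_ (expect_prod_of_dependsOn (collSites I) (G := fun j e => m.siteTr μ L I j e *
        ∏ x with Config.col I x = j, ∏ z ∈ {x, L.flip hτ x}, m.slotFactor μ L hτ I z e)
    (D := fun j => {z | Config.col I z = j ∨ Config.col I (L.flip hτ z) = j}) ?_ ?_)
  · refine Finset.expect_congr rfl fun e _ => ?_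
    -- In a good configuration `collSlots I` contains exactly one slot of every touched orbit, and
    -- its elements are grouped by colour.
    rw [Finset.prod_mul_distrib, prod_orbits (T := collSlots I) (L.flip_flip hτ)]
    · congr 1
      rw [← Finset.prod_fiberwise_of_maps_to (g := Config.col I) (t := collSites I)]
      · refine Finset.prod_congr rfl fun j hj => Finset.prod_congr ?_ fun _ _ => rfl
        ext x
        simp only [Finset.mem_filter, mem_collSlots, Finset.mem_univ, true_and, and_iff_right_iff_imp]
        rintro rfl
        exact (Finset.mem_filter.1 hj).2
      · intro x hx
        exact Finset.mem_filter.2 ⟨Finset.mem_univ _, mem_collSlots.1 hx⟩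
    · intro x
      simp only [Finset.mem_filter, Finset.mem_univ, true_and, mem_freeSlots]
      tauto
    · exact fun x hx hx' => flip_mem_collSlots L hτ hI hx hx'
  · intro j hj e e' hee
    dsimp only
    congr 1
    · exact m.siteTr_dependsOn μ L I j fun x hx => hee x (Or.inl hx)
    · refine Finset.prod_congr rfl fun x hx => orbit_dependsOn m μ L hτ I x fun y hy => hee y ?_
      have hx := (Finset.mem_filter.1 hx).2
      rcases hy with rfl | rfl
      · exact Or.inl hx
      · exact Or.inr (by rw [L.flip_flip]; exact hx)
  · intro j hj j' hj' hjj
    have hj := (Finset.mem_filter.1 (Finset.mem_coe.1 hj)).2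
    have hj' := (Finset.mem_filter.1 (Finset.mem_coe.1 hj')).2
    simp only [Function.onFun]
    rw [Set.disjoint_left]
    rintro z (rfl | rfl) (h | h)
    · exact hjj h
    · subst h
      exact hjj (by rw [flip_mem_collSlots L hτ hI (mem_collSlots.2 hj) (mem_collSlots.2 hj')])
    · subst h
      exact hjj (by rw [flip_mem_collSlots L hτ hI (mem_collSlots.2 hj') (mem_collSlots.2 hj)])
    · exact hjj h

end NetworkValue

/-! ### The network as a product over intersections, and a bound for all configurations. -/

section NetworkBounds

variable {ι : Type*} [Fintype ι] [DecidableEq ι] {M r : ℕ} (m : FlavourModel ι M r)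
  (μ : Fin r → ℝ) {N : ℕ} {U : Type*} [Fintype U] [LinearOrder U] (L : Layout U) {sz : U → ℕ}
  (hτ : ∀ u, sz u = sz (L.τ u))

/-- The powers over pairs of labels are regrouped by colours. Colours in at most one set contain no
pair of labels and contribute one. -/
lemma prod_crossSign (I : Config N sz) (q : U → U → ℂ) :
    pairWeight q Finset.univ I = ∏ j ∈ collSites I,
      ∏ u ∈ labelsAt I j, ∏ v ∈ labelsAt I j with v < u, q v u := by
  have h1 : pairWeight q Finset.univ I =
      ∏ j, ∏ u ∈ labelsAt I j, ∏ v ∈ labelsAt I j with v < u, q v u := by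
    simp only [pairWeight, labelsAt, Finset.prod_filter]
    conv_rhs => rw [Finset.prod_comm]
    refine Finset.prod_congr rfl fun u _ => ?_
    have : ∀ j : Fin N, (if j ∈ (I u).1 then
        ∏ v, (if j ∈ (I v).1 then (if v < u then q v u else (1 : ℂ)) else 1) else 1) =
        ∏ v, if v < u then (if j ∈ (I v).1 ∩ (I u).1 then q v u else 1) else 1 := by
      intro j
      by_cases h : j ∈ (I u).1
      · rw [if_pos h]
        refine Finset.prod_congr rfl fun v _ => ?_
        by_cases h' : j ∈ (I v).1 <;> simp [h, h']
      · simp [h]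
    simp only [this]
    conv_rhs => rw [Finset.prod_comm]
    refine Finset.prod_congr rfl fun v _ => ?_
    split_ifs
    · rw [Finset.prod_ite_mem, Finset.univ_inter, Finset.prod_const]
    · simp
  rw [h1, collSites, Finset.prod_filter]
  refine Finset.prod_congr rfl fun j _ => ?_
  split_ifs with h
  · rfl
  · rw [occ_eq_card_labelsAt] at h
    refine Finset.prod_eq_one fun u hu => ?_
    rw [Finset.filter_false_of_mem, Finset.prod_empty]
    intro v hv hvu
    apply h
    rw [← Finset.card_pair hvu.ne]
    exact Finset.card_le_card (Finset.insert_subset hv (Finset.singleton_subset_iff.2 hu))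

/-- The network of a good configuration is a product over the pairwise intersections. -/
theorem FlavourModel.net_of_good [NeZero M] (h : m.calN μ ≠ 0) (hn : ∀ u, m.slotNorm μ L u ≠ 0)
    (hn' : ∀ u, m.slotNorm μ L (L.τ u) = m.slotNorm μ L u) {I : Config N sz}
    (hI : Good L.τ hτ I) :
    pairWeight (crossSign L.key) Finset.univ I * m.net μ L hτ I =
      m.netNorm μ L sz * pairWeight (m.collWeight μ L) Finset.univ I := by
  have h1 : ∏ x with x ∉ freeSlots L hτ I ∧ x ∈ L.reps sz, m.slotNorm μ L x.1 =
      ∏ j ∈ collSites I, ∏ x : Slot sz with Config.col I x = j, m.slotNorm μ L x.1 := by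
    -- Off the free slots, the representatives and the colliding slots both meet every orbit once,
    -- and `slotNorm` does not distinguish opposite slots.
    rw [prod_transversal (L.flip_flip hτ) (A := Finset.univ.filter fun x => x ∉ freeSlots L hτ I)
      (T' := collSlots I), ← Finset.prod_fiberwise_of_maps_to (g := Config.col I) (t := collSites I)]
    · refine Finset.prod_congr rfl fun j hj => Finset.prod_congr ?_ fun _ _ => rfl
      ext x
      simp only [Finset.mem_filter, mem_collSlots, Finset.mem_univ, true_and, and_iff_right_iff_imp]
      rintro rfl
      exact (Finset.mem_filter.1 hj).2
    · intro x hx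
      exact Finset.mem_filter.2 ⟨Finset.mem_univ _, mem_collSlots.1 hx⟩
    · intro x
      have hf : L.flip hτ x ∈ freeSlots L hτ I ↔ x ∈ freeSlots L hτ I :=
        ⟨fun h => by simpa [L.flip_flip] using flip_mem_freeSlots L hτ h, flip_mem_freeSlots L hτ⟩
      have := L.mem_or_flip_mem_reps hτ x
      simp only [Finset.mem_filter, Finset.mem_univ, true_and, hf]
      tauto
    · intro x hx hx'
      exact L.flip_eq_of_mem_reps hτ (Finset.mem_filter.1 hx).2.2 (Finset.mem_filter.1 hx').2.2
    · intro x
      simp only [Finset.mem_filter, Finset.mem_univ, true_and, mem_freeSlots]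
      tauto
    · exact fun x hx hx' => flip_mem_collSlots L hτ hI hx hx'
    · exact fun x => hn' _
  rw [m.net_eq_free_mul μ L hτ h, m.netNorm_eq μ L hτ I, expect_touched m μ L hτ hI, h1,
    prod_crossSign, prod_crossSign]
  have h2 : ∀ j ∈ collSites I,
      (∏ u ∈ labelsAt I j, ∏ v ∈ labelsAt I j with v < u, crossSign L.key v u) *
        (𝔼 e, m.siteTr μ L I j e *
        ∏ x with Config.col I x = j, ∏ z ∈ {x, L.flip hτ x}, m.slotFactor μ L hτ I z e) =
      (∏ u ∈ labelsAt I j, ∏ v ∈ labelsAt I j with v < u, m.collWeight μ L v u) *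
        ∏ x : Slot sz with Config.col I x = j, m.slotNorm μ L x.1 := by
    intro j hj
    have hj1 := (Finset.mem_filter.1 hj).2
    have hj2 := hI.1 j
    rw [occ_eq_card_labelsAt] at hj1 hj2
    -- A colliding colour of a good configuration lies in exactly two sets.
    obtain ⟨u, v, huv, hl⟩ := Finset.card_eq_two.1 (le_antisymm hj2 hj1)
    wlog hlt : u < v generalizing u v
    · exact this v u huv.symm (by rw [hl, Finset.pair_comm]) (lt_of_le_of_ne (not_lt.1 hlt) huv.symm)
    have hu : j ∈ (I u).1 := (Finset.mem_filter.1 (show u ∈ labelsAt I j by simp [hl])).2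
    have hv : j ∈ (I v).1 := (Finset.mem_filter.1 (show v ∈ labelsAt I j by simp [hl])).2
    obtain ⟨x, rfl, hx⟩ := exists_slot I hu
    obtain ⟨y, rfl, hy⟩ := exists_slot I hv
    have hfib : (Finset.univ.filter fun z => Config.col I z = j) = {x, y} := by
      ext z
      simp only [Finset.mem_filter, Finset.mem_univ, true_and, Finset.mem_insert,
        Finset.mem_singleton]
      constructor
      · intro hz
        have : z.1 ∈ labelsAt I j := Finset.mem_filter.2 ⟨Finset.mem_univ _, hz ▸ Config.col_mem I z⟩
        rw [hl, Finset.mem_insert, Finset.mem_singleton] at this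
        exact this.imp (fun h => Config.slot_eq h (hz.trans hx.symm))
          fun h => Config.slot_eq h (hz.trans hy.symm)
      · rintro (rfl | rfl) <;> assumption
    have hne : x ≠ y := fun h => huv (by rw [h])
    have hpair : ∀ f : U → U → ℂ, (∏ u ∈ labelsAt I j, ∏ v ∈ labelsAt I j with v < u, f v u) =
        f x.1 y.1 := by
      intro f
      rw [hl, Finset.prod_pair huv]
      have f1 : (({x.1, y.1} : Finset U).filter fun w => w < x.1) = ∅ := by
        refine Finset.filter_false_of_mem fun w hw => ?_
        simp only [Finset.mem_insert, Finset.mem_singleton] at hw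
        rcases hw with rfl | rfl
        · exact lt_irrefl _
        · exact hlt.not_gt
      have f2 : (({x.1, y.1} : Finset U).filter fun w => w < y.1) = {x.1} := by
        rw [Finset.filter_insert, if_pos hlt, Finset.filter_singleton, if_neg (lt_irrefl _)]
        rfl
      rw [f1, f2, Finset.prod_empty, one_mul, Finset.prod_singleton]
    rw [hpair, hpair, hfib, Finset.prod_pair hne, FlavourModel.collWeight]
    have := expect_collision m μ L hτ hI huv hx hy hl
    simp only [Finset.prod_pair hne]
    rw [this, div_mul_cancel₀ _ (mul_ne_zero (hn _) (hn _))]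
  have h3 := Finset.prod_congr rfl h2
  rw [Finset.prod_mul_distrib, Finset.prod_mul_distrib] at h3
  rw [← mul_assoc, h3]
  ring

lemma card_collSlots_le (I : Config N sz) :
    (collSlots I).card ≤ Fintype.card U * (collSites I).card := by
  rw [Finset.card_eq_sum_card_fiberwise (f := Config.col I) (t := collSites I)]
  · rw [mul_comm]
    refine Finset.sum_le_card_nsmul _ _ _ fun j _ => ?_
    refine Finset.card_le_card_of_injOn (t := Finset.univ) (fun x => x.1) (fun _ _ => Finset.mem_coe.2 (Finset.mem_univ _)) ?_
    intro x hx y hy hxy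
    exact Config.slot_eq hxy ((Finset.mem_filter.1 hx).2.trans (Finset.mem_filter.1 hy).2.symm)
  · intro x hx
    exact Finset.mem_filter.2 ⟨Finset.mem_univ _, mem_collSlots.1 hx⟩

lemma card_not_freeSlots_le (I : Config N sz) :
    (Finset.univ.filter fun x => x ∉ freeSlots L hτ I).card ≤ 2 * (collSlots I).card := by
  have : (Finset.univ.filter fun x => x ∉ freeSlots L hτ I) ⊆
      collSlots I ∪ (collSlots I).image (L.flip hτ) := by
    intro x hx
    simp only [Finset.mem_filter, Finset.mem_univ, true_and, mem_freeSlots] at hx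
    rw [Finset.mem_union, Finset.mem_image]
    by_cases h : x ∈ collSlots I
    · exact Or.inl h
    · exact Or.inr ⟨L.flip hτ x, by tauto, L.flip_flip hτ x⟩
  refine (Finset.card_le_card this).trans ((Finset.card_union_le _ _).trans ?_)
  rw [two_mul]
  exact Nat.add_le_add_left Finset.card_image_le _

lemma norm_prod_le_pow {α : Type*} (s : Finset α) (f : α → ℂ) {K : ℝ} (hK : 1 ≤ K)
    (h : ∀ x ∈ s, ‖f x‖ ≤ K) {n : ℕ} (hn : s.card ≤ n) : ‖∏ x ∈ s, f x‖ ≤ K ^ n := by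
  rw [norm_prod]
  calc ∏ x ∈ s, ‖f x‖ ≤ ∏ _x ∈ s, K := Finset.prod_le_prod (fun _ _ => norm_nonneg _) h
    _ = K ^ s.card := by rw [Finset.prod_const]
    _ ≤ K ^ n := pow_le_pow_right₀ hK hn

lemma card_collSites_le (I : Config N sz) : (collSites I).card ≤ coll Finset.univ I := by
  have := card_pairs_le_coll Finset.univ I
  rwa [← Finset.card_filter] at this

/-- The network of a configuration is bounded exponentially in the number of collisions. -/
theorem FlavourModel.norm_net_le [NeZero M] (h : m.calN μ ≠ 0) (hn : ∀ u, m.slotNorm μ L u ≠ 0) :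
    ∃ C : ℝ, 1 ≤ C ∧ ∀ (N : ℕ) (sz : U → ℕ) (hτ : ∀ u, sz u = sz (L.τ u)) (I : Config N sz),
      ‖m.net μ L hτ I‖ ≤ ‖m.netNorm μ L sz‖ * C ^ coll Finset.univ I := by
  obtain ⟨B, hB1, hB⟩ : ∃ B : ℝ, 1 ≤ B ∧ ∀ A e, ‖m.wordTr μ L A e‖ ≤ B := by
    refine ⟨1 + ∑ A, ∑ e, ‖m.wordTr μ L A e‖, ?_, fun A e => ?_⟩
    · have : 0 ≤ ∑ A, ∑ e, ‖m.wordTr μ L A e‖ := by positivity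
      linarith
    · have h1 : ‖m.wordTr μ L A e‖ ≤ ∑ e, ‖m.wordTr μ L A e‖ :=
        Finset.single_le_sum (f := fun e => ‖m.wordTr μ L A e‖) (fun _ _ => norm_nonneg _)
          (Finset.mem_univ e)
      have h2 : ∑ e, ‖m.wordTr μ L A e‖ ≤ ∑ A, ∑ e, ‖m.wordTr μ L A e‖ :=
        Finset.single_le_sum (f := fun A => ∑ e, ‖m.wordTr μ L A e‖)
          (fun _ _ => by positivity) (Finset.mem_univ A)
      linarith
  obtain ⟨D, hD1, hD⟩ : ∃ D : ℝ, 1 ≤ D ∧ ∀ a b, ‖(Fintype.card (Fin M × Fin M) : ℂ) * m.S a b‖ ≤ D := by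
    refine ⟨1 + ∑ a, ∑ b, ‖(Fintype.card (Fin M × Fin M) : ℂ) * m.S a b‖, ?_, fun a b => ?_⟩
    · have : 0 ≤ ∑ a, ∑ b, ‖(Fintype.card (Fin M × Fin M) : ℂ) * m.S a b‖ := by positivity
      linarith
    · have h1 : ‖(Fintype.card (Fin M × Fin M) : ℂ) * m.S a b‖ ≤
          ∑ b, ‖(Fintype.card (Fin M × Fin M) : ℂ) * m.S a b‖ :=
        Finset.single_le_sum (f := fun b => ‖(Fintype.card (Fin M × Fin M) : ℂ) * m.S a b‖)
          (fun _ _ => norm_nonneg _) (Finset.mem_univ b)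
      have h2 : ∑ b, ‖(Fintype.card (Fin M × Fin M) : ℂ) * m.S a b‖ ≤
          ∑ a, ∑ b, ‖(Fintype.card (Fin M × Fin M) : ℂ) * m.S a b‖ :=
        Finset.single_le_sum (f := fun a => ∑ b, ‖(Fintype.card (Fin M × Fin M) : ℂ) * m.S a b‖)
          (fun _ _ => by positivity) (Finset.mem_univ a)
      linarith
  obtain ⟨E, hE1, hE⟩ : ∃ E : ℝ, 1 ≤ E ∧ ∀ u, ‖(m.slotNorm μ L u)⁻¹‖ ≤ E := by
    refine ⟨1 + ∑ u, ‖(m.slotNorm μ L u)⁻¹‖, ?_, fun u => ?_⟩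
    · have : 0 ≤ ∑ u, ‖(m.slotNorm μ L u)⁻¹‖ := by positivity
      linarith
    · have := Finset.single_le_sum (f := fun u => ‖(m.slotNorm μ L u)⁻¹‖)
        (fun _ _ => norm_nonneg _) (Finset.mem_univ u)
      linarith
  have hDB : 1 ≤ D * B := one_le_mul_of_one_le_of_one_le hD1 hB1
  set n := Fintype.card U
  -- There are at most `coll` colliding colours and `2 * n * coll` touched slots. `B` bounds a
  -- trace, `D * B` a slot factor, and `E` the inverse of each norm which has to be restored in
  -- `netNorm`.
  refine ⟨B * (D * B) ^ (2 * n) * E ^ (2 * n), ?_, ?_⟩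
  · exact one_le_mul_of_one_le_of_one_le (one_le_mul_of_one_le_of_one_le hB1 (one_le_pow₀ hDB))
      (one_le_pow₀ hE1)
  intro N sz hτ I
  have c1 := card_collSites_le I
  have c2 : (Finset.univ.filter fun x => x ∉ freeSlots L hτ I).card ≤
      2 * n * coll Finset.univ I := by
    calc _ ≤ 2 * (collSlots I).card := card_not_freeSlots_le L hτ I
      _ ≤ 2 * (n * coll Finset.univ I) :=
        Nat.mul_le_mul_left _ ((card_collSlots_le I).trans (Nat.mul_le_mul_left n c1))
      _ = _ := by ring
  have hsite : ∀ j e, ‖m.siteTr μ L I j e‖ ≤ B := by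
    intro j e
    classical
    -- Labels whose set misses `j` receive the arbitrary flavour pair `0`, which does not enter the
    -- trace.
    rw [m.siteTr_eq μ L I j e (η := fun u => if hu : j ∈ (I u).1 then
      e (exists_slot I hu).choose else 0)]
    · exact hB _ _
    · intro x hx
      have hu : j ∈ (I x.1).1 := hx ▸ Config.col_mem I x
      have := (exists_slot I hu).choose_spec
      rw [dif_pos hu, Config.slot_eq this.1 (this.2.trans hx.symm)]
  have hslot : ∀ x e, ‖m.slotFactor μ L hτ I x e‖ ≤ D * B := by
    intro x e
    rw [FlavourModel.slotFactor, norm_mul]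
    refine mul_le_mul (hD _ _) ?_ (norm_nonneg _) (by linarith)
    split_ifs
    · simpa using hB1
    · exact hB _ _
  rw [m.net_eq_free_mul μ L hτ h, m.netNorm_eq μ L hτ I, norm_mul, norm_mul]
  set F := ∏ x ∈ freeSlots L hτ I with x ∈ L.reps sz, m.slotNorm μ L x.1
  set T := ∏ x with x ∉ freeSlots L hτ I ∧ x ∈ L.reps sz, m.slotNorm μ L x.1 with hT
  have b1 : ‖𝔼 e : Slot sz → Fin M × Fin M, (∏ j ∈ collSites I, m.siteTr μ L I j e) *
        ∏ x with x ∉ freeSlots L hτ I, m.slotFactor μ L hτ I x e‖ ≤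
      B ^ coll Finset.univ I * (D * B) ^ (2 * n * coll Finset.univ I) := by
    refine (norm_expect_le _).trans (expect_le_of_forall_le fun e => ?_)
    rw [norm_mul]
    exact mul_le_mul (norm_prod_le_pow _ _ hB1 (fun j _ => hsite j e) c1)
      (norm_prod_le_pow _ _ hDB (fun x _ => hslot x e) c2) (norm_nonneg _) (by positivity)
  have b2 : 1 ≤ ‖T‖ * E ^ (2 * n * coll Finset.univ I) := by
    have : ‖T⁻¹‖ ≤ E ^ (2 * n * coll Finset.univ I) := by
      rw [hT, ← Finset.prod_inv_distrib]
      refine norm_prod_le_pow _ _ hE1 (fun x _ => hE x.1) (le_trans (Finset.card_le_card ?_) c2)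
      intro x hx
      simp only [Finset.mem_filter, Finset.mem_univ, true_and] at hx ⊢
      exact hx.1
    have hT0 : 0 < ‖T‖ := norm_pos_iff.2 (Finset.prod_ne_zero_iff.2 fun x _ => hn _)
    rw [norm_inv] at this
    calc 1 = ‖T‖ * ‖T‖⁻¹ := (mul_inv_cancel₀ hT0.ne').symm
      _ ≤ _ := by gcongr
  calc _ ≤ (B ^ coll Finset.univ I * (D * B) ^ (2 * n * coll Finset.univ I)) * ‖F‖ * 1 := by
        rw [mul_one]; gcongr
    _ ≤ (B ^ coll Finset.univ I * (D * B) ^ (2 * n * coll Finset.univ I)) * ‖F‖ *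
        (‖T‖ * E ^ (2 * n * coll Finset.univ I)) := by gcongr
    _ = _ := by
      rw [mul_pow (B * (D * B) ^ (2 * n)), mul_pow B, ← pow_mul, ← pow_mul]
      ring

end NetworkBounds

/-! ### Collision values for the relative positions of two oriented chords. -/

section Patterns

variable {ι : Type*} [Fintype ι] [DecidableEq ι] {M r : ℕ} (m : FlavourModel ι M r)
  (μ : Fin r → ℝ) {U : Type*} [Fintype U] [LinearOrder U] (L : Layout U)

lemma Layout.filter_eq {A : Finset U} {l : List (U × Bool)}
    (hl : l.Pairwise fun x y => L.key x < L.key y) (hm : ∀ y, y ∈ l ↔ y.1 ∈ A) :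
    (L.W.filter fun y => y.1 ∈ A) = l := by
  have h2 : (L.W.filter fun y => y.1 ∈ A).Pairwise fun x y => L.key x < L.key y :=
    L.sorted.filter _
  have n1 : l.Nodup := hl.imp fun h e => by simp [e] at h
  have n2 : (L.W.filter fun y => y.1 ∈ A).Nodup := h2.imp fun h e => by simp [e] at h
  refine List.Perm.eq_of_pairwise (fun a b _ _ h h' => absurd h h'.not_gt) h2 hl
    ((List.perm_ext_iff_of_nodup n2 n1).2 fun y => ?_)
  simp [hm, L.complete]

/-- `χ†` or `χ`. -/
def FlavourModel.sop (d : Bool) (f : Fin M) : Matrix ι ι ℂ := if d then (m.χ f)ᴴ else m.χ f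

/-- The weight of the flavours of an oriented chord, the flavour of its first end point first. -/
def FlavourModel.envDir (u : U) (d : Bool) (f g : Fin M) : ℂ :=
  m.env μ L u (if d then (f, g) else (g, f))

lemma sum_flavours (d : Bool) (F : Fin M × Fin M → ℂ) :
    ∑ a, F a = ∑ f, ∑ g, F (if d then (f, g) else (g, f)) := by
  cases d
  · rw [Fintype.sum_prod_type, Finset.sum_comm]
    simp
  · rw [Fintype.sum_prod_type]
    simp

lemma FlavourModel.leg_fst (d : Bool) (f g : Fin M) :
    m.leg (if d then (f, g) else (g, f)) d = m.sop d f := by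
  cases d <;> simp [FlavourModel.leg, FlavourModel.sop]

lemma FlavourModel.leg_snd (d : Bool) (f g : Fin M) :
    m.leg (if d then (f, g) else (g, f)) (!d) = m.sop (!d) g := by
  cases d <;> simp [FlavourModel.leg, FlavourModel.sop]

lemma FlavourModel.slotNorm_eq {u : U} {d : Bool} (h : L.key (u, d) < L.key (u, !d)) :
    m.slotNorm μ L u = ∑ f, ∑ g, m.tr μ (m.sop d f * m.sop (!d) g) * m.envDir μ L u d f g := by
  rw [FlavourModel.slotNorm, sum_flavours d]
  refine Finset.sum_congr rfl fun f _ => Finset.sum_congr rfl fun g _ => ?_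
  rw [FlavourModel.wordTr, L.filter_eq (l := [(u, d), (u, !d)]) (by simpa using h)]
  · simp only [List.map_cons, List.map_nil, List.prod_cons, List.prod_nil, mul_one, m.leg_fst,
      m.leg_snd, FlavourModel.envDir]
  · rintro ⟨v, b⟩
    cases d <;> cases b <;> simp

variable {u v : U} {d d' : Bool}

/-- The Booleans `d` and `d'` are meant to be the types of the end points which come first, so that
`f` and `f'` are the flavours at the first end points and `g` and `g'` those at the last ones. The
identity itself is a mere renaming and holds for all `d` and `d'`. -/
lemma FlavourModel.collValue_eq {l : List (U × Bool)}
    (hl : l.Pairwise fun x y => L.key x < L.key y)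
    (hm : ∀ y, y ∈ l ↔ y.1 ∈ ({u, v} : Finset U)) (d d' : Bool) :
    m.collValue μ L u v = ∑ f, ∑ g, ∑ f', ∑ g', m.tr μ
      (l.map fun y => m.leg (if y.1 = u then (if d then (f, g) else (g, f))
        else (if d' then (f', g') else (g', f'))) y.2).prod * m.envDir μ L u d f g *
          m.envDir μ L v d' f' g' := by
  rw [FlavourModel.collValue, sum_flavours d]
  refine Finset.sum_congr rfl fun f _ => Finset.sum_congr rfl fun g _ => ?_
  rw [sum_flavours d']
  refine Finset.sum_congr rfl fun f' _ => Finset.sum_congr rfl fun g' _ => ?_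
  rw [FlavourModel.wordTr, L.filter_eq hl hm]
  rfl

lemma FlavourModel.collValue_of_before (huv : u ≠ v) (h1 : L.key (u, d) < L.key (u, !d))
    (h2 : L.key (u, !d) < L.key (v, d')) (h3 : L.key (v, d') < L.key (v, !d')) :
    m.collValue μ L u v = ∑ f, ∑ g, ∑ f', ∑ g', m.tr μ
      (m.sop d f * m.sop (!d) g * m.sop d' f' * m.sop (!d') g') * m.envDir μ L u d f g *
        m.envDir μ L v d' f' g' := by
  rw [m.collValue_eq μ L (l := [(u, d), (u, !d), (v, d'), (v, !d')]) (d := d) (d' := d')]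
  · simp only [List.map_cons, List.map_nil, List.prod_cons, List.prod_nil, mul_one, if_true,
      if_neg huv.symm, m.leg_fst, m.leg_snd, mul_assoc]
  · simp only [List.pairwise_cons, List.mem_cons, List.not_mem_nil, or_false, forall_eq_or_imp,
      forall_eq, List.Pairwise.nil, and_true, false_imp_iff, implies_true]
    omega
  · rintro ⟨w, b⟩
    cases d <;> cases d' <;> cases b <;> simp

lemma FlavourModel.collValue_of_nested (huv : u ≠ v) (h1 : L.key (u, d) < L.key (v, d'))
    (h2 : L.key (v, d') < L.key (v, !d')) (h3 : L.key (v, !d') < L.key (u, !d)) :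
    m.collValue μ L u v = ∑ f, ∑ g, ∑ f', ∑ g', m.tr μ
      (m.sop d f * m.sop d' f' * m.sop (!d') g' * m.sop (!d) g) * m.envDir μ L u d f g *
        m.envDir μ L v d' f' g' := by
  rw [m.collValue_eq μ L (l := [(u, d), (v, d'), (v, !d'), (u, !d)]) (d := d) (d' := d')]
  · simp only [List.map_cons, List.map_nil, List.prod_cons, List.prod_nil, mul_one, if_true,
      if_neg huv.symm, m.leg_fst, m.leg_snd, mul_assoc]
  · simp only [List.pairwise_cons, List.mem_cons, List.not_mem_nil, or_false, forall_eq_or_imp,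
      forall_eq, List.Pairwise.nil, and_true, false_imp_iff, implies_true]
    omega
  · rintro ⟨w, b⟩
    cases d <;> cases d' <;> cases b <;> simp [or_comm]

lemma FlavourModel.collValue_of_crossing (huv : u ≠ v) (h1 : L.key (u, d) < L.key (v, d'))
    (h2 : L.key (v, d') < L.key (u, !d)) (h3 : L.key (u, !d) < L.key (v, !d')) :
    m.collValue μ L u v = ∑ f, ∑ g, ∑ f', ∑ g', m.tr μ
      (m.sop d f * m.sop d' f' * m.sop (!d) g * m.sop (!d') g') * m.envDir μ L u d f g *
        m.envDir μ L v d' f' g' := by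
  rw [m.collValue_eq μ L (l := [(u, d), (v, d'), (u, !d), (v, !d')]) (d := d) (d' := d')]
  · simp only [List.map_cons, List.map_nil, List.prod_cons, List.prod_nil, mul_one, if_true,
      if_neg huv.symm, m.leg_fst, m.leg_snd, mul_assoc]
  · simp only [List.pairwise_cons, List.mem_cons, List.not_mem_nil, or_false, forall_eq_or_imp,
      forall_eq, List.Pairwise.nil, and_true, false_imp_iff, implies_true]
    omega
  · rintro ⟨w, b⟩
    cases d <;> cases d' <;> cases b <;> simp <;> tauto

lemma crossSign_eq (key : U × Bool → ℕ) (u v : U) (d d' : Bool) : crossSign key u v =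
    (-1) ^ ((if key (u, d) < key (v, d') then 1 else 0) +
      (if key (u, d) < key (v, !d') then 1 else 0) +
      (if key (u, !d) < key (v, d') then 1 else 0) +
      (if key (u, !d) < key (v, !d') then 1 else 0)) := by
  rw [crossSign, orderCount]
  congr 1
  cases d <;> cases d' <;> simp only [Fintype.sum_bool, Bool.not_true, Bool.not_false] <;> ring

lemma crossSign_of_before {key : U × Bool → ℕ} (h1 : key (u, d) < key (u, !d))
    (h2 : key (u, !d) < key (v, d')) (h3 : key (v, d') < key (v, !d')) :
    crossSign key u v = 1 := by
  rw [crossSign_eq key u v d d', if_pos (by omega), if_pos (by omega), if_pos (by omega),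
    if_pos (by omega)]
  norm_num

lemma crossSign_of_nested {key : U × Bool → ℕ} (h1 : key (u, d) < key (v, d'))
    (h2 : key (v, d') < key (v, !d')) (h3 : key (v, !d') < key (u, !d)) :
    crossSign key u v = 1 := by
  rw [crossSign_eq key u v d d', if_pos (by omega), if_pos (by omega), if_neg (by omega),
    if_neg (by omega)]
  norm_num

lemma crossSign_of_crossing {key : U × Bool → ℕ} (h1 : key (u, d) < key (v, d'))
    (h2 : key (v, d') < key (u, !d)) (h3 : key (u, !d) < key (v, !d')) :
    crossSign key u v = -1 := by
  rw [crossSign_eq key u v d d', if_pos (by omega), if_pos (by omega), if_neg (by omega),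
    if_pos (by omega)]
  norm_num

lemma FlavourModel.collValue_comm (huv : u ≠ v) :
    m.collValue μ L u v = m.collValue μ L v u := by
  rw [FlavourModel.collValue, FlavourModel.collValue, Finset.sum_comm]
  refine Finset.sum_congr rfl fun b _ => Finset.sum_congr rfl fun a _ => ?_
  have h : m.wordTr μ L {u, v} (fun w => if w = u then a else b) =
      m.wordTr μ L {v, u} (fun w => if w = v then b else a) := by
    rw [Finset.pair_comm, FlavourModel.wordTr, FlavourModel.wordTr]
    refine congrArg (fun l => m.tr μ (List.prod l)) (List.map_congr_left fun y hy => ?_)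
    have := (List.mem_filter.1 hy).2
    simp only [Finset.mem_insert, Finset.mem_singleton, decide_eq_true_eq] at this
    rcases this with h | h <;> simp [h, huv, huv.symm]
  rw [h, mul_right_comm]

lemma FlavourModel.collWeight_comm (huv : u ≠ v) :
    m.collWeight μ L u v = m.collWeight μ L v u := by
  rw [FlavourModel.collWeight, FlavourModel.collWeight, crossSign_comm L.key_injective u v,
    mul_comm (m.slotNorm μ L u), m.collValue_comm μ L huv]

end Patterns

/-! ### The oriented chords of a chord diagram. -/

section DiagramLayout

variable {k : ℕ} (k₀ k₁ : ℕ) (π : ChordDiagram k)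

/-- The position of an H node, counting the end points of the M chord. -/
def nodePos (s : ℕ) : ℕ := s + (if k₀ ≤ s then 1 else 0) + if k₀ + k₁ ≤ s then 1 else 0

lemma nodePos_lt_iff {s t : ℕ} : nodePos k₀ k₁ s < nodePos k₀ k₁ t ↔ s < t := by
  unfold nodePos
  split_ifs <;> omega

lemma nodePos_inj {s t : ℕ} : nodePos k₀ k₁ s = nodePos k₀ k₁ t ↔ s = t := by
  unfold nodePos
  split_ifs <;> omega

/-- The position of the end points along the circle. -/
def diagramKey (y : Fin (k + 1) × Bool) : ℕ :=
  Fin.cases (motive := fun _ => ℕ) (if y.2 then 2 * k₀ else 2 * (k₀ + k₁ + 1))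
    (fun s => if y.2 then 2 * nodePos k₀ k₁ s else 2 * nodePos k₀ k₁ (π.1 s) + 1) y.1

@[simp] lemma diagramKey_zero_true : diagramKey k₀ k₁ π (0, true) = 2 * k₀ := rfl
@[simp] lemma diagramKey_zero_false : diagramKey k₀ k₁ π (0, false) = 2 * (k₀ + k₁ + 1) := rfl
@[simp] lemma diagramKey_succ_true (s : Fin k) :
    diagramKey k₀ k₁ π (s.succ, true) = 2 * nodePos k₀ k₁ s := rfl
@[simp] lemma diagramKey_succ_false (s : Fin k) :
    diagramKey k₀ k₁ π (s.succ, false) = 2 * nodePos k₀ k₁ (π.1 s) + 1 := rfl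

/-- `nodePos` skips the positions `k₀` and `k₀ + k₁ + 1`, which belong to the M chord. Positions are
doubled because an H node carries two end points, `X†` with an even key and `X` with the next odd
one; the `X` of the oriented chord of `s` sits at the node `π s`. -/
lemma diagramKey_injective : Function.Injective (diagramKey k₀ k₁ π) := by
  rintro ⟨u, b⟩ ⟨v, b'⟩ h
  refine Fin.cases (fun h => ?_) (fun s h => ?_) u h <;>
  refine Fin.cases (fun h => ?_) (fun t h => ?_) v h <;>
  cases b <;> cases b' <;>
  simp only [diagramKey_zero_true, diagramKey_zero_false, diagramKey_succ_true,
    diagramKey_succ_false] at h <;>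
  first
  | rfl
  | omega
  | (have h' : nodePos k₀ k₁ s = nodePos k₀ k₁ t := by omega
     rw [nodePos_inj, Fin.val_inj] at h'
     rw [h'])
  | (have h' : nodePos k₀ k₁ (π.1 s) = nodePos k₀ k₁ (π.1 t) := by omega
     rw [nodePos_inj, Fin.val_inj, π.1.injective.eq_iff] at h'
     rw [h'])
  | (exfalso; unfold nodePos at h; split_ifs at h <;> omega)

/-- The two end points at an H node. -/
def nodeSymbols (s : Fin k) : List (Fin (k + 1) × Bool) := [(s.succ, true), ((π.1 s).succ, false)]

/-- The end points of the oriented chords along the circle. -/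
def diagramWord : List (Fin (k + 1) × Bool) :=
  ((List.finRange k).take k₀).flatMap (nodeSymbols π) ++ [(0, true)] ++
    (((List.finRange k).drop k₀).take k₁).flatMap (nodeSymbols π) ++ [(0, false)] ++
    ((List.finRange k).drop (k₀ + k₁)).flatMap (nodeSymbols π)

lemma key_nodeSymbols {s : Fin k} {y : Fin (k + 1) × Bool} (h : y ∈ nodeSymbols π s) :
    diagramKey k₀ k₁ π y / 2 = nodePos k₀ k₁ s := by
  simp only [nodeSymbols, List.mem_cons, List.not_mem_nil, or_false] at h
  rcases h with rfl | rfl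
  · simp
  · rw [diagramKey_succ_false, (π.2 s).1]
    omega

lemma pairwise_nodes {l : List (Fin k)} (h : l.Pairwise (· < ·)) :
    (l.flatMap (nodeSymbols π)).Pairwise fun x y => diagramKey k₀ k₁ π x < diagramKey k₀ k₁ π y := by
  rw [List.pairwise_flatMap]
  constructor
  · intro s _
    simp [nodeSymbols, (π.2 s).1]
  · refine h.imp fun {s t} hst x hx y hy => ?_
    have h1 := key_nodeSymbols k₀ k₁ π hx
    have h2 := key_nodeSymbols k₀ k₁ π hy
    have h3 : nodePos k₀ k₁ s < nodePos k₀ k₁ t := (nodePos_lt_iff k₀ k₁).2 hst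
    omega

lemma mem_take_finRange {s : Fin k} {n : ℕ} (h : s ∈ (List.finRange k).take n) : s.1 < n := by
  obtain ⟨i, hi, rfl⟩ := List.mem_take_iff_getElem.1 h
  simp at hi ⊢
  omega

lemma mem_drop_finRange {s : Fin k} {n : ℕ} (h : s ∈ (List.finRange k).drop n) : n ≤ s.1 := by
  obtain ⟨i, hi, rfl⟩ := List.mem_drop_iff_getElem.1 h
  simp

lemma mem_take_drop_finRange {s : Fin k} {n n' : ℕ}
    (h : s ∈ ((List.finRange k).drop n).take n') : n ≤ s.1 ∧ s.1 < n + n' := by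
  refine ⟨mem_drop_finRange (List.mem_of_mem_take h), ?_⟩
  rw [List.take_drop] at h
  exact mem_take_finRange (List.mem_of_mem_drop h)

lemma diagramWord_sorted :
    (diagramWord k₀ k₁ π).Pairwise fun x y => diagramKey k₀ k₁ π x < diagramKey k₀ k₁ π y := by
  have hs := (List.pairwise_lt_finRange k)
  have b1 : ∀ y ∈ ((List.finRange k).take k₀).flatMap (nodeSymbols π),
      diagramKey k₀ k₁ π y / 2 < k₀ := by
    intro y hy
    obtain ⟨s, hs, hy⟩ := List.mem_flatMap.1 hy
    have := mem_take_finRange hs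
    rw [key_nodeSymbols k₀ k₁ π hy, nodePos]
    split_ifs <;> omega
  have b2 : ∀ y ∈ (((List.finRange k).drop k₀).take k₁).flatMap (nodeSymbols π),
      k₀ < diagramKey k₀ k₁ π y / 2 ∧ diagramKey k₀ k₁ π y / 2 < k₀ + k₁ + 1 := by
    intro y hy
    obtain ⟨s, hs, hy⟩ := List.mem_flatMap.1 hy
    have := mem_take_drop_finRange hs
    rw [key_nodeSymbols k₀ k₁ π hy, nodePos]
    split_ifs <;> omega
  have b3 : ∀ y ∈ ((List.finRange k).drop (k₀ + k₁)).flatMap (nodeSymbols π),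
      k₀ + k₁ + 1 < diagramKey k₀ k₁ π y / 2 := by
    intro y hy
    obtain ⟨s, hs, hy⟩ := List.mem_flatMap.1 hy
    have := mem_drop_finRange hs
    rw [key_nodeSymbols k₀ k₁ π hy, nodePos]
    split_ifs <;> omega
  rw [diagramWord]
  refine List.pairwise_append.2 ⟨List.pairwise_append.2 ⟨List.pairwise_append.2
    ⟨List.pairwise_append.2 ⟨pairwise_nodes k₀ k₁ π (hs.sublist (List.take_sublist _ _)),
    List.pairwise_singleton _ _, ?_⟩, pairwise_nodes k₀ k₁ π (hs.sublist
      ((List.take_sublist _ _).trans (List.drop_sublist _ _))), ?_⟩,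
    List.pairwise_singleton _ _, ?_⟩,
    pairwise_nodes k₀ k₁ π (hs.sublist (List.drop_sublist _ _)), ?_⟩
  · intro x hx y hy
    rw [List.mem_singleton.1 hy, diagramKey_zero_true]
    have := b1 x hx
    omega
  · intro x hx y hy
    have h2 := b2 y hy
    rw [List.mem_append, List.mem_singleton] at hx
    rcases hx with hx | rfl
    · have := b1 x hx
      omega
    · rw [diagramKey_zero_true]
      omega
  · intro x hx y hy
    rw [List.mem_singleton.1 hy, diagramKey_zero_false]
    rw [List.mem_append, List.mem_append, List.mem_singleton] at hx
    rcases hx with (hx | rfl) | hx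
    · have := b1 x hx
      omega
    · rw [diagramKey_zero_true]
      omega
    · have := b2 x hx
      omega
  · intro x hx y hy
    have h3 := b3 y hy
    rw [List.mem_append, List.mem_append, List.mem_append, List.mem_singleton,
      List.mem_singleton] at hx
    rcases hx with ((hx | rfl) | hx) | rfl
    · have := b1 x hx
      omega
    · rw [diagramKey_zero_true]
      omega
    · have := b2 x hx
      omega
    · rw [diagramKey_zero_false]
      omega

lemma diagramWord_complete (y : Fin (k + 1) × Bool) : y ∈ diagramWord k₀ k₁ π := by
  have hm : ∀ s : Fin k, s ∈ (List.finRange k).take k₀ ∨ s ∈ ((List.finRange k).drop k₀).take k₁ ∨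
      s ∈ (List.finRange k).drop (k₀ + k₁) := by
    intro s
    have h : s ∈ (List.finRange k).take k₀ ++ (((List.finRange k).drop k₀).take k₁ ++
        ((List.finRange k).drop k₀).drop k₁) := by
      rw [List.take_append_drop, List.take_append_drop]
      exact List.mem_finRange s
    rwa [List.mem_append, List.mem_append, List.drop_drop] at h
  have hn : ∀ s, ∀ y ∈ nodeSymbols π s, y ∈ diagramWord k₀ k₁ π := by
    intro s y hy
    simp only [diagramWord, List.mem_append, List.mem_flatMap, List.mem_singleton]
    rcases hm s with h | h | h
    · exact Or.inl (Or.inl (Or.inl (Or.inl ⟨s, h, hy⟩)))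
    · exact Or.inl (Or.inl (Or.inr ⟨s, h, hy⟩))
    · exact Or.inr ⟨s, h, hy⟩
  obtain ⟨u, b⟩ := y
  refine Fin.cases ?_ (fun s => ?_) u
  · cases b <;> simp [diagramWord]
  · cases b
    · exact hn (π.1 s) _ (by simp [nodeSymbols, (π.2 s).1])
    · exact hn s _ (by simp [nodeSymbols])

/-- The layout of the oriented chords of a chord diagram: `0` is the M chord and `s.succ` the
oriented chord which starts at the H node `s`. -/
def diagramLayout : Layout (Fin (k + 1)) where
  τ := Fin.cases 0 fun s => (π.1 s).succ
  τ_τ := Fin.cases rfl fun s => congrArg Fin.succ (π.2 s).1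
  key := diagramKey k₀ k₁ π
  key_injective := diagramKey_injective k₀ k₁ π
  W := diagramWord k₀ k₁ π
  sorted := diagramWord_sorted k₀ k₁ π
  complete := diagramWord_complete k₀ k₁ π

end DiagramLayout

/-! ### Multilinearity of a word in the operators at the H nodes. -/

section Word

variable {ι : Type*} [Fintype ι] [DecidableEq ι] {N k : ℕ}

/-- Attaching each insertion to the node preceding it, or to the front if there is none, displays
the word as one product with a single factor per node. This makes it multilinear; if `k₁ = 0` both
insertions sit at the same place, with `A` before `B`. -/
lemma word_eq_ofFn (k₀ k₁ : ℕ) (hk : k₀ + k₁ ≤ k) (h : Fin k → Op ι N) (A B : Op ι N) :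
    word k₀ k₁ h A B = ((if 0 = k₀ then A else 1) * if 0 = k₀ + k₁ then B else 1) *
      (List.ofFn fun s : Fin k => h s * ((if (s : ℕ) + 1 = k₀ then A else 1) *
        if (s : ℕ) + 1 = k₀ + k₁ then B else 1)).prod := by
  induction k generalizing k₀ k₁ A with
  | zero =>
    obtain ⟨rfl, rfl⟩ : k₀ = 0 ∧ k₁ = 0 := by omega
    simp [word]
  | succ k ih =>
    rw [List.ofFn_succ, List.prod_cons]
    rcases k₀ with _ | k₀
    · rcases k₁ with _ | k₁
      · simp [word]
      · have := ih 0 k₁ (by omega) (fun s => h s.succ) 1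
        simp only [word, List.take_zero, List.prod_nil, List.drop_zero, one_mul, mul_one, zero_add,
          ite_self] at this
        simp only [word, List.take_zero, List.prod_nil, List.drop_zero, one_mul, zero_add,
          List.ofFn_succ, List.take_succ_cons, List.prod_cons, List.drop_succ_cons, if_true,
          Fin.val_zero, Fin.val_succ, Nat.add_right_cancel_iff]
        rw [if_neg (by omega), if_neg (by omega)]
        simp only [mul_one, one_mul, mul_assoc] at this ⊢
        rw [this]
        simp [eq_comm]
    · have := ih k₀ k₁ (by omega) (fun s => h s.succ) A
      simp only [word] at this
      simp only [word, List.ofFn_succ, List.take_succ_cons, List.prod_cons, List.drop_succ_cons,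
          Fin.val_zero, Fin.val_succ, Nat.add_right_cancel_iff, Nat.succ_add]
      rw [if_neg (by omega), if_neg (by omega)]
      simp only [one_mul, mul_assoc] at this ⊢
      rw [this]
      simp [eq_comm, Nat.succ_eq_add_one]

/-- `word` as a multilinear map of the operators at the H nodes. -/
def wordMultilinear (k₀ k₁ : ℕ) (A B : Op ι N) :
    MultilinearMap ℂ (fun _ : Fin k => Op ι N) (Op ι N) :=
  (LinearMap.mulLeft ℂ ((if 0 = k₀ then A else 1) * if 0 = k₀ + k₁ then B else 1)).compMultilinearMap
    ((MultilinearMap.mkPiAlgebraFin ℂ k (Op ι N)).compLinearMap fun s =>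
      LinearMap.mulRight ℂ ((if (s : ℕ) + 1 = k₀ then A else 1) *
        if (s : ℕ) + 1 = k₀ + k₁ then B else 1))

lemma word_eq_multilinear {k₀ k₁ : ℕ} (hk : k₀ + k₁ ≤ k) (h : Fin k → Op ι N) (A B : Op ι N) :
    word k₀ k₁ h A B = wordMultilinear k₀ k₁ A B h := by
  rw [word_eq_ofFn k₀ k₁ hk]
  simp [wordMultilinear]

lemma word_sum_smul {C : Type*} [Fintype C] {k₀ k₁ : ℕ} (hk : k₀ + k₁ ≤ k) (z : Fin k → C → ℂ)
    (f : Fin k → C → Op ι N) (A B : Op ι N) :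
    word k₀ k₁ (fun s => ∑ c, z s c • f s c) A B =
      ∑ c : Fin k → C, (∏ s, z s (c s)) • word k₀ k₁ (fun s => f s (c s)) A B := by
  classical
  rw [word_eq_multilinear hk, MultilinearMap.map_sum]
  refine Finset.sum_congr rfl fun c _ => ?_
  rw [MultilinearMap.map_smul_univ, ← word_eq_multilinear hk]

end Word

/-! ### Traces of chord diagrams as flavour networks. -/

section DiagramNet

variable {ι : Type*} [Fintype ι] [DecidableEq ι] {M r : ℕ} (m : FlavourModel ι M r)
  (μ : Fin r → ℝ) {N k : ℕ} (k₀ k₁ : ℕ) (π : ChordDiagram k) (p pt : ℕ)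

/-- The sizes of the colour sets of the oriented chords. -/
def chordSize {k : ℕ} (p pt : ℕ) : Fin (k + 1) → ℕ := Fin.cases pt fun _ => p

lemma chordSize_τ (u : Fin (k + 1)) :
    chordSize p pt u = chordSize p pt ((diagramLayout k₀ k₁ π).τ u) :=
  Fin.cases rfl (fun _ => rfl) u

/-- The flavours at the slots in terms of the flavours at the nodes. -/
def flavourEquiv : (Slot (chordSize (k := k) p pt) → Fin M × Fin M) ≃
    ((Fin pt → Fin M) × (Fin pt → Fin M)) × (Fin k → (Fin p → Fin M) × (Fin p → Fin M)) where
  toFun e := ((fun l => (e ⟨0, l⟩).1, fun l => (e ⟨0, l⟩).2),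
    fun s => (fun l => (e ⟨s.succ, l⟩).1, fun l => (e ⟨(π.1 s).succ, l⟩).2))
  invFun c x := Fin.cases (n := k) (motive := fun u => Fin (chordSize (k := k) p pt u) → Fin M × Fin M)
    (fun l : Fin pt => (c.1.1 l, c.1.2 l)) (fun s (l : Fin p) => ((c.2 s).1 l, (c.2 (π.1 s)).2 l))
    x.1 x.2
  left_inv e := by
    -- The equality of `π (π s)` and `s` is not definitional, so the flavours are transported along
    -- it.
    have h : ∀ {s t : Fin k} (_ : s = t) (l : Fin p),
        e ⟨s.succ, (l : Fin (chordSize p pt s.succ))⟩ = e ⟨t.succ, l⟩ := by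
      rintro s _ rfl l; rfl
    ext1 ⟨u, l⟩
    revert l
    refine Fin.cases (fun l => rfl) (fun s l => ?_) u
    have h' := congrArg Prod.snd (h (π.2 s).1 l)
    exact Prod.ext rfl h'
  right_inv c := by
    refine Prod.ext rfl (funext fun s => Prod.ext rfl (funext fun l => ?_))
    change (c.2 (π.1 (π.1 s))).2 l = _
    rw [(π.2 s).1]

lemma flavourEquiv_apply (e : Slot (chordSize (k := k) p pt) → Fin M × Fin M) :
    flavourEquiv (M := M) π p pt e = ((fun l => (e ⟨0, l⟩).1, fun l => (e ⟨0, l⟩).2),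
    fun s => (fun l => (e ⟨s.succ, l⟩).1, fun l => (e ⟨(π.1 s).succ, l⟩).2)) := rfl

lemma FlavourModel.vertex_eq {N p : ℕ} (I K : ColourSet N p) : m.vertex I K =
    ∑ c : (Fin p → Fin M) × (Fin p → Fin M), m.tensorS c.1 c.2 • ((m.X I c.1)ᴴ * m.X K c.2) := by
  rw [FlavourModel.vertex, Fintype.sum_prod_type]

lemma FlavourModel.TrLam_smul (z : ℂ) (A : Op ι N) : m.TrLam μ (z • A) = z * m.TrLam μ A := by
  simp only [FlavourModel.TrLam, ntr, smul_mul_assoc, Matrix.trace_smul, smul_eq_mul, mul_div_assoc]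

lemma FlavourModel.TrLam_sum {C : Type*} (s : Finset C) (A : C → Op ι N) :
    m.TrLam μ (∑ c ∈ s, A c) = ∑ c ∈ s, m.TrLam μ (A c) := by
  simp only [FlavourModel.TrLam, ntr, Finset.sum_mul, Matrix.trace_sum, Finset.sum_div]

lemma word_eq_diagramWord {sz : Fin (k + 1) → ℕ} (I : Config N sz)
    (e : Slot sz → Fin M × Fin M) :
    ((diagramWord k₀ k₁ π).map (m.symbolOp I e)).prod =
      word k₀ k₁ (fun s => m.symbolOp I e (s.succ, true) * m.symbolOp I e ((π.1 s).succ, false))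
        (m.symbolOp I e (0, true)) (m.symbolOp I e (0, false)) := by
  have h : ∀ l : List (Fin k), ((l.flatMap (nodeSymbols π)).map (m.symbolOp I e)).prod =
      (l.map fun s => m.symbolOp I e (s.succ, true) * m.symbolOp I e ((π.1 s).succ, false)).prod := by
    intro l
    induction l with
    | nil => rfl
    | cons s l ih =>
      simp only [List.flatMap_cons, List.map_append, List.prod_append, ih, nodeSymbols,
        List.map_cons, List.map_nil, List.prod_cons, List.prod_nil, mul_one]
  simp only [diagramWord, List.map_append, List.prod_append, h, word, List.ofFn_eq_map,
    List.map_take, List.map_drop, List.map_cons, List.map_nil, List.prod_cons, List.prod_nil, mul_one]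

/-- The colour sets of all oriented chords. -/
def diagramConfig {p pt : ℕ} (It : ColourSet N pt) (Is : Fin k → ColourSet N p) :
    Config N (chordSize (k := k) p pt) :=
  fun u => Fin.cases (n := k) (motive := fun u => ColourSet N (chordSize (k := k) p pt u)) It Is u

/-- The traces in the contribution of a chord diagram are flavour networks. -/
theorem sum_TrLam_word_eq (hk : k₀ + k₁ ≤ k) {p pt : ℕ} (hp : Even p)
    (It : ColourSet N pt) (Is : Fin k → ColourSet N p) :
    ∑ A : Fin pt → Fin M, ∑ B : Fin pt → Fin M, m.tensorS A B * m.TrLam μ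
        (word k₀ k₁ (fun s : Fin k => m.vertex (Is s) (Is (π.1 s))) (m.X It A)ᴴ (m.X It B)) =
      pairWeight (crossSign (diagramLayout k₀ k₁ π).key) Finset.univ (diagramConfig It Is) *
        m.net μ (diagramLayout k₀ k₁ π) (chordSize_τ k₀ k₁ π p pt) (diagramConfig It Is) := by
  have h1 : ∀ A B : Fin pt → Fin M, m.tensorS A B * m.TrLam μ
        (word k₀ k₁ (fun s : Fin k => m.vertex (Is s) (Is (π.1 s))) (m.X It A)ᴴ (m.X It B)) =
      ∑ c : Fin k → (Fin p → Fin M) × (Fin p → Fin M), m.tensorS A B *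
        ((∏ s, m.tensorS (c s).1 (c s).2) * m.TrLam μ (word k₀ k₁
          (fun s : Fin k => (m.X (Is s) (c s).1)ᴴ * m.X (Is (π.1 s)) (c s).2)
          (m.X It A)ᴴ (m.X It B))) := by
    intro A B
    simp only [m.vertex_eq]
    rw [word_sum_smul hk, m.TrLam_sum, Finset.mul_sum]
    simp only [m.TrLam_smul]
  simp only [h1]
  rw [← Fintype.sum_prod_type', ← Fintype.sum_prod_type', ← (flavourEquiv π p pt).sum_comp,
    FlavourModel.net, Finset.mul_sum]
  refine Finset.sum_congr rfl fun e _ => ?_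
  -- Of two distinct oriented chords at least one belongs to an H chord and has the even size `p`,
  -- so the product of the sizes is even.
  have h2 := m.TrLam_word μ (diagramLayout k₀ k₁ π).key_injective (diagramLayout k₀ k₁ π).sorted
    (diagramLayout k₀ k₁ π).complete (diagramConfig It Is) (fun u v huv => by
      revert huv
      refine Fin.cases ?_ (fun s => ?_) u
      · refine Fin.cases (fun h => absurd rfl h) (fun t _ => ?_) v
        exact hp.mul_left _
      · exact fun _ => hp.mul_right _) e
  have h3 : (∏ x, m.S (e x).1 (e ((diagramLayout k₀ k₁ π).flip (chordSize_τ k₀ k₁ π p pt) x)).2) =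
      m.tensorS (fun l : Fin pt => (e ⟨0, l⟩).1) (fun l : Fin pt => (e ⟨0, l⟩).2) *
        ∏ s : Fin k, m.tensorS (p := p) (fun l : Fin p => (e ⟨s.succ, l⟩).1)
          (fun l : Fin p => (e ⟨(π.1 s).succ, l⟩).2) := by
    rw [Fintype.prod_sigma, Fin.prod_univ_succ]
    rfl
  have h4 : m.TrLam μ ((diagramLayout k₀ k₁ π).W.map (m.symbolOp (diagramConfig It Is) e)).prod =
      m.TrLam μ (word k₀ k₁
          (fun s : Fin k => (m.X (Is s) fun l : Fin p => (e ⟨s.succ, l⟩).1)ᴴ *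
            m.X (Is (π.1 s)) fun l : Fin p => (e ⟨(π.1 s).succ, l⟩).2)
          (m.X It fun l : Fin pt => (e ⟨0, l⟩).1)ᴴ (m.X It fun l : Fin pt => (e ⟨0, l⟩).2)) :=
    congrArg (m.TrLam μ) (word_eq_diagramWord m k₀ k₁ π (diagramConfig It Is) e)
  rw [h4] at h2
  have h5 : pairWeight (crossSign (diagramLayout k₀ k₁ π).key) Finset.univ (diagramConfig It Is) *
      ∏ j, m.siteTr μ (diagramLayout k₀ k₁ π) (diagramConfig It Is) j e = _ := h2.symm
  refine Eq.trans ?_ (mul_left_comm _ _ _).symm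
  refine Eq.trans ?_ (congrArg₂ (· * ·) h3.symm h5.symm)
  exact (mul_assoc _ _ _).symm

end DiagramNet

/-! ### Sums over pairs of oriented chords in terms of H chords. -/

section ChordSums

variable {k : ℕ} (π : ChordDiagram k)

/-- The first nodes of the H chords. -/
def openers : Finset (Fin k) := Finset.univ.filter fun s => s < π.1 s

/-- The label of one of the two oriented chords of the H chord which starts at `a`. -/
def chordLabel (a : Fin k) (c : Bool) : Fin k := if c then a else π.1 a

lemma mem_openers {s : Fin k} : s ∈ openers π ↔ s < π.1 s := by simp [openers]

lemma sum_eq_sum_openers {R : Type*} [AddCommMonoid R] (f : Fin k → R) :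
    ∑ s, f s = ∑ a ∈ openers π, ∑ c, f (chordLabel π a c) := by
  rw [← Finset.sum_filter_add_sum_filter_not Finset.univ (fun s => s < π.1 s)]
  have h : ∑ s with ¬ s < π.1 s, f s = ∑ s with s < π.1 s, f (π.1 s) := by
    refine Finset.sum_bij' (fun s _ => π.1 s) (fun s _ => π.1 s) ?_ ?_ ?_ ?_ ?_
    · intro s hs
      simp only [Finset.mem_filter, Finset.mem_univ, true_and, not_lt] at hs ⊢
      rw [(π.2 s).1]
      exact lt_of_le_of_ne hs (π.2 s).2
    · intro s hs
      simp only [Finset.mem_filter, Finset.mem_univ, true_and, not_lt] at hs ⊢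
      rw [(π.2 s).1]
      exact hs.le
    · exact fun s _ => (π.2 s).1
    · exact fun s _ => (π.2 s).1
    · exact fun s _ => by rw [(π.2 s).1]
  rw [h, ← Finset.sum_add_distrib]
  refine Finset.sum_congr rfl fun a _ => ?_
  simp [chordLabel]

lemma two_mul_card_openers : 2 * (openers π).card = k := by
  have := sum_eq_sum_openers π (fun _ => 1)
  simp at this
  omega

lemma sum_offDiag {α : Type*} [LinearOrder α] (s : Finset α) (f : α → α → ℂ)
    (hf : ∀ x ∈ s, ∀ y ∈ s, x ≠ y → f x y = f y x) :
    ∑ x ∈ s, ∑ y ∈ s, (if x = y then 0 else f x y) = 2 * ∑ x ∈ s, ∑ y ∈ s with y < x, f y x := by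
  have h1 : ∑ x ∈ s, ∑ y ∈ s, (if x = y then 0 else f x y) =
      ∑ x ∈ s, ∑ y ∈ s, (if y < x then f y x else 0) +
        ∑ x ∈ s, ∑ y ∈ s, (if x < y then f x y else 0) := by
    rw [← Finset.sum_add_distrib]
    refine Finset.sum_congr rfl fun x hx => ?_
    rw [← Finset.sum_add_distrib]
    refine Finset.sum_congr rfl fun y hy => ?_
    rcases lt_trichotomy x y with h | h | h
    · simp [h, h.ne, h.not_gt]
    · simp [h]
    · simp [h, h.ne', h.not_gt, hf x hx y hy h.ne']
  rw [h1, Finset.sum_comm (f := fun x y => if x < y then f x y else 0)]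
  simp only [Finset.sum_filter]
  ring

lemma sum_lt_one {α : Type*} [LinearOrder α] (s : Finset α) :
    ∑ x ∈ s, ∑ _y ∈ s with _y < x, (1 : ℂ) = (s.card.choose 2 : ℂ) := by
  have h := sum_offDiag s (fun _ _ => (1 : ℂ)) fun _ _ _ _ _ => rfl
  have h1 : ∀ x ∈ s, ∑ y ∈ s, (if x = y then 0 else (1 : ℂ)) = s.card - 1 := by
    intro x hx
    have : ∀ y, (if x = y then 0 else (1 : ℂ)) = 1 - if x = y then 1 else 0 := fun y => by
      split_ifs <;> ring
    simp only [this, Finset.sum_sub_distrib, Finset.sum_const, nsmul_eq_mul, mul_one]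
    rw [Finset.sum_ite_eq, if_pos hx]
  rw [Finset.sum_congr rfl h1, Finset.sum_const, nsmul_eq_mul] at h
  rw [Nat.cast_choose_two, h]
  ring

lemma chordLabel_ne {a b : Fin k} (ha : a ∈ openers π) (hb : b ∈ openers π) (hab : a ≠ b)
    (c c' : Bool) : chordLabel π a c ≠ chordLabel π b c' := by
  rw [mem_openers] at ha hb
  cases c <;> cases c' <;> simp only [chordLabel, if_true, Bool.false_eq_true, if_false]
  · exact fun h => hab (π.1.injective h)
  · rintro rfl
    rw [(π.2 a).1] at hb
    exact ha.not_gt hb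
  · rintro rfl
    rw [(π.2 b).1] at ha
    exact ha.not_gt hb
  · exact hab

/-- A sum over pairs of oriented chords, in terms of H chords. -/
lemma sum_pairs_eq (Q : Fin k → Fin k → ℂ) (hQ : ∀ s t, s ≠ t → Q s t = Q t s) :
    ∑ s, ∑ t with t < s, Q t s = ∑ a ∈ openers π, Q a (π.1 a) +
      ∑ b ∈ openers π, ∑ a ∈ openers π with a < b,
        ∑ c, ∑ c', Q (chordLabel π a c) (chordLabel π b c') := by
  -- Doubling passes to ordered pairs, for which it does not matter which of the two labels is
  -- larger.
  have h1 := sum_offDiag Finset.univ Q fun s _ t _ => hQ s t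
  rw [sum_eq_sum_openers π] at h1
  have h2 : ∀ a ∈ openers π, ∑ c, ∑ t, (if chordLabel π a c = t then 0 else Q (chordLabel π a c) t) =
      2 * Q a (π.1 a) + ∑ b ∈ openers π, if a = b then 0 else
        ∑ c, ∑ c', Q (chordLabel π a c) (chordLabel π b c') := by
    intro a ha
    have hne : a ≠ π.1 a := fun h => (π.2 a).2 h.symm
    simp_rw [sum_eq_sum_openers π (fun t => if chordLabel π a _ = t then 0 else Q _ t)]
    rw [Finset.sum_comm, ← Finset.add_sum_erase _ _ ha, ← Finset.add_sum_erase (openers π) (fun b =>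
      if a = b then 0 else ∑ c, ∑ c', Q (chordLabel π a c) (chordLabel π b c')) ha, if_pos rfl, zero_add]
    congr 1
    · simp only [Fintype.sum_bool, chordLabel, if_true, Bool.false_eq_true, if_false, if_neg hne,
        if_neg hne.symm, zero_add, add_zero]
      rw [hQ _ _ hne.symm]
      ring
    · refine Finset.sum_congr rfl fun b hb => ?_
      have hb' := Finset.mem_erase.1 hb
      rw [if_neg hb'.1.symm]
      refine Finset.sum_congr rfl fun c _ => Finset.sum_congr rfl fun c' _ => ?_
      rw [if_neg (chordLabel_ne π ha hb'.2 hb'.1.symm c c')]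
  rw [Finset.sum_congr rfl h2, Finset.sum_add_distrib, ← Finset.mul_sum, sum_offDiag] at h1
  · have h3 : ∀ x y z : ℂ, 2 * x + 2 * y = 2 * z → z = x + y := fun x y z h => by linear_combination -h / 2
    exact h3 _ _ _ h1
  · intro a ha b hb hab
    rw [Finset.sum_comm]
    exact Finset.sum_congr rfl fun c' _ => Finset.sum_congr rfl fun c _ =>
      hQ _ _ (chordLabel_ne π ha hb hab c c')

lemma nestedPairs_eq : (nestedPairs π : ℂ) =
    ∑ b ∈ openers π, ∑ a ∈ openers π with a < b, if π.1 b < π.1 a then 1 else 0 := by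
  simp only [Finset.sum_filter]
  rw [nestedPairs, Finset.sum_comm, ← Finset.sum_product', Finset.card_filter, Nat.cast_sum,
    ← Finset.univ_product_univ, openers, ← Finset.filter_product, Finset.sum_filter]
  refine Finset.sum_congr rfl fun q _ => ?_
  by_cases h1 : q.1 < q.2 <;> by_cases h2 : π.1 q.2 < π.1 q.1 <;> by_cases h3 : q.2 < π.1 q.2 <;>
    simp [h1, h2, h3]
  exact h1.trans (h3.trans h2)

lemma crossingPairs_eq : (crossingPairs π : ℂ) =
    ∑ b ∈ openers π, ∑ a ∈ openers π with a < b, if b < π.1 a ∧ π.1 a < π.1 b then 1 else 0 := by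
  simp only [Finset.sum_filter]
  rw [crossingPairs, Finset.sum_comm, ← Finset.sum_product', Finset.card_filter, Nat.cast_sum,
    ← Finset.univ_product_univ, openers, ← Finset.filter_product, Finset.sum_filter]
  refine Finset.sum_congr rfl fun q _ => ?_
  by_cases h1 : q.1 < q.2 <;> by_cases h2 : π.1 q.1 < π.1 q.2 <;> by_cases h3 : q.2 < π.1 q.1 <;>
    simp [h1, h2, h3]
  exact ⟨h1.trans h3, h3.trans h2⟩

end ChordSums

/-! ### Environments and collision-free values for a chord diagram. -/

section DiagramValues

variable {ι : Type*} [Fintype ι] [DecidableEq ι] {M r : ℕ} (m : FlavourModel ι M r)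
  (μ : Fin r → ℝ) {k : ℕ} (k₀ k₁ : ℕ) (π : ChordDiagram k)

/-- `W` or `W̃`. -/
def FlavourModel.WDir (c : Bool) : Fin M → Fin M → ℂ := if c then m.W μ else m.Wt μ

lemma wordTr_single {U : Type*} [Fintype U] [LinearOrder U] (L : Layout U) {u : U} {d : Bool}
    (h : L.key (u, d) < L.key (u, !d)) (e : Fin M × Fin M) :
    m.wordTr μ L {u} (fun _ => e) = m.tr μ (m.leg e d * m.leg e (!d)) := by
  rw [FlavourModel.wordTr, L.filter_eq (l := [(u, d), (u, !d)]) (by simpa using h)]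
  · simp
  · rintro ⟨v, b⟩
    cases d <;> cases b <;> simp

lemma key_chordLabel_fst (a : Fin k) (c : Bool) :
    diagramKey k₀ k₁ π ((chordLabel π a c).succ, c) / 2 = nodePos k₀ k₁ a := by
  cases c
  · simp only [chordLabel, Bool.false_eq_true, if_false, diagramKey_succ_false, (π.2 a).1]
    omega
  · simp [chordLabel]

lemma key_chordLabel_snd (a : Fin k) (c : Bool) :
    diagramKey k₀ k₁ π ((chordLabel π a c).succ, !c) / 2 = nodePos k₀ k₁ (π.1 a) := by
  cases c
  · simp [chordLabel]
  · simp only [chordLabel, Bool.not_true, if_true, diagramKey_succ_false]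
    omega

/-- For an H chord opened at `a`, the oriented chord of `a` has its `X†` at `a`, and that of `π a`
has its `X` at `a`. Hence the end point of type `c` comes first, and `c` records the orientation. -/
lemma key_chordLabel_lt {a : Fin k} (ha : a ∈ openers π) (c : Bool) :
    diagramKey k₀ k₁ π ((chordLabel π a c).succ, c) <
      diagramKey k₀ k₁ π ((chordLabel π a c).succ, !c) := by
  have h1 := key_chordLabel_fst k₀ k₁ π a c
  have h2 := key_chordLabel_snd k₀ k₁ π a c
  have h3 : nodePos k₀ k₁ a < nodePos k₀ k₁ (π.1 a) := (nodePos_lt_iff k₀ k₁).2 ((mem_openers π).1 ha)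
  omega

lemma diagramLayout_τ_chordLabel (a : Fin k) (c : Bool) :
    (diagramLayout k₀ k₁ π).τ (chordLabel π a c).succ = (chordLabel π a (!c)).succ := by
  cases c
  · exact congrArg Fin.succ (π.2 a).1
  · rfl

/-- The environment of an oriented chord is the two-point trace of the opposite one between two
tensors `S`. The order in this trace is fixed by the orientation, which selects `W` or `W̃`. -/
lemma env_chordLabel {a : Fin k} (ha : a ∈ openers π) (c : Bool) (f g : Fin M) :
    m.envDir μ (diagramLayout k₀ k₁ π) (chordLabel π a c).succ c f g = m.WDir μ c f g := by
  have hne : (chordLabel π a (!c)).succ ≠ (chordLabel π a c).succ := by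
    intro h
    have := Fin.succ_injective _ h
    cases c
    · exact (π.2 a).2 this.symm
    · exact (π.2 a).2 this
  rw [FlavourModel.envDir, FlavourModel.env, diagramLayout_τ_chordLabel, if_neg hne]
  have hk : (diagramLayout k₀ k₁ π).key ((chordLabel π a !c).succ, !c) <
      (diagramLayout k₀ k₁ π).key ((chordLabel π a !c).succ, !(!c)) := key_chordLabel_lt k₀ k₁ π ha (!c)
  simp only [wordTr_single m μ _ hk]
  cases c
  · simp only [Bool.not_false, Bool.not_true, FlavourModel.leg, if_true, Bool.false_eq_true, if_false,
      FlavourModel.WDir, FlavourModel.Wt, Fintype.sum_prod_type]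
    exact Finset.sum_congr rfl fun _ _ => Finset.sum_congr rfl fun _ _ => by ring
  · simp only [Bool.not_true, Bool.not_false, FlavourModel.leg, if_true, Bool.false_eq_true, if_false,
      FlavourModel.WDir, FlavourModel.W, Fintype.sum_prod_type]
    rw [Finset.sum_comm]
    exact Finset.sum_congr rfl fun _ _ => Finset.sum_congr rfl fun _ _ => by ring

lemma env_zero (f g : Fin M) : m.envDir μ (diagramLayout k₀ k₁ π) 0 true f g = m.S f g := by
  rw [FlavourModel.envDir, FlavourModel.env, if_pos]
  · rfl
  · rfl

lemma sum4_swap (f : Fin M → Fin M → Fin M → Fin M → ℂ) :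
    ∑ a, ∑ b, ∑ c, ∑ d, f a b c d = ∑ c, ∑ d, ∑ a, ∑ b, f a b c d := by
  have h1 : ∀ f : Fin M → Fin M → Fin M → Fin M → ℂ, ∑ a, ∑ b, ∑ c, ∑ d, f a b c d =
      ∑ x : Fin M × Fin M, ∑ y : Fin M × Fin M, f x.1 x.2 y.1 y.2 := by
    intro f
    simp only [Fintype.sum_prod_type]
  rw [h1, h1 (fun c d a b => f a b c d), Finset.sum_comm]

lemma slotNorm_zero (hxt : m.xt μ ≠ 0) :
    m.slotNorm μ (diagramLayout k₀ k₁ π) 0 = m.xt μ * (Real.sqrt M : ℂ) := by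
  -- Division by zero gives zero, so `xt ≠ 0` forces `M ≠ 0`.
  have hM : (Real.sqrt M : ℂ) ≠ 0 := fun h => hxt (by rw [FlavourModel.xt, h, div_zero])
  have hk : (diagramLayout k₀ k₁ π).key (0, true) < (diagramLayout k₀ k₁ π).key (0, !true) := by
    change 2 * k₀ < 2 * (k₀ + k₁ + 1)
    omega
  rw [m.slotNorm_eq μ _ hk, FlavourModel.xt, div_mul_cancel₀ _ hM]
  simp only [env_zero, FlavourModel.sop, Bool.not_true, if_true, Bool.false_eq_true, if_false]
  exact Finset.sum_congr rfl fun _ _ => Finset.sum_congr rfl fun _ _ => mul_comm _ _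

/-- Both orientations lead to the same contraction of two tensors `S` with the two traces, so the
normalization depends neither on the diagram nor on the orientation. -/
lemma slotNorm_chordLabel (hx : m.xSq μ ≠ 0) {a : Fin k} (ha : a ∈ openers π) (c : Bool) :
    m.slotNorm μ (diagramLayout k₀ k₁ π) (chordLabel π a c).succ = m.xSq μ * M := by
  have hM : (M : ℂ) ≠ 0 := fun h => hx (by rw [FlavourModel.xSq, h, div_zero])
  have hk : (diagramLayout k₀ k₁ π).key ((chordLabel π a c).succ, c) <
      (diagramLayout k₀ k₁ π).key ((chordLabel π a c).succ, !c) := key_chordLabel_lt k₀ k₁ π ha c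
  rw [m.slotNorm_eq μ _ hk, FlavourModel.xSq, div_mul_cancel₀ _ hM]
  simp only [env_chordLabel m μ k₀ k₁ π ha]
  cases c
  · simp only [FlavourModel.sop, Bool.not_false, if_true, Bool.false_eq_true, if_false,
      FlavourModel.WDir, FlavourModel.Wt, Finset.mul_sum]
    have h1 : ∀ f : Fin M → Fin M → Fin M → Fin M → ℂ, ∑ b, ∑ c, ∑ a, ∑ d, f a b c d =
        ∑ a, ∑ b, ∑ c, ∑ d, f a b c d := by
      intro f
      have e1 : ∀ b, ∑ c, ∑ a, ∑ d, f a b c d = ∑ a, ∑ c, ∑ d, f a b c d := fun b => Finset.sum_comm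
      simp only [e1]
      exact Finset.sum_comm
    refine Eq.trans ?_ (h1 _)
    exact Finset.sum_congr rfl fun _ _ => Finset.sum_congr rfl fun _ _ =>
      Finset.sum_congr rfl fun _ _ => Finset.sum_congr rfl fun _ _ => by ring
  · simp only [FlavourModel.sop, Bool.not_true, if_true, Bool.false_eq_true, if_false,
      FlavourModel.WDir, FlavourModel.W, Finset.mul_sum]
    have h1 : ∀ f : Fin M → Fin M → Fin M → Fin M → ℂ, ∑ a, ∑ d, ∑ b, ∑ c, f a b c d =
        ∑ a, ∑ b, ∑ c, ∑ d, f a b c d := by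
      intro f
      refine Finset.sum_congr rfl fun a _ => ?_
      rw [Finset.sum_comm]
      exact Finset.sum_congr rfl fun b _ => Finset.sum_comm
    refine Eq.trans ?_ (h1 _)
    exact Finset.sum_congr rfl fun _ _ => Finset.sum_congr rfl fun _ _ =>
      Finset.sum_congr rfl fun _ _ => Finset.sum_congr rfl fun _ _ => by ring

end DiagramValues

/-! ### From the pairwise weights to the parameters of the chord rules. -/

section Weights

variable {ι : Type*} [Fintype ι] [DecidableEq ι] {M r : ℕ} (m : FlavourModel ι M r)
  (μ : Fin r → ℝ) {k : ℕ} (k₀ k₁ : ℕ) (π : ChordDiagram k) (lamb lambt : ℝ)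

lemma FlavourModel.tr_add (A B : Matrix ι ι ℂ) : m.tr μ (A + B) = m.tr μ A + m.tr μ B := by
  simp only [FlavourModel.tr, ntr, add_mul, Matrix.trace_add, add_div]

/-- The sum over `c` and `c'` runs over the orientations of two H chords. The two mixed orientations
make up the anticommutator once the indices of the two chords are exchanged in one of them. -/
lemma FlavourModel.lamNN_eq : m.lamNN μ lamb = lamb / (m.xSq μ * M) ^ 2 * ∑ c, ∑ c',
    ∑ f, ∑ g, ∑ f', ∑ g', m.tr μ (m.sop c f * m.sop (!c) g * m.sop c' f' * m.sop (!c') g') *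
      m.WDir μ c f g * m.WDir μ c' f' g' := by
  rw [FlavourModel.lamNN]
  congr 1
  simp only [Fintype.sum_bool, FlavourModel.sop, FlavourModel.WDir, Bool.not_true, Bool.not_false,
    if_true, Bool.false_eq_true, if_false]
  rw [sum4_swap (fun f g f' g' => m.tr μ ((m.χ f)ᴴ * m.χ g * m.χ f' * (m.χ g')ᴴ) *
      m.W μ f g * m.Wt μ f' g')]
  simp only [← Finset.sum_add_distrib]
  refine Finset.sum_congr rfl fun a _ => Finset.sum_congr rfl fun b _ =>
    Finset.sum_congr rfl fun c _ => Finset.sum_congr rfl fun d _ => ?_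
  simp only [m.tr_add, mul_assoc]
  ring

lemma FlavourModel.lamN_eq : m.lamN μ lamb + m.lamNN μ lamb =
    lamb / (m.xSq μ * M) ^ 2 * ∑ c, ∑ c',
    ∑ f, ∑ g, ∑ f', ∑ g', m.tr μ (m.sop c f * m.sop c' f' * m.sop (!c') g' * m.sop (!c) g) *
      m.WDir μ c f g * m.WDir μ c' f' g' := by
  rw [FlavourModel.lamN, sub_add_cancel]
  congr 1
  simp only [Fintype.sum_bool, FlavourModel.sop, FlavourModel.WDir, Bool.not_true, Bool.not_false,
    if_true, Bool.false_eq_true, if_false]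
  rw [sum4_swap (fun f g f' g' => m.tr μ ((m.χ f)ᴴ * m.χ f' * (m.χ g')ᴴ * m.χ g) *
      m.W μ f g * m.Wt μ f' g')]
  simp only [← Finset.sum_add_distrib]
  refine Finset.sum_congr rfl fun a _ => Finset.sum_congr rfl fun b _ =>
    Finset.sum_congr rfl fun c _ => Finset.sum_congr rfl fun d _ => ?_
  ring

lemma FlavourModel.lamC_eq : m.lamC μ lamb + m.lamNN μ lamb =
    lamb / (m.xSq μ * M) ^ 2 * -∑ c, ∑ c',
    ∑ f, ∑ g, ∑ f', ∑ g', m.tr μ (m.sop c f * m.sop c' f' * m.sop (!c) g * m.sop (!c') g') *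
      m.WDir μ c f g * m.WDir μ c' f' g' := by
  rw [FlavourModel.lamC, sub_add_cancel, mul_neg]
  congr 2
  simp only [Fintype.sum_bool, FlavourModel.sop, FlavourModel.WDir, Bool.not_true, Bool.not_false,
    if_true, Bool.false_eq_true, if_false]
  rw [sum4_swap (fun f g f' g' => m.tr μ ((m.χ f)ᴴ * m.χ f' * m.χ g * (m.χ g')ᴴ) *
      m.W μ f g * m.Wt μ f' g')]
  simp only [← Finset.sum_add_distrib]
  refine Finset.sum_congr rfl fun a _ => Finset.sum_congr rfl fun b _ =>
    Finset.sum_congr rfl fun c _ => Finset.sum_congr rfl fun d _ => ?_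
  ring

variable {π}

/-- Both oriented chords of an H chord have their end points at the same two nodes, where `X†`
precedes `X`. So the chord of `a` starts first and ends last: the other is nested inside it, and the
sign is `+1`. -/
lemma FlavourModel.collWeight_self (hx : m.xSq μ ≠ 0) {a : Fin k} (ha : a ∈ openers π) :
    lamb * m.collWeight μ (diagramLayout k₀ k₁ π) a.succ (π.1 a).succ = m.lamH μ lamb := by
  have hne : a.succ ≠ (π.1 a).succ := fun h => (π.2 a).2 (Fin.succ_injective _ h).symm
  have h3 : nodePos k₀ k₁ a < nodePos k₀ k₁ (π.1 a) := (nodePos_lt_iff k₀ k₁).2 ((mem_openers π).1 ha)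
  have h1 : (diagramLayout k₀ k₁ π).key (a.succ, true) <
      (diagramLayout k₀ k₁ π).key ((π.1 a).succ, false) := by
    change 2 * nodePos k₀ k₁ a < 2 * nodePos k₀ k₁ (π.1 (π.1 a)) + 1
    rw [(π.2 a).1]
    omega
  have h2 : (diagramLayout k₀ k₁ π).key ((π.1 a).succ, false) <
      (diagramLayout k₀ k₁ π).key ((π.1 a).succ, !false) := key_chordLabel_lt k₀ k₁ π ha false
  have h4 : (diagramLayout k₀ k₁ π).key ((π.1 a).succ, !false) <
      (diagramLayout k₀ k₁ π).key (a.succ, !true) := by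
    change 2 * nodePos k₀ k₁ (π.1 a) < 2 * nodePos k₀ k₁ (π.1 a) + 1
    omega
  have e1 := env_chordLabel m μ k₀ k₁ π ha true
  have e2 := env_chordLabel m μ k₀ k₁ π ha false
  have n1 := slotNorm_chordLabel m μ k₀ k₁ π hx ha true
  have n2 := slotNorm_chordLabel m μ k₀ k₁ π hx ha false
  simp only [chordLabel, if_true, Bool.false_eq_true, if_false] at e1 e2 n1 n2
  have h5 : m.collValue μ (diagramLayout k₀ k₁ π) a.succ (π.1 a).succ = ∑ a, ∑ b, ∑ c, ∑ d,
      m.tr μ ((m.χ a)ᴴ * m.χ b * (m.χ c)ᴴ * m.χ d) * m.W μ a d * m.Wt μ b c := by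
    rw [m.collValue_of_nested μ _ hne h1 h2 h4]
    simp only [e1, e2]
    refine Finset.sum_congr rfl fun a _ => ?_
    rw [Finset.sum_comm]
    refine Finset.sum_congr rfl fun b _ => ?_
    rw [Finset.sum_comm]
    rfl
  rw [FlavourModel.collWeight, h5, crossSign_of_nested h1 h2 h4, n1, n2, FlavourModel.lamH]
  ring

/-- Different H chords have different nodes, so for all four orientations the oriented chords are
placed relative to each other like the H chords themselves. -/
lemma FlavourModel.sum_collWeight (hx : m.xSq μ ≠ 0) {a b : Fin k} (ha : a ∈ openers π)
    (hb : b ∈ openers π) (hab : a < b) :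
    ∑ c, ∑ c', lamb * m.collWeight μ (diagramLayout k₀ k₁ π) (chordLabel π a c).succ
      (chordLabel π b c').succ = m.lamNN μ lamb +
        m.lamN μ lamb * (if π.1 b < π.1 a then 1 else 0) +
        m.lamC μ lamb * (if b < π.1 a ∧ π.1 a < π.1 b then 1 else 0) := by
  have hne : ∀ c c', (chordLabel π a c).succ ≠ (chordLabel π b c').succ := fun c c' h =>
    chordLabel_ne π ha hb hab.ne c c' (Fin.succ_injective _ h)
  have ea := env_chordLabel m μ k₀ k₁ π ha
  have eb := env_chordLabel m μ k₀ k₁ π hb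
  have na := slotNorm_chordLabel m μ k₀ k₁ π hx ha
  have nb := slotNorm_chordLabel m μ k₀ k₁ π hx hb
  have k1 : ∀ c, (diagramLayout k₀ k₁ π).key ((chordLabel π a c).succ, c) / 2 = _ :=
    key_chordLabel_fst k₀ k₁ π a
  have k2 : ∀ c, (diagramLayout k₀ k₁ π).key ((chordLabel π a c).succ, !c) / 2 = _ :=
    key_chordLabel_snd k₀ k₁ π a
  have k3 : ∀ c, (diagramLayout k₀ k₁ π).key ((chordLabel π b c).succ, c) / 2 = _ :=
    key_chordLabel_fst k₀ k₁ π b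
  have k4 : ∀ c, (diagramLayout k₀ k₁ π).key ((chordLabel π b c).succ, !c) / 2 = _ :=
    key_chordLabel_snd k₀ k₁ π b
  have lt : ∀ {s t : Fin k}, s < t → nodePos k₀ k₁ s < nodePos k₀ k₁ t :=
    fun h => (nodePos_lt_iff k₀ k₁).2 h
  have ha' := (mem_openers π).1 ha
  have hb' := (mem_openers π).1 hb
  have la := lt ha'
  have lb := lt hb'
  have lab := lt hab
  have val : ∀ c c' (ε z : ℂ), crossSign (diagramLayout k₀ k₁ π).key (chordLabel π a c).succ
      (chordLabel π b c').succ = ε → m.collValue μ (diagramLayout k₀ k₁ π) (chordLabel π a c).succ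
      (chordLabel π b c').succ = z → lamb * m.collWeight μ (diagramLayout k₀ k₁ π)
      (chordLabel π a c).succ (chordLabel π b c').succ = lamb / (m.xSq μ * M) ^ 2 * (ε * z) := by
    rintro c c' ε z rfl rfl
    rw [FlavourModel.collWeight, na, nb]
    ring
  have hπ : π.1 a ≠ π.1 b := fun h => hab.ne (π.1.injective h)
  have hba : b ≠ π.1 a := by
    rintro rfl
    rw [(π.2 a).1] at hb'
    exact ha'.not_gt hb'
  rcases lt_or_gt_of_ne hba with h | h
  · have l1 := lt h
    rcases lt_or_gt_of_ne hπ with h' | h'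
    · have l2 := lt h'
      rw [if_neg h'.not_gt, if_pos ⟨h, h'⟩, mul_zero, add_zero, mul_one, add_comm (m.lamNN μ lamb), m.lamC_eq,
        ← Finset.sum_neg_distrib, Finset.mul_sum]
      refine Finset.sum_congr rfl fun c _ => ?_
      rw [← Finset.sum_neg_distrib, Finset.mul_sum]
      refine Finset.sum_congr rfl fun c' _ => ?_
      have := k1 c; have := k2 c; have := k3 c'; have := k4 c'
      rw [val c c' (-1) _ (crossSign_of_crossing (d := c) (d' := c') (by omega) (by omega) (by omega))
        (m.collValue_of_crossing μ _ (d := c) (d' := c') (hne c c') (by omega) (by omega) (by omega))]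
      simp only [ea, eb, neg_mul, one_mul]
    · have l2 := lt h'
      rw [if_pos h', if_neg fun hh => h'.not_gt hh.2, mul_zero, add_zero, mul_one, add_comm (m.lamNN μ lamb), m.lamN_eq,
        Finset.mul_sum]
      refine Finset.sum_congr rfl fun c _ => ?_
      rw [Finset.mul_sum]
      refine Finset.sum_congr rfl fun c' _ => ?_
      have := k1 c; have := k2 c; have := k3 c'; have := k4 c'
      rw [val c c' 1 _ (crossSign_of_nested (d := c) (d' := c') (by omega) (by omega) (by omega))
        (m.collValue_of_nested μ _ (d := c) (d' := c') (hne c c') (by omega) (by omega) (by omega))]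
      simp only [ea, eb, one_mul]
  · have l1 := lt h
    rw [if_neg ((h.trans hb').not_gt), if_neg fun hh => h.not_gt hh.1, mul_zero, add_zero, mul_zero,
      add_zero, m.lamNN_eq, Finset.mul_sum]
    refine Finset.sum_congr rfl fun c _ => ?_
    rw [Finset.mul_sum]
    refine Finset.sum_congr rfl fun c' _ => ?_
    have := k1 c; have := k2 c; have := k3 c'; have := k4 c'
    rw [val c c' 1 _ (crossSign_of_before (d := c) (d' := c') (by omega) (by omega) (by omega))
      (m.collValue_of_before μ _ (d := c) (d' := c') (hne c c') (by omega) (by omega) (by omega))]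
    simp only [ea, eb, one_mul]

lemma FlavourModel.gammaSum_eq (w : Bool → Fin M → Fin M → Fin M → Fin M → Matrix ι ι ℂ) :
    m.gammaSum μ lambt (w true) (w false) = lambt / (m.xSq μ * M * (m.xt μ * (Real.sqrt M : ℂ))) *
      ∑ c, ∑ e, ∑ f, ∑ a, ∑ b, m.tr μ (w c e f a b) * m.S e f * m.WDir μ c a b := by
  rw [FlavourModel.gammaSum]
  congr 1
  simp only [Fintype.sum_bool, FlavourModel.WDir, if_true, Bool.false_eq_true, if_false,
    ← Finset.sum_add_distrib]
  refine Finset.sum_congr rfl fun a _ => Finset.sum_congr rfl fun b _ =>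
    Finset.sum_congr rfl fun c _ => Finset.sum_congr rfl fun d _ => ?_
  ring

lemma FlavourModel.gammaSum_eq' (w : Bool → Fin M → Fin M → Fin M → Fin M → Matrix ι ι ℂ) :
    m.gammaSum μ lambt (w true) (w false) = lambt / (m.xSq μ * M * (m.xt μ * (Real.sqrt M : ℂ))) *
      ∑ c, ∑ a, ∑ b, ∑ e, ∑ f, m.tr μ (w c e f a b) * m.WDir μ c a b * m.S e f := by
  rw [m.gammaSum_eq μ lambt w]
  refine congrArg _ (Finset.sum_congr rfl fun c _ => ?_)
  refine (sum4_swap fun e f a b => m.tr μ (w c e f a b) * m.S e f * m.WDir μ c a b).trans ?_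
  exact Finset.sum_congr rfl fun a _ => Finset.sum_congr rfl fun b _ =>
    Finset.sum_congr rfl fun e _ => Finset.sum_congr rfl fun f _ => mul_right_comm _ _ _

/-- The six cases are the positions of an H chord relative to the M chord. Where the H chord starts
first, symmetry of the weight is used to put it first, and the sums are taken in the corresponding
order. -/
lemma FlavourModel.sum_collWeight_zero (hx : m.xSq μ ≠ 0) (hxt : m.xt μ ≠ 0) {a : Fin k}
    (ha : a ∈ openers π) :
    ∑ c, lambt * m.collWeight μ (diagramLayout k₀ k₁ π) 0 (chordLabel π a c).succ =
      m.gammaHM μ lambt k₀ k₁ a (π.1 a) := by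
  have ea := env_chordLabel m μ k₀ k₁ π ha
  have e0 := env_zero m μ k₀ k₁ π
  have na := slotNorm_chordLabel m μ k₀ k₁ π hx ha
  have n0 := slotNorm_zero m μ k₀ k₁ π hxt
  have k1 : ∀ c, (diagramLayout k₀ k₁ π).key ((chordLabel π a c).succ, c) / 2 = _ :=
    key_chordLabel_fst k₀ k₁ π a
  have k2 : ∀ c, (diagramLayout k₀ k₁ π).key ((chordLabel π a c).succ, !c) / 2 = _ :=
    key_chordLabel_snd k₀ k₁ π a
  have z1 : (diagramLayout k₀ k₁ π).key (0, true) = 2 * k₀ := rfl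
  have z2 : (diagramLayout k₀ k₁ π).key (0, !true) = 2 * (k₀ + k₁ + 1) := rfl
  have la : (a : ℕ) < π.1 a := (mem_openers π).1 ha
  have h0 : ∀ c, (0 : Fin (k + 1)) ≠ (chordLabel π a c).succ := fun c => (Fin.succ_ne_zero _).symm
  have val : ∀ c (ε z : ℂ), crossSign (diagramLayout k₀ k₁ π).key 0 (chordLabel π a c).succ = ε →
      m.collValue μ (diagramLayout k₀ k₁ π) 0 (chordLabel π a c).succ = z →
      lambt * m.collWeight μ (diagramLayout k₀ k₁ π) 0 (chordLabel π a c).succ =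
        lambt / (m.xSq μ * M * (m.xt μ * (Real.sqrt M : ℂ))) * (ε * z) := by
    rintro c ε z rfl rfl
    rw [FlavourModel.collWeight, na, n0]
    ring
  have val' : ∀ c (ε z : ℂ), crossSign (diagramLayout k₀ k₁ π).key (chordLabel π a c).succ 0 = ε →
      m.collValue μ (diagramLayout k₀ k₁ π) (chordLabel π a c).succ 0 = z →
      lambt * m.collWeight μ (diagramLayout k₀ k₁ π) 0 (chordLabel π a c).succ =
        lambt / (m.xSq μ * M * (m.xt μ * (Real.sqrt M : ℂ))) * (ε * z) := by
    rintro c ε z rfl rfl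
    rw [m.collWeight_comm μ _ (h0 c), FlavourModel.collWeight, na, n0]
    ring
  have pos : ∀ s : ℕ, nodePos k₀ k₁ s = s + (if k₀ ≤ s then 1 else 0) + if k₀ + k₁ ≤ s then 1 else 0 :=
    fun _ => rfl
  have pa := pos a
  have pb := pos (π.1 a)
  unfold FlavourModel.gammaHM
  split_ifs with c1 c2 c3 c3 c2
  · rw [if_neg (by omega), if_neg (by omega)] at pa pb
    refine Eq.trans ?_ (m.gammaSum_eq' μ lambt fun c e f a b =>
      m.sop c a * m.sop (!c) b * (m.χ e)ᴴ * m.χ f).symm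
    rw [Finset.mul_sum]
    refine Finset.sum_congr rfl fun c _ => ?_
    have := k1 c; have := k2 c
    rw [val' c 1 _ (crossSign_of_before (d := c) (d' := true) (by omega) (by omega) (by omega))
      (m.collValue_of_before μ _ (d := c) (d' := true) (h0 c).symm (by omega) (by omega) (by omega))]
    simp only [ea, e0, one_mul, FlavourModel.sop, Bool.not_true, if_true, Bool.false_eq_true, if_false]
  · rw [if_neg (by omega), if_neg (by omega)] at pa
    rw [if_pos (by omega), if_neg (by omega)] at pb
    refine Eq.trans ?_ (congrArg Neg.neg (m.gammaSum_eq' μ lambt fun c e f a b =>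
      m.sop c a * (m.χ e)ᴴ * m.sop (!c) b * m.χ f).symm)
    rw [← mul_neg, ← Finset.sum_neg_distrib, Finset.mul_sum]
    refine Finset.sum_congr rfl fun c _ => ?_
    have := k1 c; have := k2 c
    rw [val' c (-1) _ (crossSign_of_crossing (d := c) (d' := true) (by omega) (by omega) (by omega))
      (m.collValue_of_crossing μ _ (d := c) (d' := true) (h0 c).symm (by omega) (by omega) (by omega))]
    simp only [ea, e0, one_mul, neg_mul, FlavourModel.sop, Bool.not_true, if_true,
      Bool.false_eq_true, if_false]
  · rw [if_neg (by omega), if_neg (by omega)] at pa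
    rw [if_pos (by omega), if_pos (by omega)] at pb
    refine Eq.trans ?_ (m.gammaSum_eq' μ lambt fun c e f a b =>
      m.sop c a * (m.χ e)ᴴ * m.χ f * m.sop (!c) b).symm
    rw [Finset.mul_sum]
    refine Finset.sum_congr rfl fun c _ => ?_
    have := k1 c; have := k2 c
    rw [val' c 1 _ (crossSign_of_nested (d := c) (d' := true) (by omega) (by omega) (by omega))
      (m.collValue_of_nested μ _ (d := c) (d' := true) (h0 c).symm (by omega) (by omega) (by omega))]
    simp only [ea, e0, one_mul, FlavourModel.sop, Bool.not_true, if_true, Bool.false_eq_true, if_false]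
  · rw [if_pos (by omega), if_neg (by omega)] at pa pb
    refine Eq.trans ?_ (m.gammaSum_eq μ lambt fun c e f a b =>
      (m.χ e)ᴴ * m.sop c a * m.sop (!c) b * m.χ f).symm
    rw [Finset.mul_sum]
    refine Finset.sum_congr rfl fun c _ => ?_
    have := k1 c; have := k2 c
    rw [val c 1 _ (crossSign_of_nested (d := true) (d' := c) (by omega) (by omega) (by omega))
      (m.collValue_of_nested μ _ (d := true) (d' := c) (h0 c) (by omega) (by omega) (by omega))]
    simp only [ea, e0, one_mul, FlavourModel.sop, Bool.not_true, if_true, Bool.false_eq_true, if_false]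
  · rw [if_pos (by omega), if_neg (by omega)] at pa
    rw [if_pos (by omega), if_pos (by omega)] at pb
    refine Eq.trans ?_ (congrArg Neg.neg (m.gammaSum_eq μ lambt fun c e f a b =>
      (m.χ e)ᴴ * m.sop c a * m.χ f * m.sop (!c) b).symm)
    rw [← mul_neg, ← Finset.sum_neg_distrib, Finset.mul_sum]
    refine Finset.sum_congr rfl fun c _ => ?_
    have := k1 c; have := k2 c
    rw [val c (-1) _ (crossSign_of_crossing (d := true) (d' := c) (by omega) (by omega) (by omega))
      (m.collValue_of_crossing μ _ (d := true) (d' := c) (h0 c) (by omega) (by omega) (by omega))]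
    simp only [ea, e0, one_mul, neg_mul, FlavourModel.sop, Bool.not_true, if_true,
      Bool.false_eq_true, if_false]
  · rw [if_pos (by omega), if_pos (by omega)] at pa pb
    refine Eq.trans ?_ (m.gammaSum_eq μ lambt fun c e f a b =>
      (m.χ e)ᴴ * m.χ f * m.sop c a * m.sop (!c) b).symm
    rw [Finset.mul_sum]
    refine Finset.sum_congr rfl fun c _ => ?_
    have := k1 c; have := k2 c
    rw [val c 1 _ (crossSign_of_before (d := true) (d' := c) (by omega) (by omega) (by omega))
      (m.collValue_of_before μ _ (d := true) (d' := c) (h0 c) (by omega) (by omega) (by omega))]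
    simp only [ea, e0, one_mul, FlavourModel.sop, Bool.not_true, if_true, Bool.false_eq_true, if_false]

variable (π) in
/-- The exponent of the weight of a chord diagram as a sum over pairs of oriented chords. -/
theorem FlavourModel.exp_sum_collWeight (hx : m.xSq μ ≠ 0) (hxt : m.xt μ ≠ 0) :
    Complex.exp (∑ u : Fin (k + 1), ∑ v with v < u, ((if v = 0 then lambt else lamb : ℝ) : ℂ) *
      (m.collWeight μ (diagramLayout k₀ k₁ π) v u - 1)) = m.diagramWeight μ lamb lambt k₀ k₁ π := by
  set q := m.collWeight μ (diagramLayout k₀ k₁ π) with hq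
  have h1 : ∑ u : Fin (k + 1), ∑ v with v < u, ((if v = 0 then lambt else lamb : ℝ) : ℂ) *
      (q v u - 1) = ∑ s : Fin k, lambt * (q 0 s.succ - 1) +
        ∑ s : Fin k, ∑ t with t < s, lamb * (q t.succ s.succ - 1) := by
    rw [Fin.sum_univ_succ]
    have : (Finset.univ.filter fun v : Fin (k + 1) => v < 0) = ∅ :=
      Finset.filter_false_of_mem fun v _ => Fin.not_lt_zero v
    rw [this, Finset.sum_empty, zero_add, ← Finset.sum_add_distrib]
    refine Finset.sum_congr rfl fun s _ => ?_
    rw [Finset.sum_filter, Fin.sum_univ_succ, if_pos (Fin.succ_pos s), if_pos rfl, Finset.sum_filter]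
    congr 1
    refine Finset.sum_congr rfl fun t _ => ?_
    simp only [Fin.succ_lt_succ_iff, Fin.succ_ne_zero, if_false]
  -- The M chord meets each of the `k` oriented chords; the weights are then collected by H chords.
  have h2 : ∑ s : Fin k, lambt * (q 0 s.succ - 1) =
      -lambt * k + ∑ a ∈ openers π, m.gammaHM μ lambt k₀ k₁ a (π.1 a) := by
    simp only [mul_sub, mul_one, Finset.sum_sub_distrib, Finset.sum_const, Finset.card_univ,
      Fintype.card_fin, nsmul_eq_mul]
    rw [sum_eq_sum_openers π, Finset.sum_congr rfl fun a ha =>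
      m.sum_collWeight_zero μ k₀ k₁ lambt hx hxt ha]
    ring
  have hcard := two_mul_card_openers π
  have hk2 : (openers π).card = k / 2 := by omega
  have hcard' : (2 : ℂ) * (openers π).card = k := by exact_mod_cast hcard
  -- Among the `k.choose 2` pairs of oriented chords, `k / 2` are the two halves of one H chord. The
  -- others come in fours from `(k / 2).choose 2` pairs of H chords, and each such pair contributes
  -- `λ_NN` together with `λ_N` or `λ_C` if it is nested or intersecting.
  have h3 : ∑ s : Fin k, ∑ t with t < s, lamb * (q t.succ s.succ - 1) =
      -lamb * (k.choose 2 : ℂ) + k * m.lamH μ lamb / 2 + m.lamNN μ lamb * ((k / 2).choose 2 : ℂ) +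
        nestedPairs π * m.lamN μ lamb + crossingPairs π * m.lamC μ lamb := by
    have e1 : ∑ s : Fin k, ∑ t with t < s, lamb * (q t.succ s.succ - 1) =
        ∑ s : Fin k, ∑ t with t < s, lamb * q t.succ s.succ - lamb * (k.choose 2 : ℂ) := by
      have := sum_lt_one (Finset.univ : Finset (Fin k))
      rw [Finset.card_univ, Fintype.card_fin] at this
      rw [← this, Finset.mul_sum, ← Finset.sum_sub_distrib]
      refine Finset.sum_congr rfl fun s _ => ?_
      rw [Finset.mul_sum, ← Finset.sum_sub_distrib]
      exact Finset.sum_congr rfl fun t _ => by ring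
    rw [e1, sum_pairs_eq π (fun t s => lamb * q t.succ s.succ) fun s t hst => by
      rw [hq, m.collWeight_comm μ _ fun h => hst (Fin.succ_injective _ h)]]
    rw [Finset.sum_congr rfl fun a ha => m.collWeight_self μ k₀ k₁ lamb hx ha,
      Finset.sum_congr rfl fun b hb => Finset.sum_congr rfl fun a ha =>
        m.sum_collWeight μ k₀ k₁ lamb hx (Finset.mem_filter.1 ha).1 hb (Finset.mem_filter.1 ha).2]
    simp only [Finset.sum_add_distrib, ← Finset.mul_sum]
    rw [← nestedPairs_eq, ← crossingPairs_eq, Finset.sum_const, nsmul_eq_mul]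
    have e2 : ∑ b ∈ openers π, ∑ a ∈ openers π with a < b, m.lamNN μ lamb =
        m.lamNN μ lamb * ((k / 2).choose 2 : ℂ) := by
      rw [← hk2, ← sum_lt_one, Finset.mul_sum]
      refine Finset.sum_congr rfl fun b _ => ?_
      rw [Finset.mul_sum]
      exact Finset.sum_congr rfl fun a _ => (mul_one _).symm
    rw [e2, ← hcard']
    ring
  rw [h1, h2, h3, FlavourModel.diagramWeight, ← Complex.exp_sum, ← Complex.exp_nat_mul,
    ← Complex.exp_nat_mul, ← Complex.exp_add, ← Complex.exp_add, ← Complex.exp_add, ← Complex.exp_add]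
  congr 1
  rw [openers]
  ring

end Weights

/-! ### The averaged network in the limit. -/

section NetLimit

variable {ι : Type*} [Fintype ι] [DecidableEq ι] {M r : ℕ} (m : FlavourModel ι M r)
  (μ : Fin r → ℝ) {U : Type*} [Fintype U] [LinearOrder U] (L : Layout U)

lemma norm_crossSign_le (key : U × Bool → ℕ) (u v : U) : ‖crossSign key u v‖ ≤ 1 := by
  rw [crossSign, norm_pow, norm_neg, norm_one, one_pow]

open scoped Classical in
/-- The flavour network deviates from the product of the pair weights only on bad configurations. -/
lemma norm_net_sub_le [NeZero M] (h : m.calN μ ≠ 0) (hn : ∀ u, m.slotNorm μ L u ≠ 0)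
    (hn' : ∀ u, m.slotNorm μ L (L.τ u) = m.slotNorm μ L u) :
    ∃ C : ℝ, 1 ≤ C ∧ ∀ (N : ℕ) (sz : U → ℕ) (hτ : ∀ u, sz u = sz (L.τ u)) (I : Config N sz),
      ‖pairWeight (crossSign L.key) Finset.univ I * m.net μ L hτ I / m.netNorm μ L sz -
        pairWeight (m.collWeight μ L) Finset.univ I‖ ≤
          C ^ coll Finset.univ I * ind (¬ Good L.τ hτ I) := by
  obtain ⟨C, hC1, hC⟩ := m.norm_net_le μ L h hn
  obtain ⟨D, hD1, hD⟩ : ∃ D : ℝ, 1 ≤ D ∧ ∀ u v, ‖m.collWeight μ L u v‖ ≤ D := by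
    refine ⟨1 + ∑ u, ∑ v, ‖m.collWeight μ L u v‖, ?_, fun u v => ?_⟩
    · have : 0 ≤ ∑ u, ∑ v, ‖m.collWeight μ L u v‖ := by positivity
      linarith
    · have h1 : ‖m.collWeight μ L u v‖ ≤ ∑ v, ‖m.collWeight μ L u v‖ :=
        Finset.single_le_sum (f := fun v => ‖m.collWeight μ L u v‖)
          (fun _ _ => norm_nonneg _) (Finset.mem_univ v)
      have h2 : ∑ v, ‖m.collWeight μ L u v‖ ≤ ∑ u, ∑ v, ‖m.collWeight μ L u v‖ :=
        Finset.single_le_sum (f := fun u => ∑ v, ‖m.collWeight μ L u v‖)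
          (fun _ _ => by positivity) (Finset.mem_univ u)
      linarith
  refine ⟨C + D, by linarith, fun N sz hτ I => ?_⟩
  have hnn : m.netNorm μ L sz ≠ 0 := Finset.prod_ne_zero_iff.2 fun x _ => hn _
  by_cases hI : Good L.τ hτ I
  · rw [m.net_of_good μ L hτ h hn hn' hI, mul_div_cancel_left₀ _ hnn, sub_self, norm_zero]
    exact mul_nonneg (by positivity) (ind_nonneg _)
  · rw [ind, if_pos hI, mul_one]
    refine (norm_sub_le _ _).trans ?_
    have b1 := norm_pairWeight_le hD Finset.univ I
    have b2 := norm_pairWeight_le (norm_crossSign_le L.key) Finset.univ I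
    rw [one_pow] at b2
    have b3 : ‖pairWeight (crossSign L.key) Finset.univ I * m.net μ L hτ I / m.netNorm μ L sz‖ ≤
        C ^ coll Finset.univ I := by
      rw [norm_div, norm_mul, div_le_iff₀ (norm_pos_iff.2 hnn)]
      calc _ ≤ 1 * (‖m.netNorm μ L sz‖ * C ^ coll Finset.univ I) := by
            gcongr
            exact hC N sz hτ I
        _ = _ := by ring
    -- Without collisions the configuration is good. Otherwise the exponent is positive, and the sum
    -- of the powers is at most the power of the sum.
    rcases Nat.eq_zero_or_pos (coll Finset.univ I) with hc | hc
    · exfalso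
      refine hI ⟨fun i => ?_, fun u hu l => ?_⟩
      all_goals
        have hs : (collSites I) = ∅ := Finset.card_eq_zero.1 (by
          have := card_collSites_le I
          omega)
        have ho : ∀ i, occ Finset.univ I i ≤ 1 := fun i => by
          by_contra hh
          have : i ∈ collSites I := Finset.mem_filter.2 ⟨Finset.mem_univ _, by omega⟩
          rw [hs] at this
          exact absurd this (Finset.notMem_empty _)
      · exact (ho i).trans one_le_two
      · exact Or.inl (ho _)
    · calc _ ≤ C ^ coll Finset.univ I + D ^ coll Finset.univ I := add_le_add b3 b1
        _ ≤ (C + D) ^ coll Finset.univ I :=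
          pow_add_pow_le (by linarith) (by linarith) hc.ne'

/-- The averaged flavour network in the double scaling limit. -/
theorem tendsto_expect_net [NeZero M] (h : m.calN μ ≠ 0) (hn : ∀ u, m.slotNorm μ L u ≠ 0)
    (hn' : ∀ u, m.slotNorm μ L (L.τ u) = m.slotNorm μ L u)
    {N : ℕ → ℕ} {sz : ℕ → U → ℕ} {lam : U → U → ℝ} (hN : Tendsto N atTop atTop)
    (hle : ∀ᶠ n in atTop, ∀ u, sz n u ≤ N n)
    (hsz : ∀ u, Tendsto (fun n => sz n u) atTop atTop)
    (hρ : ∀ u, Tendsto (fun n => (sz n u : ℝ) / N n) atTop (𝓝 0))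
    (hlam : ∀ u v, u ≠ v → Tendsto (fun n => (sz n u : ℝ) * sz n v / N n) atTop (𝓝 (lam u v)))
    (hτ : ∀ n u, sz n u = sz n (L.τ u)) :
    Tendsto (fun n => 𝔼 I : Config (N n) (sz n),
      pairWeight (crossSign L.key) Finset.univ I * m.net μ L (hτ n) I / m.netNorm μ L (sz n)) atTop
      (𝓝 (Complex.exp (∑ u, ∑ v with v < u, (lam v u : ℂ) * (m.collWeight μ L v u - 1)))) := by
  classical
  have hlam' : ∀ u v, v < u → Tendsto (fun n => (sz n u : ℝ) * sz n v / N n) atTop (𝓝 (lam v u)) :=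
    fun u v huv => by simpa only [mul_comm] using hlam v u huv.ne
  have h1 := tendsto_expect_pairWeight hle hsz hρ hlam' (m.collWeight μ L) Finset.univ
  have h2 := tendsto_expect_not_good hN hle hρ hlam L.τ hτ
  obtain ⟨C, hC1, hC⟩ := norm_net_sub_le m μ L h hn hn'
  rw [tendsto_iff_norm_sub_tendsto_zero] at h1 ⊢
  set B := fun n => Real.exp ((C ^ 2) ^ Fintype.card U *
      ∑ u, ∑ v with v < u, ((sz n u : ℝ) * sz n v / N n)) with hB
  have hBlim : Tendsto B atTop (𝓝 (Real.exp ((C ^ 2) ^ Fintype.card U *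
      ∑ u, ∑ v with v < u, lam v u))) := by
    refine (Real.continuous_exp.tendsto _).comp (Tendsto.const_mul _ ?_)
    exact tendsto_finsetSum _ fun u _ => tendsto_finsetSum _ fun v hv =>
      hlam' u v (Finset.mem_filter.1 hv).2
  obtain ⟨K, hK⟩ := hBlim.bddAbove_range
  have hK0 : 0 ≤ K := (Real.exp_pos _).le.trans (hK ⟨0, rfl⟩)
  -- By `x y ≤ δ x² + y² / (4δ)` with `y` the indicator of bad configurations, the average is
  -- controlled by the bounded moment of `(C ^ 2) ^ coll` and by the vanishing probability. The
  -- choice of `δ` makes the first part at most `ε / 2`.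
  have key : ∀ ε : ℝ, 0 < ε → ∀ᶠ n in atTop, 𝔼 I : Config (N n) (sz n),
      C ^ coll Finset.univ I * ind (¬ Good L.τ (hτ n) I) ≤ ε := by
    intro ε hε
    set δ := ε / (2 * (K + 1)) with hδ
    have hδ0 : 0 < δ := by positivity
    have h3 : Tendsto (fun n => (1 / (4 * δ)) * 𝔼 I : Config (N n) (sz n),
        ind (¬ Good L.τ (hτ n) I)) atTop (𝓝 0) := by
      simpa using h2.const_mul (1 / (4 * δ))
    filter_upwards [h3.eventually (gt_mem_nhds (half_pos hε)), hle] with n hn1 hn2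
    calc 𝔼 I : Config (N n) (sz n), C ^ coll Finset.univ I * ind (¬ Good L.τ (hτ n) I)
        ≤ 𝔼 I : Config (N n) (sz n), (δ * (C ^ 2) ^ coll Finset.univ I +
            (1 / (4 * δ)) * ind (¬ Good L.τ (hτ n) I)) := by
          refine expect_le_expect' fun I => ?_
          have hi : ind (¬ Good L.τ (hτ n) I) ^ 2 = ind (¬ Good L.τ (hτ n) I) := by
            unfold ind; split_ifs <;> norm_num
          rw [← pow_mul, mul_comm 2, pow_mul]
          revert hi
          generalize ind (¬ Good L.τ (hτ n) I) = y
          generalize C ^ coll Finset.univ I = x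
          intro hi
          have h5 : δ * x ^ 2 + 1 / (4 * δ) * y ^ 2 - x * y = (2 * δ * x - y) ^ 2 / (4 * δ) := by
            field_simp
            ring
          have h6 : 0 ≤ (2 * δ * x - y) ^ 2 / (4 * δ) := by positivity
          rw [hi] at h5
          linarith
      _ = δ * 𝔼 I : Config (N n) (sz n), (C ^ 2) ^ coll Finset.univ I +
            (1 / (4 * δ)) * 𝔼 I : Config (N n) (sz n), ind (¬ Good L.τ (hτ n) I) := by
          rw [Finset.expect_add_distrib, Finset.mul_expect, Finset.mul_expect]
      _ ≤ δ * K + ε / 2 := by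
          gcongr
          exact (expect_pow_coll_le hn2 (one_le_pow₀ hC1) Finset.univ).trans (hK ⟨n, rfl⟩)
      _ ≤ ε := by
          have : δ * K ≤ ε / 2 := by
            rw [hδ, div_mul_eq_mul_div, div_le_div_iff₀ (by positivity) (by norm_num)]
            nlinarith
          linarith
  have h3 : Tendsto (fun n => 𝔼 I : Config (N n) (sz n),
      C ^ coll Finset.univ I * ind (¬ Good L.τ (hτ n) I)) atTop (𝓝 0) := by
    rw [Metric.tendsto_atTop']
    intro ε hε
    obtain ⟨a, ha⟩ := eventually_atTop.1 (key (ε / 2) (half_pos hε))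
    refine ⟨a, fun n hna => ?_⟩
    have h0 : 0 ≤ 𝔼 I : Config (N n) (sz n), C ^ coll Finset.univ I * ind (¬ Good L.τ (hτ n) I) :=
      expect_nonneg' fun I => mul_nonneg (by positivity) (ind_nonneg _)
    rw [Real.dist_eq, sub_zero, abs_of_nonneg h0]
    exact (ha n hna.le).trans_lt (half_lt_self hε)
  have h5 := h3.add h1
  rw [add_zero] at h5
  refine squeeze_zero (fun n => norm_nonneg _) (fun n => ?_) h5
  have h4 : (𝔼 I : Config (N n) (sz n), pairWeight (crossSign L.key) Finset.univ I *
      m.net μ L (hτ n) I / m.netNorm μ L (sz n)) -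
        Complex.exp (∑ u, ∑ v with v < u, (lam v u : ℂ) * (m.collWeight μ L v u - 1)) =
      (𝔼 I : Config (N n) (sz n), (pairWeight (crossSign L.key) Finset.univ I *
      m.net μ L (hτ n) I / m.netNorm μ L (sz n) - pairWeight (m.collWeight μ L) Finset.univ I)) +
      ((𝔼 I : Config (N n) (sz n), pairWeight (m.collWeight μ L) Finset.univ I) -
        Complex.exp (∑ u, ∑ v with v < u, (lam v u : ℂ) * (m.collWeight μ L v u - 1))) := by
    rw [Finset.expect_sub_distrib]
    ring
  rw [h4]
  refine (norm_add_le _ _).trans (add_le_add_left ?_ _)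
  exact (norm_expect_le _).trans (expect_le_expect' fun I => hC _ _ _ I)

end NetLimit

/-! ### The limit of a single chord diagram. -/

section DiagramLimit

variable {ι : Type*} [Fintype ι] [DecidableEq ι] {M r : ℕ} (m : FlavourModel ι M r)
  (μ : Fin r → ℝ) {k : ℕ} (k₀ k₁ : ℕ) (π : ChordDiagram k)

/-- The colour sets of the M chord and of the oriented chords of the H chords. -/
def diagramConfigEquiv (N p pt k : ℕ) :
    (Fin k → ColourSet N p) × ColourSet N pt ≃ Config N (chordSize (k := k) p pt) where
  toFun x := diagramConfig x.2 x.1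
  invFun I := (fun s => I s.succ, I 0)
  left_inv _ := rfl
  right_inv I := by
    funext u
    exact Fin.cases rfl (fun _ => rfl) u

lemma FlavourModel.calN_ne_zero (hxt : m.xt μ ≠ 0) : m.calN μ ≠ 0 := by
  intro h
  apply hxt
  have : ∀ A, m.tr μ A = 0 := fun A => by
    rw [FlavourModel.tr, show ntr (m.lam μ) = 0 from h, div_zero]
  simp [FlavourModel.xt, this]

/-- The representatives are the slots of the M chord and, for every H chord, those of the oriented
chord starting at its first node. -/
lemma netNorm_diagram (hx : m.xSq μ ≠ 0) (hxt : m.xt μ ≠ 0) (p pt : ℕ) :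
    m.netNorm μ (diagramLayout k₀ k₁ π) (chordSize (k := k) p pt) =
      (m.xt μ * (Real.sqrt M : ℂ)) ^ pt * (m.xSq μ * M) ^ (p * k / 2) := by
  have h1 : p * k / 2 = p * (openers π).card := by
    have h : p * k = 2 * (p * (openers π).card) := by
      rw [mul_left_comm, two_mul_card_openers π]
    rw [h, Nat.mul_div_cancel_left _ two_pos]
  rw [FlavourModel.netNorm, Layout.reps, Finset.prod_filter, Fintype.prod_sigma,
    Fin.prod_univ_succ]
  congr 1
  · rw [← slotNorm_zero m μ k₀ k₁ π hxt]
    have : (0 : Fin (k + 1)) ≤ (diagramLayout k₀ k₁ π).τ 0 := Fin.zero_le _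
    simp only [if_pos this, Finset.prod_const, Finset.card_univ, Fintype.card_fin]
    rfl
  · rw [h1, pow_mul, ← Finset.prod_const, openers, Finset.prod_filter]
    refine Finset.prod_congr rfl fun s _ => ?_
    by_cases hs : s < π.1 s
    · have h2 : s.succ ≤ (diagramLayout k₀ k₁ π).τ s.succ := Fin.succ_le_succ_iff.2 hs.le
      have h3 := slotNorm_chordLabel m μ k₀ k₁ π hx ((mem_openers π).2 hs) true
      simp only [chordLabel, if_true] at h3
      simp only [if_pos h2, if_pos hs, Finset.prod_const, Finset.card_univ, Fintype.card_fin, h3]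
      rfl
    · have h2 : ¬ s.succ ≤ (diagramLayout k₀ k₁ π).τ s.succ := fun h =>
        hs (lt_of_le_of_ne (Fin.succ_le_succ_iff.1 h) (π.2 s).2.symm)
      simp only [if_neg h2, if_neg hs, Finset.prod_const_one]

/-- The contribution of a chord diagram as an average of flavour networks. -/
lemma diagramMoment_div_prefactor (hx : m.xSq μ ≠ 0) (hxt : m.xt μ ≠ 0) (hk : k₀ + k₁ ≤ k)
    {N p pt : ℕ} (hp : Even p) (hpN : p ≤ N) (hptN : pt ≤ N) :
    diagramMoment m μ N p pt k₀ k₁ π / m.prefactor μ N p pt k =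
      𝔼 I : Config N (chordSize (k := k) p pt),
        pairWeight (crossSign (diagramLayout k₀ k₁ π).key) Finset.univ I *
          m.net μ (diagramLayout k₀ k₁ π) (chordSize_τ k₀ k₁ π p pt) I /
            m.netNorm μ (diagramLayout k₀ k₁ π) (chordSize (k := k) p pt) := by
  have hcal := m.calN_ne_zero μ hxt
  have hM : (M : ℂ) ≠ 0 := fun h => hx (by rw [FlavourModel.xSq, h, div_zero])
  have hM' : (Real.sqrt M : ℂ) ≠ 0 := fun h => hxt (by rw [FlavourModel.xt, h, div_zero])
  have c1 : ((N.choose p : ℕ) : ℂ) ≠ 0 := by exact_mod_cast (Nat.choose_pos hpN).ne'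
  have c2 : ((N.choose pt : ℕ) : ℂ) ≠ 0 := by exact_mod_cast (Nat.choose_pos hptN).ne'
  have hcard : (Fintype.card (Config N (chordSize (k := k) p pt)) : ℂ) =
      (N.choose p : ℂ) ^ k * (N.choose pt : ℂ) := by
    rw [← Fintype.card_congr (diagramConfigEquiv N p pt k), Fintype.card_prod, Fintype.card_fun,
      card_colourSet, card_colourSet, Fintype.card_fin]
    push_cast
    rfl
  rw [Fintype.expect_eq_sum_div_card, hcard, ← Finset.sum_div, diagramMoment,
    ← (diagramConfigEquiv N p pt k).sum_comp, Fintype.sum_prod_type, netNorm_diagram m μ k₀ k₁ π hx hxt]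
  simp only [sum_TrLam_word_eq m μ k₀ k₁ π hk hp]
  set Z := ∑ I : Fin k → ColourSet N p, ∑ It : ColourSet N pt,
    pairWeight (crossSign (diagramLayout k₀ k₁ π).key) Finset.univ (diagramConfig It I) *
      m.net μ (diagramLayout k₀ k₁ π) (chordSize_τ k₀ k₁ π p pt) (diagramConfig It I) with hZ
  change _ = Z / _ / _
  rw [FlavourModel.prefactor, mul_pow, mul_pow]
  field_simp

/-- The contribution of a chord diagram in the double scaling limit. -/
theorem tendsto_diagramMoment (hx : m.xSq μ ≠ 0) (hxt : m.xt μ ≠ 0) (hk : k₀ + k₁ ≤ k)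
    {N p pt : ℕ → ℕ} {lamb lambt : ℝ}
    (hN : Tendsto N atTop atTop) (hp : Tendsto p atTop atTop) (hpt : Tendsto pt atTop atTop)
    (hp_even : ∀ n, Even (p n))
    (hlamb : Tendsto (fun n => (p n : ℝ) ^ 2 / (N n : ℝ)) atTop (𝓝 lamb))
    (hlambt : Tendsto (fun n => (p n : ℝ) * (pt n : ℝ) / (N n : ℝ)) atTop (𝓝 lambt)) :
    Tendsto (fun n => diagramMoment m μ (N n) (p n) (pt n) k₀ k₁ π /
      m.prefactor μ (N n) (p n) (pt n) k) atTop (𝓝 (m.diagramWeight μ lamb lambt k₀ k₁ π)) := by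
  have hM : M ≠ 0 := fun h => hx (by
    rw [FlavourModel.xSq, show (M : ℂ) = 0 by exact_mod_cast h, div_zero])
  have : NeZero M := ⟨hM⟩
  have hM' : (M : ℂ) ≠ 0 := Nat.cast_ne_zero.2 hM
  have hM'' : (Real.sqrt M : ℂ) ≠ 0 := fun h => hxt (by rw [FlavourModel.xt, h, div_zero])
  have hp' : Tendsto (fun n => (p n : ℝ)) atTop atTop := tendsto_natCast_atTop_atTop.comp hp
  -- The density is `p² / N` divided by `p`, hence tends to zero.
  have hpN : Tendsto (fun n => (p n : ℝ) / N n) atTop (𝓝 0) := by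
    refine (hlamb.div_atTop hp').congr' ?_
    filter_upwards [hp'.eventually_gt_atTop 0] with n hn
    field_simp
  have hptN : Tendsto (fun n => (pt n : ℝ) / N n) atTop (𝓝 0) := by
    refine (hlambt.div_atTop hp').congr' ?_
    filter_upwards [hp'.eventually_gt_atTop 0] with n hn
    field_simp
  have hle : ∀ {f : ℕ → ℕ}, Tendsto (fun n => (f n : ℝ) / N n) atTop (𝓝 0) →
      ∀ᶠ n in atTop, f n ≤ N n := by
    intro f hf
    filter_upwards [hf.eventually (gt_mem_nhds one_pos), hN.eventually_gt_atTop 0] with n h1 h2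
    rw [div_lt_one (by exact_mod_cast h2)] at h1
    exact_mod_cast h1.le
  have hns : ∀ s : Fin k, m.slotNorm μ (diagramLayout k₀ k₁ π) s.succ = m.xSq μ * M := by
    intro s
    rcases lt_or_gt_of_ne (π.2 s).2 with h | h
    · have h1 : π.1 s ∈ openers π := (mem_openers π).2 (by rwa [(π.2 s).1])
      have := slotNorm_chordLabel m μ k₀ k₁ π hx h1 false
      simpa only [chordLabel, Bool.false_eq_true, if_false, (π.2 s).1] using this
    · exact slotNorm_chordLabel m μ k₀ k₁ π hx ((mem_openers π).2 h) true
  have hn0 : m.slotNorm μ (diagramLayout k₀ k₁ π) 0 = _ := slotNorm_zero m μ k₀ k₁ π hxt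
  have key := tendsto_expect_net m μ (diagramLayout k₀ k₁ π) (m.calN_ne_zero μ hxt)
    (fun u => Fin.cases (by rw [hn0]; exact mul_ne_zero hxt hM'')
      (fun s => by rw [hns]; exact mul_ne_zero hx hM') u)
    (fun u => Fin.cases rfl (fun s => (hns (π.1 s)).trans (hns s).symm) u)
    (N := N) (sz := fun n => chordSize (k := k) (p n) (pt n))
    (lam := fun u v => if u = 0 ∨ v = 0 then lambt else lamb) hN
    (by
      filter_upwards [hle hpN, hle hptN] with n h1 h2 u
      exact Fin.cases h2 (fun _ => h1) u)
    (fun u => Fin.cases hpt (fun _ => hp) u)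
    (fun u => Fin.cases hptN (fun _ => hpN) u)
    (fun u v => by
      refine Fin.cases ?_ (fun s => ?_) u
      · refine Fin.cases (fun h => absurd rfl h) (fun t _ => ?_) v
        rw [if_pos (Or.inl rfl)]
        exact hlambt.congr fun n => by rw [mul_comm]; rfl
      · refine Fin.cases (fun _ => ?_) (fun t _ => ?_) v
        · rw [if_pos (Or.inr rfl)]
          exact hlambt
        · rw [if_neg (by simp [Fin.succ_ne_zero])]
          exact hlamb.congr fun n => by rw [sq]; rfl)
    (fun n => chordSize_τ k₀ k₁ π (p n) (pt n))
  have hexp := m.exp_sum_collWeight μ k₀ k₁ π lamb lambt hx hxt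
  have h2 : ∑ u : Fin (k + 1), ∑ v with v < u,
      (((fun u v => if u = 0 ∨ v = 0 then lambt else lamb : Fin (k + 1) → Fin (k + 1) → ℝ) v u : ℝ) : ℂ) *
      (m.collWeight μ (diagramLayout k₀ k₁ π) v u - 1) =
      ∑ u : Fin (k + 1), ∑ v with v < u, ((if v = 0 then lambt else lamb : ℝ) : ℂ) *
      (m.collWeight μ (diagramLayout k₀ k₁ π) v u - 1) := by
    refine Finset.sum_congr rfl fun u _ => Finset.sum_congr rfl fun v hv => ?_
    have hvu := (Finset.mem_filter.1 hv).2
    have hu : u ≠ 0 := fun h => by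
      rw [h] at hvu
      exact absurd hvu (Fin.not_lt_zero v)
    simp only [hu, or_false]
  rw [h2, hexp] at key
  refine key.congr' ?_
  filter_upwards [hle hpN, hle hptN] with n h1 h2
  exact (diagramMoment_div_prefactor m μ k₀ k₁ π hx hxt hk (hp_even n) h1 h2).symm

end DiagramLimit

/-! ### Wick's theorem for centred Gaussian measures. -/

section Wick

/-- The permutations that restrict to a fixed point free involution of `A` and are trivial off
`A`, that is, the perfect matchings of `A`. -/
def matchings {K : Type*} [Fintype K] [DecidableEq K] (A : Finset K) : Finset (Equiv.Perm K) :=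
  Finset.univ.filter fun π => ∀ s, π (π s) = s ∧ (π s ≠ s ↔ s ∈ A)

lemma mem_matchings {K : Type*} [Fintype K] [DecidableEq K] {A : Finset K} {π : Equiv.Perm K} :
    π ∈ matchings A ↔ ∀ s, π (π s) = s ∧ (π s ≠ s ↔ s ∈ A) := by
  simp [matchings]

/-- The weight `C s t` of a pair counted once, for `s < t`. -/
def matchWeight {K : Type*} [LinearOrder K] (C : K → K → ℂ) (s t : K) : ℂ :=
  if s < t then C s t else 1

/-- The sum over perfect matchings of `A` of the product of the weights of the pairs. -/
def matchingSum {K : Type*} [Fintype K] [LinearOrder K] (C : K → K → ℂ) (A : Finset K) : ℂ :=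
  ∑ π ∈ matchings A, ∏ s, matchWeight C s (π s)

lemma matchings_empty {K : Type*} [Fintype K] [DecidableEq K] :
    matchings (∅ : Finset K) = {1} := by
  ext π
  rw [mem_matchings, Finset.mem_singleton]
  constructor
  · intro h
    ext s
    have := (h s).2
    simpa using this
  · rintro rfl s
    simp

lemma matchingSum_empty {K : Type*} [Fintype K] [LinearOrder K] (C : K → K → ℂ) :
    matchingSum C ∅ = 1 := by
  simp [matchingSum, matchings_empty, matchWeight]

/-- Left multiplication by the transposition dissolves the pair of `a` and `t`. Being an involution,
it also restores the pair, as the next lemma states. -/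
lemma swap_mul_mem_matchings_erase {K : Type*} [Fintype K] [DecidableEq K] {A : Finset K} {a t : K}
    (ha : a ∉ A) (ht : t ∈ A) {π : Equiv.Perm K} (hπ : π ∈ matchings (insert a A))
    (hat : π a = t) : Equiv.swap a t * π ∈ matchings (A.erase t) := by
  rw [mem_matchings] at hπ ⊢
  have hta : π t = a := by rw [← hat, (hπ a).1]
  have hne : a ≠ t := fun h => ha (h ▸ ht)
  intro s
  rw [Equiv.Perm.mul_apply, Equiv.Perm.mul_apply, Finset.mem_erase]
  by_cases hsa : s = a
  · subst hsa
    rw [hat, Equiv.swap_apply_right, hat, Equiv.swap_apply_right]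
    simp [ha]
  by_cases hst : s = t
  · subst hst
    rw [hta, Equiv.swap_apply_left, hta, Equiv.swap_apply_left]
    simp
  have h1 : π s ≠ a := fun h => hst (by rw [← (hπ s).1, h, hat])
  have h2 : π s ≠ t := fun h => hsa (by rw [← (hπ s).1, h, hta])
  rw [Equiv.swap_apply_of_ne_of_ne h1 h2, (hπ s).1, Equiv.swap_apply_of_ne_of_ne hsa hst,
    (hπ s).2, Finset.mem_insert]
  simp [hsa, hst]

lemma swap_mul_mem_matchings_insert {K : Type*} [Fintype K] [DecidableEq K] {A : Finset K}
    {a t : K} (ha : a ∉ A) (ht : t ∈ A) {π : Equiv.Perm K} (hπ : π ∈ matchings (A.erase t)) :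
    Equiv.swap a t * π ∈ matchings (insert a A) ∧ (Equiv.swap a t * π) a = t := by
  rw [mem_matchings] at hπ ⊢
  have hne : a ≠ t := fun h => ha (h ▸ ht)
  have hta : π t = t := by
    have := (hπ t).2
    simpa using this
  have haa : π a = a := by
    have := (hπ a).2
    simpa [ha] using this
  refine ⟨fun s => ?_, by simp [haa]⟩
  rw [Equiv.Perm.mul_apply, Equiv.Perm.mul_apply, Finset.mem_insert]
  by_cases hsa : s = a
  · subst hsa
    rw [haa, Equiv.swap_apply_left, hta, Equiv.swap_apply_right]
    simp [hne.symm]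
  by_cases hst : s = t
  · subst hst
    rw [hta, Equiv.swap_apply_right, haa, Equiv.swap_apply_left]
    simp [ht, hne]
  have h1 : π s ≠ a := fun h => hsa (by rw [← (hπ s).1, h, haa])
  have h2 : π s ≠ t := fun h => hst (by rw [← (hπ s).1, h, hta])
  rw [Equiv.swap_apply_of_ne_of_ne h1 h2, (hπ s).1, Equiv.swap_apply_of_ne_of_ne hsa hst,
    (hπ s).2, Finset.mem_erase]
  simp [hsa, hst]

/-- The matchings are sorted by the partner `t` of `a`. Symmetry of `C` removes the dependence on
which of `a` and `t` is smaller. -/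
lemma matchingSum_insert {K : Type*} [Fintype K] [LinearOrder K] {C : K → K → ℂ}
    (hC : ∀ s t, C s t = C t s) {A : Finset K} {a : K} (ha : a ∉ A) :
    matchingSum C (insert a A) = ∑ t ∈ A, C a t * matchingSum C (A.erase t) := by
  unfold matchingSum
  rw [← Finset.sum_fiberwise_of_maps_to (g := fun π : Equiv.Perm K => π a) (t := A)]
  · refine Finset.sum_congr rfl fun t ht => ?_
    have hne : a ≠ t := fun h => ha (h ▸ ht)
    rw [Finset.mul_sum]
    refine Finset.sum_nbij' (fun π => Equiv.swap a t * π) (fun π => Equiv.swap a t * π) ?_ ?_ ?_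
      ?_ ?_
    · intro π hπ
      rw [Finset.mem_filter] at hπ
      exact swap_mul_mem_matchings_erase ha ht hπ.1 hπ.2
    · intro π hπ
      rw [Finset.mem_filter]
      exact swap_mul_mem_matchings_insert ha ht hπ
    · intro π _
      simp [← mul_assoc]
    · intro π _
      simp [← mul_assoc]
    · intro π hπ
      rw [Finset.mem_filter] at hπ
      obtain ⟨hπ, hat⟩ := hπ
      have hπ' := mem_matchings.1 hπ
      have hta : π t = a := by rw [← hat, (hπ' a).1]
      have hta' : t ∈ Finset.univ.erase a := by simp [hne.symm]
      have hsplit : ∀ f : K → ℂ, ∏ s, f s = f a * (f t * ∏ s ∈ (Finset.univ.erase a).erase t, f s) :=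
        fun f => by
          rw [Finset.mul_prod_erase _ f hta', Finset.mul_prod_erase _ f (Finset.mem_univ a)]
      rw [hsplit, hsplit fun s => matchWeight C s ((Equiv.swap a t * π) s)]
      simp only [Equiv.Perm.mul_apply, hat, hta, Equiv.swap_apply_left, Equiv.swap_apply_right]
      have hw : matchWeight C a t * matchWeight C t a = C a t := by
        rcases lt_or_gt_of_ne hne with h | h
        · simp [matchWeight, h, h.not_gt]
        · simp [matchWeight, h, h.not_gt, hC a t]
      have hw' : ∀ s, matchWeight C s s = 1 := fun s => by simp [matchWeight]
      rw [hw', hw', one_mul, one_mul, ← mul_assoc, hw]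
      congr 1
      refine Finset.prod_congr rfl fun s hs => ?_
      simp only [Finset.mem_erase, Finset.mem_univ, and_true] at hs
      have h1 : π s ≠ a := fun h => hs.1 (by rw [← (hπ' s).1, h, hat])
      have h2 : π s ≠ t := fun h => hs.2 (by rw [← (hπ' s).1, h, hta])
      rw [Equiv.swap_apply_of_ne_of_ne h1 h2]
  · intro π hπ
    have hπ' := mem_matchings.1 hπ
    have h1 : π a ≠ a := (hπ' a).2.2 (Finset.mem_insert_self _ _)
    have h2 : π a ∈ insert a A := (hπ' (π a)).2.1 (by rw [(hπ' a).1]; exact h1.symm)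
    exact (Finset.mem_insert.1 h2).resolve_left h1

/-- A function on finite sets obeying the Wick recursion is the sum over matchings. -/
lemma eq_matchingSum {K : Type*} [Fintype K] [LinearOrder K] {C : K → K → ℂ}
    (hC : ∀ s t, C s t = C t s) {f : Finset K → ℂ} (h0 : f ∅ = 1)
    (hf : ∀ a A, a ∉ A → f (insert a A) = ∑ t ∈ A, C a t * f (A.erase t)) (A : Finset K) :
    f A = matchingSum C A := by
  induction A using Finset.strongInduction with
  | H A ih =>
    rcases A.eq_empty_or_nonempty with rfl | ⟨a, ha⟩
    · rw [h0, matchingSum_empty]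
    · rw [← Finset.insert_erase ha, hf a _ (Finset.notMem_erase a A),
        matchingSum_insert hC (Finset.notMem_erase a A)]
      refine Finset.sum_congr rfl fun t _ => ?_
      rw [ih _ ((Finset.erase_subset _ _).trans_ssubset (Finset.erase_ssubset ha))]

lemma matchingSum_univ {k : ℕ} (C : Fin k → Fin k → ℂ) :
    matchingSum C Finset.univ =
      ∑ π : ChordDiagram k, ∏ s with s < π.1 s, C s (π.1 s) := by
  unfold matchingSum matchWeight
  simp_rw [Finset.prod_filter]
  rw [Finset.sum_subtype (matchings (Finset.univ : Finset (Fin k)))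
    (p := fun π : Equiv.Perm (Fin k) => ∀ s, π (π s) = s ∧ π s ≠ s)]
  intro π
  rw [mem_matchings]
  simp

variable {E : Type*} [NormedAddCommGroup E] [NormedSpace ℝ E] [MeasurableSpace E] [BorelSpace E]
  [CompleteSpace E] [SecondCountableTopology E] {ν : Measure E} [IsGaussian ν]

/-- The product is bounded by a constant times a power of the norm, and Gaussian measures have all
moments. -/
lemma integrable_prod_clm {K : Type*} (L : K → E →L[ℝ] ℂ) (A : Finset K) :
    Integrable (fun x => ∏ t ∈ A, L t x) ν := by
  have h1 : Integrable (fun x : E => (∏ t ∈ A, ‖L t‖) * ‖x‖ ^ A.card) ν := by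
    refine Integrable.const_mul ?_ _
    have := (IsGaussian.memLp_id ν (A.card : ENNReal) (by simp)).integrable_norm_pow'
    simpa using this
  refine h1.mono' (by fun_prop) (ae_of_all _ fun x => ?_)
  rw [norm_prod, ← Finset.prod_const, ← Finset.prod_mul_distrib]
  exact Finset.prod_le_prod (fun _ _ => norm_nonneg _) fun t _ => (L t).le_opNorm x

/-- At angle zero only the terms with at most one factor of the sine besides the bracket contribute
to the derivative, which reduces a sum over all subsets to the empty set and the singletons. -/
lemma hasDerivAt_cos_pow_mul_sin_pow (b d : ℕ) (u v : ℂ) :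
    HasDerivAt (fun θ : ℝ => ((Real.sin θ : ℂ) ^ d * (Real.cos θ : ℂ) ^ b) *
      (-(Real.sin θ : ℂ) * u + (Real.cos θ : ℂ) * v))
      (if d = 0 then -u else if d = 1 then v else 0) 0 := by
  have hs : HasDerivAt (fun θ : ℝ => (Real.sin θ : ℂ)) 1 0 := by
    simpa using (Real.hasDerivAt_sin 0).ofReal_comp
  have hc : HasDerivAt (fun θ : ℝ => (Real.cos θ : ℂ)) 0 0 := by
    simpa using (Real.hasDerivAt_cos 0).ofReal_comp
  have h := ((hs.fun_pow d).mul (hc.fun_pow b)).mul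
    ((hs.neg.mul_const u).add (hc.mul_const v))
  refine h.congr_deriv ?_
  rcases d with _ | _ | d <;> simp

/-- The Wick recursion, obtained by differentiating the invariance of `ν.prod ν` under rotations. -/
lemma integral_mul_prod_clm (hν : ν[id] = 0) {K : Type*} [DecidableEq K] (L : K → E →L[ℝ] ℂ)
    (a : K) (A : Finset K) :
    ∫ x, L a x * ∏ t ∈ A, L t x ∂ν =
      ∑ t ∈ A, (∫ x, L a x * L t x ∂ν) * ∫ x, ∏ s ∈ A.erase t, L s x ∂ν := by
  have hprod : ∀ B : Finset K, Integrable (fun x => L a x * ∏ t ∈ B, L t x) ν := by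
    intro B
    have := integrable_prod_clm (ν := ν) (fun o : Option K => o.elim (L a) L)
      (Finset.insertNone B)
    simpa using this
  have hLa : ∀ t, ∫ x, L t x ∂ν = 0 := by
    intro t
    have h := (L t).integral_comp_comm (IsGaussian.integrable_id (μ := ν))
    rw [hν, map_zero] at h
    exact h
  -- The integral of `(∏ t ∈ A, L t x) * L a y` over `ν.prod ν` vanishes because `L a` is centred,
  -- and it remains zero after a rotation by `θ`. In the expansion, `B` collects the factors that
  -- read the second coordinate.
  have key : ∀ θ : ℝ, ∑ B ∈ A.powerset,
      ((Real.sin θ : ℂ) ^ B.card * (Real.cos θ : ℂ) ^ (A \ B).card) *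
        (-(Real.sin θ : ℂ) * ((∫ x, L a x * ∏ t ∈ A \ B, L t x ∂ν) * ∫ y, ∏ t ∈ B, L t y ∂ν) +
          (Real.cos θ : ℂ) * ((∫ x, ∏ t ∈ A \ B, L t x ∂ν) *
            ∫ y, L a y * ∏ t ∈ B, L t y ∂ν)) = 0 := by
    intro θ
    have h0 : ∫ z, (∏ t ∈ A, L t z.1) * L a z.2 ∂(ν.prod ν) = 0 := by
      rw [integral_prod_mul (fun x => ∏ t ∈ A, L t x) (fun y => L a y), hLa, mul_zero]
    rw [← IsGaussian.map_rotation_eq_self hν θ, integral_map (by fun_prop)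
      (by fun_prop)] at h0
    rw [← h0]
    have hexp : ∀ z : E × E, (∏ t ∈ A, L t (ContinuousLinearMap.rotation θ z).1) *
        L a (ContinuousLinearMap.rotation θ z).2 = ∑ B ∈ A.powerset,
        ((Real.sin θ : ℂ) ^ B.card * (Real.cos θ : ℂ) ^ (A \ B).card) *
        (-(Real.sin θ : ℂ) * ((L a z.1 * ∏ t ∈ A \ B, L t z.1) * ∏ t ∈ B, L t z.2) +
          (Real.cos θ : ℂ) * ((∏ t ∈ A \ B, L t z.1) * (L a z.2 * ∏ t ∈ B, L t z.2))) := by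
      intro z
      rw [ContinuousLinearMap.rotation_apply]
      simp only [map_add, map_smul, Complex.real_smul, Complex.ofReal_neg]
      simp_rw [add_comm ((Real.cos θ : ℂ) * (L _) z.1)]
      rw [Finset.prod_add, Finset.sum_mul]
      refine Finset.sum_congr rfl fun B _ => ?_
      rw [Finset.prod_mul_distrib, Finset.prod_mul_distrib, Finset.prod_const, Finset.prod_const]
      ring
    have hi1 : ∀ B, Integrable (fun z : E × E =>
        (L a z.1 * ∏ t ∈ A \ B, L t z.1) * ∏ t ∈ B, L t z.2) (ν.prod ν) := fun B =>
      (hprod _).mul_prod (integrable_prod_clm L B)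
    have hi2 : ∀ B, Integrable (fun z : E × E =>
        (∏ t ∈ A \ B, L t z.1) * (L a z.2 * ∏ t ∈ B, L t z.2)) (ν.prod ν) := fun B =>
      (integrable_prod_clm L (A \ B)).mul_prod (hprod B)
    simp_rw [hexp]
    rw [integral_finsetSum]
    swap
    · exact fun B _ => (((hi1 B).const_mul _).add ((hi2 B).const_mul _)).const_mul _
    refine Finset.sum_congr rfl fun B _ => ?_
    rw [integral_const_mul, integral_add ((hi1 B).const_mul _) ((hi2 B).const_mul _),
      integral_const_mul, integral_const_mul,
      integral_prod_mul (fun x => L a x * ∏ t ∈ A \ B, L t x) (fun y => ∏ t ∈ B, L t y),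
      integral_prod_mul (fun x => ∏ t ∈ A \ B, L t x) (fun y => L a y * ∏ t ∈ B, L t y)]
  have hder := HasDerivAt.fun_sum fun B (_ : B ∈ A.powerset) =>
    hasDerivAt_cos_pow_mul_sin_pow (A \ B).card B.card
      ((∫ x, L a x * ∏ t ∈ A \ B, L t x ∂ν) * ∫ y, ∏ t ∈ B, L t y ∂ν)
      ((∫ x, ∏ t ∈ A \ B, L t x ∂ν) * ∫ y, L a y * ∏ t ∈ B, L t y ∂ν)
  simp_rw [key] at hder
  have h := hder.unique (hasDerivAt_const (0 : ℝ) (0 : ℂ))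
  -- The empty set yields minus the left side of the recursion, the singletons yield its right side.
  have hsplit : ∀ B : Finset K, (if B.card = 0 then
      -((∫ x, L a x * ∏ t ∈ A \ B, L t x ∂ν) * ∫ y, ∏ t ∈ B, L t y ∂ν) else if B.card = 1 then
      ((∫ x, ∏ t ∈ A \ B, L t x ∂ν) * ∫ y, L a y * ∏ t ∈ B, L t y ∂ν) else 0) =
      (if B = ∅ then -(∫ x, L a x * ∏ t ∈ A, L t x ∂ν) else 0) + if B.card = 1 then
      ((∫ x, ∏ t ∈ A \ B, L t x ∂ν) * ∫ y, L a y * ∏ t ∈ B, L t y ∂ν) else 0 := by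
    intro B
    rcases B.eq_empty_or_nonempty with rfl | hB
    · simp
    · simp [hB.ne_empty]
  simp_rw [hsplit, Finset.sum_add_distrib] at h
  rw [Finset.sum_ite_eq' A.powerset ∅, if_pos (Finset.empty_mem_powerset A), neg_add_eq_zero,
    ← Finset.sum_filter, ← Finset.powersetCard_eq_filter, Finset.powersetCard_one,
    Finset.sum_map] at h
  rw [h]
  refine Finset.sum_congr rfl fun t _ => ?_
  simp only [Function.Embedding.coeFn_mk, Finset.prod_singleton, Finset.sdiff_singleton_eq_erase]
  ring

/-- Wick's theorem for the coordinates of a centred Gaussian measure. -/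
theorem integral_prod_clm_eq_sum_chordDiagram (hν : ν[id] = 0) {k : ℕ} (L : Fin k → E →L[ℝ] ℂ) :
    ∫ x, ∏ s, L s x ∂ν =
      ∑ π : ChordDiagram k, ∏ s with s < π.1 s, ∫ x, L s x * L (π.1 s) x ∂ν := by
  rw [← matchingSum_univ (fun s t => ∫ x, L s x * L t x ∂ν)]
  refine eq_matchingSum (C := fun s t => ∫ x, L s x * L t x ∂ν)
    (f := fun A : Finset (Fin k) => ∫ x, ∏ t ∈ A, L t x ∂ν) (fun s t => ?_) (by simp)
    (fun a A ha => ?_) Finset.univ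
  · simp_rw [mul_comm]
  · simp_rw [Finset.prod_insert ha]
    exact integral_mul_prod_clm hν L a A

end Wick

/-! ### Invariance of the Hamiltonian under the charges. -/

section Charges

variable {ι : Type*} [Fintype ι] [DecidableEq ι] {M r : ℕ} (m : FlavourModel ι M r)
  (μ : Fin r → ℝ) {N : ℕ}

/-- The parity string of the fermions of colour `i`. -/
def FlavourModel.parityString (i : Fin N) : Op ι N :=
  tensorOp fun j => if j < i then m.parity else 1

lemma FlavourModel.fermion_eq (i : Fin N) (a : Fin M) :
    m.fermion i a = m.parityString i * siteHom i (m.χ a) := by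
  rw [FlavourModel.fermion, FlavourModel.parityString, siteHom_apply, tensorOp_mul]
  congr 1
  ext1 j
  by_cases h1 : j < i
  · simp [h1, h1.ne]
  · by_cases h2 : j = i <;> simp [h1, h2]

lemma conjTranspose_siteHom (i : Fin N) (B : Matrix ι ι ℂ) : (siteHom i B)ᴴ = siteHom i Bᴴ := by
  rw [siteHom_apply, siteHom_apply, conjTranspose_tensorOp]
  congr 1
  ext1 j
  split_ifs <;> simp

lemma FlavourModel.totalCharge_eq (N : ℕ) (α : Fin r) :
    m.totalCharge N α = ∑ i, siteHom i (m.Q α) := rfl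

lemma FlavourModel.conjTranspose_totalCharge (N : ℕ) (α : Fin r) :
    (m.totalCharge N α)ᴴ = m.totalCharge N α := by
  rw [m.totalCharge_eq, Matrix.conjTranspose_sum]
  refine Finset.sum_congr rfl fun i _ => ?_
  rw [conjTranspose_siteHom, (m.Q_isHermitian α).eq]

lemma FlavourModel.commute_totalCharge_parityString (α : Fin r) (i : Fin N) :
    Commute (m.totalCharge N α) (m.parityString i) := by
  rw [m.totalCharge_eq]
  refine Commute.sum_left _ _ _ fun j _ => ?_
  rw [Commute, SemiconjBy, siteHom_apply, FlavourModel.parityString, tensorOp_mul, tensorOp_mul]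
  congr 1
  ext1 l
  split_ifs <;> simp [(m.Q_even α).eq]

/-- The charges of the other colours commute with the one-colour factor, and parity-even charges
commute with the string. -/
lemma FlavourModel.totalCharge_commutator {α : Fin r} {T : Matrix (Fin M) (Fin M) ℂ}
    (hT : ∀ a, m.Q α * m.χ a - m.χ a * m.Q α = ∑ b, T b a • m.χ b) (i : Fin N) (a : Fin M) :
    m.totalCharge N α * m.fermion i a - m.fermion i a * m.totalCharge N α =
      ∑ b, T b a • m.fermion i b := by
  have h1 : m.totalCharge N α * siteHom i (m.χ a) - siteHom i (m.χ a) * m.totalCharge N α =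
      siteHom i (m.Q α * m.χ a - m.χ a * m.Q α) := by
    rw [m.totalCharge_eq, Finset.sum_mul, Finset.mul_sum, ← Finset.sum_sub_distrib,
      Finset.sum_eq_single i, map_sub, map_mul, map_mul]
    · intro j _ hj
      rw [(siteHom_commute hj (m.Q α) (m.χ a)).eq, sub_self]
    · simp
  simp only [m.fermion_eq]
  rw [← mul_assoc, (m.commute_totalCharge_parityString α i).eq, mul_assoc, mul_assoc, ← mul_sub, h1,
    hT, map_sum, Finset.mul_sum]
  refine Finset.sum_congr rfl fun b _ => ?_
  rw [map_smul, mul_smul_comm]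

lemma FlavourModel.totalCharge_commutator_conjTranspose {α : Fin r} {T : Matrix (Fin M) (Fin M) ℂ}
    (hT : ∀ a, m.Q α * m.χ a - m.χ a * m.Q α = ∑ b, T b a • m.χ b) (i : Fin N) (a : Fin M) :
    m.totalCharge N α * (m.fermion i a)ᴴ - (m.fermion i a)ᴴ * m.totalCharge N α =
      -∑ b, star (T b a) • (m.fermion i b)ᴴ := by
  have h := congrArg Matrix.conjTranspose (m.totalCharge_commutator hT i a)
  rw [Matrix.conjTranspose_sub, Matrix.conjTranspose_mul, Matrix.conjTranspose_mul,
    m.conjTranspose_totalCharge, Matrix.conjTranspose_sum] at h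
  simp only [Matrix.conjTranspose_smul] at h
  rw [← h, neg_sub]

/-- Conjugating an invariant operator by a contracted pair of fermions gives an invariant
operator. -/
lemma FlavourModel.commute_totalCharge_contract (α : Fin r) (i j : Fin N) {V : Op ι N}
    (hV : Commute (m.totalCharge N α) V) : Commute (m.totalCharge N α)
      (∑ a, ∑ b, m.S a b • ((m.fermion i a)ᴴ * V * m.fermion j b)) := by
  obtain ⟨T, hT, hS⟩ := m.invariant α
  set D := m.totalCharge N α with hD
  have h1 : ∀ a b, D * ((m.fermion i a)ᴴ * V * m.fermion j b) -
      (m.fermion i a)ᴴ * V * m.fermion j b * D =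
      (∑ c, T c b • ((m.fermion i a)ᴴ * V * m.fermion j c)) -
        ∑ c, star (T c a) • ((m.fermion i c)ᴴ * V * m.fermion j b) := by
    intro a b
    have e : D * ((m.fermion i a)ᴴ * V * m.fermion j b) -
      (m.fermion i a)ᴴ * V * m.fermion j b * D =
      (m.fermion i a)ᴴ * V * (D * m.fermion j b - m.fermion j b * D) +
      (D * (m.fermion i a)ᴴ - (m.fermion i a)ᴴ * D) * V * m.fermion j b +
      (m.fermion i a)ᴴ * (D * V - V * D) * m.fermion j b := by noncomm_ring
    rw [e, hV.eq, sub_self, mul_zero, zero_mul, add_zero, m.totalCharge_commutator hT,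
      m.totalCharge_commutator_conjTranspose hT, sub_eq_add_neg]
    simp only [Finset.mul_sum, Finset.sum_mul, mul_smul_comm, smul_mul_assoc, neg_mul]
  rw [Commute, SemiconjBy, ← sub_eq_zero]
  simp only [Finset.mul_sum, Finset.sum_mul, ← Finset.sum_sub_distrib, mul_smul_comm,
    smul_mul_assoc, ← smul_sub, h1]
  simp only [smul_sub, Finset.smul_sum, Finset.sum_sub_distrib, smul_smul]
  rw [sub_eq_zero]
  -- The charge rotates `χ` by `T` and `χ†` by minus the conjugate of `T`. The invariance of `S`
  -- states exactly that the two contributions cancel.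
  have hl : ∑ a, ∑ b, ∑ c, (m.S a b * T c b) • ((m.fermion i a)ᴴ * V * m.fermion j c) =
      ∑ a, ∑ c, (m.S * Tᵀ) a c • ((m.fermion i a)ᴴ * V * m.fermion j c) := by
    refine Finset.sum_congr rfl fun a _ => ?_
    rw [Finset.sum_comm]
    refine Finset.sum_congr rfl fun c _ => ?_
    rw [← Finset.sum_smul]
    rfl
  have hr : ∑ a, ∑ b, ∑ c, (m.S a b * star (T c a)) • ((m.fermion i c)ᴴ * V * m.fermion j b) =
      ∑ c, ∑ b, (T.map star * m.S) c b • ((m.fermion i c)ᴴ * V * m.fermion j b) := by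
    rw [Finset.sum_comm]
    simp_rw [Finset.sum_comm (s := Finset.univ (α := Fin M)) (t := Finset.univ (α := Fin M))
      (f := fun a c => (m.S a _ * star (T c a)) • ((m.fermion i c)ᴴ * V * m.fermion j _))]
    rw [Finset.sum_comm]
    refine Finset.sum_congr rfl fun c _ => Finset.sum_congr rfl fun b _ => ?_
    rw [← Finset.sum_smul]
    congr 1
    rw [Matrix.mul_apply]
    exact Finset.sum_congr rfl fun a _ => mul_comm _ _
  rw [hl, hr, hS]

lemma sum_pi_succ {C R : Type*} [Fintype C] [AddCommMonoid R] {p : ℕ} (F : (Fin (p + 1) → C) → R) :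
    ∑ A, F A = ∑ a, ∑ A : Fin p → C, F (Fin.cons a A) := by
  rw [← (Fin.consEquiv fun _ => C).sum_comp, Fintype.sum_prod_type]
  rfl

/-- In `X† V X` the first fermions of both strings stand next to `V`. Contracting them gives another
invariant operator, so the induction absorbs one pair at a time and needs a general `V`. -/
lemma FlavourModel.commute_totalCharge_strings (α : Fin r) {p : ℕ} (f g : Fin p → Fin N) {V : Op ι N}
    (hV : Commute (m.totalCharge N α) V) : Commute (m.totalCharge N α)
      (∑ A : Fin p → Fin M, ∑ B : Fin p → Fin M, m.tensorS A B •
        (((List.ofFn fun l => m.fermion (f l) (A l)).prod)ᴴ * V *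
          (List.ofFn fun l => m.fermion (g l) (B l)).prod)) := by
  induction p generalizing V with
  | zero => simpa [FlavourModel.tensorS] using hV
  | succ p ih =>
    have h := ih (fun l => f l.succ) (fun l => g l.succ)
      (m.commute_totalCharge_contract α (f 0) (g 0) hV)
    convert h using 1
    rw [sum_pi_succ, Finset.sum_comm]
    refine Finset.sum_congr rfl fun A _ => ?_
    simp_rw [sum_pi_succ (C := Fin M) (p := p) (fun B => _ • _)]
    simp_rw [Finset.mul_sum, Finset.sum_mul, Finset.smul_sum]
    rw [Finset.sum_comm' (s := Finset.univ (α := Fin p → Fin M)) (t' := Finset.univ (α := Fin M))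
      (s' := fun _ => Finset.univ) (t := fun _ => Finset.univ) (by simp)]
    refine Finset.sum_congr rfl fun a _ => ?_
    rw [Finset.sum_comm]
    refine Finset.sum_congr rfl fun B _ => Finset.sum_congr rfl fun b _ => ?_
    simp only [List.ofFn_succ, List.prod_cons, Fin.cons_zero, Fin.cons_succ,
      Matrix.conjTranspose_mul, FlavourModel.tensorS, Fin.prod_univ_succ, mul_smul_comm,
      smul_mul_assoc, smul_smul, mul_assoc]
    rw [mul_comm]

lemma FlavourModel.commute_totalCharge_vertex (α : Fin r) {p : ℕ} (I K : ColourSet N p) :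
    Commute (m.totalCharge N α) (m.vertex I K) := by
  have h := m.commute_totalCharge_strings α (fun l => I.1.orderEmbOfFin I.2 l)
    (fun l => K.1.orderEmbOfFin K.2 l) (Commute.one_right _)
  simp only [mul_one] at h
  exact h

open scoped Matrix.Norms.Operator in
lemma FlavourModel.commute_Lam {V : Op ι N} (hV : ∀ α, Commute (m.totalCharge N α) V) :
    Commute (m.Lam μ N) V := by
  refine Commute.exp_left (Commute.neg_left ?_)
  exact Commute.sum_left _ _ _ fun α _ => (hV α).smul_left _

lemma FlavourModel.commute_Lam_hamiltonian {p : ℕ} (J : ColourSet N p → ColourSet N p → ℂ) :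
    Commute (m.Lam μ N) (m.hamiltonian J) :=
  Commute.sum_right _ _ _ fun I _ => Commute.sum_right _ _ _ fun K _ =>
    (m.commute_Lam μ fun α => m.commute_totalCharge_vertex α I K).smul_right _

lemma FlavourModel.TrLam_mul_comm {V : Op ι N} (hV : Commute (m.Lam μ N) V) (A : Op ι N) :
    m.TrLam μ (A * V) = m.TrLam μ (V * A) := by
  have h : (A * V * m.Lam μ N).trace = (V * A * m.Lam μ N).trace := by
    rw [mul_assoc, ← hV.eq, ← mul_assoc, Matrix.trace_mul_comm, ← mul_assoc]
  simp only [FlavourModel.TrLam, ntr, h]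

/-- Factors of the Hamiltonian can be moved cyclically past `Λ`. -/
lemma FlavourModel.TrLam_eq_word {p k k₀ k₁ : ℕ} (hk : k₀ + k₁ ≤ k)
    (J : ColourSet N p → ColourSet N p → ℂ) (A B : Op ι N) :
    m.TrLam μ (A * m.hamiltonian J ^ k₁ * B * m.hamiltonian J ^ (k - k₁)) =
      m.TrLam μ (word k₀ k₁ (fun _ : Fin k => m.hamiltonian J) A B) := by
  -- The last `k₀` factors of `H` are carried past `Λ` to the front.
  have h1 : k - k₁ = (k - (k₀ + k₁)) + k₀ := by omega
  rw [h1, pow_add, ← mul_assoc, m.TrLam_mul_comm μ ((m.commute_Lam_hamiltonian μ J).pow_right k₀)]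
  simp only [word, List.ofFn_const, List.take_replicate, List.drop_replicate, List.prod_replicate]
  rw [min_eq_left (by omega), min_eq_left (by omega)]
  simp only [mul_assoc]

end Charges

/-! ### Gaussian averages of the couplings. -/

section Couplings

variable {Ω : Type*} [MeasurableSpace Ω] {P : Measure Ω} [IsProbabilityMeasure P]
  {M N p pt : ℕ} {J : Ω → ColourSet N p → ColourSet N p → ℂ} {Jt : Ω → ColourSet N pt → ℝ}

/-- The evaluation of the coupling matrix at an entry. -/
def couplingEval (c : ColourSet N p × ColourSet N p) :
    (ColourSet N p → ColourSet N p → ℂ) →L[ℝ] ℂ :=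
  (ContinuousLinearMap.proj (R := ℝ) (φ := fun _ : ColourSet N p => ℂ) c.2).comp
    (ContinuousLinearMap.proj (R := ℝ) (φ := fun _ : ColourSet N p => ColourSet N p → ℂ) c.1)

lemma couplingEval_apply (c : ColourSet N p × ColourSet N p)
    (x : ColourSet N p → ColourSet N p → ℂ) : couplingEval c x = x c.1 c.2 := rfl

lemma IsCouplingEnsemble.integral_id_map (h : IsCouplingEnsemble P M N p pt J Jt) :
    (P.map J)[id] = 0 := by
  have hJ := h.gaussian.fst
  rw [integral_map hJ.aemeasurable aestronglyMeasurable_id]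
  ext I K
  have h1 := (couplingEval (I, K)).integral_comp_comm hJ.integrable
  simp only [couplingEval_apply, h.mean_J] at h1
  exact h1.symm

/-- Wick's theorem for the couplings: the expectation of a product of couplings is the sum over
chord diagrams of the index contractions. -/
lemma IsCouplingEnsemble.integral_prod (h : IsCouplingEnsemble P M N p pt J Jt) {k : ℕ}
    (c : Fin k → ColourSet N p × ColourSet N p) :
    ∫ ω, ∏ s, J ω (c s).1 (c s).2 ∂P = ∑ π : ChordDiagram k,
      if ∀ s, (c s).2 = (c (π.1 s)).1 then
        1 / ((N.choose p : ℂ) ^ k * (M : ℂ) ^ (p * k / 2)) else 0 := by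
  have hJ := h.gaussian.fst
  have := hJ.isGaussian_map
  have hmap : ∀ f : (ColourSet N p → ColourSet N p → ℂ) → ℂ, Continuous f →
      ∫ x, f x ∂(P.map J) = ∫ ω, f (J ω) ∂P := fun f hf =>
    integral_map hJ.aemeasurable hf.aestronglyMeasurable
  have hw := integral_prod_clm_eq_sum_chordDiagram h.integral_id_map fun s => couplingEval (c s)
  rw [hmap _ (by fun_prop)] at hw
  simp only [couplingEval_apply] at hw
  rw [hw]
  refine Finset.sum_congr rfl fun π _ => ?_
  have h2 : ∀ s, ∫ x, x (c s).1 (c s).2 * x (c (π.1 s)).1 (c (π.1 s)).2 ∂(P.map J) =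
      if (c s).1 = (c (π.1 s)).2 ∧ (c s).2 = (c (π.1 s)).1 then
        1 / ((N.choose p : ℂ) ^ 2 * (M : ℂ) ^ p) else 0 := fun s => by
    rw [hmap _ (by fun_prop), h.cov_J]
  simp only [h2]
  rw [Finset.prod_ite_zero, Finset.prod_const]
  have hcard := two_mul_card_openers π
  have h3 : (1 / ((N.choose p : ℂ) ^ 2 * (M : ℂ) ^ p)) ^ (openers π).card =
      1 / ((N.choose p : ℂ) ^ k * (M : ℂ) ^ (p * k / 2)) := by
    have h4 : p * k / 2 = p * (openers π).card := by
      refine Nat.div_eq_of_eq_mul_right two_pos ?_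
      rw [mul_left_comm, hcard]
    rw [h4, div_pow, one_pow, mul_pow, ← pow_mul, ← pow_mul, hcard]
  -- A pair yields two index equations, counted once at its first node. They amount to a single
  -- equation at each node, since the equation at `π s` is the other one.
  have h5 : (∀ s ∈ Finset.univ.filter (fun s : Fin k => s < π.1 s),
      (c s).1 = (c (π.1 s)).2 ∧ (c s).2 = (c (π.1 s)).1) ↔ ∀ s, (c s).2 = (c (π.1 s)).1 := by
    constructor
    · intro hs s
      rcases lt_or_gt_of_ne (π.2 s).2 with hlt | hlt
      · have := (hs (π.1 s) (by simpa [(π.2 s).1] using hlt)).1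
        rw [(π.2 s).1] at this
        exact this.symm
      · exact (hs s (by simpa using hlt)).2
    · intro hs s _
      refine ⟨?_, hs s⟩
      rw [hs (π.1 s), (π.2 s).1]
  simp only [h5]
  split_ifs
  · exact h3
  · rfl

lemma IsCouplingEnsemble.integrable_prod (h : IsCouplingEnsemble P M N p pt J Jt) {k : ℕ}
    (c : Fin k → ColourSet N p × ColourSet N p) :
    Integrable (fun ω => ∏ s, J ω (c s).1 (c s).2) P := by
  have hJ := h.gaussian.fst
  have := hJ.isGaussian_map
  exact (integrable_prod_clm (ν := P.map J) (fun s => couplingEval (c s)) Finset.univ).comp_aemeasurable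
    hJ.aemeasurable

lemma IsCouplingEnsemble.integrable_mul_probe (h : IsCouplingEnsemble P M N p pt J Jt)
    (I K : ColourSet N pt) : Integrable (fun ω => ((Jt ω I * Jt ω K : ℝ) : ℂ)) P := by
  have hJ := h.gaussian.snd
  have h1 : ∀ I, MemLp (fun ω => Jt ω I) 2 P := fun I => (hJ.eval I).memLp_two
  exact ((h1 I).integrable_mul (h1 K)).ofReal

lemma IsCouplingEnsemble.indepFun_prod (h : IsCouplingEnsemble P M N p pt J Jt) {k : ℕ}
    (c : Fin k → ColourSet N p × ColourSet N p) (I K : ColourSet N pt) :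
    IndepFun (fun ω => ∏ s, J ω (c s).1 (c s).2) (fun ω => ((Jt ω I * Jt ω K : ℝ) : ℂ)) P :=
  h.indep.comp (φ := fun x : ColourSet N p → ColourSet N p → ℂ => ∏ s, x (c s).1 (c s).2)
    (ψ := fun y : ColourSet N pt → ℝ => ((y I * y K : ℝ) : ℂ)) (by fun_prop) (by fun_prop)

lemma IsCouplingEnsemble.integrable_monomial (h : IsCouplingEnsemble P M N p pt J Jt) {k : ℕ}
    (c : Fin k → ColourSet N p × ColourSet N p) (I K : ColourSet N pt) :
    Integrable (fun ω => (∏ s, J ω (c s).1 (c s).2) * ((Jt ω I * Jt ω K : ℝ) : ℂ)) P :=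
  (h.indepFun_prod c I K).integrable_mul (h.integrable_prod c) (h.integrable_mul_probe I K)

lemma IsCouplingEnsemble.integral_monomial (h : IsCouplingEnsemble P M N p pt J Jt) {k : ℕ}
    (c : Fin k → ColourSet N p × ColourSet N p) (I K : ColourSet N pt) :
    ∫ ω, (∏ s, J ω (c s).1 (c s).2) * ((Jt ω I * Jt ω K : ℝ) : ℂ) ∂P =
      (∑ π : ChordDiagram k, if ∀ s, (c s).2 = (c (π.1 s)).1 then
        1 / ((N.choose p : ℂ) ^ k * (M : ℂ) ^ (p * k / 2)) else 0) *
      if I = K then 1 / ((N.choose pt : ℂ) * (Real.sqrt M : ℂ) ^ pt) else 0 := by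
  rw [(h.indepFun_prod c I K).integral_fun_mul_eq_mul_integral
    (h.integrable_prod c).aestronglyMeasurable (h.integrable_mul_probe I K).aestronglyMeasurable,
    h.integral_prod, integral_complex_ofReal, h.cov_Jt]
  congr 1
  split_ifs <;> simp

end Couplings

/-! ### The moment as a sum over chord diagrams. -/

section Moment

variable {ι : Type*} [Fintype ι] [DecidableEq ι] {M r : ℕ} (m : FlavourModel ι M r)
  (μ : Fin r → ℝ) {N p pt : ℕ}

lemma word_sum_smul_sum_smul {k : ℕ} {C : Type*} [Fintype C] (k₀ k₁ : ℕ) (h : Fin k → Op ι N)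
    (z w : C → ℂ) (A B : C → Op ι N) :
    word k₀ k₁ h (∑ I, z I • A I) (∑ K, w K • B K) =
      ∑ I, ∑ K, (z I * w K) • word k₀ k₁ h (A I) (B K) := by
  simp only [word, Finset.mul_sum, Finset.sum_mul, mul_smul_comm, smul_mul_assoc]
  simp only [Finset.smul_sum, smul_smul]
  rw [Finset.sum_comm]
  refine Finset.sum_congr rfl fun I _ => Finset.sum_congr rfl fun K _ => ?_
  rw [mul_comm]

lemma FlavourModel.conjTranspose_probe (Jt : ColourSet N pt → ℝ) (A : Fin pt → Fin M) :
    (m.probe Jt A)ᴴ = ∑ I, (Jt I : ℂ) • (m.X I A)ᴴ := by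
  simp [FlavourModel.probe, Matrix.conjTranspose_sum, Matrix.conjTranspose_smul]

lemma FlavourModel.hamiltonian_eq (J : ColourSet N p → ColourSet N p → ℂ) :
    m.hamiltonian J = ∑ c : ColourSet N p × ColourSet N p, J c.1 c.2 • m.vertex c.1 c.2 := by
  rw [FlavourModel.hamiltonian, Fintype.sum_prod_type]

lemma FlavourModel.TrLam_word_hamiltonian {k k₀ k₁ : ℕ} (hk : k₀ + k₁ ≤ k)
    (J : ColourSet N p → ColourSet N p → ℂ) (Jt : ColourSet N pt → ℝ) (A B : Fin pt → Fin M) :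
    m.TrLam μ (word k₀ k₁ (fun _ : Fin k => m.hamiltonian J) (m.probe Jt A)ᴴ (m.probe Jt B)) =
      ∑ q : (Fin k → ColourSet N p × ColourSet N p) × ColourSet N pt × ColourSet N pt,
        (∏ s, J (q.1 s).1 (q.1 s).2) * ((Jt q.2.1 * Jt q.2.2 : ℝ) : ℂ) *
          m.TrLam μ (word k₀ k₁ (fun s => m.vertex (q.1 s).1 (q.1 s).2)
            (m.X q.2.1 A)ᴴ (m.X q.2.2 B)) := by
  have h := word_sum_smul (k := k) hk (fun _ (c : ColourSet N p × ColourSet N p) => J c.1 c.2)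
    (fun _ c => m.vertex c.1 c.2) (m.probe Jt A)ᴴ (m.probe Jt B)
  simp only [← m.hamiltonian_eq] at h
  rw [h, m.TrLam_sum, Fintype.sum_prod_type]
  refine Finset.sum_congr rfl fun c _ => ?_
  rw [m.TrLam_smul, m.conjTranspose_probe, FlavourModel.probe, word_sum_smul_sum_smul, m.TrLam_sum,
    Finset.mul_sum, Fintype.sum_prod_type]
  refine Finset.sum_congr rfl fun I _ => ?_
  rw [m.TrLam_sum, Finset.mul_sum]
  refine Finset.sum_congr rfl fun K _ => ?_
  simp only [m.TrLam_smul, Complex.ofReal_mul, mul_assoc]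

/-- The contraction identifies the second index at `s` with the first index at `π s`, so only the
first indices stay free. -/
lemma sum_contractions {C : Type*} [Fintype C] [DecidableEq C] {k : ℕ} (π : ChordDiagram k)
    (F : (Fin k → C × C) → ℂ) :
    ∑ c : Fin k → C × C, (if ∀ s, (c s).2 = (c (π.1 s)).1 then F c else 0) =
      ∑ I : Fin k → C, F fun s => (I s, I (π.1 s)) := by
  rw [← Finset.sum_filter]
  refine Finset.sum_nbij' (fun c s => (c s).1) (fun I s => (I s, I (π.1 s))) (by simp) (by simp) ?_
    (by simp) ?_
  · intro c hc
    simp only [Finset.mem_filter, Finset.mem_univ, true_and] at hc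
    funext s
    exact Prod.ext rfl (hc s).symm
  · intro c hc
    simp only [Finset.mem_filter, Finset.mem_univ, true_and] at hc
    congr 1
    funext s
    exact Prod.ext rfl (hc s)

/-- The moments of the two-point function are sums over chord diagrams. -/
theorem twoPointMoment_eq_sum {Ω : Type*} [MeasurableSpace Ω] {P : Measure Ω}
    [IsProbabilityMeasure P] {J : Ω → ColourSet N p → ColourSet N p → ℂ}
    {Jt : Ω → ColourSet N pt → ℝ} (h : IsCouplingEnsemble P M N p pt J Jt) {k k₀ k₁ : ℕ}
    (hk : k₀ + k₁ ≤ k) :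
    twoPointMoment m μ P J Jt k k₁ =
      ∑ π : ChordDiagram k, diagramMoment m μ N p pt k₀ k₁ π := by
  -- `G` gathers everything in a monomial of the couplings that is not random, so that the average
  -- only acts on the couplings.
  set G : (Fin k → ColourSet N p × ColourSet N p) → ColourSet N pt → ColourSet N pt → ℂ :=
    fun c I K => ∑ A : Fin pt → Fin M, ∑ B : Fin pt → Fin M, m.tensorS A B *
      m.TrLam μ (word k₀ k₁ (fun s => m.vertex (c s).1 (c s).2) (m.X I A)ᴴ (m.X K B)) with hG
  have h1 : ∀ ω, ∑ A : Fin pt → Fin M, ∑ B : Fin pt → Fin M,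
      m.tensorS A B * m.TrLam μ ((m.probe (Jt ω) A)ᴴ * m.hamiltonian (J ω) ^ k₁ *
        m.probe (Jt ω) B * m.hamiltonian (J ω) ^ (k - k₁)) =
      ∑ q : (Fin k → ColourSet N p × ColourSet N p) × ColourSet N pt × ColourSet N pt,
        (∏ s, J ω (q.1 s).1 (q.1 s).2) * ((Jt ω q.2.1 * Jt ω q.2.2 : ℝ) : ℂ) *
          G q.1 q.2.1 q.2.2 := by
    intro ω
    simp only [m.TrLam_eq_word μ hk, m.TrLam_word_hamiltonian μ hk]
    simp only [hG, Finset.mul_sum]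
    refine (Finset.sum_congr rfl fun A _ => Finset.sum_comm).trans (Finset.sum_comm.trans ?_)
    refine Finset.sum_congr rfl fun q _ => Finset.sum_congr rfl fun A _ =>
      Finset.sum_congr rfl fun B _ => mul_left_comm _ _ _
  rw [twoPointMoment]
  simp only [h1]
  rw [integral_finsetSum _ fun q _ => (h.integrable_monomial _ _ _).mul_const _]
  simp only [integral_mul_const, h.integral_monomial]
  set κ : ℂ := 1 / ((N.choose p : ℂ) ^ k * (M : ℂ) ^ (p * k / 2)) with hκ
  set κt : ℂ := 1 / ((N.choose pt : ℂ) * (Real.sqrt M : ℂ) ^ pt) with hκt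
  have h2 : ∀ c : Fin k → ColourSet N p × ColourSet N p,
      ∑ y : ColourSet N pt × ColourSet N pt,
        (∑ π : ChordDiagram k, if ∀ s, (c s).2 = (c (π.1 s)).1 then κ else 0) *
          (if y.1 = y.2 then κt else 0) * G c y.1 y.2 =
      ∑ π : ChordDiagram k, if ∀ s, (c s).2 = (c (π.1 s)).1 then
        κ * κt * ∑ I, G c I I else 0 := by
    intro c
    rw [Fintype.sum_prod_type]
    simp only [mul_ite, ite_mul, mul_zero, zero_mul, Finset.sum_ite_eq, Finset.mem_univ, if_true]
    rw [← Finset.mul_sum, Finset.sum_mul, Finset.sum_mul]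
    refine Finset.sum_congr rfl fun π _ => ?_
    split_ifs <;> simp
  rw [Fintype.sum_prod_type]
  simp only [h2]
  rw [Finset.sum_comm, Finset.mul_sum]
  refine Finset.sum_congr rfl fun π _ => ?_
  rw [sum_contractions π fun c => κ * κt * ∑ I, G c I I, ← Finset.mul_sum, diagramMoment, ← mul_assoc]
  congr 1
  rw [hκ, hκt]
  field_simp

end Moment

end DSSYK

end

theorem mainTheorem5 {ι : Type*} [Fintype ι] [DecidableEq ι] {M r : ℕ}
    (m : DSSYK.FlavourModel ι M r) (μ : Fin r → ℝ)
    (hx : m.xSq μ ≠ 0) (hxt : m.xt μ ≠ 0)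
    -- the double scaling limit
    (N p pt : ℕ → ℕ) (lamb lambt : ℝ)
    (hN : Tendsto N atTop atTop) (hp : Tendsto p atTop atTop) (hpt : Tendsto pt atTop atTop)
    (hp_even : ∀ n, Even (p n))
    (hlamb : Tendsto (fun n => (p n : ℝ) ^ 2 / (N n : ℝ)) atTop (𝓝 lamb))
    (hlambt : Tendsto (fun n => (p n : ℝ) * (pt n : ℝ) / (N n : ℝ)) atTop (𝓝 lambt))
    -- the random couplings
    {Ω : ℕ → Type*} [∀ n, MeasurableSpace (Ω n)] (P : ∀ n, Measure (Ω n))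
    [∀ n, IsProbabilityMeasure (P n)]
    (J : ∀ n, Ω n → DSSYK.ColourSet (N n) (p n) → DSSYK.ColourSet (N n) (p n) → ℂ)
    (Jt : ∀ n, Ω n → DSSYK.ColourSet (N n) (pt n) → ℝ)
    (hJ : ∀ n, DSSYK.IsCouplingEnsemble (P n) M (N n) (p n) (pt n) (J n) (Jt n))
    -- the moment, and the number of H nodes between the insertion of `Λ` and the M chord
    (k k₁ k₀ : ℕ) (hk : k₀ + k₁ ≤ k) :
    (∀ n, DSSYK.twoPointMoment m μ (P n) (J n) (Jt n) k k₁ =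
      ∑ π : DSSYK.ChordDiagram k, DSSYK.diagramMoment m μ (N n) (p n) (pt n) k₀ k₁ π) ∧
    (∀ π : DSSYK.ChordDiagram k,
      Tendsto (fun n => DSSYK.diagramMoment m μ (N n) (p n) (pt n) k₀ k₁ π /
          m.prefactor μ (N n) (p n) (pt n) k) atTop
        (𝓝 (m.diagramWeight μ lamb lambt k₀ k₁ π))) ∧
    Tendsto (fun n => DSSYK.twoPointMoment m μ (P n) (J n) (Jt n) k k₁ /
        m.prefactor μ (N n) (p n) (pt n) k) atTop
      (𝓝 (∑ π : DSSYK.ChordDiagram k, m.diagramWeight μ lamb lambt k₀ k₁ π)) := by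
  have h1 := fun n => DSSYK.twoPointMoment_eq_sum m μ (hJ n) hk
  have h2 := fun π : DSSYK.ChordDiagram k => DSSYK.tendsto_diagramMoment m μ k₀ k₁ π hx hxt hk
    hN hp hpt hp_even hlamb hlambt
  refine ⟨h1, h2, ?_⟩
  simp only [h1, Finset.sum_div]
  exact tendsto_finsetSum _ fun π _ => h2 π
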